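/- **Setting.** Let $\Sigma\subseteq\mathbb R$ be bounded, $\nu$ a probability measure on the Borel sets of $\Sigma$, and $[d,D]$ the smallest interval with $\nu(\sigma^2\in[d,D])=1$. Let $\xi:\mathbb R\to\mathbb R$ be three times continuously differentiable with $\xi(0)=0$, $\xi(-x)=\xi(x)$, and $\xi''(x)>0$ for $x>0$; put $\theta(q)=q\xi'(q)-\xi(q)$. For $N\ge1$ and $\sigma^1,\sigma^2\in\Sigma^N$ let $R_{1,2}=\frac1N\sum_{i\le N}\sigma^1_i\sigma^2_i$ and $R_{1,1}=\frac1N\sum_{i\le N}(\sigma_i^1)^2$. Let $H_N$ be a centered Gaussian process indexed by $\Sigma^N$, jointly measurable in the configuration and the randomness, with $$\Bigl|\tfrac1N\mathbb E H_N(\sigma^1)H_N(\sigma^2)-\xi(R_{1,2})\Bigr|\le c(N)\qquad\text{for all }\sigma^1,\sigma^2\in\Sigma^N .$$ Let $u\in[d,D]$, $\varepsilon_N>0$ and $U_N=\{\sigma\in\Sigma^N: R_{1,1}\in[u-\varepsilon_N,u+\varepsilon_N]\}$, and assume $\nu^N(U_N)>0$. Let $F_N(u,\varepsilon_N)=\frac1N\mathbb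 E\log\int_{U_N}e^{H_N}d\nu^N$. Let $k\ge1$, $0=m_0\le m_1\le\dots\le m_k=1$ and $0=q_0\le q_1\le\dots\le q_{k+1}=u$. **Parisi functional.** For a function $F$ of independent random vectors $z_0,\dots,z_k$ put $F_{k+1}=F$ and, for $0\le l\le k$, $F_l=\frac1{m_l}\log\mathbb E_l\exp(m_lF_{l+1})$ (meaning $\mathbb E_lF_{l+1}$ if $m_l=0$), where $\mathbb E_l$ is the expectation in $(z_p)_{p\ge l}$. Put $\mathcal P(\vec m)F=F_0$ and $W_l=\exp m_l(F_{l+1}-F_l)$. **Interpolation.** Let $z_{i,p}$ ($i\le N$, $0\le p\le k$) be independent centered Gaussian variables, independent of $H_N$, with $\mathbb E z_{i,p}^2=\xi'(q_{p+1})-\xi'(q_p)$. For $t\in[0,1]$ let $$H_t(\sigma)=\sqrt t\,H_N(\sigma)+\sqrt{1-t}\sum_{i\le N}\sigma_i\sum_{0\le p\le k}z_{i,p},\qquad F=\log\int_{U_N}e^{H_t}d\nu^N,\qquad \varphi_N(t)=\tfrac1N\mathbb E\,\mathcal P(\vec m)F,$$ where $\mathcal P(\vec m)$ is taken with respect to $z_p=(z_{i,p})_{i\le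 N}$. Let $\langle h\rangle_t=e^{-F}\int_{U_N}h\,e^{H_t}d\nu^N$, let $\gamma_l$ be the random probability measure on $U_N$ given by $\gamma_l(h)=\mathbb E_l(W_l\cdots W_k\langle h\rangle_t)$, and for a function $h$ of two configurations let $\mu_l(h)=\mathbb E\bigl(W_1\cdots W_{l-1}\,\gamma_l^{\otimes2}(h)\bigr)$. Finally, for $\lambda\in\mathbb R$, let $X_0(\vec m,\vec q,\lambda)=\mathcal P(\vec m)X_{k+1}$ with $X_{k+1}=\log\int_\Sigma\exp\bigl(\sigma\sum_{0\le p\le k}z_p+\lambda\sigma^2\bigr)d\nu(\sigma)$, where the $z_p$ are independent centered Gaussian variables with $\mathbb Ez_p^2=\xi'(q_{p+1})-\xi'(q_p)$, and let $u_N(\lambda)=\max(d,u-\varepsilon_N)$ if $\lambda\ge0$, $u_N(\lambda)=\min(D,u+\varepsilon_N)$ if $\lambda<0$. **Theorem (Guerra's interpolation).** There is a constant $L>0$ depending only on $\xi$ and $\nu$ such that, for all data as above, the following holds. 1. For every $t\in[0,1]$ (with one-sided derivatives at $t=0$ and $t=1$), $$\varphi_N'(t)=-\frac12\sum_{1\le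 l\le k}m_l\bigl(\theta(q_{l+1})-\theta(q_l)\bigr)-\frac12\sum_{1\le l\le k}(m_l-m_{l-1})\,\mu_l\bigl(\xi(R_{1,2})-R_{1,2}\,\xi'(q_l)+\theta(q_l)\bigr)+\mathcal R$$ with $|\mathcal R|\le c(N)+L\varepsilon_N$, and every term of the second sum, $(m_l-m_{l-1})\,\mu_l(\,\cdot\,)$, is nonnegative. 2. Consequently $$F_N(u,\varepsilon_N)=\varphi_N(1)\le\varphi_N(0)-\frac12\sum_{1\le l\le k}m_l\bigl(\theta(q_{l+1})-\theta(q_l)\bigr)+c(N)+L\varepsilon_N,$$ and for every $\lambda\in\mathbb R$ $$F_N(u,\varepsilon_N)\le-\lambda u_N(\lambda)+X_0(\vec m,\vec q,\lambda)-\frac12\sum_{1\le l\le k}m_l\bigl(\theta(q_{l+1})-\theta(q_l)\bigr)+c(N)+L\varepsilon_N .$$ Equivalently, $F_N(u,\varepsilon_N)-c(N)-L\varepsilon_N$ is at most the infimum over $k,\vec m,\vec q,\lambda$ of the remaining right-hand side. -/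

import Mathlib

open MeasureTheory ProbabilityTheory

namespace SpinGlass

/-! ### The Parisi functional -/

section ParisiFunctional

variable {E : Type*} [MeasurableSpace E] {k : ℕ}

/-- The expectation `𝔼_l G` of a function `G` of the independent random vectors `z_0, …, z_k`
with laws `γ_0, …, γ_k`: the average over all `z_p` with `p ≥ l`, the `z_p` with `p < l`
being kept fixed. -/
noncomputable def condE (γ : Fin (k + 1) → Measure E) (l : ℕ)
    (G : (Fin (k + 1) → E) → ℝ) (z : Fin (k + 1) → E) : ℝ :=
  ∫ z', G (fun p => if (p : ℕ) < l then z p else z' p) ∂(Measure.pi γ)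

/-- One step of the recursion, `G ↦ (1/a) log 𝔼_l exp (a G)`, read as `𝔼_l G` if `a = 0`. -/
noncomputable def parisiStep (γ : Fin (k + 1) → Measure E) (l : ℕ) (a : ℝ)
    (G : (Fin (k + 1) → E) → ℝ) (z : Fin (k + 1) → E) : ℝ :=
  if a = 0 then condE γ l G z
  else (1 / a) * Real.log (condE γ l (fun z' => Real.exp (a * G z')) z)

/-- The recursion run `j` times, downwards from `F_{k+1} = F`: the value is `F_{k+1-j}`. -/
noncomputable def parisiIter (γ : Fin (k + 1) → Measure E) (m : ℕ → ℝ)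
    (F : (Fin (k + 1) → E) → ℝ) : ℕ → (Fin (k + 1) → E) → ℝ
  | 0 => F
  | j + 1 => parisiStep γ (k - j) (m (k - j)) (parisiIter γ m F j)

/-- The functions `F_l`, `0 ≤ l ≤ k + 1`, of the recursion. -/
noncomputable def parisiLevel (γ : Fin (k + 1) → Measure E) (m : ℕ → ℝ)
    (F : (Fin (k + 1) → E) → ℝ) (l : ℕ) : (Fin (k + 1) → E) → ℝ :=
  parisiIter γ m F (k + 1 - l)

theorem parisiLevel_last (γ : Fin (k + 1) → Measure E) (m : ℕ → ℝ)
    (F : (Fin (k + 1) → E) → ℝ) : parisiLevel γ m F (k + 1) = F := by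
  simp [parisiLevel, parisiIter]

theorem parisiLevel_of_le (γ : Fin (k + 1) → Measure E) (m : ℕ → ℝ)
    (F : (Fin (k + 1) → E) → ℝ) {l : ℕ} (hl : l ≤ k) :
    parisiLevel γ m F l = parisiStep γ l (m l) (parisiLevel γ m F (l + 1)) := by
  have h1 : k + 1 - l = (k - l) + 1 := by omega
  have h2 : k + 1 - (l + 1) = k - l := by omega
  have h3 : k - (k - l) = l := by omega
  simp only [parisiLevel, h1, h2, parisiIter, h3]

/-- `F_0` does not depend on `z`. -/
theorem parisiLevel_zero_const (γ : Fin (k + 1) → Measure E) (m : ℕ → ℝ)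
    (F : (Fin (k + 1) → E) → ℝ) (z z' : Fin (k + 1) → E) :
    parisiLevel γ m F 0 z = parisiLevel γ m F 0 z' := by
  rw [parisiLevel_of_le γ m F (Nat.zero_le k)]
  simp [parisiStep, condE]

/-- The Parisi functional `𝒫(m) F = F_0` (a constant, evaluated here at `z = 0`). -/
noncomputable def parisiFunctional [Zero E] (γ : Fin (k + 1) → Measure E) (m : ℕ → ℝ)
    (F : (Fin (k + 1) → E) → ℝ) : ℝ :=
  parisiLevel γ m F 0 0

/-- `W_l = exp (m_l (F_{l+1} - F_l))`. -/
noncomputable def parisiW (γ : Fin (k + 1) → Measure E) (m : ℕ → ℝ)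
    (F : (Fin (k + 1) → E) → ℝ) (l : ℕ) (z : Fin (k + 1) → E) : ℝ :=
  Real.exp (m l * (parisiLevel γ m F (l + 1) z - parisiLevel γ m F l z))

end ParisiFunctional

/-! ### The parameters of the model -/

/-- `ξ` is of class `C³`, `ξ(0) = 0`, `ξ` is even, and `ξ''(x) > 0` for `x > 0`. -/
structure IsCovarianceFunction (ξ : ℝ → ℝ) : Prop where
  contDiff : ContDiff ℝ 3 ξ
  map_zero : ξ 0 = 0
  even : ∀ x, ξ (-x) = ξ x
  deriv2_pos : ∀ x, 0 < x → 0 < deriv (deriv ξ) x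

/-- `θ(q) = q ξ'(q) - ξ(q)`. -/
noncomputable def theta (ξ : ℝ → ℝ) (q : ℝ) : ℝ := q * deriv ξ q - ξ q

/-- `[d, D]` is the smallest interval with `ν {σ : σ² ∈ [d, D]} = 1`. -/
def IsSmallestSqInterval {S : Set ℝ} (ν : Measure S) (d D : ℝ) : Prop :=
  ν {σ : S | (σ : ℝ) ^ 2 ∈ Set.Icc d D} = 1 ∧
    ∀ a b : ℝ, ν {σ : S | (σ : ℝ) ^ 2 ∈ Set.Icc a b} = 1 → a ≤ d ∧ D ≤ b

/-- `k ≥ 1`, `0 = m_0 ≤ m_1 ≤ … ≤ m_k = 1` and `0 = q_0 ≤ q_1 ≤ … ≤ q_{k+1} = u`;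
only the entries `m_0, …, m_k` and `q_0, …, q_{k+1}` of the sequences are used. -/
structure IsParisiParam (k : ℕ) (m q : ℕ → ℝ) (u : ℝ) : Prop where
  one_le : 1 ≤ k
  m_zero : m 0 = 0
  m_mono : ∀ l < k, m l ≤ m (l + 1)
  m_last : m k = 1
  q_zero : q 0 = 0
  q_mono : ∀ l ≤ k, q l ≤ q (l + 1)
  q_last : q (k + 1) = u

/-- The law of `z_p`: centered Gaussian with variance `ξ'(q_{p+1}) - ξ'(q_p)`. -/
noncomputable def zLaw (ξ : ℝ → ℝ) (q : ℕ → ℝ) (p : ℕ) : Measure ℝ :=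
  gaussianReal 0 (Real.toNNReal (deriv ξ (q (p + 1)) - deriv ξ (q p)))

/-- The law of `(z_{i,p})_{i ≤ N}`: independent copies of `z_p`. -/
noncomputable def zLawN (N : ℕ) (ξ : ℝ → ℝ) (q : ℕ → ℝ) (p : ℕ) : Measure (Fin N → ℝ) :=
  Measure.pi (fun _ : Fin N => zLaw ξ q p)

/-- `X_{k+1} = log ∫ exp (σ ∑_p z_p + λ σ²) dν(σ)`. -/
noncomputable def XLast {S : Set ℝ} (ν : Measure S) (k : ℕ) (lam : ℝ)
    (z : Fin (k + 1) → ℝ) : ℝ :=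
  Real.log (∫ σ : S, Real.exp ((σ : ℝ) * ∑ p, z p + lam * (σ : ℝ) ^ 2) ∂ν)

/-- `X_0(m, q, λ)`. -/
noncomputable def X0 {S : Set ℝ} (ν : Measure S) (ξ : ℝ → ℝ) (k : ℕ) (m q : ℕ → ℝ)
    (lam : ℝ) : ℝ :=
  parisiFunctional (fun p : Fin (k + 1) => zLaw ξ q p) m (XLast ν k lam)

/-! ### Configurations, Hamiltonian and local free energy -/

/-- The overlap `R_{1,2} = (1/N) ∑ σ¹_i σ²_i`. -/
noncomputable def overlap {S : Set ℝ} {N : ℕ} (σ τ : Fin N → S) : ℝ :=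
  (1 / (N : ℝ)) * ∑ i, (σ i : ℝ) * (τ i : ℝ)

/-- The configurations whose self-overlap lies in `[u - ε, u + ε]`. -/
def selfOverlapWindow (S : Set ℝ) (N : ℕ) (u ε : ℝ) : Set (Fin N → S) :=
  {σ | overlap σ σ ∈ Set.Icc (u - ε) (u + ε)}

/-- The restriction to the window `U_N` of the product measure `ν^N` on `S^N`. -/
noncomputable def windowMeasure {S : Set ℝ} (ν : Measure S) (N : ℕ) (u ε : ℝ) :
    Measure (Fin N → S) :=
  (Measure.pi (fun _ : Fin N => ν)).restrict (selfOverlapWindow S N u ε)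

/-- `H` is a jointly measurable centered Gaussian process on the probability space `(Ω, P)`,
indexed by the configurations, with `|(1/N) 𝔼 H(σ¹) H(σ²) - ξ(R_{1,2})| ≤ c`. -/
structure IsHamiltonian {S : Set ℝ} {N : ℕ} {Ω : Type*} [MeasurableSpace Ω] (P : Measure Ω)
    (ξ : ℝ → ℝ) (c : ℝ) (H : (Fin N → S) → Ω → ℝ) : Prop where
  measurable : Measurable (fun x : (Fin N → S) × Ω => H x.1 x.2)
  gaussian : IsGaussianProcess H P
  centered : ∀ σ, ∫ ω, H σ ω ∂P = 0
  covariance : ∀ σ τ,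
    |(1 / (N : ℝ)) * ∫ ω, H σ ω * H τ ω ∂P - ξ (overlap σ τ)| ≤ c

/-- The local free energy `F_N(u, ε) = (1/N) 𝔼 log ∫_{U_N} exp H dν^N`. -/
noncomputable def localFreeEnergy {S : Set ℝ} (ν : Measure S) {N : ℕ} {Ω : Type*}
    [MeasurableSpace Ω] (P : Measure Ω) (H : (Fin N → S) → Ω → ℝ) (u ε : ℝ) : ℝ :=
  (1 / (N : ℝ)) * ∫ ω, Real.log (∫ σ, Real.exp (H σ ω) ∂(windowMeasure ν N u ε)) ∂P

/-! ### The interpolation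

In what follows `h : S^N → ℝ` is a realization of the Hamiltonian and `z p i` stands for
`z_{i,p}`. -/

section Interpolation

variable {S : Set ℝ} {N : ℕ}

/-- The interpolating Hamiltonian `√t h(σ) + √(1-t) ∑_i σ_i ∑_p z_{i,p}`. -/
noncomputable def interpH (k : ℕ) (t : ℝ) (h : (Fin N → S) → ℝ)
    (z : Fin (k + 1) → Fin N → ℝ) (σ : Fin N → S) : ℝ :=
  √t * h σ + √(1 - t) * ∑ i, (σ i : ℝ) * ∑ p, z p i

/-- `F = log ∫_{U_N} exp H_t dν^N`. -/
noncomputable def interpF (ν : Measure S) (u ε : ℝ) (k : ℕ) (t : ℝ)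
    (h : (Fin N → S) → ℝ) (z : Fin (k + 1) → Fin N → ℝ) : ℝ :=
  Real.log (∫ σ, Real.exp (interpH k t h z σ) ∂(windowMeasure ν N u ε))

/-- `φ_N(t) = (1/N) 𝔼 𝒫(m) F`. -/
noncomputable def interpPhi (ν : Measure S) (ξ : ℝ → ℝ) (u ε : ℝ) (k : ℕ) (m q : ℕ → ℝ)
    {Ω : Type*} [MeasurableSpace Ω] (P : Measure Ω) (H : (Fin N → S) → Ω → ℝ) (t : ℝ) : ℝ :=
  (1 / (N : ℝ)) * ∫ ω, parisiFunctional (fun p : Fin (k + 1) => zLawN N ξ q p) m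
    (interpF ν u ε k t (fun σ => H σ ω)) ∂P

/-- The Gibbs average `⟨f⟩_t` on `U_N`: `⟨f⟩_t exp F = ∫_{U_N} f exp H_t dν^N`. -/
noncomputable def gibbsAvg (ν : Measure S) (u ε : ℝ) (k : ℕ) (t : ℝ)
    (h : (Fin N → S) → ℝ) (f : (Fin N → S) → ℝ) (z : Fin (k + 1) → Fin N → ℝ) : ℝ :=
  (∫ σ, f σ * Real.exp (interpH k t h z σ) ∂(windowMeasure ν N u ε)) /
    Real.exp (interpF ν u ε k t h z)

/-- `W_l` for the function `F` of the interpolation. -/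
noncomputable def interpW (ν : Measure S) (ξ : ℝ → ℝ) (u ε : ℝ) (k : ℕ) (m q : ℕ → ℝ)
    (t : ℝ) (h : (Fin N → S) → ℝ) (l : ℕ) (z : Fin (k + 1) → Fin N → ℝ) : ℝ :=
  parisiW (fun p : Fin (k + 1) => zLawN N ξ q p) m (interpF ν u ε k t h) l z

/-- The random probability `γ_l` on `U_N`, as a functional:
`γ_l(f) = 𝔼_l (W_l ⋯ W_k ⟨f⟩_t)`. -/
noncomputable def gammaL (ν : Measure S) (ξ : ℝ → ℝ) (u ε : ℝ) (k : ℕ) (m q : ℕ → ℝ)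
    (t : ℝ) (h : (Fin N → S) → ℝ) (l : ℕ) (f : (Fin N → S) → ℝ)
    (z : Fin (k + 1) → Fin N → ℝ) : ℝ :=
  condE (fun p : Fin (k + 1) => zLawN N ξ q p) l
    (fun z' => (∏ j ∈ Finset.Icc l k, interpW ν ξ u ε k m q t h j z') *
      gibbsAvg ν u ε k t h f z') z

/-- The average `γ_l^{⊗2}(f)` of `f(σ¹, σ²)` with respect to the product of `γ_l` with itself,
computed one variable after the other. -/
noncomputable def gammaL2 (ν : Measure S) (ξ : ℝ → ℝ) (u ε : ℝ) (k : ℕ) (m q : ℕ → ℝ)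
    (t : ℝ) (h : (Fin N → S) → ℝ) (l : ℕ) (f : (Fin N → S) → (Fin N → S) → ℝ)
    (z : Fin (k + 1) → Fin N → ℝ) : ℝ :=
  gammaL ν ξ u ε k m q t h l
    (fun σ => gammaL ν ξ u ε k m q t h l (fun τ => f σ τ) z) z

/-- `μ_l(f) = 𝔼 (W_1 ⋯ W_{l-1} γ_l^{⊗2}(f))`, the expectation being over the Hamiltonian and
all `z_{i,p}`, which are independent of each other. -/
noncomputable def muL (ν : Measure S) (ξ : ℝ → ℝ) (u ε : ℝ) (k : ℕ) (m q : ℕ → ℝ)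
    {Ω : Type*} [MeasurableSpace Ω] (P : Measure Ω) (H : (Fin N → S) → Ω → ℝ) (t : ℝ)
    (l : ℕ) (f : (Fin N → S) → (Fin N → S) → ℝ) : ℝ :=
  ∫ x : Ω × (Fin (k + 1) → Fin N → ℝ),
    (∏ j ∈ Finset.Ico 1 l, interpW ν ξ u ε k m q t (fun σ => H σ x.1) j x.2) *
      gammaL2 ν ξ u ε k m q t (fun σ => H σ x.1) l f x.2
    ∂(P.prod (Measure.pi (fun p : Fin (k + 1) => zLawN N ξ q p)))

end Interpolation

/-- `u_N(λ)`: `max(d, u - ε)` for `λ ≥ 0` and `min(D, u + ε)` for `λ < 0`. -/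
noncomputable def uWindow (d D u ε lam : ℝ) : ℝ :=
  if 0 ≤ lam then max d (u - ε) else min D (u + ε)

end SpinGlass

namespace SpinGlass

/-! One step `(1/m_l) log 𝔼_l exp (m_l ·)` of the recursion has as its derivative an average tilted
by `W_l`, and `W_l` has conditional mean one. Iterating, and using `W_0 = 1` because `m_0 = 0`, the
derivative of the Parisi functional of `F` is the expectation of `W_1 ⋯ W_k` times that of `F`
(`DerivFam.parisiLevel`, `weightedAvg_eq_parisiAvg`). So `φ_N'(t)` is the average of `∂H_t/∂t`,
which is linear in the Gaussian variables, against the density `rho = W_1 ⋯ W_k exp (H_t - F)`, and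
Gaussian integration by parts applies.

The core is the logarithmic derivative of `rho`. Its logarithm is `∑ m_j (F_{j+1} - F_j) + H_t(σ) -
F_{k+1}`; summation by parts with `m_0 = 0` and `m_k = 1` shows that in a direction changing `H_t`
by `f` it moves by `f(σ) - ∑ (m_j - m_{j-1}) γ_j(f)` (`abel_sum`, `hasDerivAt_weight`). In the
direction of a variable `z_{i,p}` only the levels `j > p` move (`hasDerivAt_rho_translate`). The
part coming from `H_N` therefore gives half of the diagonal covariance minus half of `∑ (m_j -
m_{j-1}) μ_j(covariance)`. The external field gives, with the opposite sign, the same expression for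
the overlap with the variances `ξ'(q_{p+1}) - ξ'(q_p)`, whose sum over `p < j` telescopes to
`ξ'(q_j)` since `ξ'(0) = 0`. Completing by `θ`, every bracket becomes `ξ(R) - R ξ'(q) + θ(q)`, the
gap between the convex function `ξ` and its tangent at `q`. This is nonnegative everywhere, and of
order `ε` on the diagonal, where `q = u` and the self-overlap is within `ε` of `u`. The terms
`θ(q_l)`, summed by parts, form the first sum, and the covariance error costs `c/2` twice
(`exists_hasDerivWithinAt_interpPhi`).

The analytic difficulty is that `H_N` has an uncountable index set and is only jointly measurable.
At a fixed `σ` write `H τ = (C(σ,τ)/C(σ,σ)) H σ + residual`. The residual process is independent of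
`H σ`, and `rho` sees it only through the occupation measure, the image of `μ` under `τ ↦ (τ,
residual τ)`. This random measure is measurable for the residual σ-algebra up to null sets
(`eventuallyMeasurable_measure_section`), hence also independent of `H σ`, and the one-dimensional
formula can be used (`integral_process_mul`, `integral_process_mul_rho`). Path regularity is
replaced by exponential moments of almost every path under `μ` (`IsBddGaussian.ae_isExpWeight`). The
formula so obtained is continuous on `[0, 1]`, which yields the one-sided derivatives at the end
points.

For the upper bound, drop the nonnegative terms and integrate. At `t = 0` the Hamiltonian is a sum
over sites: inserting `exp (λ ∑ σ_i² - N λ u_N(λ)) ≥ 1` and enlarging the window to the full product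
space gives independent sites (`log_integral_window_le`), and the recursion is monotone and additive
over independent sites (`parisiLevel_mono`, `parisiLevel_sum`). -/

/-- Gaussian integration by parts on the line. -/
theorem integral_id_mul_gaussianReal {v : NNReal} {f f' : ℝ → ℝ}
    (hf : ∀ x, HasDerivAt f (f' x) x)
    (h0 : Integrable f (gaussianReal 0 v))
    (h1 : Integrable (fun x => x * f x) (gaussianReal 0 v))
    (h2 : Integrable f' (gaussianReal 0 v)) :
    ∫ x, x * f x ∂(gaussianReal 0 v) = v * ∫ x, f' x ∂(gaussianReal 0 v) := by
  -- Variance zero means the Dirac mass at `0`, which has no density; both sides then vanish.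
  rcases eq_or_ne v 0 with rfl | hv
  · simp
  have hv' : (v : ℝ) ≠ 0 := by exact_mod_cast hv
  rw [gaussianReal_of_var_ne_zero 0 hv] at h0 h1 h2
  have hmeas : Measurable (gaussianPDF 0 v) := measurable_gaussianPDF 0 v
  have hlt : ∀ᵐ x ∂(volume : Measure ℝ), gaussianPDF 0 v x < ⊤ :=
    ae_of_all _ fun x => gaussianPDF_lt_top
  rw [integrable_withDensity_iff_integrable_smul' hmeas hlt] at h0 h1 h2
  simp only [toReal_gaussianPDF, smul_eq_mul] at h0 h1 h2
  rw [integral_gaussianReal_eq_integral_smul hv, integral_gaussianReal_eq_integral_smul hv]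
  simp only [smul_eq_mul]
  -- The density satisfies `p' = -(x / v) p`, so `x p = -v p'` and the claim becomes integration by
  -- parts for Lebesgue measure.
  have hp : ∀ x, HasDerivAt (gaussianPDFReal 0 v) (-(x / v) * gaussianPDFReal 0 v x) x := by
    intro x
    have h : HasDerivAt (fun x : ℝ => -(x - 0) ^ 2 / (2 * v)) (-(x / v)) x := by
      have := ((((hasDerivAt_id x).sub_const 0).pow 2).neg).div_const (2 * (v : ℝ))
      refine this.congr_deriv ?_
      simp only [id, sub_zero]
      field_simp
      norm_num
    have := (h.exp).const_mul ((√(2 * Real.pi * v))⁻¹)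
    refine this.congr_deriv ?_
    simp only [gaussianPDFReal]
    ring
  have := integral_mul_deriv_eq_deriv_mul_of_integrable (u := f) (v := gaussianPDFReal 0 v)
    (u' := f') (v' := fun x => -(x / v) * gaussianPDFReal 0 v x)
    (fun x _ => hf x) (fun x _ => hp x)
    (by refine (h1.mul_const (-(v : ℝ)⁻¹)).congr (ae_of_all _ fun x => ?_)
        simp only [Pi.mul_apply]; field_simp)
    (by refine h2.congr (ae_of_all _ fun x => ?_); simp only [Pi.mul_apply]; ring)
    (by refine h0.congr (ae_of_all _ fun x => ?_); simp only [Pi.mul_apply]; ring)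
  have e1 : ∫ x, gaussianPDFReal 0 v x * (x * f x)
      = -v * ∫ x, f x * (-(x / v) * gaussianPDFReal 0 v x) := by
    rw [← integral_const_mul]
    congr 1; ext x; field_simp
  rw [e1, this]
  simp only [neg_mul, mul_neg, neg_neg]
  congr 2; ext x; ring

/-! ### Averages over the variables from a given level on -/

section CondE

variable {E : Type*} {k : ℕ}

/-- The vector with the components of `z` below `l` and those of `z'` from `l` on. -/
def merge (l : ℕ) (z z' : Fin (k + 1) → E) : Fin (k + 1) → E :=
  fun p => if (p : ℕ) < l then z p else z' p

theorem merge_merge_left {l l' : ℕ} (h : l ≤ l') (z z' z'' : Fin (k + 1) → E) :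
    merge l (merge l' z z') z'' = merge l z z'' := by
  funext p
  simp only [merge]
  split_ifs <;> first | rfl | omega

theorem merge_merge_assoc {l l' : ℕ} (h : l ≤ l') (z z' z'' : Fin (k + 1) → E) :
    merge l' (merge l z z') z'' = merge l z (merge l' z' z'') := by
  funext p
  simp only [merge]
  split_ifs <;> first | rfl | omega

theorem merge_zero (z z' : Fin (k + 1) → E) : merge 0 z z' = z' := by
  funext p; simp [merge]

theorem merge_last (z z' : Fin (k + 1) → E) : merge (k + 1) z z' = z := by
  funext p; simp only [merge]; rw [if_pos p.2]

/-- `f` depends on the components below `l` only. -/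
def DependsBelow {α : Type*} (l : ℕ) (f : (Fin (k + 1) → E) → α) : Prop :=
  ∀ z z', f (merge l z z') = f z

theorem DependsBelow.mono {α : Type*} {l l' : ℕ} (h : l ≤ l') {f : (Fin (k + 1) → E) → α}
    (hf : DependsBelow l f) : DependsBelow l' f := by
  intro z z'
  rw [← hf (merge l' z z') z, merge_merge_left h, hf]

variable [MeasurableSpace E] (γ : Fin (k + 1) → Measure E)

theorem condE_eq (l : ℕ) (G : (Fin (k + 1) → E) → ℝ) (z : Fin (k + 1) → E) :
    condE γ l G z = ∫ z', G (merge l z z') ∂(Measure.pi γ) := rfl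

theorem dependsBelow_condE (l : ℕ) (G : (Fin (k + 1) → E) → ℝ) :
    DependsBelow l (condE γ l G) := by
  intro z z'
  simp only [condE_eq, merge_merge_left le_rfl]

theorem condE_zero (G : (Fin (k + 1) → E) → ℝ) (z : Fin (k + 1) → E) :
    condE γ 0 G z = ∫ z', G z' ∂(Measure.pi γ) := by
  simp only [condE_eq, merge_zero]

theorem dependsBelow_parisiStep (l : ℕ) (a : ℝ) (G : (Fin (k + 1) → E) → ℝ) :
    DependsBelow l (parisiStep γ l a G) := by
  intro z z'
  simp only [parisiStep, dependsBelow_condE γ l _ z z']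

theorem dependsBelow_parisiLevel (m : ℕ → ℝ) (F : (Fin (k + 1) → E) → ℝ) {l : ℕ}
    (hl : l ≤ k + 1) : DependsBelow l (parisiLevel γ m F l) := by
  rcases Nat.lt_or_ge k l with h | h
  · obtain rfl : l = k + 1 := by omega
    intro z z'
    rw [merge_last]
  · rw [parisiLevel_of_le γ m F h]
    exact dependsBelow_parisiStep γ l _ _

theorem dependsBelow_parisiW (m : ℕ → ℝ) (F : (Fin (k + 1) → E) → ℝ) {l : ℕ}
    (hl : l ≤ k) : DependsBelow (l + 1) (parisiW γ m F l) := by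
  intro z z'
  simp only [parisiW]
  rw [dependsBelow_parisiLevel γ m F (by omega) z z',
    (dependsBelow_parisiLevel γ m F (show l ≤ k + 1 by omega)).mono (Nat.le_succ l) z z']

/-- The weighted average `𝔼_l (W_l ⋯ W_k f)`. -/
noncomputable def parisiAvg (m : ℕ → ℝ) (F : (Fin (k + 1) → E) → ℝ) (l : ℕ)
    (f : (Fin (k + 1) → E) → ℝ) (z : Fin (k + 1) → E) : ℝ :=
  condE γ l (fun w => (∏ j ∈ Finset.Icc l k, parisiW γ m F j w) * f w) z

theorem dependsBelow_parisiAvg (m : ℕ → ℝ) (F : (Fin (k + 1) → E) → ℝ) (l : ℕ)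
    (f : (Fin (k + 1) → E) → ℝ) : DependsBelow l (parisiAvg γ m F l f) :=
  dependsBelow_condE γ l _

theorem condE_mul_left {l : ℕ} {A : (Fin (k + 1) → E) → ℝ} (hA : DependsBelow l A)
    (G : (Fin (k + 1) → E) → ℝ) (z : Fin (k + 1) → E) :
    condE γ l (fun w => A w * G w) z = A z * condE γ l G z := by
  simp only [condE_eq, hA z]
  rw [integral_const_mul]

theorem measurable_merge (l : ℕ) :
    Measurable (fun x : (Fin (k + 1) → E) × (Fin (k + 1) → E) => merge l x.1 x.2) := by
  refine measurable_pi_iff.2 fun p => ?_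
  by_cases h : (p : ℕ) < l
  · simp only [merge, h, if_true]; fun_prop
  · simp only [merge, h, if_false]; fun_prop

theorem measurable_merge_right (l : ℕ) (z : Fin (k + 1) → E) : Measurable (merge l z) :=
  (measurable_merge l).comp measurable_prodMk_left

variable [∀ p, IsProbabilityMeasure (γ p)]

theorem condE_last (G : (Fin (k + 1) → E) → ℝ) (z : Fin (k + 1) → E) :
    condE γ (k + 1) G z = G z := by
  simp [condE_eq, merge_last]

/-- The coordinates below `l` of one sample and those from `l` on of an independent one form again a
sample, as the coordinates are independent. Hence `condE` is a genuine conditional expectation: the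
formula for total expectation and the tower property both come from here. -/
theorem measurePreserving_merge (l : ℕ) :
    MeasurePreserving (fun x : (Fin (k + 1) → E) × (Fin (k + 1) → E) => merge l x.1 x.2)
      ((Measure.pi γ).prod (Measure.pi γ)) (Measure.pi γ) := by
  refine ⟨measurable_merge l, (Measure.pi_eq fun s hs => ?_).symm⟩
  rw [Measure.map_apply (measurable_merge l) (MeasurableSet.univ_pi hs)]
  have : (fun x : (Fin (k + 1) → E) × (Fin (k + 1) → E) => merge l x.1 x.2) ⁻¹'
      (Set.univ.pi s) = (Set.univ.pi fun p : Fin (k + 1) => if (p : ℕ) < l then s p else Set.univ) ×ˢ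
        (Set.univ.pi fun p : Fin (k + 1) => if (p : ℕ) < l then Set.univ else s p) := by
    ext x
    simp only [Set.mem_preimage, Set.mem_univ_pi, Set.mem_prod, merge, ← forall_and]
    refine forall_congr' fun p => ?_
    by_cases h : (p : ℕ) < l <;> simp [h]
  rw [this, Measure.prod_prod, Measure.pi_pi, Measure.pi_pi, ← Finset.prod_mul_distrib]
  refine Finset.prod_congr rfl fun p _ => ?_
  by_cases h : (p : ℕ) < l <;> simp [h]

theorem integral_condE {l : ℕ} {G : (Fin (k + 1) → E) → ℝ}
    (hG : Integrable G (Measure.pi γ)) :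
    ∫ z, condE γ l G z ∂(Measure.pi γ) = ∫ z, G z ∂(Measure.pi γ) := by
  have hmp := measurePreserving_merge γ l
  have hi : Integrable (fun x : (Fin (k + 1) → E) × (Fin (k + 1) → E) =>
      G (merge l x.1 x.2)) ((Measure.pi γ).prod (Measure.pi γ)) :=
    hmp.integrable_comp_of_integrable hG
  simp only [condE_eq]
  rw [← integral_prod _ hi]
  conv_rhs => rw [← hmp.map_eq]
  rw [integral_map hmp.measurable.aemeasurable]
  rw [hmp.map_eq]; exact hG.aestronglyMeasurable

/-- Integrability is asked only on the slice over `z`, so the tower property holds at every `z` and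
not just almost everywhere; the recursion is evaluated at individual points. -/
theorem condE_condE {l l' : ℕ} (h : l ≤ l') {G : (Fin (k + 1) → E) → ℝ}
    (z : Fin (k + 1) → E) (hG : Integrable (fun w => G (merge l z w)) (Measure.pi γ)) :
    condE γ l (condE γ l' G) z = condE γ l G z := by
  have := integral_condE γ (l := l') hG
  simp only [condE_eq] at this ⊢
  simp only [merge_merge_assoc h]
  exact this

/-- The parameter `a` will carry the disorder, a shift, or an occupation measure, so measurability
is needed jointly in the parameter and in `z`. -/
theorem measurable_condE {α : Type*} [MeasurableSpace α]
    {G : α → (Fin (k + 1) → E) → ℝ} (hG : Measurable (Function.uncurry G)) (l : ℕ) :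
    Measurable (Function.uncurry fun a => condE γ l (G a)) := by
  have : StronglyMeasurable (fun x : (α × (Fin (k + 1) → E)) × (Fin (k + 1) → E) =>
      G x.1.1 (merge l x.1.2 x.2)) := by
    refine Measurable.stronglyMeasurable ?_
    have h2 : Measurable (fun x : (α × (Fin (k + 1) → E)) × (Fin (k + 1) → E) =>
        (x.1.1, merge l x.1.2 x.2)) :=
      Measurable.prodMk (by fun_prop) ((measurable_merge l).comp
        (g := fun x : (Fin (k + 1) → E) × (Fin (k + 1) → E) => merge l x.1 x.2)
        (f := fun x : (α × (Fin (k + 1) → E)) × (Fin (k + 1) → E) => (x.1.2, x.2))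
        (by fun_prop))
    exact hG.comp h2
  exact this.integral_prod_right'.measurable

theorem measurable_parisiStep {α : Type*} [MeasurableSpace α]
    {G : α → (Fin (k + 1) → E) → ℝ} (hG : Measurable (Function.uncurry G)) (l : ℕ) (a : ℝ) :
    Measurable (Function.uncurry fun x => parisiStep γ l a (G x)) := by
  by_cases ha : a = 0
  · have : (fun x => parisiStep γ l a (G x)) = fun x => condE γ l (G x) := by
      funext x z; simp only [parisiStep, if_pos ha]
    rw [this]
    exact measurable_condE γ hG l
  · have : (fun x => parisiStep γ l a (G x)) = fun x z =>
        1 / a * Real.log (condE γ l (fun z' => Real.exp (a * G x z')) z) := by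
      funext x z; simp only [parisiStep, if_neg ha]
    rw [this]
    have h1 : Measurable (Function.uncurry fun x z => Real.exp (a * G x z)) :=
      (hG.const_mul a).exp
    exact ((measurable_condE γ h1 l).log).const_mul _

theorem measurable_parisiIter {α : Type*} [MeasurableSpace α]
    {G : α → (Fin (k + 1) → E) → ℝ} (hG : Measurable (Function.uncurry G)) (m : ℕ → ℝ)
    (j : ℕ) : Measurable (Function.uncurry fun x => parisiIter γ m (G x) j) := by
  induction j with
  | zero => exact hG
  | succ j ih => exact measurable_parisiStep γ ih _ _

theorem measurable_parisiLevel {α : Type*} [MeasurableSpace α]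
    {G : α → (Fin (k + 1) → E) → ℝ} (hG : Measurable (Function.uncurry G)) (m : ℕ → ℝ)
    (l : ℕ) : Measurable (Function.uncurry fun x => parisiLevel γ m (G x) l) :=
  measurable_parisiIter γ hG m _

theorem measurable_parisiW {α : Type*} [MeasurableSpace α]
    {G : α → (Fin (k + 1) → E) → ℝ} (hG : Measurable (Function.uncurry G)) (m : ℕ → ℝ)
    (l : ℕ) : Measurable (Function.uncurry fun x => parisiW γ m (G x) l) :=
  (((measurable_parisiLevel γ hG m (l + 1)).sub
    (measurable_parisiLevel γ hG m l)).const_mul (m l)).exp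

theorem measurable_prod_parisiW {α : Type*} [MeasurableSpace α]
    {G : α → (Fin (k + 1) → E) → ℝ} (hG : Measurable (Function.uncurry G)) (m : ℕ → ℝ)
    (s : Finset ℕ) :
    Measurable (Function.uncurry fun x z => ∏ j ∈ s, parisiW γ m (G x) j z) :=
  Finset.measurable_fun_prod s fun j _ => measurable_parisiW γ hG m j

theorem measurable_parisiAvg {α : Type*} [MeasurableSpace α]
    {G f : α → (Fin (k + 1) → E) → ℝ} (hG : Measurable (Function.uncurry G))
    (hf : Measurable (Function.uncurry f)) (m : ℕ → ℝ) (l : ℕ) :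
    Measurable (Function.uncurry fun x => parisiAvg γ m (G x) l (f x)) :=
  measurable_condE γ (G := fun x w => (∏ j ∈ Finset.Icc l k, parisiW γ m (G x) j w) * f x w)
    ((measurable_prod_parisiW γ hG m _).mul hf) l

end CondE


/-! ### Functions of exponential growth -/

section Growth

variable {Z : Type*} [NormedAddCommGroup Z]

/-- `|f z| ≤ exp (K (1 + ‖z‖))` for all `z`. -/
def ExpBounded (K : ℝ) (f : Z → ℝ) : Prop := ∀ z, |f z| ≤ Real.exp (K * (1 + ‖z‖))

theorem one_add_norm_pos (z : Z) : 0 < 1 + ‖z‖ := by positivity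

theorem ExpBounded.mono {K K' : ℝ} (h : K ≤ K') {f : Z → ℝ} (hf : ExpBounded K f) :
    ExpBounded K' f := fun z =>
  (hf z).trans (Real.exp_le_exp.2 (mul_le_mul_of_nonneg_right h (one_add_norm_pos z).le))

theorem ExpBounded.mul {K K' : ℝ} {f g : Z → ℝ} (hf : ExpBounded K f) (hg : ExpBounded K' g) :
    ExpBounded (K + K') fun z => f z * g z := by
  intro z
  rw [abs_mul, add_mul, Real.exp_add]
  exact mul_le_mul (hf z) (hg z) (abs_nonneg _) (Real.exp_pos _).le

theorem expBounded_prod {ι : Type*} (s : Finset ι) {K : ι → ℝ} {f : ι → Z → ℝ}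
    (hf : ∀ i ∈ s, ExpBounded (K i) (f i)) :
    ExpBounded (∑ i ∈ s, K i) fun z => ∏ i ∈ s, f i z := by
  intro z
  rw [Finset.abs_prod, Finset.sum_mul, Real.exp_sum]
  exact Finset.prod_le_prod (fun _ _ => abs_nonneg _) fun i hi => hf i hi z

/-- Since `c ≤ exp (c (1 + ‖z‖))`, a prefactor is absorbed into the rate, and growth can be tracked
by a single number. -/
theorem expBounded_const_mul {c K : ℝ} {f : Z → ℝ} (hc : 0 ≤ c)
    (h : ∀ z, |f z| ≤ c * Real.exp (K * (1 + ‖z‖))) : ExpBounded (c + K) f := by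
  intro z
  refine (h z).trans ?_
  rw [add_mul, Real.exp_add]
  refine mul_le_mul_of_nonneg_right ?_ (Real.exp_pos _).le
  have h1 : c ≤ c * (1 + ‖z‖) := by nlinarith [norm_nonneg z]
  linarith [Real.add_one_le_exp (c * (1 + ‖z‖))]

theorem expBounded_of_le {c : ℝ} {f : Z → ℝ} (h : ∀ z, |f z| ≤ c) : ExpBounded c f := by
  have hc : 0 ≤ c := (abs_nonneg _).trans (h 0)
  simpa using expBounded_const_mul (K := 0) hc (f := f) (by simpa using h)

/-- `f` is Lipschitz with constant `B`. -/
def IsLip (B : ℝ) (f : Z → ℝ) : Prop := ∀ z z', |f z - f z'| ≤ B * ‖z - z'‖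

theorem IsLip.continuous {B : ℝ} {f : Z → ℝ} (hf : IsLip B f) : Continuous f := by
  have : LipschitzWith (Real.toNNReal B) f := by
    refine LipschitzWith.of_dist_le_mul fun x y => ?_
    rw [Real.dist_eq, dist_eq_norm]
    exact (hf x y).trans (mul_le_mul_of_nonneg_right (Real.le_coe_toNNReal B) (norm_nonneg _))
  exact this.continuous

theorem IsLip.abs_le {B : ℝ} {f : Z → ℝ} (hf : IsLip B f) (z : Z) :
    |f z| ≤ |f 0| + B * ‖z‖ := by
  have h1 := hf z 0
  rw [sub_zero] at h1
  have h2 := abs_sub_abs_le_abs_sub (f z) (f 0)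
  linarith

theorem IsLip.exp_le {B a : ℝ} {f : Z → ℝ} (hf : IsLip B f) (hB : 0 ≤ B) (ha : 0 ≤ a) :
    ExpBounded (a * (|f 0| + B)) fun z => Real.exp (a * f z) := by
  intro z
  rw [Real.abs_exp, Real.exp_le_exp]
  have h1 := (le_abs_self _).trans (hf.abs_le z)
  have h2 : |f 0| + B * ‖z‖ ≤ (|f 0| + B) * (1 + ‖z‖) := by
    nlinarith [norm_nonneg z, abs_nonneg (f 0)]
  calc a * f z ≤ a * ((|f 0| + B) * (1 + ‖z‖)) := mul_le_mul_of_nonneg_left (h1.trans h2) ha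
    _ = _ := by ring

theorem IsLip.expBounded {B : ℝ} {f : Z → ℝ} (hf : IsLip B f) (hB : 0 ≤ B) :
    ExpBounded (|f 0| + B) f := by
  intro z
  have h1 := hf.abs_le z
  have h2 : |f 0| + B * ‖z‖ ≤ (|f 0| + B) * (1 + ‖z‖) := by
    nlinarith [norm_nonneg z, abs_nonneg (f 0)]
  linarith [Real.add_one_le_exp ((|f 0| + B) * (1 + ‖z‖))]

end Growth

/-! ### The elementary step -/

section LogSumExp

variable {Z : Type*} [MeasurableSpace Z]

/-- `(1/a) log ∫ exp (a g) dP`, read as `∫ g dP` if `a = 0`. -/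
noncomputable def lse (P : Measure Z) (a : ℝ) (g : Z → ℝ) : ℝ :=
  if a = 0 then ∫ z, g z ∂P else (1 / a) * Real.log (∫ z, Real.exp (a * g z) ∂P)

variable {P : Measure Z} [IsProbabilityMeasure P] {a : ℝ}

/-- Serves twice: with `c` a multiple of a distance it carries Lipschitz bounds through the
recursion, with `c` a constant it compares two recursions. -/
theorem lse_mono {f g : Z → ℝ} {c : ℝ} (ha : 0 ≤ a)
    (hf : Integrable f P) (hg : Integrable g P)
    (hf' : Integrable (fun z => Real.exp (a * f z)) P)
    (hg' : Integrable (fun z => Real.exp (a * g z)) P)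
    (h : ∀ z, f z ≤ g z + c) : lse P a f ≤ lse P a g + c := by
  by_cases h0 : a = 0
  · simp only [lse, if_pos h0]
    calc ∫ z, f z ∂P ≤ ∫ z, (g z + c) ∂P :=
          integral_mono hf (hg.add (integrable_const c)) h
      _ = _ := by rw [integral_add hg (integrable_const c)]; simp
  · have hpos : 0 < a := lt_of_le_of_ne ha (Ne.symm h0)
    simp only [lse, if_neg h0]
    have h1 : ∫ z, Real.exp (a * f z) ∂P ≤ (∫ z, Real.exp (a * g z) ∂P) * Real.exp (a * c) := by
      rw [← integral_mul_const]
      refine integral_mono hf' (hg'.mul_const _) fun z => ?_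
      simp only
      rw [← Real.exp_add, Real.exp_le_exp, ← mul_add]
      exact mul_le_mul_of_nonneg_left (h z) ha
    have h2 := Real.log_le_log (integral_exp_pos hf') h1
    rw [Real.log_mul (integral_exp_pos hg').ne' (Real.exp_pos _).ne', Real.log_exp] at h2
    have h3 := mul_le_mul_of_nonneg_left h2 (one_div_pos.2 hpos).le
    rw [mul_add] at h3
    have h4 : 1 / a * (a * c) = c := by field_simp
    linarith

/-- The normalization that makes each `W_l` a conditional probability density; for `a = 0` the
weight is identically one. -/
theorem exp_mul_lse {g : Z → ℝ} (hg' : Integrable (fun z => Real.exp (a * g z)) P) :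
    ∫ z, Real.exp (a * (g z - lse P a g)) ∂P = 1 := by
  by_cases h0 : a = 0
  · simp [h0]
  · have e : ∀ z, Real.exp (a * (g z - lse P a g))
        = Real.exp (a * g z) * (∫ z, Real.exp (a * g z) ∂P)⁻¹ := by
      intro z
      simp only [lse, if_neg h0]
      rw [mul_sub, Real.exp_sub, ← mul_assoc, mul_one_div_cancel h0, one_mul,
        Real.exp_log (integral_exp_pos hg'), div_eq_mul_inv]
    simp only [e]
    rw [integral_mul_const, mul_inv_cancel₀ (integral_exp_pos hg').ne']

/-- The tilt `exp (a (g - lse g))` equals one if `a = 0` and `exp (a g) / ∫ exp (a g)` otherwise, so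
one formula covers both readings of the step. The single dominating function `b` controls `g'`,
needed when `a = 0`, and the derivative of `exp (a g)`, needed when `a ≠ 0`. -/
theorem hasDerivAt_lse {U : Set ℝ} {s : ℝ} (hU : U ∈ nhds s) {g g' : ℝ → Z → ℝ}
    {b : Z → ℝ} (hb : Integrable b P)
    (hm : ∀ r ∈ U, Measurable (g r)) (hm' : ∀ r ∈ U, Measurable (g' r))
    (hi : ∀ r ∈ U, Integrable (g r) P)
    (hi' : ∀ r ∈ U, Integrable (fun z => Real.exp (a * g r z)) P)
    (hd : ∀ r ∈ U, ∀ z, HasDerivAt (fun r => g r z) (g' r z) r)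
    (hb1 : ∀ r ∈ U, ∀ z, |g' r z| ≤ b z)
    (hb2 : ∀ r ∈ U, ∀ z, |Real.exp (a * g r z) * (a * g' r z)| ≤ b z) :
    HasDerivAt (fun r => lse P a (g r))
      (∫ z, Real.exp (a * (g s z - lse P a (g s))) * g' s z ∂P) s := by
  have hs : s ∈ U := mem_of_mem_nhds hU
  by_cases h0 : a = 0
  · have := (hasDerivAt_integral_of_dominated_loc_of_deriv_le (μ := P) (F := g) (F' := g')
      (bound := b) hU (Filter.eventually_of_mem hU fun r hr => (hm r hr).aestronglyMeasurable)
      (hi s hs) (hm' s hs).aestronglyMeasurable (ae_of_all _ fun z r hr => hb1 r hr z) hb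
      (ae_of_all _ fun z r hr => hd r hr z)).2
    simpa [lse, h0] using this
  · have h1 := (hasDerivAt_integral_of_dominated_loc_of_deriv_le (μ := P)
      (F := fun r z => Real.exp (a * g r z))
      (F' := fun r z => Real.exp (a * g r z) * (a * g' r z))
      (bound := b) hU
      (Filter.eventually_of_mem hU fun r hr => (((hm r hr).const_mul a).exp).aestronglyMeasurable)
      (hi' s hs)
      ((((hm s hs).const_mul a).exp).mul ((hm' s hs).const_mul a)).aestronglyMeasurable
      (ae_of_all _ fun z r hr => hb2 r hr z) hb
      (ae_of_all _ fun z r hr => ((hd r hr z).const_mul a).exp)).2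
    have hpos := integral_exp_pos (hi' s hs)
    have h2 := (h1.log hpos.ne').const_mul (1 / a)
    have e : (fun r => lse P a (g r)) =
        fun r => 1 / a * Real.log (∫ z, Real.exp (a * g r z) ∂P) := by
      funext r; simp only [lse, if_neg h0]
    have e2 : ∀ z, Real.exp (a * (g s z - lse P a (g s))) * g' s z
        = (1 / a * (∫ z, Real.exp (a * g s z) ∂P)⁻¹) *
          (Real.exp (a * g s z) * (a * g' s z)) := by
      intro z
      simp only [lse, if_neg h0]
      rw [mul_sub, Real.exp_sub, ← mul_assoc a, mul_one_div_cancel h0, one_mul,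
        Real.exp_log hpos]
      field_simp
    rw [e]
    refine h2.congr_deriv ?_
    simp only [e2]
    rw [integral_const_mul]
    ring

theorem tendsto_lse {T : Type*} {L : Filter T} [L.IsCountablyGenerated] {g : T → Z → ℝ}
    {g0 : Z → ℝ} {b : Z → ℝ} (hb : Integrable b P)
    (hm : ∀ᶠ r in L, Measurable (g r))
    (hi' : Integrable (fun z => Real.exp (a * g0 z)) P)
    (hd : ∀ z, Filter.Tendsto (fun r => g r z) L (nhds (g0 z)))
    (hb1 : ∀ᶠ r in L, ∀ z, |g r z| ≤ b z)
    (hb2 : ∀ᶠ r in L, ∀ z, Real.exp (a * g r z) ≤ b z) :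
    Filter.Tendsto (fun r => lse P a (g r)) L (nhds (lse P a g0)) := by
  by_cases h0 : a = 0
  · simp only [lse, if_pos h0]
    exact tendsto_integral_filter_of_dominated_convergence b
      (hm.mono fun r hr => hr.aestronglyMeasurable)
      (hb1.mono fun r hr => ae_of_all _ hr) hb (ae_of_all _ hd)
  · simp only [lse, if_neg h0]
    refine Filter.Tendsto.const_mul _ (Filter.Tendsto.log ?_ (integral_exp_pos hi').ne')
    refine tendsto_integral_filter_of_dominated_convergence b
      (hm.mono fun r hr => ((hr.const_mul a).exp).aestronglyMeasurable)
      (hb2.mono fun r hr => ae_of_all _ fun z => ?_) hb (ae_of_all _ fun z => ?_)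
    · rw [Real.norm_eq_abs, Real.abs_exp]; exact hr z
    · exact (Real.continuous_exp.tendsto _).comp ((hd z).const_mul a)

end LogSumExp

/-! ### The recursion on Lipschitz functions -/

section Levels

variable {E : Type*} [NormedAddCommGroup E] [MeasurableSpace E] [BorelSpace E]
  [SecondCountableTopology E] {k : ℕ}

/-- `γ_0 ⊗ ⋯ ⊗ γ_k` has all exponential moments. -/
def HasExpMoments (γ : Fin (k + 1) → Measure E) : Prop :=
  ∀ K : ℝ, Integrable (fun z => Real.exp (K * ‖z‖)) (Measure.pi γ)

omit [MeasurableSpace E] [BorelSpace E] [SecondCountableTopology E] in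
theorem norm_merge_le (l : ℕ) (z z' : Fin (k + 1) → E) : ‖merge l z z'‖ ≤ ‖z‖ + ‖z'‖ := by
  refine (pi_norm_le_iff_of_nonneg (by positivity)).2 fun p => ?_
  simp only [merge]
  split_ifs
  · exact (norm_le_pi_norm z p).trans (by linarith [norm_nonneg z'])
  · exact (norm_le_pi_norm z' p).trans (by linarith [norm_nonneg z])

omit [MeasurableSpace E] [BorelSpace E] [SecondCountableTopology E] in
theorem norm_merge_sub_merge_le (l : ℕ) (z₁ z₂ z' : Fin (k + 1) → E) :
    ‖merge l z₁ z' - merge l z₂ z'‖ ≤ ‖z₁ - z₂‖ := by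
  refine (pi_norm_le_iff_of_nonneg (norm_nonneg _)).2 fun p => ?_
  simp only [merge, Pi.sub_apply]
  split_ifs
  · exact norm_le_pi_norm (z₁ - z₂) p
  · simp

omit [MeasurableSpace E] [BorelSpace E] [SecondCountableTopology E] in
theorem norm_merge_sub_le (l : ℕ) (z z' : Fin (k + 1) → E) :
    ‖merge l z z' - z‖ ≤ ‖z‖ + ‖z'‖ := by
  refine (pi_norm_le_iff_of_nonneg (by positivity)).2 fun p => ?_
  simp only [merge, Pi.sub_apply]
  split_ifs
  · simp only [sub_self, norm_zero]; positivity
  · exact (norm_sub_le _ _).trans (by linarith [norm_le_pi_norm z p, norm_le_pi_norm z' p])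

omit [MeasurableSpace E] [BorelSpace E] [SecondCountableTopology E] in
theorem ExpBounded.merge {K : ℝ} (hK : 0 ≤ K) {f : (Fin (k + 1) → E) → ℝ}
    (hf : ExpBounded K f) (l : ℕ) (z z' : Fin (k + 1) → E) :
    |f (merge l z z')| ≤ Real.exp (K * (1 + ‖z‖)) * Real.exp (K * ‖z'‖) := by
  refine (hf _).trans ?_
  rw [← Real.exp_add, Real.exp_le_exp, ← mul_add]
  exact mul_le_mul_of_nonneg_left (by linarith [norm_merge_le l z z']) hK

variable {γ : Fin (k + 1) → Measure E} [∀ p, IsProbabilityMeasure (γ p)]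

omit [BorelSpace E] [SecondCountableTopology E] [∀ p, IsProbabilityMeasure (γ p)] in
theorem ExpBounded.integrable_merge (hγ : HasExpMoments γ) {K : ℝ}
    {f : (Fin (k + 1) → E) → ℝ} (hf : ExpBounded K f) (hm : Measurable f) (l : ℕ)
    (z : Fin (k + 1) → E) : Integrable (fun z' => f (SpinGlass.merge l z z')) (Measure.pi γ) := by
  have hf' := hf.mono (le_max_left K 0)
  exact ((hγ (max K 0)).const_mul _).mono'
    (hm.comp (measurable_merge_right l z)).aestronglyMeasurable
    (ae_of_all _ fun z' => hf'.merge (le_max_right _ _) l z z')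

omit [BorelSpace E] [SecondCountableTopology E] [∀ p, IsProbabilityMeasure (γ p)] in
theorem exists_expBounded_condE (hγ : HasExpMoments γ) (l : ℕ) (K : ℝ) :
    ∃ K', 0 ≤ K' ∧ ∀ f : (Fin (k + 1) → E) → ℝ, ExpBounded K f → ExpBounded K' (condE γ l f) := by
  set K₀ := max K 0
  set I := ∫ z', Real.exp (K₀ * ‖z'‖) ∂(Measure.pi γ)
  have hI : 0 ≤ I := integral_nonneg fun _ => (Real.exp_pos _).le
  refine ⟨I + K₀, add_nonneg hI (le_max_right _ _), fun f hf => ?_⟩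
  have hf' := hf.mono (le_max_left K 0)
  refine expBounded_const_mul hI fun z => ?_
  rw [condE_eq, mul_comm, ← integral_const_mul, ← Real.norm_eq_abs]
  refine norm_integral_le_of_norm_le ((hγ K₀).const_mul _) (ae_of_all _ fun z' => ?_)
  exact hf'.merge (le_max_right _ _) l z z'

omit [NormedAddCommGroup E] [BorelSpace E] [SecondCountableTopology E]
  [∀ p, IsProbabilityMeasure (γ p)] in
theorem parisiStep_eq_lse (l : ℕ) (a : ℝ) (G : (Fin (k + 1) → E) → ℝ) (z : Fin (k + 1) → E) :
    parisiStep γ l a G z = lse (Measure.pi γ) a (fun z' => G (merge l z z')) := rfl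

section Lip

variable {B a : ℝ} (hB : 0 ≤ B) (ha : 0 ≤ a) {F : (Fin (k + 1) → E) → ℝ} (hF : IsLip B F)

include hB hF in
omit [∀ p, IsProbabilityMeasure (γ p)] in
theorem IsLip.integrable_merge (hγ : HasExpMoments γ) (l : ℕ) (z : Fin (k + 1) → E) :
    Integrable (fun z' => F (SpinGlass.merge l z z')) (Measure.pi γ) :=
  (hF.expBounded hB).integrable_merge hγ hF.continuous.measurable l z

include hB ha hF in
omit [∀ p, IsProbabilityMeasure (γ p)] in
theorem IsLip.integrable_exp_merge (hγ : HasExpMoments γ) (l : ℕ) (z : Fin (k + 1) → E) :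
    Integrable (fun z' => Real.exp (a * F (SpinGlass.merge l z z'))) (Measure.pi γ) :=
  (hF.exp_le hB ha).integrable_merge hγ
    ((hF.continuous.measurable.const_mul a).exp) l z

include hB ha hF in
theorem parisiStep_le (hγ : HasExpMoments γ) {G : (Fin (k + 1) → E) → ℝ} (hG : IsLip B G)
    (l : ℕ) {z₁ z₂ : Fin (k + 1) → E} {c : ℝ}
    (h : ∀ z', F (merge l z₁ z') ≤ G (merge l z₂ z') + c) :
    parisiStep γ l a F z₁ ≤ parisiStep γ l a G z₂ + c :=
  lse_mono ha (hF.integrable_merge hB hγ l _) (hG.integrable_merge hB hγ l _)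
    (hF.integrable_exp_merge hB ha hγ l _) (hG.integrable_exp_merge hB ha hγ l _) h

include hB ha hF in
-- Merging is nonexpansive in the frozen variables, and `lse` is monotone and commutes with
-- constants; so the Lipschitz constant does not deteriorate along the recursion.
theorem IsLip.parisiStep (hγ : HasExpMoments γ) (l : ℕ) : IsLip B (parisiStep γ l a F) := by
  have key : ∀ z₁ z₂, SpinGlass.parisiStep γ l a F z₁
      ≤ SpinGlass.parisiStep γ l a F z₂ + B * ‖z₁ - z₂‖ := by
    intro z₁ z₂
    refine parisiStep_le hB ha hF hγ hF l fun z' => ?_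
    have h1 := (le_abs_self _).trans (hF (SpinGlass.merge l z₁ z') (SpinGlass.merge l z₂ z'))
    have h2 := mul_le_mul_of_nonneg_left (norm_merge_sub_merge_le l z₁ z₂ z') hB
    linarith
  intro z z'
  rw [abs_sub_le_iff]
  have h1 := key z z'
  have h2 := key z' z
  rw [norm_sub_rev] at h2
  constructor <;> linarith

include hB ha in
-- Under the average, `F` differs from `F z` by at most `B (‖z‖ + ‖z'‖)`, so the step is compared
-- with `lse` of `± B ‖·‖`. The constant depends on `B`, `a` and the laws but not on `F`; this is
-- what bounds the weights `W_l` uniformly in the disorder.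
theorem exists_parisiStep_sub_le (hγ : HasExpMoments γ) (l : ℕ) :
    ∃ C, 0 ≤ C ∧ ∀ F : (Fin (k + 1) → E) → ℝ, IsLip B F →
      ∀ z, |F z - parisiStep γ l a F z| ≤ C * (1 + ‖z‖) := by
  set g : (Fin (k + 1) → E) → ℝ := fun z => B * ‖z‖
  have hg : IsLip B g := by
    intro z z'
    simp only [g, ← mul_sub, abs_mul, abs_of_nonneg hB]
    exact mul_le_mul_of_nonneg_left (abs_norm_sub_norm_le z z') hB
  have hg' : IsLip B fun z => -g z := by
    intro z z'
    have := hg z' z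
    rw [norm_sub_rev] at this
    rwa [neg_sub_neg]
  set c₁ := lse (Measure.pi γ) a g
  set c₂ := lse (Measure.pi γ) a fun z => -g z
  refine ⟨|c₁| + |c₂| + B, by positivity, fun F hF z => ?_⟩
  have hg0 := hg.integrable_merge (γ := γ) hB hγ 0 0
  have hg0' := hg'.integrable_merge (γ := γ) hB hγ 0 0
  have hge := hg.integrable_exp_merge (γ := γ) hB ha hγ 0 0
  have hge' := hg'.integrable_exp_merge (γ := γ) hB ha hγ 0 0
  simp only [merge_zero] at hg0 hg0' hge hge'
  have hb : ∀ z', |F (merge l z z') - F z| ≤ g z' + B * ‖z‖ := by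
    intro z'
    have := mul_le_mul_of_nonneg_left (norm_merge_sub_le l z z') hB
    exact (hF _ _).trans (by simp only [g]; linarith)
  have h1 : parisiStep γ l a F z ≤ c₁ + (F z + B * ‖z‖) :=
    lse_mono ha (hF.integrable_merge hB hγ l _) hg0 (hF.integrable_exp_merge hB ha hγ l _) hge
      fun z' => by
        have := (abs_sub_le_iff.1 (hb z')).1
        change F (merge l z z') ≤ _
        linarith
  have h2 : c₂ ≤ parisiStep γ l a F z + (B * ‖z‖ - F z) :=
    lse_mono ha hg0' (hF.integrable_merge hB hγ l _) hge' (hF.integrable_exp_merge hB ha hγ l _)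
      fun z' => by
        have := (abs_sub_le_iff.1 (hb z')).2
        change _ ≤ F (merge l z z') + _
        linarith
  have hz := norm_nonneg z
  have e1 := mul_nonneg (abs_nonneg c₁) hz
  have e2 := mul_nonneg (abs_nonneg c₂) hz
  rw [abs_sub_le_iff]
  constructor
  · have := neg_le_abs c₂
    nlinarith [abs_nonneg c₁]
  · have := le_abs_self c₁
    nlinarith [abs_nonneg c₂]

end Lip

variable {m : ℕ → ℝ} {B : ℝ}

/-- Downward induction on the level. -/
theorem level_induction {k : ℕ} {p : ℕ → Prop} (h0 : p (k + 1))
    (hs : ∀ l ≤ k, p (l + 1) → p l) : ∀ l ≤ k + 1, p l := by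
  intro l hl
  induction h : k + 1 - l generalizing l with
  | zero => obtain rfl : l = k + 1 := by omega
            exact h0
  | succ j ih => exact hs l (by omega) (ih (l + 1) (by omega) (by omega))

theorem IsLip.parisiLevel (hγ : HasExpMoments γ) (hB : 0 ≤ B) (hm : ∀ l ≤ k, 0 ≤ m l)
    {F : (Fin (k + 1) → E) → ℝ} (hF : IsLip B F) :
    ∀ l ≤ k + 1, IsLip B (parisiLevel γ m F l) := by
  refine level_induction ?_ fun l hl ih => ?_
  · rwa [parisiLevel_last]
  · rw [parisiLevel_of_le γ m F hl]
    exact ih.parisiStep hB (hm l hl) hγ l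

theorem parisiLevel_mono (hγ : HasExpMoments γ) (hB : 0 ≤ B) (hm : ∀ l ≤ k, 0 ≤ m l)
    {F G : (Fin (k + 1) → E) → ℝ} (hF : IsLip B F) (hG : IsLip B G) {c : ℝ}
    (h : ∀ z, F z ≤ G z + c) :
    ∀ l ≤ k + 1, ∀ z, parisiLevel γ m F l z ≤ parisiLevel γ m G l z + c := by
  refine level_induction ?_ fun l hl ih => ?_
  · simpa only [parisiLevel_last] using h
  · intro z
    rw [parisiLevel_of_le γ m F hl, parisiLevel_of_le γ m G hl]
    exact parisiStep_le hB (hm l hl) (hF.parisiLevel hγ hB hm (l + 1) (by omega)) hγ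
      (hG.parisiLevel hγ hB hm (l + 1) (by omega)) l fun z' => ih _

theorem exists_expBounded_parisiW (hγ : HasExpMoments γ) (hB : 0 ≤ B)
    (hm : ∀ l ≤ k, 0 ≤ m l) {l : ℕ} (hl : l ≤ k) :
    ∃ K, 0 ≤ K ∧ ∀ F : (Fin (k + 1) → E) → ℝ, IsLip B F → ExpBounded K (parisiW γ m F l) := by
  obtain ⟨C, hC, h⟩ := exists_parisiStep_sub_le (γ := γ) hB (hm l hl) hγ l
  refine ⟨m l * C, mul_nonneg (hm l hl) hC, fun F hF z => ?_⟩
  have h1 := h _ (hF.parisiLevel hγ hB hm (l + 1) (by omega)) z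
  rw [← parisiLevel_of_le γ m F hl] at h1
  rw [parisiW, Real.abs_exp, Real.exp_le_exp, mul_assoc]
  exact mul_le_mul_of_nonneg_left ((le_abs_self _).trans h1) (hm l hl)

/-- The rate is fixed before `F`: later `F` varies with the disorder, with `t` and with shifts,
while the bound must not. -/
theorem exists_expBounded_prod_parisiW (hγ : HasExpMoments γ) (hB : 0 ≤ B)
    (hm : ∀ l ≤ k, 0 ≤ m l) :
    ∃ K, 0 ≤ K ∧ ∀ F : (Fin (k + 1) → E) → ℝ, IsLip B F → ∀ s ⊆ Finset.range (k + 1),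
      ExpBounded K fun z => ∏ j ∈ s, parisiW γ m F j z := by
  choose! K hK h using fun (l : ℕ) (hl : l ≤ k) =>
    exists_expBounded_parisiW (γ := γ) hγ hB hm hl
  refine ⟨∑ j ∈ Finset.range (k + 1), K j,
    Finset.sum_nonneg fun j hj => hK j (by simp at hj; omega), fun F hF s hs => ?_⟩
  refine (expBounded_prod s fun j hj => h j (by have := hs hj; simp at this; omega) F hF).mono ?_
  exact Finset.sum_le_sum_of_subset_of_nonneg hs fun j hj _ => hK j (by simp at hj; omega)

omit [NormedAddCommGroup E] [BorelSpace E] [SecondCountableTopology E]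
  [∀ p, IsProbabilityMeasure (γ p)] in
theorem parisiW_pos (F : (Fin (k + 1) → E) → ℝ) (l : ℕ) (z : Fin (k + 1) → E) :
    0 < parisiW γ m F l z := Real.exp_pos _

theorem condE_parisiW (hγ : HasExpMoments γ) (hB : 0 ≤ B) (hm : ∀ l ≤ k, 0 ≤ m l)
    {F : (Fin (k + 1) → E) → ℝ} (hF : IsLip B F) {l : ℕ} (hl : l ≤ k) (z : Fin (k + 1) → E) :
    condE γ l (parisiW γ m F l) z = 1 := by
  have h1 := (hF.parisiLevel hγ hB hm (l + 1) (by omega)).integrable_exp_merge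
    (γ := γ) hB (hm l hl) hγ l z
  rw [← exp_mul_lse h1, condE_eq]
  congr 1; ext z'
  rw [parisiW, dependsBelow_parisiLevel γ m F (show l ≤ k + 1 by omega) z z',
    parisiLevel_of_le γ m F hl, parisiStep_eq_lse]

end Levels


/-! ### Weighted averages and the derivative of the recursion -/

section Deriv

variable {E : Type*} [NormedAddCommGroup E] [MeasurableSpace E] [BorelSpace E]
  [SecondCountableTopology E] {k : ℕ}
  {γ : Fin (k + 1) → Measure E} [∀ p, IsProbabilityMeasure (γ p)] {m : ℕ → ℝ} {B : ℝ}

omit [NormedAddCommGroup E] [BorelSpace E] [SecondCountableTopology E] in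
theorem measurable_condE_const {G : (Fin (k + 1) → E) → ℝ} (hG : Measurable G) (l : ℕ) :
    Measurable (condE γ l G) :=
  (measurable_condE (α := Unit) γ (G := fun _ => G) (hG.comp measurable_snd) l).comp
    (measurable_prodMk_left (x := ()))

omit [NormedAddCommGroup E] [BorelSpace E] [SecondCountableTopology E] in
theorem measurable_parisiW_const {F : (Fin (k + 1) → E) → ℝ} (hF : Measurable F) (l : ℕ) :
    Measurable (parisiW γ m F l) :=
  (measurable_parisiW (α := Unit) γ (G := fun _ => F) (hF.comp measurable_snd) m l).comp
    (measurable_prodMk_left (x := ()))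

omit [NormedAddCommGroup E] [BorelSpace E] [SecondCountableTopology E] in
theorem measurable_prod_parisiW_const {F : (Fin (k + 1) → E) → ℝ} (hF : Measurable F)
    (s : Finset ℕ) : Measurable fun z => ∏ j ∈ s, parisiW γ m F j z :=
  Finset.measurable_fun_prod s fun j _ => measurable_parisiW_const hF j

omit [NormedAddCommGroup E] [BorelSpace E] [SecondCountableTopology E] in
theorem measurable_parisiAvg_const {F f : (Fin (k + 1) → E) → ℝ} (hF : Measurable F)
    (hf : Measurable f) (l : ℕ) : Measurable (parisiAvg γ m F l f) :=
  measurable_condE_const ((measurable_prod_parisiW_const hF _).mul hf) l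

omit [BorelSpace E] [SecondCountableTopology E] [∀ p, IsProbabilityMeasure (γ p)] in
theorem Icc_subset_range (l : ℕ) : Finset.Icc l k ⊆ Finset.range (k + 1) := by
  intro j hj
  simp only [Finset.mem_Icc, Finset.mem_range] at *
  omega

theorem integrable_prod_parisiW_mul (hγ : HasExpMoments γ) (hB : 0 ≤ B)
    (hm : ∀ l ≤ k, 0 ≤ m l) {F f : (Fin (k + 1) → E) → ℝ} (hF : IsLip B F) {K : ℝ}
    (hf : ExpBounded K f) (hf' : Measurable f) {s : Finset ℕ} (hs : s ⊆ Finset.range (k + 1))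
    (l : ℕ) (z : Fin (k + 1) → E) :
    Integrable (fun w => (∏ j ∈ s, parisiW γ m F j (merge l z w)) * f (merge l z w))
      (Measure.pi γ) := by
  obtain ⟨K₁, -, h₁⟩ := exists_expBounded_prod_parisiW (γ := γ) hγ hB hm
  exact ((h₁ F hF s hs).mul hf).integrable_merge hγ
    ((measurable_prod_parisiW_const hF.continuous.measurable s).mul hf') l z

/-- `W_l` involves only the variables up to `z_l`, so it leaves `𝔼_{l+1}`; the rest is the tower
property. The derivatives of the levels `F_l` satisfy the same recursion. -/
theorem parisiAvg_succ (hγ : HasExpMoments γ) (hB : 0 ≤ B) (hm : ∀ l ≤ k, 0 ≤ m l)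
    {F f : (Fin (k + 1) → E) → ℝ} (hF : IsLip B F) {K : ℝ} (hf : ExpBounded K f)
    (hf' : Measurable f) {l : ℕ} (hl : l ≤ k) (z : Fin (k + 1) → E) :
    parisiAvg γ m F l f z =
      condE γ l (fun w => parisiW γ m F l w * parisiAvg γ m F (l + 1) f w) z := by
  have h1 : ∀ w, parisiW γ m F l w * parisiAvg γ m F (l + 1) f w
      = condE γ (l + 1) (fun w => (∏ j ∈ Finset.Icc l k, parisiW γ m F j w) * f w) w := by
    intro w
    rw [parisiAvg, ← condE_mul_left γ (dependsBelow_parisiW γ m F hl)]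
    congr 1; ext w
    rw [← Finset.insert_Icc_add_one_left_eq_Icc hl, Finset.prod_insert (by simp), mul_assoc]
  simp only [h1]
  rw [condE_condE γ (Nat.le_succ l)
    z (integrable_prod_parisiW_mul hγ hB hm hF hf hf' (Icc_subset_range l) l z)]
  rfl

omit [NormedAddCommGroup E] [BorelSpace E] [SecondCountableTopology E] in
theorem parisiAvg_last (F f : (Fin (k + 1) → E) → ℝ) (z : Fin (k + 1) → E) :
    parisiAvg γ m F (k + 1) f z = f z := by
  simp [parisiAvg, condE_last]

/-- Each `W_l` has conditional mean one, hence `𝔼_l (W_l ⋯ W_k ·)` averages against a probability.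
-/
theorem parisiAvg_one (hγ : HasExpMoments γ) (hB : 0 ≤ B) (hm : ∀ l ≤ k, 0 ≤ m l)
    {F : (Fin (k + 1) → E) → ℝ} (hF : IsLip B F) :
    ∀ l ≤ k + 1, ∀ z, parisiAvg γ m F l (fun _ => 1) z = 1 := by
  refine level_induction (fun z => parisiAvg_last F _ z) fun l hl ih z => ?_
  rw [parisiAvg_succ hγ hB hm hF (expBounded_of_le (c := 1) (by simp)) measurable_const hl]
  simp only [ih, mul_one]
  exact condE_parisiW hγ hB hm hF hl z

/-- `F` is, for `s ∈ U`, a family of Lipschitz functions that is differentiable in `s` with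
derivative `F'`, with locally uniform bounds. -/
structure DerivFam {Z : Type*} [NormedAddCommGroup Z] [MeasurableSpace Z] (U : Set ℝ)
    (B K : ℝ) (F F' : ℝ → Z → ℝ) : Prop where
  lip : ∀ s ∈ U, IsLip B (F s)
  bdd : ∀ s ∈ U, |F s 0| ≤ K
  deriv : ∀ s ∈ U, ∀ z, HasDerivAt (fun s => F s z) (F' s z) s
  growth : ∀ s ∈ U, ExpBounded K (F' s)
  meas : ∀ s ∈ U, Measurable (F' s)

/-- The class of families is stable under a step: `B` is preserved and only `K` grows, so the
differentiation can be repeated down the levels. -/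
theorem DerivFam.parisiStep {U : Set ℝ} (hU : IsOpen U) (hγ : HasExpMoments γ) (hB : 0 ≤ B)
    {a : ℝ} (ha : 0 ≤ a) {K : ℝ} {F F' : ℝ → (Fin (k + 1) → E) → ℝ} (h : DerivFam U B K F F')
    (l : ℕ) :
    ∃ K', DerivFam U B K' (fun s => parisiStep γ l a (F s))
      (fun s => condE γ l fun w =>
        Real.exp (a * (F s w - parisiStep γ l a (F s) w)) * F' s w) := by
  obtain ⟨C, hC, hstep⟩ := exists_parisiStep_sub_le (γ := γ) hB ha hγ l
  have hW : ∀ s ∈ U, ExpBounded (a * C)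
      fun w => Real.exp (a * (F s w - SpinGlass.parisiStep γ l a (F s) w)) := by
    intro s hs w
    rw [Real.abs_exp, Real.exp_le_exp, mul_assoc]
    exact mul_le_mul_of_nonneg_left ((le_abs_self _).trans (hstep _ (h.lip s hs) w)) ha
  obtain ⟨K₁, hK₁, h₁⟩ := exists_expBounded_condE hγ l (a * C + K)
  have hlip : ∀ s ∈ U, IsLip B (SpinGlass.parisiStep γ l a (F s)) :=
    fun s hs => (h.lip s hs).parisiStep hB ha hγ l
  refine ⟨max (K + C) K₁, hlip, fun s hs => ?_, fun s hs z => ?_,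
    fun s hs => (h₁ _ ((hW s hs).mul (h.growth s hs))).mono (le_max_right _ _), fun s hs => ?_⟩
  · refine le_max_of_le_left ?_
    have h1 := hstep _ (h.lip s hs) 0
    have h2 := h.bdd s hs
    rw [norm_zero, add_zero, mul_one] at h1
    rw [abs_le] at *
    constructor <;> linarith
  -- A common rate for the dominating function. `K` serves for `F'`; for `exp (a F) * (a F')` the
  -- exponential has rate `a (K + B)`, because `F` is `B`-Lipschitz with `|F 0| ≤ K`, and the factor
  -- `a F'` has rate `a + K`.
  · set K₂ := max 0 (max K (a * (K + B) + (a + K)))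
    have hK₂ : 0 ≤ K₂ := le_max_left _ _
    have hb1 : ∀ r ∈ U, ExpBounded K₂ (F' r) := fun r hr =>
      (h.growth r hr).mono ((le_max_left _ _).trans (le_max_right _ _))
    have hb2 : ∀ r ∈ U, ExpBounded K₂ (fun w => Real.exp (a * F r w) * (a * F' r w)) := by
      intro r hr
      have e1 : ExpBounded (a + K) fun w => a * F' r w := by
        refine expBounded_const_mul ha fun w => ?_
        rw [abs_mul, abs_of_nonneg ha]
        exact mul_le_mul_of_nonneg_left (h.growth r hr w) ha
      have e2 := ((h.lip r hr).exp_le hB ha).mul e1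
      refine e2.mono (le_trans ?_ ((le_max_right _ _).trans (le_max_right _ _)))
      have := mul_le_mul_of_nonneg_left (add_le_add_left (h.bdd r hr) B) ha
      linarith
    have := hasDerivAt_lse (P := Measure.pi γ) (a := a) (hU.mem_nhds hs)
      (g := fun r z' => F r (merge l z z')) (g' := fun r z' => F' r (merge l z z'))
      (b := fun z' => Real.exp (K₂ * (1 + ‖z‖)) * Real.exp (K₂ * ‖z'‖)) ((hγ K₂).const_mul _)
      (fun r hr => (h.lip r hr).continuous.measurable.comp (measurable_merge_right l z))
      (fun r hr => (h.meas r hr).comp (measurable_merge_right l z))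
      (fun r hr => (h.lip r hr).integrable_merge hB hγ l z)
      (fun r hr => (h.lip r hr).integrable_exp_merge hB ha hγ l z)
      (fun r hr z' => h.deriv r hr _)
      (fun r hr z' => (hb1 r hr).merge hK₂ l z z')
      (fun r hr z' => (hb2 r hr).merge hK₂ l z z')
    refine this.congr_deriv ?_
    rw [condE_eq]
    congr 1; ext z'
    rw [dependsBelow_parisiStep γ l a (F s) z z', parisiStep_eq_lse]
  · exact measurable_condE_const (((((h.lip s hs).continuous.measurable).sub
      (hlip s hs).continuous.measurable).const_mul a).exp.mul (h.meas s hs)) l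

omit [MeasurableSpace E] [BorelSpace E] [SecondCountableTopology E] in
theorem DerivFam.congr_deriv {Z : Type*} [NormedAddCommGroup Z] [MeasurableSpace Z] {U : Set ℝ}
    {B K : ℝ} {F F₁ F' F₁' : ℝ → Z → ℝ} (h : DerivFam U B K F F') (h0 : ∀ s ∈ U, F s = F₁ s)
    (hU : IsOpen U) (h' : ∀ s ∈ U, F' s = F₁' s) : DerivFam U B K F₁ F₁' where
  lip s hs := h0 s hs ▸ h.lip s hs
  bdd s hs := h0 s hs ▸ h.bdd s hs
  deriv s hs z := h' s hs ▸ (h.deriv s hs z).congr_of_eventuallyEq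
    (Filter.eventually_of_mem (hU.mem_nhds hs) fun r hr => by simp only [h0 r hr])
  growth s hs := h' s hs ▸ h.growth s hs
  meas s hs := h' s hs ▸ h.meas s hs

/-- The tilts of the successive steps multiply, by `parisiAvg_succ`: differentiating `F_l` amounts
to averaging the derivative of `F` with the weight `W_l ⋯ W_k`. -/
theorem DerivFam.parisiLevel {U : Set ℝ} (hU : IsOpen U) (hγ : HasExpMoments γ) (hB : 0 ≤ B)
    (hm : ∀ l ≤ k, 0 ≤ m l) {K : ℝ} {F F' : ℝ → (Fin (k + 1) → E) → ℝ}
    (h : DerivFam U B K F F') :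
    ∀ l ≤ k + 1, ∃ K', DerivFam U B K' (fun s => parisiLevel γ m (F s) l)
      (fun s => parisiAvg γ m (F s) l (F' s)) := by
  refine level_induction ⟨K, ?_⟩ fun l hl ⟨K', ih⟩ => ?_
  · refine h.congr_deriv (fun s _ => (parisiLevel_last γ m _).symm) hU fun s _ => ?_
    funext z; rw [parisiAvg_last]
  · obtain ⟨K₁, h₁⟩ := ih.parisiStep hU hγ hB (hm l hl) l
    refine ⟨K₁, h₁.congr_deriv (fun s _ => (parisiLevel_of_le γ m _ hl).symm) hU fun s hs => ?_⟩
    funext z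
    rw [parisiAvg_succ hγ hB hm (h.lip s hs) (h.growth s hs) (h.meas s hs) hl]
    simp only [← parisiLevel_of_le γ m _ hl]
    rfl

/-- Separation of the levels below `l` in a weighted expectation. -/
theorem integral_prod_parisiW_mul (hγ : HasExpMoments γ) (hB : 0 ≤ B) (hm : ∀ l ≤ k, 0 ≤ m l)
    {F : (Fin (k + 1) → E) → ℝ} (hF : IsLip B F)
    {f : (Fin (k + 1) → E) → (Fin (k + 1) → E) → ℝ} {K : ℝ}
    (hf : ExpBounded K fun z => f z z) (hf' : Measurable fun z => f z z) {l : ℕ}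
    (hl : l ∈ Finset.Icc 1 (k + 1)) (hd : ∀ w, DependsBelow l fun z => f z w) :
    ∫ z, (∏ j ∈ Finset.Icc 1 k, parisiW γ m F j z) * f z z ∂(Measure.pi γ) =
      ∫ z, (∏ j ∈ Finset.Ico 1 l, parisiW γ m F j z) * parisiAvg γ m F l (f z) z
        ∂(Measure.pi γ) := by
  rw [Finset.mem_Icc] at hl
  have hi := integrable_prod_parisiW_mul (γ := γ) hγ hB hm hF hf hf' (Icc_subset_range 1) 0 0
  simp only [merge_zero] at hi
  rw [← integral_condE γ (l := l) hi]
  congr 1; ext z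
  -- `W_j` involves the variables up to `z_j` only, so the weights with `j < l` are frozen under
  -- `𝔼_l`. By `hd` the first argument of `f` is frozen too, while the second is averaged.
  have hprod : DependsBelow l fun z => ∏ j ∈ Finset.Ico 1 l, parisiW γ m F j z := by
    intro z z'
    refine Finset.prod_congr rfl fun j hj => ?_
    rw [Finset.mem_Ico] at hj
    exact (dependsBelow_parisiW γ m F (show j ≤ k by omega)).mono (by omega) z z'
  have e : ∀ z, (∏ j ∈ Finset.Icc 1 k, parisiW γ m F j z) * f z z =
      (∏ j ∈ Finset.Ico 1 l, parisiW γ m F j z) *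
        ((∏ j ∈ Finset.Icc l k, parisiW γ m F j z) * f z z) := by
    intro z
    have : Finset.Icc 1 k = Finset.Ico 1 l ∪ Finset.Icc l k := by
      ext j; simp only [Finset.mem_Icc, Finset.mem_union, Finset.mem_Ico]; omega
    rw [this, Finset.prod_union, mul_assoc]
    rw [Finset.disjoint_left]
    intro j hj hj'
    simp only [Finset.mem_Icc, Finset.mem_Ico] at *
    omega
  simp only [e]
  rw [condE_mul_left γ hprod, parisiAvg]
  simp only [condE_eq]
  congr 2; ext w
  congr 1
  exact hd _ z w

/-- Separating the levels of the constant `1` shows that the integral does not depend on `l`; at `l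
= 1` the product is empty. -/
theorem integral_prod_parisiW_Ico (hγ : HasExpMoments γ) (hB : 0 ≤ B) (hm : ∀ l ≤ k, 0 ≤ m l)
    {F : (Fin (k + 1) → E) → ℝ} (hF : IsLip B F) {l : ℕ} (hl : l ∈ Finset.Icc 1 (k + 1)) :
    ∫ z, ∏ j ∈ Finset.Ico 1 l, parisiW γ m F j z ∂(Measure.pi γ) = 1 := by
  have key : ∀ l ∈ Finset.Icc 1 (k + 1),
      ∫ z, (∏ j ∈ Finset.Icc 1 k, parisiW γ m F j z) * 1 ∂(Measure.pi γ) =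
      ∫ z, ∏ j ∈ Finset.Ico 1 l, parisiW γ m F j z ∂(Measure.pi γ) := by
    intro l hl
    rw [integral_prod_parisiW_mul hγ hB hm hF (f := fun _ _ => 1)
      (expBounded_of_le (c := 1) (by simp)) measurable_const hl (fun _ _ _ => rfl)]
    simp only [parisiAvg_one hγ hB hm hF l (Finset.mem_Icc.1 hl).2, mul_one]
  rw [← key l hl, key 1 (by simp)]
  simp

omit [NormedAddCommGroup E] [BorelSpace E] [SecondCountableTopology E]
  [∀ p, IsProbabilityMeasure (γ p)] in
theorem parisiAvg_const_mul (F f : (Fin (k + 1) → E) → ℝ) (l : ℕ) (c : ℝ)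
    (z : Fin (k + 1) → E) :
    parisiAvg γ m F l (fun w => c * f w) z = c * parisiAvg γ m F l f z := by
  simp only [parisiAvg, condE_eq, mul_left_comm _ c, integral_const_mul]

omit [NormedAddCommGroup E] [BorelSpace E] [SecondCountableTopology E]
  [∀ p, IsProbabilityMeasure (γ p)] in
theorem parisiAvg_nonneg {F f : (Fin (k + 1) → E) → ℝ} (hf : ∀ w, 0 ≤ f w) (l : ℕ)
    (z : Fin (k + 1) → E) : 0 ≤ parisiAvg γ m F l f z :=
  integral_nonneg fun _ =>
    mul_nonneg (Finset.prod_nonneg fun _ _ => (parisiW_pos F _ _).le) (hf _)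

section Linear

variable (hγ : HasExpMoments γ) (hB : 0 ≤ B) (hm : ∀ l ≤ k, 0 ≤ m l)
  {F : (Fin (k + 1) → E) → ℝ} (hF : IsLip B F)

include hγ hB hm hF

theorem parisiAvg_sub {f g : (Fin (k + 1) → E) → ℝ} {K K' : ℝ} (hf : ExpBounded K f)
    (hf' : Measurable f) (hg : ExpBounded K' g) (hg' : Measurable g) (l : ℕ)
    (z : Fin (k + 1) → E) :
    parisiAvg γ m F l (fun w => f w - g w) z =
      parisiAvg γ m F l f z - parisiAvg γ m F l g z := by
  simp only [parisiAvg, condE_eq, mul_sub]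
  exact integral_sub (integrable_prod_parisiW_mul hγ hB hm hF hf hf' (Icc_subset_range l) l z)
    (integrable_prod_parisiW_mul hγ hB hm hF hg hg' (Icc_subset_range l) l z)

/-- Positive weights of total mass one: bounds pass to the average with the same constant, which
keeps the later estimates free of the disorder. -/
theorem abs_parisiAvg_le {f : (Fin (k + 1) → E) → ℝ} {c : ℝ} (hf : ∀ w, |f w| ≤ c)
    {l : ℕ} (hl : l ≤ k + 1) (z : Fin (k + 1) → E) : |parisiAvg γ m F l f z| ≤ c := by
  have h1 := parisiAvg_const_mul (γ := γ) (m := m) F (fun _ => 1) l c z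
  rw [parisiAvg_one hγ hB hm hF l hl z, mul_one] at h1
  rw [← h1, parisiAvg, parisiAvg, condE_eq, condE_eq, ← Real.norm_eq_abs]
  refine norm_integral_le_of_norm_le (integrable_prod_parisiW_mul hγ hB hm hF
    (f := fun _ => c) (expBounded_of_le fun _ => le_rfl) measurable_const
    (Icc_subset_range l) l z) (ae_of_all _ fun w => ?_)
  have hp : 0 ≤ ∏ j ∈ Finset.Icc l k, parisiW γ m F j (merge l z w) :=
    Finset.prod_nonneg fun _ _ => (parisiW_pos F _ _).le
  rw [Real.norm_eq_abs, abs_mul, abs_of_nonneg hp]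
  exact mul_le_mul_of_nonneg_left (hf _) hp

end Linear

/-! ### Continuity -/

/-- `F t` converges to `F₀` along `L`, with uniform bounds. -/
structure ConvFam {Z T : Type*} [NormedAddCommGroup Z] (L : Filter T) (B K : ℝ)
    (F : T → Z → ℝ) (F₀ : Z → ℝ) : Prop where
  lip : ∀ t, IsLip B (F t)
  bdd : ∀ t, |F t 0| ≤ K
  lip_lim : IsLip B F₀
  tendsto : ∀ z, Filter.Tendsto (fun t => F t z) L (nhds (F₀ z))

variable {T : Type*} {L : Filter T} [L.IsCountablyGenerated]

theorem ConvFam.parisiStep (hγ : HasExpMoments γ) (hB : 0 ≤ B) {a : ℝ} (ha : 0 ≤ a) {K : ℝ}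
    {F : T → (Fin (k + 1) → E) → ℝ} {F₀ : (Fin (k + 1) → E) → ℝ} (h : ConvFam L B K F F₀)
    (l : ℕ) :
    ∃ K', ConvFam L B K' (fun t => parisiStep γ l a (F t)) (parisiStep γ l a F₀) := by
  obtain ⟨C, hC, hstep⟩ := exists_parisiStep_sub_le (γ := γ) hB ha hγ l
  refine ⟨K + C, fun t => (h.lip t).parisiStep hB ha hγ l, fun t => ?_,
    h.lip_lim.parisiStep hB ha hγ l, fun z => ?_⟩
  · have h1 := hstep _ (h.lip t) 0
    have h2 := h.bdd t
    rw [norm_zero, add_zero, mul_one] at h1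
    rw [abs_le] at *
    constructor <;> linarith
  · set K₂ := max 0 (max (K + B) (a * (K + B)))
    have hK₂ : 0 ≤ K₂ := le_max_left _ _
    have hb1 : ∀ t, ExpBounded K₂ (F t) := fun t =>
      ((h.lip t).expBounded hB).mono (((add_le_add_left (h.bdd t) B).trans (le_max_left _ _)).trans
        (le_max_right _ _))
    have hb2 : ∀ t, ExpBounded K₂ (fun w => Real.exp (a * F t w)) := fun t =>
      ((h.lip t).exp_le hB ha).mono
        (((mul_le_mul_of_nonneg_left (add_le_add_left (h.bdd t) B) ha).trans
          (le_max_right _ _)).trans (le_max_right _ _))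
    exact tendsto_lse (P := Measure.pi γ) (a := a)
      (g := fun t z' => F t (merge l z z')) (g0 := fun z' => F₀ (merge l z z'))
      (b := fun z' => Real.exp (K₂ * (1 + ‖z‖)) * Real.exp (K₂ * ‖z'‖)) ((hγ K₂).const_mul _)
      (Filter.Eventually.of_forall fun t =>
        (h.lip t).continuous.measurable.comp (measurable_merge_right l z))
      (h.lip_lim.integrable_exp_merge hB ha hγ l z) (fun z' => h.tendsto _)
      (Filter.Eventually.of_forall fun t z' => (hb1 t).merge hK₂ l z z')
      (Filter.Eventually.of_forall fun t z' =>
        (le_abs_self _).trans ((hb2 t).merge hK₂ l z z'))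

theorem ConvFam.parisiLevel (hγ : HasExpMoments γ) (hB : 0 ≤ B) (hm : ∀ l ≤ k, 0 ≤ m l)
    {K : ℝ} {F : T → (Fin (k + 1) → E) → ℝ} {F₀ : (Fin (k + 1) → E) → ℝ}
    (h : ConvFam L B K F F₀) :
    ∀ l ≤ k + 1, ∃ K', ConvFam L B K' (fun t => parisiLevel γ m (F t) l)
      (parisiLevel γ m F₀ l) := by
  refine level_induction ⟨K, ?_⟩ fun l hl ⟨K', ih⟩ => ?_
  · simpa only [parisiLevel_last] using h
  · simp only [parisiLevel_of_le γ m _ hl]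
    exact ih.parisiStep hγ hB (hm l hl) l

theorem ConvFam.parisiW (hγ : HasExpMoments γ) (hB : 0 ≤ B) (hm : ∀ l ≤ k, 0 ≤ m l)
    {K : ℝ} {F : T → (Fin (k + 1) → E) → ℝ} {F₀ : (Fin (k + 1) → E) → ℝ}
    (h : ConvFam L B K F F₀) {l : ℕ} (hl : l ≤ k) (z : Fin (k + 1) → E) :
    Filter.Tendsto (fun t => parisiW γ m (F t) l z) L (nhds (parisiW γ m F₀ l z)) := by
  obtain ⟨_, h1⟩ := h.parisiLevel hγ hB hm (l + 1) (by omega)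
  obtain ⟨_, h2⟩ := h.parisiLevel hγ hB hm l (by omega)
  exact (Real.continuous_exp.tendsto _).comp (((h1.tendsto z).sub (h2.tendsto z)).const_mul (m l))

theorem ConvFam.prod_parisiW (hγ : HasExpMoments γ) (hB : 0 ≤ B) (hm : ∀ l ≤ k, 0 ≤ m l)
    {K : ℝ} {F : T → (Fin (k + 1) → E) → ℝ} {F₀ : (Fin (k + 1) → E) → ℝ}
    (h : ConvFam L B K F F₀) {s : Finset ℕ} (hs : s ⊆ Finset.range (k + 1))
    (z : Fin (k + 1) → E) :
    Filter.Tendsto (fun t => ∏ j ∈ s, SpinGlass.parisiW γ m (F t) j z) L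
      (nhds (∏ j ∈ s, SpinGlass.parisiW γ m F₀ j z)) :=
  tendsto_finsetProd s fun _ hj => h.parisiW hγ hB hm
    (Nat.lt_succ_iff.1 (Finset.mem_range.1 (hs hj))) z

/-- Dominated convergence: the weights have an exponential rate that does not depend on `t`, and
they converge pointwise because every level does. -/
theorem ConvFam.parisiAvg (hγ : HasExpMoments γ) (hB : 0 ≤ B) (hm : ∀ l ≤ k, 0 ≤ m l)
    {K : ℝ} {F : T → (Fin (k + 1) → E) → ℝ} {F₀ : (Fin (k + 1) → E) → ℝ}
    (h : ConvFam L B K F F₀) {f : T → (Fin (k + 1) → E) → ℝ} {f₀ : (Fin (k + 1) → E) → ℝ}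
    {K' : ℝ} (hf : ∀ t, ExpBounded K' (f t)) (hf' : ∀ t, Measurable (f t))
    (hlim : ∀ z, Filter.Tendsto (fun t => f t z) L (nhds (f₀ z))) (l : ℕ)
    (z : Fin (k + 1) → E) :
    Filter.Tendsto (fun t => parisiAvg γ m (F t) l (f t) z) L
      (nhds (parisiAvg γ m F₀ l f₀ z)) := by
  obtain ⟨K₁, -, h₁⟩ := exists_expBounded_prod_parisiW (γ := γ) hγ hB hm
  set K₂ := max 0 (K₁ + K')
  have hb : ∀ t, ExpBounded K₂ fun w =>
      (∏ j ∈ Finset.Icc l k, SpinGlass.parisiW γ m (F t) j w) * f t w := fun t =>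
    ((h₁ _ (h.lip t) _ (Icc_subset_range l)).mul (hf t)).mono (le_max_right _ _)
  simp only [SpinGlass.parisiAvg, condE_eq]
  refine tendsto_integral_filter_of_dominated_convergence
    (fun z' => Real.exp (K₂ * (1 + ‖z‖)) * Real.exp (K₂ * ‖z'‖))
    (Filter.Eventually.of_forall fun t => ?_)
    (Filter.Eventually.of_forall fun t => ae_of_all _ fun z' =>
      (hb t).merge (le_max_left _ _) l z z')
    ((hγ K₂).const_mul _) (ae_of_all _ fun z' => ?_)
  · exact ((((measurable_prod_parisiW_const (h.lip t).continuous.measurable _).mul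
      (hf' t))).comp (measurable_merge_right l z)).aestronglyMeasurable
  · exact (h.prod_parisiW hγ hB hm (Icc_subset_range l) _).mul (hlim _)

end Deriv


/-! ### Gibbs averages -/

section Gibbs

variable {X Z : Type*} [MeasurableSpace X]

/-- `log ∫ exp V dμ`. -/
noncomputable def logZ (μ : Measure X) (V : X → Z → ℝ) (z : Z) : ℝ :=
  Real.log (∫ σ, Real.exp (V σ z) ∂μ)

/-- The Gibbs average of `f`. -/
noncomputable def gibbs (μ : Measure X) (V : X → Z → ℝ) (f : X → ℝ) (z : Z) : ℝ :=
  (∫ σ, f σ * Real.exp (V σ z) ∂μ) / Real.exp (logZ μ V z)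

/-- The reference measure is allowed to vary measurably with the parameter, since it will be a
random occupation measure. -/
theorem measurable_logZ [MeasurableSpace Z] {α : Type*} [MeasurableSpace α] (κ : Kernel α X)
    [IsSFiniteKernel κ]
    {V : α → X → Z → ℝ} (hV : Measurable fun x : (α × Z) × X => V x.1.1 x.2 x.1.2) :
    Measurable (Function.uncurry fun a => logZ (κ a) (V a)) := by
  have := (hV.exp.stronglyMeasurable).integral_kernel_prod_right'
    (κ := κ.comap (Prod.fst : α × Z → α) measurable_fst)
  exact this.measurable.log

theorem measurable_gibbs [MeasurableSpace Z] {α : Type*} [MeasurableSpace α] (κ : Kernel α X)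
    [IsSFiniteKernel κ]
    {V : α → X → Z → ℝ} (hV : Measurable fun x : (α × Z) × X => V x.1.1 x.2 x.1.2)
    {f : α → X → ℝ} (hf : Measurable (Function.uncurry f)) :
    Measurable (Function.uncurry fun a => gibbs (κ a) (V a) (f a)) := by
  have hm : Measurable fun x : (α × Z) × X => f x.1.1 x.2 * Real.exp (V x.1.1 x.2 x.1.2) := by
    refine Measurable.mul ?_ hV.exp
    exact hf.comp (f := fun x : (α × Z) × X => (x.1.1, x.2)) (by fun_prop)
  have := hm.stronglyMeasurable.integral_kernel_prod_right'
    (κ := κ.comap (Prod.fst : α × Z → α) measurable_fst)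
  exact this.measurable.div (measurable_logZ κ hV).exp

variable [NormedAddCommGroup Z]

/-- `exp (K A)` is integrable for all `K`. -/
structure IsExpWeight (μ : Measure X) (A : X → ℝ) : Prop where
  meas : Measurable A
  nonneg : ∀ σ, 0 ≤ A σ
  integrable : ∀ K : ℝ, Integrable (fun σ => Real.exp (K * A σ)) μ

/-- `V` is measurable, Lipschitz in `z`, and at `z = 0` dominated by the weight `A`. -/
structure IsHam [MeasurableSpace Z] (B : ℝ) (A : X → ℝ) (V : X → Z → ℝ) : Prop where
  meas : Measurable (Function.uncurry V)
  lip : ∀ σ, IsLip B (V σ)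
  bdd : ∀ σ, |V σ 0| ≤ A σ

variable [MeasurableSpace Z] {μ : Measure X} {B : ℝ} {A : X → ℝ} {V : X → Z → ℝ}

theorem IsHam.abs_apply_le (h : IsHam B A V) (σ : X) (z : Z) : |V σ z| ≤ A σ + B * ‖z‖ :=
  ((h.lip σ).abs_le z).trans (by linarith [h.bdd σ])

theorem IsHam.measurable_left (h : IsHam B A V) (z : Z) : Measurable fun σ => V σ z :=
  h.meas.comp (measurable_prodMk_right (y := z))

theorem IsHam.exp_le (h : IsHam B A V) (σ : X) (z : Z) :
    Real.exp (V σ z) ≤ Real.exp (B * ‖z‖) * Real.exp (A σ) := by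
  rw [← Real.exp_add, Real.exp_le_exp]
  linarith [(abs_le.1 (h.abs_apply_le σ z)).2]

theorem IsHam.le_exp (h : IsHam B A V) (σ : X) (z : Z) :
    Real.exp (-(B * ‖z‖)) * Real.exp (-A σ) ≤ Real.exp (V σ z) := by
  rw [← Real.exp_add, Real.exp_le_exp]
  linarith [(abs_le.1 (h.abs_apply_le σ z)).1]

theorem IsExpWeight.integrable_one (hA : IsExpWeight μ A) :
    Integrable (fun σ => Real.exp (A σ)) μ := by simpa using hA.integrable 1

theorem IsExpWeight.integrable_neg (hA : IsExpWeight μ A) :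
    Integrable (fun σ => Real.exp (-A σ)) μ := by simpa using hA.integrable (-1)

theorem IsHam.integrable_exp (h : IsHam B A V) (hA : IsExpWeight μ A) (z : Z) :
    Integrable (fun σ => Real.exp (V σ z)) μ := by
  refine (hA.integrable_one.const_mul (Real.exp (B * ‖z‖))).mono'
    (h.measurable_left z).exp.aestronglyMeasurable (ae_of_all _ fun σ => ?_)
  rw [Real.norm_eq_abs, Real.abs_exp]
  exact h.exp_le σ z

variable [NeZero μ]

theorem IsHam.exp_logZ (h : IsHam B A V) (hA : IsExpWeight μ A) (z : Z) :
    Real.exp (logZ μ V z) = ∫ σ, Real.exp (V σ z) ∂μ :=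
  Real.exp_log (integral_exp_pos (h.integrable_exp hA z))

theorem logZ_le {V' : X → Z → ℝ} (h : IsHam B A V) (hA : IsExpWeight μ A) (z z' : Z)
    (hV' : Integrable (fun σ => Real.exp (V' σ z')) μ) {c : ℝ}
    (hle : ∀ᵐ σ ∂μ, V σ z ≤ V' σ z' + c) : logZ μ V z ≤ logZ μ V' z' + c := by
  have h1 : ∫ σ, Real.exp (V σ z) ∂μ ≤ (∫ σ, Real.exp (V' σ z') ∂μ) * Real.exp c := by
    rw [← integral_mul_const]
    refine integral_mono_ae (h.integrable_exp hA z) (hV'.mul_const _) ?_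
    filter_upwards [hle] with σ hσ
    rw [← Real.exp_add, Real.exp_le_exp]
    exact hσ
  have h2 := Real.log_le_log (integral_exp_pos (h.integrable_exp hA z)) h1
  rwa [Real.log_mul (integral_exp_pos hV').ne' (Real.exp_pos _).ne', Real.log_exp] at h2

theorem IsHam.isLip_logZ (h : IsHam B A V) (hA : IsExpWeight μ A) : IsLip B (logZ μ V) := by
  intro z z'
  have key : ∀ z z', logZ μ V z ≤ logZ μ V z' + B * ‖z - z'‖ := fun z z' =>
    logZ_le h hA z z' (h.integrable_exp hA z') (ae_of_all _ fun σ => by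
      linarith [(abs_le.1 (h.lip σ z z')).2])
  have h1 := key z z'
  have h2 := key z' z
  rw [norm_sub_rev] at h2
  rw [abs_sub_le_iff]
  constructor <;> linarith

/-- The partition function is bounded below through `V ≥ -A - B ‖z‖`. The reciprocal of the
partition function is the delicate factor in Gibbs averages, and this reduces it to `(∫ exp (-A)
dμ)⁻¹`. -/
theorem IsHam.exp_neg_logZ_le (h : IsHam B A V) (hA : IsExpWeight μ A) (z : Z) :
    Real.exp (-logZ μ V z) ≤ Real.exp (B * ‖z‖) * (∫ σ, Real.exp (-A σ) ∂μ)⁻¹ := by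
  have h0 := integral_exp_pos hA.integrable_neg
  have h1 : Real.exp (-(B * ‖z‖)) * ∫ σ, Real.exp (-A σ) ∂μ ≤ Real.exp (logZ μ V z) := by
    rw [h.exp_logZ hA, ← integral_const_mul]
    exact integral_mono (hA.integrable_neg.const_mul _) (h.integrable_exp hA z)
      fun σ => h.le_exp σ z
  rw [Real.exp_neg]
  refine (inv_anti₀ (by positivity) h1).trans_eq ?_
  rw [mul_inv, ← Real.exp_neg, neg_neg]

/-- A bound on `log ∫ exp V dμ` at `z = 0`. -/
noncomputable def logZBound (μ : Measure X) (A : X → ℝ) : ℝ :=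
  |Real.log (∫ σ, Real.exp (A σ) ∂μ)| + |Real.log (∫ σ, Real.exp (-A σ) ∂μ)|

theorem IsHam.abs_logZ_zero_le (h : IsHam B A V) (hA : IsExpWeight μ A) :
    |logZ μ V 0| ≤ logZBound μ A := by
  have h1 : ∫ σ, Real.exp (V σ 0) ∂μ ≤ ∫ σ, Real.exp (A σ) ∂μ :=
    integral_mono (h.integrable_exp hA 0) hA.integrable_one fun σ => by
      simpa using h.exp_le σ 0
  have h2 : ∫ σ, Real.exp (-A σ) ∂μ ≤ ∫ σ, Real.exp (V σ 0) ∂μ :=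
    integral_mono hA.integrable_neg (h.integrable_exp hA 0) fun σ => by
      simpa using h.le_exp σ 0
  have h3 := Real.log_le_log (integral_exp_pos (h.integrable_exp hA 0)) h1
  have h4 := Real.log_le_log (integral_exp_pos hA.integrable_neg) h2
  rw [logZ, logZBound, abs_le]
  constructor
  · have := neg_abs_le (Real.log (∫ σ, Real.exp (-A σ) ∂μ))
    have := abs_nonneg (Real.log (∫ σ, Real.exp (A σ) ∂μ))
    linarith
  · have := le_abs_self (Real.log (∫ σ, Real.exp (A σ) ∂μ))
    have := abs_nonneg (Real.log (∫ σ, Real.exp (-A σ) ∂μ))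
    linarith

theorem IsHam.abs_gibbs_le (h : IsHam B A V) (hA : IsExpWeight μ A) {f : X → ℝ} {c : ℝ}
    (hf : ∀ᵐ σ ∂μ, |f σ| ≤ c) (z : Z) : |gibbs μ V f z| ≤ c := by
  rw [gibbs, abs_div, Real.abs_exp, div_le_iff₀ (Real.exp_pos _), h.exp_logZ hA,
    ← integral_const_mul, ← Real.norm_eq_abs]
  refine norm_integral_le_of_norm_le ((h.integrable_exp hA z).const_mul c) ?_
  filter_upwards [hf] with σ hσ
  rw [Real.norm_eq_abs, abs_mul, Real.abs_exp]
  exact mul_le_mul_of_nonneg_right hσ (Real.exp_pos _).le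

/-- A bound on Gibbs averages of functions dominated by `exp A`. -/
noncomputable def gibbsBound (μ : Measure X) (A : X → ℝ) : ℝ :=
  (∫ σ, Real.exp (2 * A σ) ∂μ) * (∫ σ, Real.exp (-A σ) ∂μ)⁻¹

omit [NeZero μ] in
theorem gibbsBound_nonneg : 0 ≤ gibbsBound μ A :=
  mul_nonneg (integral_nonneg fun _ => (Real.exp_pos _).le)
    (inv_nonneg.2 (integral_nonneg fun _ => (Real.exp_pos _).le))

theorem IsHam.abs_gibbs_le_bound (h : IsHam B A V) (hA : IsExpWeight μ A) {f : X → ℝ} {c : ℝ}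
    (hc : 0 ≤ c) (hf : ∀ σ, |f σ| ≤ c * Real.exp (A σ)) (z : Z) :
    |gibbs μ V f z| ≤ gibbsBound μ A * (c * Real.exp (2 * B * ‖z‖)) := by
  have h1 : |∫ σ, f σ * Real.exp (V σ z) ∂μ|
      ≤ (c * Real.exp (B * ‖z‖)) * ∫ σ, Real.exp (2 * A σ) ∂μ := by
    rw [← integral_const_mul, ← Real.norm_eq_abs]
    refine norm_integral_le_of_norm_le ((hA.integrable 2).const_mul _) (ae_of_all _ fun σ => ?_)
    rw [Real.norm_eq_abs, abs_mul, Real.abs_exp]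
    calc |f σ| * Real.exp (V σ z)
        ≤ (c * Real.exp (A σ)) * (Real.exp (B * ‖z‖) * Real.exp (A σ)) :=
          mul_le_mul (hf σ) (h.exp_le σ z) (Real.exp_pos _).le (by positivity)
      _ = _ := by rw [two_mul, Real.exp_add]; ring
  have h2 := h.exp_neg_logZ_le hA z
  rw [gibbs, div_eq_mul_inv, ← Real.exp_neg, abs_mul, Real.abs_exp]
  refine (mul_le_mul h1 h2 (Real.exp_pos _).le ?_).trans_eq ?_
  · exact mul_nonneg (by positivity) (integral_nonneg fun _ => (Real.exp_pos _).le)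
  · rw [gibbsBound, show 2 * B * ‖z‖ = B * ‖z‖ + B * ‖z‖ by ring, Real.exp_add]
    ring

/-- A differentiable family of Hamiltonians. -/
structure HamFam (U : Set ℝ) (B c : ℝ) (A : X → ℝ) (V V' : ℝ → X → Z → ℝ) : Prop where
  ham : ∀ s ∈ U, IsHam B A (V s)
  deriv : ∀ s ∈ U, ∀ σ z, HasDerivAt (fun s => V s σ z) (V' s σ z) s
  bound : ∀ s ∈ U, ∀ σ z, |V' s σ z| ≤ Real.exp (c * (1 + ‖z‖)) * Real.exp (A σ)
  meas : ∀ s ∈ U, Measurable (Function.uncurry (V' s))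

/-- Gibbs average of a function of `σ` and `z`. -/
noncomputable def gibbs' (μ : Measure X) (V : X → Z → ℝ) (f : X → Z → ℝ) (z : Z) : ℝ :=
  gibbs μ V (fun σ => f σ z) z

/-- The derivative of a logarithm of a partition function is the Gibbs average of the derivative of
the Hamiltonian. The bounds make `log ∫ exp V dμ` an admissible starting point for the recursion. -/
theorem HamFam.derivFam [SFinite μ] {U : Set ℝ} (hU : IsOpen U) {c : ℝ} (hB : 0 ≤ B)
    {V V' : ℝ → X → Z → ℝ}
    (h : HamFam U B c A V V') (hA : IsExpWeight μ A) :
    ∃ K, DerivFam U B K (fun s => logZ μ (V s)) (fun s => gibbs' μ (V s) (V' s)) := by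
  refine ⟨max (logZBound μ A) (gibbsBound μ A + (c + 2 * B)),
    fun s hs => (h.ham s hs).isLip_logZ hA,
    fun s hs => ((h.ham s hs).abs_logZ_zero_le hA).trans (le_max_left _ _),
    fun s hs z => ?_, fun s hs => ?_, fun s hs => ?_⟩
  · have h1 := (hasDerivAt_integral_of_dominated_loc_of_deriv_le (μ := μ)
      (F := fun r σ => Real.exp (V r σ z)) (F' := fun r σ => Real.exp (V r σ z) * V' r σ z)
      (bound := fun σ => (Real.exp (B * ‖z‖) * Real.exp (c * (1 + ‖z‖))) * Real.exp (2 * A σ))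
      (hU.mem_nhds hs)
      (Filter.eventually_of_mem (hU.mem_nhds hs) fun r hr =>
        ((h.ham r hr).measurable_left z).exp.aestronglyMeasurable)
      ((h.ham s hs).integrable_exp hA z)
      (((h.ham s hs).measurable_left z).exp.mul
        ((h.meas s hs).comp (measurable_prodMk_right (y := z)))).aestronglyMeasurable
      (ae_of_all _ fun σ r hr => ?_) ((hA.integrable 2).const_mul _)
      (ae_of_all _ fun σ r hr => (h.deriv r hr σ z).exp)).2
    · refine (h1.log (integral_exp_pos ((h.ham s hs).integrable_exp hA z)).ne').congr_deriv ?_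
      rw [gibbs', gibbs, (h.ham s hs).exp_logZ hA]
      simp only [mul_comm]
    · rw [Real.norm_eq_abs, abs_mul, Real.abs_exp]
      refine (mul_le_mul ((h.ham r hr).exp_le σ z) (h.bound r hr σ z) (abs_nonneg _)
        (by positivity)).trans_eq ?_
      rw [two_mul (A σ), Real.exp_add (A σ)]; ring
  · refine (expBounded_const_mul gibbsBound_nonneg fun z => ?_).mono (le_max_right _ _)
    refine ((h.ham s hs).abs_gibbs_le_bound hA (Real.exp_pos (c * (1 + ‖z‖))).le
      (fun σ => h.bound s hs σ z) z).trans ?_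
    refine mul_le_mul_of_nonneg_left ?_ gibbsBound_nonneg
    rw [← Real.exp_add, Real.exp_le_exp]
    nlinarith
  · have hm : Measurable fun x : Z × X => V' s x.2 x.1 * Real.exp (V s x.2 x.1) :=
      ((h.meas s hs).comp measurable_swap).mul ((h.ham s hs).meas.comp measurable_swap).exp
    have hm2 : Measurable fun x : Z × X => Real.exp (V s x.2 x.1) :=
      ((h.ham s hs).meas.comp measurable_swap).exp
    exact (hm.stronglyMeasurable.integral_prod_right' (ν := μ)).measurable.div
      (hm2.stronglyMeasurable.integral_prod_right' (ν := μ)).measurable.log.exp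

section Conv

variable {T : Type*} {L : Filter T} [L.IsCountablyGenerated] {V : T → X → Z → ℝ}
  {V₀ : X → Z → ℝ}

omit [NeZero μ] in
theorem tendsto_integral_mul_exp (hV : ∀ t, IsHam B A (V t)) (hA : IsExpWeight μ A)
    (hlim : ∀ σ z, Filter.Tendsto (fun t => V t σ z) L (nhds (V₀ σ z)))
    {f : T → X → ℝ} {f₀ : X → ℝ} {c : ℝ} (hf : ∀ t, Measurable (f t))
    (hc : ∀ t σ, |f t σ| ≤ c) (hfl : ∀ σ, Filter.Tendsto (fun t => f t σ) L (nhds (f₀ σ)))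
    (z : Z) :
    Filter.Tendsto (fun t => ∫ σ, f t σ * Real.exp (V t σ z) ∂μ) L
      (nhds (∫ σ, f₀ σ * Real.exp (V₀ σ z) ∂μ)) := by
  refine tendsto_integral_filter_of_dominated_convergence
    (fun σ => c * (Real.exp (B * ‖z‖) * Real.exp (A σ)))
    (Filter.Eventually.of_forall fun t =>
      ((hf t).mul ((hV t).measurable_left z).exp).aestronglyMeasurable)
    (Filter.Eventually.of_forall fun t => ae_of_all _ fun σ => ?_)
    ((hA.integrable_one.const_mul _).const_mul _) (ae_of_all _ fun σ => ?_)
  · rw [Real.norm_eq_abs, abs_mul, Real.abs_exp]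
    exact mul_le_mul (hc t σ) ((hV t).exp_le σ z) (Real.exp_pos _).le
      ((abs_nonneg _).trans (hc t σ))
  · exact (hfl σ).mul ((Real.continuous_exp.tendsto _).comp (hlim σ z))

theorem tendsto_logZ (hV : ∀ t, IsHam B A (V t)) (hV₀ : IsHam B A V₀) (hA : IsExpWeight μ A)
    (hlim : ∀ σ z, Filter.Tendsto (fun t => V t σ z) L (nhds (V₀ σ z))) (z : Z) :
    Filter.Tendsto (fun t => logZ μ (V t) z) L (nhds (logZ μ V₀ z)) := by
  have := tendsto_integral_mul_exp (μ := μ) hV hA hlim (f := fun _ _ => 1) (f₀ := fun _ => 1)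
    (c := 1) (fun _ => measurable_const) (fun _ _ => by simp) (fun _ => tendsto_const_nhds) z
  simp only [one_mul] at this
  exact this.log (integral_exp_pos (hV₀.integrable_exp hA z)).ne'

theorem convFam_logZ (hV : ∀ t, IsHam B A (V t)) (hV₀ : IsHam B A V₀) (hA : IsExpWeight μ A)
    (hlim : ∀ σ z, Filter.Tendsto (fun t => V t σ z) L (nhds (V₀ σ z))) :
    ConvFam L B (logZBound μ A) (fun t => logZ μ (V t)) (logZ μ V₀) :=
  ⟨fun t => (hV t).isLip_logZ hA, fun t => (hV t).abs_logZ_zero_le hA, hV₀.isLip_logZ hA,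
    fun z => tendsto_logZ hV hV₀ hA hlim z⟩

theorem tendsto_gibbs (hV : ∀ t, IsHam B A (V t)) (hV₀ : IsHam B A V₀) (hA : IsExpWeight μ A)
    (hlim : ∀ σ z, Filter.Tendsto (fun t => V t σ z) L (nhds (V₀ σ z)))
    {f : T → X → ℝ} {f₀ : X → ℝ} {c : ℝ} (hf : ∀ t, Measurable (f t))
    (hc : ∀ t σ, |f t σ| ≤ c) (hfl : ∀ σ, Filter.Tendsto (fun t => f t σ) L (nhds (f₀ σ)))
    (z : Z) :
    Filter.Tendsto (fun t => gibbs μ (V t) (f t) z) L (nhds (gibbs μ V₀ f₀ z)) :=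
  (tendsto_integral_mul_exp hV hA hlim hf hc hfl z).div
    ((Real.continuous_exp.tendsto _).comp (tendsto_logZ hV hV₀ hA hlim z)) (Real.exp_pos _).ne'

end Conv

end Gibbs

/-! ### The density of the weighted Gibbs measure -/

/-- Summation by parts moves the differences from the levels to the parameters `m_j`, which is how
the increments `m_j - m_{j-1}` arise. -/
theorem abel_sum (m δ : ℕ → ℝ) (n : ℕ) :
    ∑ j ∈ Finset.Icc 1 n, m j * (δ (j + 1) - δ j) =
      m n * δ (n + 1) - m 0 * δ 1 - ∑ j ∈ Finset.Icc 1 n, (m j - m (j - 1)) * δ j := by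
  induction n with
  | zero => simp
  | succ n ih =>
    rw [Finset.sum_Icc_succ_top (by omega), Finset.sum_Icc_succ_top (by omega), ih]
    simp only [Nat.add_sub_cancel]
    ring

/-- After summation by parts the boundary term at level `1` vanishes as `m_0 = 0`, and the one at
level `k + 1` cancels `-Φ (k + 1)` as `m_k = 1`. The levels are abstract functions of `y` because
two kinds of directions are needed: shifts of the Hamiltonian and translations of a variable `z_p`.
-/
theorem hasDerivAt_weight {k : ℕ} {m : ℕ → ℝ} (hm0 : m 0 = 0) (hmk : m k = 1)
    {Φ : ℕ → ℝ → ℝ} {δ : ℕ → ℝ} {w : ℝ → ℝ} {w' y : ℝ}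
    (hΦ : ∀ j ∈ Finset.Icc 1 (k + 1), HasDerivAt (Φ j) (δ j) y) (hw : HasDerivAt w w' y) :
    HasDerivAt (fun y => (∏ j ∈ Finset.Icc 1 k, Real.exp (m j * (Φ (j + 1) y - Φ j y))) *
        Real.exp (w y - Φ (k + 1) y))
      (((∏ j ∈ Finset.Icc 1 k, Real.exp (m j * (Φ (j + 1) y - Φ j y))) *
        Real.exp (w y - Φ (k + 1) y)) *
          (w' - ∑ j ∈ Finset.Icc 1 k, (m j - m (j - 1)) * δ j)) y := by
  simp only [← Real.exp_sum, ← Real.exp_add]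
  have h1 : HasDerivAt (fun y => ∑ j ∈ Finset.Icc 1 k, m j * (Φ (j + 1) y - Φ j y))
      (∑ j ∈ Finset.Icc 1 k, m j * (δ (j + 1) - δ j)) y := by
    refine HasDerivAt.fun_sum fun j hj => ?_
    rw [Finset.mem_Icc] at hj
    exact ((hΦ (j + 1) (Finset.mem_Icc.2 (by omega))).sub
      (hΦ j (Finset.mem_Icc.2 (by omega)))).const_mul _
  have h2 := h1.add (hw.sub (hΦ (k + 1) (Finset.mem_Icc.2 (by omega))))
  refine h2.exp.congr_deriv ?_
  rw [abel_sum, hm0, hmk]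
  simp only [Pi.add_apply, Pi.sub_apply]
  ring


/-! ### Conditioning and integration by parts for a jointly measurable Gaussian process -/

section GaussianProcess

variable {Ω T : Type*} {𝒢 mΩ : MeasurableSpace Ω} [MeasurableSpace T] {P : Measure Ω}
  [IsProbabilityMeasure P] {μ : Measure T} [IsFiniteMeasure μ]

/-- If all sections `{ω | (τ, ω) ∈ s}` belong to `𝒢`, then `ω ↦ μ {τ | (τ, ω) ∈ s}` is
measurable with respect to `𝒢` up to null sets. -/
theorem eventuallyMeasurable_measure_section (h𝒢 : 𝒢 ≤ mΩ)
    {s : Set (T × Ω)} (hs : MeasurableSet s)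
    (hs' : ∀ τ, MeasurableSet[𝒢] {ω | (τ, ω) ∈ s}) :
    EventuallyMeasurable 𝒢 (ae P) fun ω => μ {τ | (τ, ω) ∈ s} := by
  set g : Ω → ℝ := fun ω => μ.real {τ | (τ, ω) ∈ s} with hg
  have hgm : Measurable g := (measurable_measure_prodMk_right hs).ennreal_toReal
  have hgc : ∀ ω, |g ω| ≤ μ.real Set.univ := fun ω => by
    rw [abs_of_nonneg measureReal_nonneg]
    exact measureReal_mono (Set.subset_univ _)
  have hgi : Integrable g P :=
    (integrable_const (μ.real Set.univ)).mono' hgm.aestronglyMeasurable (ae_of_all _ hgc)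
  -- The aim is `𝔼 (g - g')² = 0`. The product with `g'` integrates to zero by the definition of
  -- conditional expectation (`e1`). For the product with `g`, Fubini over `τ` reduces the claim to
  -- the integral of `g - g'` over each section, and this vanishes because the sections belong to
  -- `𝒢` (`e2`).
  set g' : Ω → ℝ := P[g | 𝒢]
  have hg'c : ∀ᵐ ω ∂P, |g' ω| ≤ μ.real Set.univ :=
    ae_bdd_abs_condExp_of_ae_bdd_abs (ae_of_all _ hgc)
  have hg'i : Integrable g' P := integrable_condExp
  have hDi : Integrable (g - g') P := hgi.sub hg'i
  have hgD : Integrable (fun ω => g ω * (g - g') ω) P :=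
    hDi.bdd_mul hgm.aestronglyMeasurable (ae_of_all _ hgc)
  have hg'D : Integrable (fun ω => g' ω * (g - g') ω) P :=
    hDi.bdd_mul hg'i.aestronglyMeasurable hg'c
  have e1 : ∫ ω, g' ω * (g - g') ω ∂P = 0 := by
    have h1 := condExp_mul_of_stronglyMeasurable_left (m := 𝒢) (μ := P) (f := g') (g := g - g')
      stronglyMeasurable_condExp hg'D hDi
    have h2 : P[g - g' | 𝒢] =ᵐ[P] 0 := by
      refine (condExp_sub hgi hg'i 𝒢).trans ?_
      rw [condExp_of_stronglyMeasurable h𝒢 stronglyMeasurable_condExp hg'i]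
      filter_upwards with ω
      simp
    rw [← integral_condExp h𝒢]
    refine integral_eq_zero_of_ae (h1.trans ?_)
    filter_upwards [h2] with ω hω
    simp [hω]
  have e2 : ∫ ω, g ω * (g - g') ω ∂P = 0 := by
    have h1 : ∀ ω, g ω * (g - g') ω
        = ∫ τ, s.indicator (fun x : T × Ω => (g - g') x.2) (τ, ω) ∂μ := by
      intro ω
      have : ∀ τ, s.indicator (fun x : T × Ω => (g - g') x.2) (τ, ω)
          = {τ | (τ, ω) ∈ s}.indicator (fun _ => (g - g') ω) τ := fun τ => rfl
      simp only [this]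
      have hms : MeasurableSet {τ | (τ, ω) ∈ s} := measurable_prodMk_right hs
      rw [integral_indicator_const _ hms]
      rfl
    have h2 : Integrable (fun x : T × Ω => s.indicator (fun x : T × Ω => (g - g') x.2) x)
        (μ.prod P) := (hDi.comp_snd μ).indicator hs
    simp only [h1]
    rw [← integral_integral_swap (f := fun τ ω =>
      s.indicator (fun x : T × Ω => (g - g') x.2) (τ, ω)) h2]
    refine integral_eq_zero_of_ae (ae_of_all _ fun τ => ?_)
    have : ∀ ω, s.indicator (fun x : T × Ω => (g - g') x.2) (τ, ω)
          = {ω | (τ, ω) ∈ s}.indicator (g - g') ω := fun ω => rfl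
    simp only [this]
    rw [integral_indicator (h𝒢 _ (hs' τ))]
    simp only [Pi.sub_apply, Pi.zero_apply]
    rw [integral_sub hgi.integrableOn hg'i.integrableOn,
      setIntegral_condExp h𝒢 hgi (hs' τ), sub_self]
  have e3 : ∫ ω, ((g - g') ω) ^ 2 ∂P = 0 := by
    have : ∀ ω, ((g - g') ω) ^ 2 = g ω * (g - g') ω - g' ω * (g - g') ω := fun ω => by
      simp only [Pi.sub_apply]; ring
    simp only [this]
    rw [integral_sub hgD hg'D, e1, e2, sub_zero]
  have hsq : Integrable (fun ω => ((g - g') ω) ^ 2) P := by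
    refine (hgD.sub hg'D).congr (ae_of_all _ fun ω => ?_)
    simp only [Pi.sub_apply]; ring
  have e4 : g =ᵐ[P] g' := by
    have := (integral_eq_zero_iff_of_nonneg (fun ω => sq_nonneg ((g - g') ω)) hsq).1 e3
    filter_upwards [this] with ω hω
    have h0 : (g - g') ω = 0 := by simpa using hω
    simpa [sub_eq_zero] using h0
  have hg'm : Measurable[𝒢] fun ω => ENNReal.ofReal (g' ω) :=
    (stronglyMeasurable_condExp (m := 𝒢) (f := g) (μ := P)).measurable.ennreal_ofReal
  refine hg'm.eventuallyMeasurable_of_eventuallyEq ?_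
  filter_upwards [e4] with ω hω
  rw [← hω, hg]
  simp only
  rw [ofReal_measureReal]

omit [IsProbabilityMeasure P] in
-- Independence only concerns probabilities, so null-set modifications of the events are harmless.
theorem indep_eventuallyMeasurableSpace {Ω : Type*} {m₁ 𝒢 mΩ : MeasurableSpace Ω}
    {P : Measure Ω} (h : Indep m₁ 𝒢 P) :
    Indep m₁ (eventuallyMeasurableSpace 𝒢 (ae P)) P := by
  rw [Indep_iff] at *
  rintro t₁ t₂ h₁ ⟨t₂', h₂', h₂⟩
  rw [measure_congr h₂, ← h t₁ t₂' h₁ h₂']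
  exact measure_congr ((ae_eq_refl t₁).inter h₂)

/-- Measures of total mass at most `C`. -/
abbrev BddMeasure (Y : Type*) [MeasurableSpace Y] (C : ENNReal) : Type _ :=
  {M : Measure Y // M Set.univ ≤ C}

/-- The tautological kernel. -/
noncomputable def bddKernel (Y : Type*) [MeasurableSpace Y] (C : ENNReal) :
    Kernel (BddMeasure Y C) Y where
  toFun := Subtype.val
  measurable' := measurable_subtype_coe

theorem isFiniteKernel_bddKernel (Y : Type*) [MeasurableSpace Y] {C : ENNReal} (hC : C < ⊤) :
    IsFiniteKernel (bddKernel Y C) := ⟨⟨C, hC, fun M => M.2⟩⟩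

omit [IsFiniteMeasure μ] in
theorem map_section_apply {G : T → Ω → ℝ} (hG : Measurable fun x : T × Ω => G x.1 x.2) (ω : Ω)
    {s : Set (T × ℝ)} (hs : MeasurableSet s) :
    μ.map (fun τ => (τ, G τ ω)) s = μ {τ | (τ, ω) ∈ (fun x : T × Ω => (x.1, G x.1 x.2)) ⁻¹' s} := by
  have hm : Measurable fun τ => (τ, G τ ω) :=
    measurable_id.prodMk (hG.comp (measurable_prodMk_right (y := ω)))
  rw [Measure.map_apply hm hs]
  rfl

/-- The distribution of `(τ, G τ ω)` under `μ (dτ)`. -/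
noncomputable def occupation (μ : Measure T) (G : T → Ω → ℝ)
    (hG : Measurable fun x : T × Ω => G x.1 x.2) (ω : Ω) :
    BddMeasure (T × ℝ) (μ Set.univ) :=
  ⟨μ.map fun τ => (τ, G τ ω), by
    rw [map_section_apply hG ω MeasurableSet.univ]
    simp⟩

theorem measurable_occupation {G : T → Ω → ℝ} (hG : Measurable fun x : T × Ω => G x.1 x.2) :
    Measurable (occupation μ G hG) := by
  refine Measurable.subtype_mk (Measure.measurable_of_measurable_coe _ fun s hs => ?_)
  have hm : Measurable fun x : T × Ω => (x.1, G x.1 x.2) := measurable_fst.prodMk hG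
  simp only [map_section_apply hG _ hs]
  exact measurable_measure_prodMk_right (hm hs)

/-- The occupation measure integrates over an uncountable index set, so measurability of each `G τ`
does not give its measurability with respect to `𝒢`. Up to null sets it holds, by the section lemma
applied to preimages of measurable sets. -/
theorem measurable_occupation_eventually (h𝒢 : 𝒢 ≤ mΩ) {G : T → Ω → ℝ}
    (hG : Measurable fun x : T × Ω => G x.1 x.2) (hG𝒢 : ∀ τ, Measurable[𝒢] (G τ)) :
    Measurable[eventuallyMeasurableSpace 𝒢 (ae P)] (occupation μ G hG) := by
  refine Measurable.subtype_mk (Measure.measurable_of_measurable_coe _ fun s hs => ?_)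
  have hm : Measurable fun x : T × Ω => (x.1, G x.1 x.2) := measurable_fst.prodMk hG
  have := eventuallyMeasurable_measure_section (P := P) (μ := μ) h𝒢 (hm hs) fun τ => by
    have h1 : Measurable[𝒢] fun ω => (τ, G τ ω) := measurable_const.prodMk (hG𝒢 τ)
    exact h1 hs
  simp only [map_section_apply hG _ hs]
  exact this

/-- Take for `𝒢` the σ-algebra generated by the process; the null sets needed for the occupation
measure do not affect independence. -/
theorem indepFun_occupation {G : T → Ω → ℝ} (hG : Measurable fun x : T × Ω => G x.1 x.2)
    {Y : Ω → ℝ} (hind : IndepFun Y (fun ω τ => G τ ω) P) :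
    IndepFun Y (occupation μ G hG) P := by
  have hGτ : ∀ τ, Measurable (G τ) := fun τ => hG.comp (measurable_prodMk_left (x := τ))
  have hM := measurable_occupation_eventually (P := P) (μ := μ)
    (measurable_pi_iff.2 hGτ).comap_le hG
    (fun τ => (measurable_pi_apply τ).comp (comap_measurable (fun ω τ => G τ ω)))
  have h1 := indep_eventuallyMeasurableSpace ((IndepFun_iff_Indep _ _ _).1 hind)
  exact (IndepFun_iff_Indep _ _ _).2 (indep_of_indep_of_le_right h1 hM.comap_le)

variable {H : T → Ω → ℝ}

/-- The covariance of a centered process. -/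
noncomputable def cov2 (P : Measure Ω) (H : T → Ω → ℝ) (σ τ : T) : ℝ := ∫ ω, H σ ω * H τ ω ∂P

omit [MeasurableSpace T] [IsProbabilityMeasure P] in
theorem integrable_mul_of_gaussian (hH : IsGaussianProcess H P) (σ τ : T) :
    Integrable (fun ω => H σ ω * H τ ω) P :=
  (hH.hasGaussianLaw_eval σ).memLp_two.integrable_mul (hH.hasGaussianLaw_eval τ).memLp_two

omit [MeasurableSpace T] [IsProbabilityMeasure P] in
theorem map_eq_gaussianReal (hH : IsGaussianProcess H P) (hc : ∀ σ, ∫ ω, H σ ω ∂P = 0) (σ : T) :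
    P.map (H σ) = gaussianReal 0 (cov2 P H σ σ).toNNReal := by
  rw [(hH.hasGaussianLaw_eval σ).map_eq_gaussianReal, hc σ,
    variance_of_integral_eq_zero (hH.aemeasurable σ) (hc σ)]
  congr 3
  funext ω; rw [sq]

omit [MeasurableSpace T] [IsProbabilityMeasure P] in
theorem cov2_self_nonneg (σ : T) : 0 ≤ cov2 P H σ σ :=
  integral_nonneg fun ω => mul_self_nonneg (H σ ω)

/-- The part of the process that is independent of its value at `σ`. -/
noncomputable def residual (P : Measure Ω) (H : T → Ω → ℝ) (σ τ : T) (ω : Ω) : ℝ :=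
  H τ ω - cov2 P H σ τ / cov2 P H σ σ * H σ ω

omit [MeasurableSpace T] [IsProbabilityMeasure P] in
-- If the variance vanishes the quotient is zero by convention, and the covariance is zero as well
-- because `H σ = 0` almost surely. Degenerate configurations thus need no separate treatment.
theorem cov2_div_mul_self (hH : IsGaussianProcess H P) (σ τ : T) :
    cov2 P H σ τ / cov2 P H σ σ * cov2 P H σ σ = cov2 P H σ τ := by
  by_cases h : cov2 P H σ σ = 0
  · have h1 : (fun ω => H σ ω * H σ ω) =ᵐ[P] 0 :=
      (integral_eq_zero_iff_of_nonneg (fun ω => mul_self_nonneg _)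
        (integrable_mul_of_gaussian hH σ σ)).1 h
    have h2 : cov2 P H σ τ = 0 := by
      refine integral_eq_zero_of_ae ?_
      filter_upwards [h1] with ω hω
      have : H σ ω = 0 := by simpa using hω
      simp [this]
    rw [h2]; simp
  · field_simp

omit [MeasurableSpace T] [IsProbabilityMeasure P] in
-- The value at `σ` and all residuals are jointly Gaussian and uncorrelated, hence independent as
-- processes.
theorem indepFun_residual (hH : IsGaussianProcess H P) (hc : ∀ σ, ∫ ω, H σ ω ∂P = 0) (σ : T) :
    IndepFun (H σ) (fun ω τ => residual P H σ τ ω) P := by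
  classical
  have := hH.isProbabilityMeasure
  have hproc : IsGaussianProcess
      (Sum.elim (fun _ : Unit => H σ) (fun τ : T => residual P H σ τ)) P := by
    refine hH.of_isGaussianProcess fun s => ?_
    rcases s with u | τ
    · exact ⟨{σ}, ContinuousLinearMap.proj ⟨σ, by simp⟩, fun ω => by simp⟩
    · refine ⟨{σ, τ}, ContinuousLinearMap.proj ⟨τ, by simp⟩ -
        (cov2 P H σ τ / cov2 P H σ σ) • ContinuousLinearMap.proj ⟨σ, by simp⟩, fun ω => ?_⟩
      simp [residual]
  have h2 := fun τ => (hH.hasGaussianLaw_eval τ).memLp_two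
  have hres : ∀ τ, AEMeasurable (residual P H σ τ) P := fun τ =>
    (hH.aemeasurable τ).sub ((hH.aemeasurable σ).const_mul _)
  have hind := hproc.indepFun_of_covariance_eq_zero (X := fun _ : Unit => H σ)
    (Y := fun τ : T => residual P H σ τ) (fun _ => hH.aemeasurable σ) hres (fun _ τ => by
      have : residual P H σ τ = H τ - fun ω => cov2 P H σ τ / cov2 P H σ σ * H σ ω := rfl
      rw [this, covariance_sub_right (h2 σ) (h2 τ) ((h2 σ).const_mul _),
        covariance_const_mul_right, covariance_eq_sub (h2 σ) (h2 τ),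
        covariance_eq_sub (h2 σ) (h2 σ), hc σ]
      have := cov2_div_mul_self hH σ τ
      simp only [cov2, Pi.mul_apply] at *
      linarith)
  exact hind.comp (φ := fun f : Unit → ℝ => f ()) (ψ := id) (measurable_pi_apply ()) measurable_id

/-- Gaussian integration by parts for a process: functionals of the value at `σ` and of the
occupation measure of the residual process. -/
theorem integral_process_mul (hH : IsGaussianProcess H P) (hc : ∀ σ, ∫ ω, H σ ω ∂P = 0)
    {σ : T} (hHσ : Measurable (H σ))
    (hG : Measurable fun x : T × Ω => residual P H σ x.1 x.2)
    {Ψ Ψ' : ℝ → BddMeasure (T × ℝ) (μ Set.univ) → ℝ}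
    (hΨ : Measurable (Function.uncurry Ψ)) (hΨ' : Measurable (Function.uncurry Ψ'))
    (hd : ∀ᵐ ω ∂P, ∀ y, HasDerivAt (fun y => Ψ y (occupation μ _ hG ω))
      (Ψ' y (occupation μ _ hG ω)) y)
    (h0 : Integrable (fun ω => Ψ (H σ ω) (occupation μ _ hG ω)) P)
    (h1 : Integrable (fun ω => H σ ω * Ψ (H σ ω) (occupation μ _ hG ω)) P)
    (h2 : Integrable (fun ω => Ψ' (H σ ω) (occupation μ _ hG ω)) P) :
    ∫ ω, H σ ω * Ψ (H σ ω) (occupation μ _ hG ω) ∂P =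
      cov2 P H σ σ * ∫ ω, Ψ' (H σ ω) (occupation μ _ hG ω) ∂P := by
  set M := occupation μ _ hG
  have hM : Measurable M := measurable_occupation hG
  set v := (cov2 P H σ σ).toNNReal
  -- By independence the value `H σ` may be replaced by a Gaussian variable `y` on a separate
  -- factor. For almost every `ω` the functional is then a function of `y` alone, to which the
  -- formula on the line applies.
  have hlaw : P.map (fun ω => (H σ ω, M ω)) =
      ((gaussianReal 0 v).prod P).map fun x => (x.1, M x.2) := by
    rw [(indepFun_iff_map_prod_eq_prod_map_map hHσ.aemeasurable hM.aemeasurable).1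
      (indepFun_occupation hG (indepFun_residual hH hc σ)), map_eq_gaussianReal hH hc]
    have := Measure.map_prod_map (gaussianReal 0 v) P measurable_id hM
    rw [Measure.map_id] at this
    exact this
  have hpm : Measurable fun ω => (H σ ω, M ω) := hHσ.prodMk hM
  have hpm' : Measurable fun x : ℝ × Ω => (x.1, M x.2) :=
    measurable_fst.prodMk (hM.comp measurable_snd)
  have hint : ∀ {f : ℝ → BddMeasure (T × ℝ) (μ Set.univ) → ℝ},
      Measurable (Function.uncurry f) → Integrable (fun ω => f (H σ ω) (M ω)) P →
      Integrable (fun x : ℝ × Ω => f x.1 (M x.2)) ((gaussianReal 0 v).prod P) ∧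
      ∫ ω, f (H σ ω) (M ω) ∂P = ∫ ω, ∫ y, f y (M ω) ∂(gaussianReal 0 v) ∂P := by
    intro f hf hi
    have e1 := (integrable_map_measure (f := fun ω => (H σ ω, M ω)) (g := Function.uncurry f)
      (μ := P) hf.aestronglyMeasurable hpm.aemeasurable).2 hi
    rw [hlaw] at e1
    have e2 := (integrable_map_measure (f := fun x : ℝ × Ω => (x.1, M x.2))
      (g := Function.uncurry f)
      (μ := (gaussianReal 0 v).prod P) hf.aestronglyMeasurable hpm'.aemeasurable).1 e1
    refine ⟨e2, ?_⟩
    have e3 := integral_map (μ := P) hpm.aemeasurable (f := Function.uncurry f)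
      hf.aestronglyMeasurable
    have e4 := integral_map (μ := (gaussianReal 0 v).prod P) hpm'.aemeasurable
      (f := Function.uncurry f) hf.aestronglyMeasurable
    rw [hlaw, e4] at e3
    exact e3.symm.trans (integral_prod_symm _ e2)
  obtain ⟨i0, -⟩ := hint hΨ h0
  obtain ⟨i1, q1⟩ := hint (f := fun y M => y * Ψ y M) (measurable_fst.mul hΨ) h1
  obtain ⟨i2, q2⟩ := hint hΨ' h2
  rw [q1, q2, ← integral_const_mul]
  refine integral_congr_ae ?_
  filter_upwards [hd, i0.prod_left_ae, i1.prod_left_ae, i2.prod_left_ae] with ω a0 a1 a2 a3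
  rw [integral_id_mul_gaussianReal a0 a1 a2 a3, Real.coe_toNNReal _ (cov2_self_nonneg σ)]

end GaussianProcess


/-! ### The density `rho` and its derivatives in the two kinds of directions -/

section Rho

variable {X : Type*} [MeasurableSpace X] {μ : Measure X} [IsFiniteMeasure μ] [NeZero μ]
  {E : Type*} [NormedAddCommGroup E] [MeasurableSpace E] [BorelSpace E]
  [SecondCountableTopology E] {k : ℕ}
  {γ : Fin (k + 1) → Measure E} [∀ p, IsProbabilityMeasure (γ p)] {m : ℕ → ℝ} {B : ℝ}
  {A : X → ℝ} {V : X → (Fin (k + 1) → E) → ℝ}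

/-- The density `W_1 ⋯ W_k exp (V - F)` of the weighted Gibbs measure. -/
noncomputable def rho (γ : Fin (k + 1) → Measure E) (m : ℕ → ℝ) (μ : Measure X)
    (V : X → (Fin (k + 1) → E) → ℝ) (σ : X) (z : Fin (k + 1) → E) : ℝ :=
  (∏ j ∈ Finset.Icc 1 k, parisiW γ m (logZ μ V) j z) * Real.exp (V σ z - logZ μ V z)

omit [IsFiniteMeasure μ] [NeZero μ] [NormedAddCommGroup E] [BorelSpace E]
  [SecondCountableTopology E] [∀ p, IsProbabilityMeasure (γ p)] in
theorem prod_parisiW_mul_gibbs (f : X → ℝ) (z : Fin (k + 1) → E) :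
    (∏ j ∈ Finset.Icc 1 k, parisiW γ m (logZ μ V) j z) * gibbs μ V f z =
      ∫ σ, f σ * rho γ m μ V σ z ∂μ := by
  simp only [rho, gibbs, Real.exp_sub]
  rw [div_eq_mul_inv, ← integral_mul_const, ← integral_const_mul]
  congr 1; ext σ; ring

omit [IsFiniteMeasure μ] [NeZero μ] [NormedAddCommGroup E] [BorelSpace E]
  [SecondCountableTopology E] [∀ p, IsProbabilityMeasure (γ p)] in
theorem rho_pos (σ : X) (z : Fin (k + 1) → E) : 0 < rho γ m μ V σ z :=
  mul_pos (Finset.prod_pos fun _ _ => parisiW_pos _ _ _) (Real.exp_pos _)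

/-- The factor `(∫ exp (-A) dμ)⁻¹`. -/
noncomputable def invMass (μ : Measure X) (A : X → ℝ) : ℝ := (∫ σ, Real.exp (-A σ) ∂μ)⁻¹

omit [IsFiniteMeasure μ] [NeZero μ] in
theorem invMass_nonneg : 0 ≤ invMass μ A :=
  inv_nonneg.2 (integral_nonneg fun _ => (Real.exp_pos _).le)

omit [IsFiniteMeasure μ] in
-- The rate `K` is chosen before `μ`, `A` and `V`, so all dependence on the disorder sits in `exp A`
-- and in the inverse mass.
theorem exists_rho_le (X : Type*) [MeasurableSpace X] (hγ : HasExpMoments γ) (hB : 0 ≤ B)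
    (hm : ∀ l ≤ k, 0 ≤ m l) :
    ∃ K, 0 ≤ K ∧ ∀ (μ : Measure X) [NeZero μ] (A : X → ℝ) (V : X → (Fin (k + 1) → E) → ℝ),
      IsHam B A V → IsExpWeight μ A → ∀ σ z,
        rho γ m μ V σ z ≤ Real.exp (K * (1 + ‖z‖)) * (Real.exp (A σ) * invMass μ A) := by
  obtain ⟨K, hK, h⟩ := exists_expBounded_prod_parisiW (γ := γ) hγ hB hm
  refine ⟨K + 2 * B, by positivity, fun μ _ A V hV hA σ z => ?_⟩
  have h1 := (le_abs_self _).trans (h _ (hV.isLip_logZ hA) _ (Icc_subset_range 1) z)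
  have h2 : Real.exp (V σ z - logZ μ V z) ≤
      Real.exp (2 * B * (1 + ‖z‖)) * (Real.exp (A σ) * invMass μ A) := by
    rw [sub_eq_add_neg, Real.exp_add]
    refine (mul_le_mul (hV.exp_le σ z) (hV.exp_neg_logZ_le hA z) (Real.exp_pos _).le
      (by positivity)).trans ?_
    have : Real.exp (B * ‖z‖) * Real.exp (B * ‖z‖) ≤ Real.exp (2 * B * (1 + ‖z‖)) := by
      rw [← Real.exp_add, Real.exp_le_exp]; linarith
    calc _ = (Real.exp (B * ‖z‖) * Real.exp (B * ‖z‖)) * (Real.exp (A σ) * invMass μ A) := by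
          rw [invMass]; ring
      _ ≤ _ := mul_le_mul_of_nonneg_right this (mul_nonneg (Real.exp_pos _).le invMass_nonneg)
  refine (mul_le_mul h1 h2 (Real.exp_pos _).le (Real.exp_pos _).le).trans_eq ?_
  rw [add_mul, Real.exp_add]; ring

omit [IsFiniteMeasure μ] [NeZero μ] [NormedAddCommGroup E] [BorelSpace E]
  [SecondCountableTopology E] in
theorem measurable_rho {α : Type*} [MeasurableSpace α] (κ : Kernel α X) [IsSFiniteKernel κ]
    {V : α → X → (Fin (k + 1) → E) → ℝ}
    (hV : Measurable fun x : (α × (Fin (k + 1) → E)) × X => V x.1.1 x.2 x.1.2) :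
    Measurable fun x : (α × (Fin (k + 1) → E)) × X =>
      rho γ m (κ x.1.1) (V x.1.1) x.2 x.1.2 :=
  ((measurable_prod_parisiW γ (measurable_logZ κ hV) m (Finset.Icc 1 k)).comp
    measurable_fst).mul ((hV.sub ((measurable_logZ κ hV).comp measurable_fst)).exp)

omit [NeZero μ] [NormedAddCommGroup E] [BorelSpace E] [SecondCountableTopology E] in
theorem measurable_rho_const (hV : Measurable (Function.uncurry V)) :
    Measurable (Function.uncurry (rho γ m μ V)) :=
  (measurable_rho (α := Unit) (Kernel.const Unit μ) (V := fun _ => V)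
    (hV.comp (f := fun x : (Unit × (Fin (k + 1) → E)) × X => (x.2, x.1.2)) (by fun_prop))).comp
    (f := fun x : X × (Fin (k + 1) → E) => (((), x.2), x.1)) (by fun_prop)

omit [IsFiniteMeasure μ] [NeZero μ] in
theorem IsExpWeight.add_const (hA : IsExpWeight μ A) {c : ℝ} (hc : 0 ≤ c) :
    IsExpWeight μ fun σ => A σ + c where
  meas := hA.meas.add_const c
  nonneg σ := add_nonneg (hA.nonneg σ) hc
  integrable K := by
    simp only [mul_add, Real.exp_add]
    exact (hA.integrable K).mul_const _

/-- The Hamiltonian `V + y b`. -/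
def shift {Z : Type*} (V : X → Z → ℝ) (b : X → ℝ) (y : ℝ) (σ : X) (z : Z) : ℝ := V σ z + y * b σ

/-- For `|y| ≤ R` the term `y b` is absorbed by adding the constant `R c` to the weight. -/
theorem IsHam.shift {Z : Type*} [NormedAddCommGroup Z] [MeasurableSpace Z] {V : X → Z → ℝ}
    (hV : IsHam B A V) {b : X → ℝ} (hb : Measurable b) {c : ℝ} (hc : ∀ σ, |b σ| ≤ c) {y R : ℝ}
    (hy : |y| ≤ R) : IsHam B (fun σ => A σ + R * c) (shift V b y) where
  meas := hV.meas.add ((hb.comp measurable_fst).const_mul y)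
  lip σ z z' := by simpa [SpinGlass.shift] using hV.lip σ z z'
  bdd σ := by
    refine (abs_add_le _ _).trans (add_le_add (hV.bdd σ) ?_)
    rw [abs_mul]
    exact mul_le_mul hy (hc σ) (abs_nonneg _) ((abs_nonneg _).trans hy)

omit [IsFiniteMeasure μ] [NeZero μ] in
theorem IsHam.hamFam_shift {Z : Type*} [NormedAddCommGroup Z] [MeasurableSpace Z]
    {V : X → Z → ℝ} (hV : IsHam B A V) (hA : IsExpWeight μ A) {b : X → ℝ} (hb : Measurable b)
    {c : ℝ} (hc0 : 0 ≤ c) (hc : ∀ σ, |b σ| ≤ c) {R : ℝ} (hR : 0 ≤ R) :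
    HamFam (Set.Ioo (-R) R) B c (fun σ => A σ + R * c) (SpinGlass.shift V b)
      (fun _ σ _ => b σ) where
  ham s hs := hV.shift hb hc (abs_le.2 ⟨hs.1.le, hs.2.le⟩)
  deriv s _ σ z := by
    simpa [SpinGlass.shift] using ((hasDerivAt_id s).mul_const (b σ)).const_add (V σ z)
  bound s _ σ z := by
    have h1 : c ≤ Real.exp (c * (1 + ‖z‖)) := by
      have : c ≤ c * (1 + ‖z‖) := by nlinarith [norm_nonneg z]
      linarith [Real.add_one_le_exp (c * (1 + ‖z‖))]
    have h2 : 1 ≤ Real.exp (A σ + R * c) :=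
      Real.one_le_exp (add_nonneg (hA.nonneg σ) (mul_nonneg hR hc0))
    nlinarith [hc σ, Real.exp_pos (c * (1 + ‖z‖))]
  meas _ _ := hb.comp measurable_fst

variable (hγ : HasExpMoments γ) (hB : 0 ≤ B) (hm : ∀ l ≤ k, 0 ≤ m l)
  (hV : IsHam B A V) (hA : IsExpWeight μ A) {b : X → ℝ} (hb : Measurable b)
  {c : ℝ} (hc : ∀ σ, |b σ| ≤ c)

include hγ hB hm hV hA hb hc in
theorem hasDerivAt_parisiLevel_shift {l : ℕ} (hl : l ≤ k + 1) (y : ℝ) (z : Fin (k + 1) → E) :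
    HasDerivAt (fun y => parisiLevel γ m (logZ μ (shift V b y)) l z)
      (parisiAvg γ m (logZ μ (shift V b y)) l (gibbs μ (shift V b y) b) z) y := by
  rcases isEmpty_or_nonempty X with hX | ⟨⟨σ₀⟩⟩
  · exact absurd (Measure.eq_zero_of_isEmpty μ) (NeZero.ne μ)
  have hc0 : 0 ≤ c := (abs_nonneg _).trans (hc σ₀)
  -- The bounds are uniform only for bounded shifts, so the derivative at `y` is taken inside the
  -- interval of radius `|y| + 1`.
  have hR : 0 ≤ |y| + 1 := by positivity
  have hy : y ∈ Set.Ioo (-(|y| + 1)) (|y| + 1) :=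
    ⟨by linarith [neg_abs_le y], by linarith [le_abs_self y]⟩
  obtain ⟨K, hK⟩ := (hV.hamFam_shift hA hb hc0 hc hR).derivFam isOpen_Ioo hB
    (hA.add_const (mul_nonneg hR hc0))
  obtain ⟨K', hK'⟩ := hK.parisiLevel isOpen_Ioo hγ hB hm l hl
  exact hK'.deriv y hy z

variable (hm0 : m 0 = 0) (hmk : m k = 1)

include hγ hB hm hV hA hb hc hm0 hmk in
-- A shift of the Hamiltonian moves all the levels, so the sum over all `j` appears. This is the
-- direction of a value of `H_N`.
theorem hasDerivAt_rho_shift (σ : X) (y : ℝ) (z : Fin (k + 1) → E) :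
    HasDerivAt (fun y => rho γ m μ (shift V b y) σ z)
      (rho γ m μ (shift V b y) σ z * (b σ - ∑ j ∈ Finset.Icc 1 k, (m j - m (j - 1)) *
        parisiAvg γ m (logZ μ (shift V b y)) j (gibbs μ (shift V b y) b) z)) y := by
  have := hasDerivAt_weight (k := k) hm0 hmk
    (Φ := fun j y => parisiLevel γ m (logZ μ (shift V b y)) j z)
    (δ := fun j => parisiAvg γ m (logZ μ (shift V b y)) j (gibbs μ (shift V b y) b) z)
    (w := fun y => shift V b y σ z) (w' := b σ) (y := y)
    (fun j hj => hasDerivAt_parisiLevel_shift hγ hB hm hV hA hb hc (Finset.mem_Icc.1 hj).2 y z)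
    (by simpa [shift] using ((hasDerivAt_id y).mul_const (b σ)).const_add (V σ z))
  simp only [parisiLevel_last] at this
  simpa only [rho, parisiW] using this

omit [MeasurableSpace E] [BorelSpace E] [SecondCountableTopology E] in
theorem merge_add {p : Fin (k + 1)} {e : Fin (k + 1) → E} (he : ∀ p', p' ≠ p → e p' = 0) {l : ℕ}
    (hl : (p : ℕ) < l) (z z' : Fin (k + 1) → E) : merge l z z' + e = merge l (z + e) z' := by
  funext p'
  simp only [merge, Pi.add_apply]
  split_ifs with h
  · rfl
  · rw [he p' (by rintro rfl; exact h hl), add_zero]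

omit [BorelSpace E] [SecondCountableTopology E] [∀ p, IsProbabilityMeasure (γ p)] in
theorem condE_translate {p : Fin (k + 1)} {e : Fin (k + 1) → E} (he : ∀ p', p' ≠ p → e p' = 0)
    {l : ℕ} (hl : (p : ℕ) < l) (G : (Fin (k + 1) → E) → ℝ) (z : Fin (k + 1) → E) :
    condE γ l (fun w => G (w + e)) z = condE γ l G (z + e) := by
  simp only [condE_eq, merge_add he hl]

omit [BorelSpace E] [SecondCountableTopology E] [∀ p, IsProbabilityMeasure (γ p)] in
-- For `l > p` the component `z_p` is frozen by every average from level `l` on, so translating it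
-- commutes with the recursion down to level `l`.
theorem parisiLevel_translate {p : Fin (k + 1)} {e : Fin (k + 1) → E}
    (he : ∀ p', p' ≠ p → e p' = 0) (F : (Fin (k + 1) → E) → ℝ) :
    ∀ l ≤ k + 1, (p : ℕ) < l → ∀ z,
      parisiLevel γ m (fun w => F (w + e)) l z = parisiLevel γ m F l (z + e) := by
  refine level_induction (fun _ z => ?_) fun l hl ih hpl z => ?_
  · simp only [parisiLevel_last]
  · rw [parisiLevel_of_le γ m _ hl, parisiLevel_of_le γ m _ hl]
    have : parisiLevel γ m (fun w => F (w + e)) (l + 1) =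
        fun w => parisiLevel γ m F (l + 1) (w + e) := funext fun w => ih (by omega) w
    rw [this, parisiStep, parisiStep, condE_translate he hpl,
      condE_translate he hpl (fun w => Real.exp (m l * parisiLevel γ m F (l + 1) w))]

omit [BorelSpace E] [SecondCountableTopology E] [∀ p, IsProbabilityMeasure (γ p)] in
theorem parisiAvg_translate {p : Fin (k + 1)} {e : Fin (k + 1) → E}
    (he : ∀ p', p' ≠ p → e p' = 0) (F f : (Fin (k + 1) → E) → ℝ) {l : ℕ}
    (hpl : (p : ℕ) < l) (z : Fin (k + 1) → E) :
    parisiAvg γ m (fun w => F (w + e)) l (fun w => f (w + e)) z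
      = parisiAvg γ m F l f (z + e) := by
  rw [parisiAvg, parisiAvg, ← condE_translate he hpl]
  simp only [condE_eq]
  congr 1; ext w
  congr 1
  refine Finset.prod_congr rfl fun j hj => ?_
  rw [Finset.mem_Icc] at hj
  simp only [parisiW]
  rw [parisiLevel_translate he F _ (by omega) (by omega),
    parisiLevel_translate he F _ (by omega) (by omega)]

include hγ hB hm hV hA hb hc hm0 hmk in
-- For levels `j > p` a translation of `z_p` acts as a shift of the Hamiltonian, and the previous
-- derivative applies; levels `j ≤ p` have already averaged `z_p` out. This restriction to `j > p`
-- produces the telescoping of the variances.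
theorem hasDerivAt_rho_translate {p : Fin (k + 1)} {e : ℝ → Fin (k + 1) → E}
    (he : ∀ y p', p' ≠ p → e y p' = 0) (hVe : ∀ σ z y, V σ (z + e y) = V σ z + y * b σ)
    (σ : X) (y : ℝ) (z : Fin (k + 1) → E) :
    HasDerivAt (fun y => rho γ m μ V σ (z + e y))
      (rho γ m μ V σ (z + e y) * (b σ - ∑ j ∈ Finset.Icc 1 k, (m j - m (j - 1)) *
        if (p : ℕ) < j then parisiAvg γ m (logZ μ V) j (gibbs μ V b) (z + e y) else 0)) y := by
  have hF : ∀ y, logZ μ (shift V b y) = fun w => logZ μ V (w + e y) := by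
    intro y; funext w; simp only [logZ, shift, hVe]
  have hg : ∀ y, gibbs μ (shift V b y) b = fun w => gibbs μ V b (w + e y) := by
    intro y; funext w; simp only [gibbs, hF]; simp only [shift, hVe]
  have := hasDerivAt_weight (k := k) hm0 hmk
    (Φ := fun j y => parisiLevel γ m (logZ μ V) j (z + e y))
    (δ := fun j => if (p : ℕ) < j then
      parisiAvg γ m (logZ μ V) j (gibbs μ V b) (z + e y) else 0)
    (w := fun y => V σ (z + e y)) (w' := b σ) (y := y)
    (fun j hj => by
      have hj' := (Finset.mem_Icc.1 hj).2
      by_cases hpj : (p : ℕ) < j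
      · simp only [if_pos hpj]
        have h := hasDerivAt_parisiLevel_shift hγ hB hm hV hA hb hc hj' y z
        simp only [hF, hg, parisiLevel_translate (he _) _ j hj' hpj,
          parisiAvg_translate (he _) _ _ hpj] at h
        exact h
      · simp only [if_neg hpj]
        -- `F_j` depends only on the components of index below `j`, and `z_p` is not among them.
        have : ∀ y, parisiLevel γ m (logZ μ V) j (z + e y) = parisiLevel γ m (logZ μ V) j z := by
          intro y
          have hdep := dependsBelow_parisiLevel γ m (logZ μ V) hj'
          rw [← hdep (z + e y) z]
          congr 1
          funext p'
          simp only [merge, Pi.add_apply]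
          split_ifs with h
          · rw [he y p' (by rintro rfl; exact hpj h), add_zero]
          · rfl
        simp only [this]
        exact hasDerivAt_const _ _)
    (by simp only [hVe]
        simpa using ((hasDerivAt_id y).mul_const (b σ)).const_add (V σ z))
  simp only [parisiLevel_last] at this
  simpa only [rho, parisiW] using this

end Rho

/-! ### Gaussian integration by parts for one component of a product -/

section Pi

variable {ι : Type*} [Fintype ι] [DecidableEq ι] {α : ι → Type*} [∀ i, MeasurableSpace (α i)]
  (ν : ∀ i, Measure (α i)) [∀ i, IsProbabilityMeasure (ν i)]

/-- Resampling one independent coordinate preserves the product law. It lets one coordinate be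
integrated while the others are fixed. -/
theorem measurePreserving_update (i : ι) :
    MeasurePreserving (fun x : (∀ i, α i) × α i => Function.update x.1 i x.2)
      ((Measure.pi ν).prod (ν i)) (Measure.pi ν) := by
  have hm : Measurable (fun x : (∀ i, α i) × α i => Function.update x.1 i x.2) := by
    refine measurable_pi_iff.2 fun j => ?_
    by_cases h : j = i
    · subst h; simp only [Function.update_self]; fun_prop
    · simp only [Function.update_of_ne h]; fun_prop
  refine ⟨hm, (Measure.pi_eq fun s hs => ?_).symm⟩
  rw [Measure.map_apply hm (MeasurableSet.univ_pi hs)]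
  have : (fun x : (∀ i, α i) × α i => Function.update x.1 i x.2) ⁻¹' (Set.univ.pi s) =
      (Set.univ.pi (Function.update s i Set.univ)) ×ˢ s i := by
    ext x
    simp only [Set.mem_preimage, Set.mem_univ_pi, Set.mem_prod]
    constructor
    · intro h
      refine ⟨fun j => ?_, by simpa using h i⟩
      by_cases hj : j = i
      · subst hj; simp
      · simpa [hj] using h j
    · rintro ⟨h1, h2⟩ j
      by_cases hj : j = i
      · subst hj; simpa using h2
      · simpa [hj] using h1 j
  rw [this, Measure.prod_prod, Measure.pi_pi, ← Finset.mul_prod_erase _ _ (Finset.mem_univ i),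
    ← Finset.mul_prod_erase Finset.univ (fun i => ν i (s i)) (Finset.mem_univ i)]
  simp only [Function.update_self, measure_univ, one_mul]
  rw [mul_comm]
  congr 1
  refine Finset.prod_congr rfl fun j hj => ?_
  rw [Function.update_of_ne (Finset.ne_of_mem_erase hj)]

theorem integrable_update {i : ι} {f : (∀ i, α i) → ℝ} (hf : Integrable f (Measure.pi ν)) :
    Integrable (fun x : (∀ i, α i) × α i => f (Function.update x.1 i x.2))
      ((Measure.pi ν).prod (ν i)) :=
  (measurePreserving_update ν i).integrable_comp_of_integrable hf

theorem integral_update {i : ι} {f : (∀ i, α i) → ℝ} (hf : Integrable f (Measure.pi ν)) :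
    ∫ x, f x ∂(Measure.pi ν) =
      ∫ x, ∫ y, f (Function.update x i y) ∂(ν i) ∂(Measure.pi ν) := by
  have hmp := measurePreserving_update ν i
  rw [integral_integral (f := fun x y => f (Function.update x i y)) (integrable_update ν hf)]
  conv_lhs => rw [← hmp.map_eq]
  rw [integral_map hmp.measurable.aemeasurable]
  rw [hmp.map_eq]; exact hf.aestronglyMeasurable

end Pi

/-- By Fubini the formula on the line is applied to the sections in coordinate `i`; the
integrability of almost every section follows from that of the whole. -/
theorem integral_apply_mul_pi {N : ℕ} {v : NNReal} (i : Fin N) {f f' : (Fin N → ℝ) → ℝ}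
    (hf : ∀ w y, HasDerivAt (fun y => f (Function.update w i y))
      (f' (Function.update w i y)) y)
    (h0 : Integrable f (Measure.pi fun _ => gaussianReal 0 v))
    (h1 : Integrable (fun w => w i * f w) (Measure.pi fun _ => gaussianReal 0 v))
    (h2 : Integrable f' (Measure.pi fun _ => gaussianReal 0 v)) :
    ∫ w, w i * f w ∂(Measure.pi fun _ => gaussianReal 0 v) =
      v * ∫ w, f' w ∂(Measure.pi fun _ => gaussianReal 0 v) := by
  rw [integral_update _ (i := i) h1, integral_update _ (i := i) h2, ← integral_const_mul]
  refine integral_congr_ae ?_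
  filter_upwards [(integrable_update _ (i := i) h0).prod_right_ae,
    (integrable_update _ (i := i) h1).prod_right_ae,
    (integrable_update _ (i := i) h2).prod_right_ae] with w a0 a1 a2
  simp only [Function.update_self] at a1 ⊢
  exact integral_id_mul_gaussianReal (fun y => hf w y) a0 a1 a2

theorem integral_apply_apply_mul_pi {N k : ℕ} {v : Fin (k + 1) → NNReal} (p : Fin (k + 1))
    (i : Fin N) {f f' : (Fin (k + 1) → Fin N → ℝ) → ℝ}
    (hf : ∀ z w y, HasDerivAt (fun y => f (Function.update z p (Function.update w i y)))
      (f' (Function.update z p (Function.update w i y))) y)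
    (h0 : Integrable f (Measure.pi fun p => Measure.pi fun _ => gaussianReal 0 (v p)))
    (h1 : Integrable (fun z => z p i * f z)
      (Measure.pi fun p => Measure.pi fun _ => gaussianReal 0 (v p)))
    (h2 : Integrable f' (Measure.pi fun p => Measure.pi fun _ => gaussianReal 0 (v p))) :
    ∫ z, z p i * f z ∂(Measure.pi fun p => Measure.pi fun _ => gaussianReal 0 (v p)) =
      v p * ∫ z, f' z ∂(Measure.pi fun p => Measure.pi fun _ => gaussianReal 0 (v p)) := by
  rw [integral_update _ (i := p) h1, integral_update _ (i := p) h2, ← integral_const_mul]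
  refine integral_congr_ae ?_
  filter_upwards [(integrable_update _ (i := p) h0).prod_right_ae,
    (integrable_update _ (i := p) h1).prod_right_ae,
    (integrable_update _ (i := p) h2).prod_right_ae] with z a0 a1 a2
  simp only [Function.update_self] at a1 ⊢
  exact integral_apply_mul_pi i (fun w y => hf z w y) a0 a1 a2


/-! ### The averages `γ_l` over one and two configurations -/

section Avg2

variable {X : Type*} [MeasurableSpace X] {μ : Measure X} [IsFiniteMeasure μ] [NeZero μ]
  {E : Type*} [NormedAddCommGroup E] [MeasurableSpace E] [BorelSpace E]
  [SecondCountableTopology E] {k : ℕ}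
  {γ : Fin (k + 1) → Measure E} [∀ p, IsProbabilityMeasure (γ p)] {m : ℕ → ℝ} {B : ℝ}
  {A : X → ℝ} {V : X → (Fin (k + 1) → E) → ℝ}

omit [IsFiniteMeasure μ] [NeZero μ] in
theorem IsHam.integrable_mul_exp {Z : Type*} [NormedAddCommGroup Z] [MeasurableSpace Z]
    {V : X → Z → ℝ} (hV : IsHam B A V) (hA : IsExpWeight μ A) {f : X → ℝ} (hf : Measurable f)
    {c : ℝ} (hc : ∀ σ, |f σ| ≤ c) (z : Z) :
    Integrable (fun σ => f σ * Real.exp (V σ z)) μ :=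
  (hV.integrable_exp hA z).bdd_mul hf.aestronglyMeasurable (ae_of_all _ hc)

omit [IsFiniteMeasure μ] [NeZero μ] in
theorem gibbs_lin {Z : Type*} [NormedAddCommGroup Z] [MeasurableSpace Z]
    {V : X → Z → ℝ} (hV : IsHam B A V) (hA : IsExpWeight μ A) {f g : X → ℝ} (hf : Measurable f)
    (hg : Measurable g) {c c' : ℝ} (hc : ∀ σ, |f σ| ≤ c) (hc' : ∀ σ, |g σ| ≤ c') (a a' : ℝ)
    (z : Z) : gibbs μ V (fun σ => a * f σ + a' * g σ) z = a * gibbs μ V f z + a' * gibbs μ V g z := by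
  simp only [gibbs, add_mul, mul_assoc]
  rw [integral_add ((hV.integrable_mul_exp hA hf hc z).const_mul a)
    ((hV.integrable_mul_exp hA hg hc' z).const_mul a'), integral_const_mul, integral_const_mul]
  ring

omit [IsFiniteMeasure μ] in
theorem gibbs_one {Z : Type*} [NormedAddCommGroup Z] [MeasurableSpace Z]
    {V : X → Z → ℝ} (hV : IsHam B A V) (hA : IsExpWeight μ A) (z : Z) :
    gibbs μ V (fun _ => 1) z = 1 := by
  simp only [gibbs, one_mul]
  rw [hV.exp_logZ hA]
  exact div_self (integral_exp_pos (hV.integrable_exp hA z)).ne'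

omit [NeZero μ] in
theorem measurable_gibbs_const {Z : Type*} [MeasurableSpace Z] {V : X → Z → ℝ}
    (hV : Measurable (Function.uncurry V)) {α : Type*} [MeasurableSpace α] {f : α → X → ℝ}
    (hf : Measurable (Function.uncurry f)) :
    Measurable (Function.uncurry fun a => gibbs μ V (f a)) :=
  measurable_gibbs (Kernel.const α μ) (V := fun _ => V)
    (hV.comp (f := fun x : (α × Z) × X => (x.2, x.1.2)) (by fun_prop)) hf

omit [NeZero μ] in
theorem measurable_gibbs_single {Z : Type*} [MeasurableSpace Z] {V : X → Z → ℝ}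
    (hV : Measurable (Function.uncurry V)) {f : X → ℝ} (hf : Measurable f) :
    Measurable (gibbs μ V f) :=
  (measurable_gibbs_const (α := Unit) hV (f := fun _ => f) (hf.comp measurable_snd)).comp
    (measurable_prodMk_left (x := ()))

omit [IsFiniteMeasure μ] [NeZero μ] in
theorem gibbs_nonneg {Z : Type*} {V : X → Z → ℝ} {f : X → ℝ} (hf : ∀ σ, 0 ≤ f σ) (z : Z) :
    0 ≤ gibbs μ V f z :=
  div_nonneg (integral_nonneg fun σ => mul_nonneg (hf σ) (Real.exp_pos _).le) (Real.exp_pos _).le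

/-- `γ_l (f) = 𝔼_l (W_l ⋯ W_k ⟨f⟩)`. -/
noncomputable def levelAvg (γ : Fin (k + 1) → Measure E) (m : ℕ → ℝ) (μ : Measure X)
    (V : X → (Fin (k + 1) → E) → ℝ) (l : ℕ) (f : X → ℝ) (z : Fin (k + 1) → E) : ℝ :=
  parisiAvg γ m (logZ μ V) l (gibbs μ V f) z

/-- `γ_l^{⊗2} (f)`. -/
noncomputable def levelAvg2 (γ : Fin (k + 1) → Measure E) (m : ℕ → ℝ) (μ : Measure X)
    (V : X → (Fin (k + 1) → E) → ℝ) (l : ℕ) (f : X → X → ℝ) (z : Fin (k + 1) → E) : ℝ :=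
  levelAvg γ m μ V l (fun σ => levelAvg γ m μ V l (f σ) z) z

omit [IsFiniteMeasure μ] [NeZero μ] [NormedAddCommGroup E] [BorelSpace E]
  [SecondCountableTopology E] in
theorem measurable_levelAvg_kernel {α : Type*} [MeasurableSpace α] (κ : Kernel α X)
    [IsSFiniteKernel κ] {V : α → X → (Fin (k + 1) → E) → ℝ}
    (hV : Measurable fun x : (α × (Fin (k + 1) → E)) × X => V x.1.1 x.2 x.1.2)
    {f : α → X → ℝ} (hf : Measurable (Function.uncurry f)) (l : ℕ) :
    Measurable (Function.uncurry fun a => levelAvg γ m (κ a) (V a) l (f a)) :=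
  measurable_parisiAvg γ (measurable_logZ κ hV) (measurable_gibbs κ hV hf) m l

omit [NeZero μ] [NormedAddCommGroup E] [BorelSpace E] [SecondCountableTopology E] in
theorem measurable_levelAvg {α : Type*} [MeasurableSpace α]
    {V : α → X → (Fin (k + 1) → E) → ℝ}
    (hV : Measurable fun x : (α × (Fin (k + 1) → E)) × X => V x.1.1 x.2 x.1.2)
    {f : α → X → ℝ} (hf : Measurable (Function.uncurry f)) (l : ℕ) :
    Measurable (Function.uncurry fun a => levelAvg γ m μ (V a) l (f a)) :=
  measurable_levelAvg_kernel (Kernel.const α μ) hV hf l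

omit [NeZero μ] [NormedAddCommGroup E] [BorelSpace E] [SecondCountableTopology E] in
theorem measurable_levelAvg_prod {α : Type*} [MeasurableSpace α]
    {V : α → X → (Fin (k + 1) → E) → ℝ}
    (hV : Measurable fun x : (α × (Fin (k + 1) → E)) × X => V x.1.1 x.2 x.1.2)
    {f : X → X → ℝ} (hf : Measurable (Function.uncurry f)) (l : ℕ) :
    Measurable fun x : (α × (Fin (k + 1) → E)) × X => levelAvg γ m μ (V x.1.1) l (f x.2) x.1.2 := by
  have := measurable_levelAvg (γ := γ) (m := m) (μ := μ) (α := α × X) (V := fun a => V a.1)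
    (hV.comp (f := fun x : ((α × X) × (Fin (k + 1) → E)) × X => ((x.1.1.1, x.1.2), x.2))
      (by fun_prop)) (f := fun a => f a.2)
    (hf.comp (f := fun x : (α × X) × X => (x.1.2, x.2)) (by fun_prop)) l
  exact this.comp (f := fun x : (α × (Fin (k + 1) → E)) × X => ((x.1.1, x.2), x.1.2))
    (by fun_prop)

omit [NeZero μ] [NormedAddCommGroup E] [BorelSpace E] [SecondCountableTopology E] in
theorem measurable_levelAvg2 {α : Type*} [MeasurableSpace α]
    {V : α → X → (Fin (k + 1) → E) → ℝ}
    (hV : Measurable fun x : (α × (Fin (k + 1) → E)) × X => V x.1.1 x.2 x.1.2)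
    {f : X → X → ℝ} (hf : Measurable (Function.uncurry f)) (l : ℕ) :
    Measurable (Function.uncurry fun a => levelAvg2 γ m μ (V a) l f) := by
  have h2 := measurable_levelAvg (γ := γ) (m := m) (μ := μ) (α := α × (Fin (k + 1) → E))
    (V := fun a => V a.1)
    (hV.comp (f := fun x : ((α × (Fin (k + 1) → E)) × (Fin (k + 1) → E)) × X =>
      ((x.1.1.1, x.1.2), x.2)) (by fun_prop))
    (f := fun a σ => levelAvg γ m μ (V a.1) l (f σ) a.2)
    (measurable_levelAvg_prod hV hf l) l
  exact h2.comp (f := fun x : α × (Fin (k + 1) → E) => (x, x.2)) (by fun_prop)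

omit [IsFiniteMeasure μ] [NeZero μ] [BorelSpace E] [SecondCountableTopology E]
  [∀ p, IsProbabilityMeasure (γ p)] [NormedAddCommGroup E] in
theorem levelAvg_nonneg {l : ℕ} {f : X → ℝ} (hf : ∀ σ, 0 ≤ f σ) (z : Fin (k + 1) → E) :
    0 ≤ levelAvg γ m μ V l f z := parisiAvg_nonneg (fun w => gibbs_nonneg hf w) l z

omit [IsFiniteMeasure μ] [NeZero μ] [BorelSpace E] [SecondCountableTopology E]
  [∀ p, IsProbabilityMeasure (γ p)] [NormedAddCommGroup E] in
theorem levelAvg2_nonneg {l : ℕ} {f : X → X → ℝ} (hf : ∀ σ τ, 0 ≤ f σ τ)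
    (z : Fin (k + 1) → E) : 0 ≤ levelAvg2 γ m μ V l f z :=
  levelAvg_nonneg (fun σ => levelAvg_nonneg (hf σ) z) z

variable (hγ : HasExpMoments γ) (hB : 0 ≤ B) (hm : ∀ l ≤ k, 0 ≤ m l)
  (hV : IsHam B A V) (hA : IsExpWeight μ A)

include hγ hB hm hV hA

omit [IsFiniteMeasure μ] in
theorem abs_levelAvg_le {f : X → ℝ} {c : ℝ} (hc : ∀ σ, |f σ| ≤ c) {l : ℕ} (hl : l ≤ k + 1)
    (z : Fin (k + 1) → E) : |levelAvg γ m μ V l f z| ≤ c :=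
  abs_parisiAvg_le hγ hB hm (hV.isLip_logZ hA)
    (fun w => hV.abs_gibbs_le hA (ae_of_all _ hc) w) hl z

omit [IsFiniteMeasure μ] in
theorem abs_levelAvg2_le {f : X → X → ℝ} {c : ℝ} (hc : ∀ σ τ, |f σ τ| ≤ c) {l : ℕ}
    (hl : l ≤ k + 1) (z : Fin (k + 1) → E) : |levelAvg2 γ m μ V l f z| ≤ c :=
  abs_levelAvg_le hγ hB hm hV hA
    (fun σ => abs_levelAvg_le hγ hB hm hV hA (hc σ) hl z) hl z

theorem levelAvg_lin {f g : X → ℝ} (hf : Measurable f) (hg : Measurable g) {c c' : ℝ}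
    (hc : ∀ σ, |f σ| ≤ c) (hc' : ∀ σ, |g σ| ≤ c') (a a' : ℝ) (l : ℕ) (z : Fin (k + 1) → E) :
    levelAvg γ m μ V l (fun σ => a * f σ + a' * g σ) z =
      a * levelAvg γ m μ V l f z + a' * levelAvg γ m μ V l g z := by
  have h1 : gibbs μ V (fun σ => a * f σ + a' * g σ) =
      fun w => a * gibbs μ V f w - (-a') * gibbs μ V g w := by
    funext w; rw [gibbs_lin hV hA hf hg hc hc']; ring
  have hb : ∀ (a : ℝ) {f : X → ℝ} {c : ℝ}, (∀ σ, |f σ| ≤ c) →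
      ExpBounded (|a| * c) fun w => a * gibbs μ V f w := fun a f c hc =>
    expBounded_of_le fun w => by
      rw [abs_mul]
      exact mul_le_mul_of_nonneg_left (hV.abs_gibbs_le hA (ae_of_all _ hc) w) (abs_nonneg a)
  simp only [levelAvg]
  rw [h1, parisiAvg_sub hγ hB hm (hV.isLip_logZ hA) (hb a hc)
    ((measurable_gibbs_single hV.meas hf).const_mul a) (hb (-a') hc')
    ((measurable_gibbs_single hV.meas hg).const_mul _), parisiAvg_const_mul, parisiAvg_const_mul]
  ring

omit [IsFiniteMeasure μ] in
theorem levelAvg_one {l : ℕ} (hl : l ≤ k + 1) (z : Fin (k + 1) → E) :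
    levelAvg γ m μ V l (fun _ => 1) z = 1 := by
  have : gibbs μ V (fun _ => 1) = fun _ => 1 := funext fun w => gibbs_one hV hA w
  rw [levelAvg, this]
  exact parisiAvg_one hγ hB hm (hV.isLip_logZ hA) l hl z

omit [IsFiniteMeasure μ] in
theorem levelAvg2_one {l : ℕ} (hl : l ≤ k + 1) (z : Fin (k + 1) → E) :
    levelAvg2 γ m μ V l (fun _ _ => 1) z = 1 := by
  simp only [levelAvg2, levelAvg_one hγ hB hm hV hA hl]

omit hγ hB hm hA in
omit [NeZero μ] [BorelSpace E] [SecondCountableTopology E] in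
theorem measurable_levelAvg_left {f : X → X → ℝ} (hf : Measurable (Function.uncurry f)) (l : ℕ) :
    Measurable (Function.uncurry fun σ => levelAvg γ m μ V l (f σ)) :=
  measurable_levelAvg (α := X) (V := fun _ => V)
    (hV.meas.comp (f := fun x : (X × (Fin (k + 1) → E)) × X => (x.2, x.1.2)) (by fun_prop)) hf l

theorem levelAvg2_lin {f g : X → X → ℝ} (hf : Measurable (Function.uncurry f))
    (hg : Measurable (Function.uncurry g)) {c c' : ℝ}
    (hc : ∀ σ τ, |f σ τ| ≤ c) (hc' : ∀ σ τ, |g σ τ| ≤ c') (a a' : ℝ) {l : ℕ} (hl : l ≤ k + 1)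
    (z : Fin (k + 1) → E) :
    levelAvg2 γ m μ V l (fun σ τ => a * f σ τ + a' * g σ τ) z =
      a * levelAvg2 γ m μ V l f z + a' * levelAvg2 γ m μ V l g z := by
  have h1 : ∀ σ, levelAvg γ m μ V l (fun τ => a * f σ τ + a' * g σ τ) z =
      a * levelAvg γ m μ V l (f σ) z + a' * levelAvg γ m μ V l (g σ) z := fun σ =>
    levelAvg_lin hγ hB hm hV hA (hf.comp (measurable_prodMk_left (x := σ)))
      (hg.comp (measurable_prodMk_left (x := σ))) (hc σ) (hc' σ) a a' l z
  simp only [levelAvg2, h1]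
  exact levelAvg_lin hγ hB hm hV hA
    ((measurable_levelAvg_left hV hf l).comp (measurable_prodMk_right (y := z)))
    ((measurable_levelAvg_left hV hg l).comp (measurable_prodMk_right (y := z)))
    (fun σ => abs_levelAvg_le hγ hB hm hV hA (hc σ) hl z)
    (fun σ => abs_levelAvg_le hγ hB hm hV hA (hc' σ) hl z) a a' l z

omit hγ hB hm hA in
omit [NeZero μ] [BorelSpace E] [SecondCountableTopology E] in
theorem measurable_levelAvg_swap {f : X → X → ℝ} (hf : Measurable (Function.uncurry f)) (l : ℕ) :
    Measurable (Function.uncurry fun (z : Fin (k + 1) → E) σ => levelAvg γ m μ V l (f σ) z) := by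
  have := (measurable_levelAvg_left (γ := γ) (m := m) (μ := μ) hV hf l).comp
    (measurable_swap (α := Fin (k + 1) → E) (β := X))
  exact this

omit hγ hB hm hA in
omit [NeZero μ] [BorelSpace E] [SecondCountableTopology E] in
theorem measurable_gibbs_levelAvg {f : X → X → ℝ} (hf : Measurable (Function.uncurry f)) (l : ℕ) :
    Measurable fun z => gibbs μ V (fun σ => levelAvg γ m μ V l (f σ) z) z := by
  have := @measurable_gibbs_const X _ μ _ (Fin (k + 1) → E) _ V hV.meas (Fin (k + 1) → E) _
    (fun z σ => levelAvg γ m μ V l (f σ) z) (measurable_levelAvg_swap hV hf l)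
  exact this.comp (f := fun z => (z, z)) (by fun_prop)

/-- The second copy of the weighted Gibbs measure can be averaged at level `l`. -/
theorem integral_rho_mul_levelAvg {f : X → X → ℝ} (hf : Measurable (Function.uncurry f)) {c : ℝ}
    (hc : ∀ σ τ, |f σ τ| ≤ c) {l : ℕ} (hl : l ∈ Finset.Icc 1 (k + 1)) :
    ∫ z, ∫ σ, levelAvg γ m μ V l (f σ) z * rho γ m μ V σ z ∂μ ∂(Measure.pi γ) =
      ∫ z, (∏ j ∈ Finset.Ico 1 l, parisiW γ m (logZ μ V) j z) * levelAvg2 γ m μ V l f z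
        ∂(Measure.pi γ) := by
  have hl' := (Finset.mem_Icc.1 hl).2
  have hdiag := measurable_gibbs_levelAvg (γ := γ) (m := m) (μ := μ) hV hf l
  -- Once averaged by `γ_l`, the second configuration depends on the variables below `l` only. It is
  -- therefore frozen when the weights from level `l` on act on the first configuration, and these
  -- turn the first average into `γ_l` too.
  have hd : ∀ w, DependsBelow l fun z => gibbs μ V (fun σ => levelAvg γ m μ V l (f σ) z) w := by
    intro w z z'
    have : (fun σ => levelAvg γ m μ V l (f σ) (merge l z z')) =
        fun σ => levelAvg γ m μ V l (f σ) z :=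
      funext fun σ => dependsBelow_parisiAvg γ m _ l _ z z'
    simp only [this]
  have key := integral_prod_parisiW_mul hγ hB hm (hV.isLip_logZ hA)
    (f := fun z w => gibbs μ V (fun σ => levelAvg γ m μ V l (f σ) z) w) (K := c)
    (expBounded_of_le fun z => hV.abs_gibbs_le hA
      (ae_of_all _ fun σ => abs_levelAvg_le hγ hB hm hV hA (hc σ) hl' z) z) hdiag hl hd
  have h1 : ∀ z, ∫ σ, levelAvg γ m μ V l (f σ) z * rho γ m μ V σ z ∂μ =
      (∏ j ∈ Finset.Icc 1 k, parisiW γ m (logZ μ V) j z) *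
        gibbs μ V (fun σ => levelAvg γ m μ V l (f σ) z) z :=
    fun z => (prod_parisiW_mul_gibbs (μ := μ) (V := V) (γ := γ) (m := m) _ z).symm
  rw [integral_congr_ae (ae_of_all _ h1)]
  exact key

omit [IsFiniteMeasure μ] in
theorem integrable_prod_Ico_mul {g : (Fin (k + 1) → E) → ℝ} (hg : Measurable g) {c : ℝ}
    (hc : ∀ z, |g z| ≤ c) {l : ℕ} (hl : l ≤ k + 1) :
    Integrable (fun z => (∏ j ∈ Finset.Ico 1 l, parisiW γ m (logZ μ V) j z) * g z)
      (Measure.pi γ) := by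
  have := integrable_prod_parisiW_mul (γ := γ) (m := m) hγ hB hm (hV.isLip_logZ hA)
    (expBounded_of_le hc) hg (s := Finset.Ico 1 l)
    (fun j hj => by simp only [Finset.mem_Ico, Finset.mem_range] at *; omega) 0 0
  simpa only [merge_zero] using this

omit [IsFiniteMeasure μ] in
theorem abs_integral_prod_Ico_mul_le {g : (Fin (k + 1) → E) → ℝ} {c : ℝ}
    (hc : ∀ z, |g z| ≤ c) {l : ℕ} (hl : l ∈ Finset.Icc 1 (k + 1)) :
    |∫ z, (∏ j ∈ Finset.Ico 1 l, parisiW γ m (logZ μ V) j z) * g z ∂(Measure.pi γ)| ≤ c := by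
  have h1 := integral_prod_parisiW_Ico (γ := γ) hγ hB hm (hV.isLip_logZ hA) hl
  have h2 := integrable_prod_Ico_mul hγ hB hm hV hA (g := fun _ => c) measurable_const
    (c := |c|) (fun _ => le_rfl) (Finset.mem_Icc.1 hl).2
  have h3 : ∫ z, (∏ j ∈ Finset.Ico 1 l, parisiW γ m (logZ μ V) j z) * c ∂(Measure.pi γ) = c := by
    rw [integral_mul_const, h1, one_mul]
  rw [← h3, ← Real.norm_eq_abs]
  refine norm_integral_le_of_norm_le h2 (ae_of_all _ fun z => ?_)
  have hp : 0 ≤ ∏ j ∈ Finset.Ico 1 l, parisiW γ m (logZ μ V) j z :=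
    Finset.prod_nonneg fun _ _ => (parisiW_pos _ _ _).le
  rw [Real.norm_eq_abs, abs_mul, abs_of_nonneg hp]
  exact mul_le_mul_of_nonneg_left (hc z) hp

end Avg2


/-! ### Gaussian processes with bounded covariance -/

section BddCov

variable {Ω T : Type*} [MeasurableSpace Ω] [MeasurableSpace T] {P : Measure Ω}
  [IsProbabilityMeasure P] {μ : Measure T} [IsFiniteMeasure μ] {H : T → Ω → ℝ}

/-- A jointly measurable centered Gaussian process with covariance bounded by `v`. -/
structure IsBddGaussian (P : Measure Ω) (H : T → Ω → ℝ) (v : ℝ) : Prop where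
  meas : Measurable fun x : T × Ω => H x.1 x.2
  gaussian : IsGaussianProcess H P
  centered : ∀ σ, ∫ ω, H σ ω ∂P = 0
  bdd : ∀ σ τ, |cov2 P H σ τ| ≤ v

variable {v : ℝ}

omit [IsProbabilityMeasure P] in
theorem IsBddGaussian.measurable_apply (h : IsBddGaussian P H v) (σ : T) : Measurable (H σ) :=
  h.meas.comp (measurable_prodMk_left (x := σ))

omit [IsProbabilityMeasure P] in
theorem IsBddGaussian.measurable_path (h : IsBddGaussian P H v) (ω : Ω) :
    Measurable fun σ => H σ ω :=
  h.meas.comp (measurable_prodMk_right (y := ω))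

theorem exp_mul_abs_le (K x : ℝ) :
    Real.exp (K * |x|) ≤ Real.exp (K * x) + Real.exp (-K * x) := by
  rcases abs_cases x with ⟨h, -⟩ | ⟨h, -⟩ <;> rw [h]
  · linarith [Real.exp_pos (-K * x)]
  · rw [show K * -x = -K * x by ring]; linarith [Real.exp_pos (K * x)]

omit [IsProbabilityMeasure P] in
-- The variances are at most `v`, so the exponential moments are bounded uniformly over the index
-- set and remain integrable over a finite measure on it.
theorem IsBddGaussian.exp_moment (h : IsBddGaussian P H v) (K : ℝ) (σ : T) :
    Integrable (fun ω => Real.exp (K * |H σ ω|)) P ∧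
      ∫ ω, Real.exp (K * |H σ ω|) ∂P ≤ 2 * Real.exp (v * K ^ 2 / 2) := by
  have hmap := map_eq_gaussianReal h.gaussian h.centered σ
  have hm := h.measurable_apply σ
  have hi : ∀ K, Integrable (fun ω => Real.exp (K * H σ ω)) P := fun K => by
    have := integrable_exp_mul_gaussianReal (μ := 0) (v := (cov2 P H σ σ).toNNReal) K
    rw [← hmap] at this
    exact this.comp_measurable hm
  have he : ∀ K, ∫ ω, Real.exp (K * H σ ω) ∂P ≤ Real.exp (v * K ^ 2 / 2) := fun K => by
    have := mgf_gaussianReal hmap K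
    rw [mgf] at this
    rw [this, Real.coe_toNNReal _ (cov2_self_nonneg σ), Real.exp_le_exp]
    have := (le_abs_self _).trans (h.bdd σ σ)
    nlinarith [sq_nonneg K]
  have hb := (hi K).add (hi (-K))
  have hle : ∀ ω, Real.exp (K * |H σ ω|) ≤ Real.exp (K * H σ ω) + Real.exp (-K * H σ ω) :=
    fun ω => exp_mul_abs_le _ _
  have h1 : Integrable (fun ω => Real.exp (K * |H σ ω|)) P :=
    hb.mono' (by fun_prop) (ae_of_all _ fun ω => by
      rw [Real.norm_eq_abs, Real.abs_exp]; exact hle ω)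
  refine ⟨h1, (integral_mono h1 hb hle).trans ?_⟩
  have h2 := he K
  have h3 := he (-K)
  rw [neg_sq] at h3
  have : ∫ ω, ((fun ω => Real.exp (K * H σ ω)) + fun ω => Real.exp (-K * H σ ω)) ω ∂P =
      ∫ ω, Real.exp (K * H σ ω) ∂P + ∫ ω, Real.exp (-K * H σ ω) ∂P :=
    integral_add (hi K) (hi (-K))
  rw [this]; linarith

theorem IsBddGaussian.integrable_exp_prod (h : IsBddGaussian P H v) (K : ℝ) :
    Integrable (fun x : T × Ω => Real.exp (K * |H x.1 x.2|)) (μ.prod P) := by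
  have hm : Measurable fun x : T × Ω => Real.exp (K * |H x.1 x.2|) := by
    have := h.meas; fun_prop
  refine (integrable_prod_iff hm.aestronglyMeasurable).2
    ⟨ae_of_all _ fun σ => (h.exp_moment K σ).1, ?_⟩
  refine Integrable.mono' (integrable_const (2 * Real.exp (v * K ^ 2 / 2)))
    (hm.norm.stronglyMeasurable.integral_prod_right' (ν := P)).aestronglyMeasurable
    (ae_of_all _ fun σ => ?_)
  simp only [Real.norm_eq_abs, Real.abs_exp]
  rw [abs_of_nonneg (integral_nonneg fun _ => (Real.exp_pos _).le)]
  exact (h.exp_moment K σ).2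

theorem IsBddGaussian.integrable_integral_exp (h : IsBddGaussian P H v) (K : ℝ) :
    Integrable (fun ω => ∫ σ, Real.exp (K * |H σ ω|) ∂μ) P :=
  (h.integrable_exp_prod (μ := μ) K).integral_prod_right

/-- Fubini gives finite exponential moments of almost every path for each natural rate; countably
many rates share one null set and dominate all real ones. This is the only regularity of paths that
is used. -/
theorem IsBddGaussian.ae_isExpWeight (h : IsBddGaussian P H v) :
    ∀ᵐ ω ∂P, IsExpWeight μ fun σ => |H σ ω| := by
  have : ∀ n : ℕ, ∀ᵐ ω ∂P, Integrable (fun σ => Real.exp (n * |H σ ω|)) μ := fun n =>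
    (h.integrable_exp_prod (μ := μ) n).prod_left_ae
  filter_upwards [ae_all_iff.2 this] with ω hω
  have hm : Measurable fun σ => |H σ ω| := (h.measurable_path ω).abs
  refine ⟨hm, fun _ => abs_nonneg _, fun K => ?_⟩
  obtain ⟨n, hn⟩ := exists_nat_ge K
  refine (hω n).mono' (hm.const_mul K).exp.aestronglyMeasurable (ae_of_all _ fun σ => ?_)
  rw [Real.norm_eq_abs, Real.abs_exp, Real.exp_le_exp]
  exact mul_le_mul_of_nonneg_right hn (abs_nonneg _)

/-- The Cauchy–Schwarz inequality against `1`, from the nonnegativity of the variance around the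
mean `J / r`. -/
theorem integral_sq_le_mul {f : T → ℝ} (hf : Integrable f μ)
    (hf2 : Integrable (fun σ => f σ ^ 2) μ) :
    (∫ σ, f σ ∂μ) ^ 2 ≤ μ.real Set.univ * ∫ σ, f σ ^ 2 ∂μ := by
  set r := μ.real Set.univ with hr
  rcases (measureReal_nonneg (μ := μ) (s := Set.univ)).eq_or_lt with h0 | h0
  · have : μ = 0 := by
      rw [measureReal_def, eq_comm, ENNReal.toReal_eq_zero_iff] at h0
      simpa using h0
    simp [this]
  · set J := ∫ σ, f σ ∂μ
    have h1 : 0 ≤ ∫ σ, (f σ - J / r) ^ 2 ∂μ := integral_nonneg fun _ => sq_nonneg _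
    have h2 : ∫ σ, (f σ - J / r) ^ 2 ∂μ = ∫ σ, f σ ^ 2 ∂μ - J ^ 2 / r := by
      have : ∀ σ, (f σ - J / r) ^ 2 = f σ ^ 2 - (2 * (J / r) * f σ - (J / r) ^ 2) :=
        fun σ => by ring
      simp only [this]
      have hi : Integrable (fun σ => 2 * (J / r) * f σ - (J / r) ^ 2) μ :=
        (hf.const_mul _).sub (integrable_const _)
      rw [integral_sub hf2 hi,
        integral_sub (hf.const_mul _) (integrable_const _), integral_const_mul, integral_const,
        ← hr, smul_eq_mul]
      have : r ≠ 0 := h0.ne'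
      field_simp
      ring
    rw [h2, sub_nonneg, div_le_iff₀ h0] at h1
    linarith

/-- Two uses of Cauchy–Schwarz: `r² ≤ (∫ exp A)(∫ exp (-A))` moves the reciprocal to a positive
exponential, and `(∫ exp A)² ≤ r ∫ exp (2 A)`. The square of the inverse mass thereby becomes
integrable over the disorder. -/
theorem invMass_sq_le [NeZero μ] {A : T → ℝ} (hA : IsExpWeight μ A) :
    invMass μ A ^ 2 ≤ (μ.real Set.univ)⁻¹ ^ 3 * ∫ σ, Real.exp (2 * A σ) ∂μ := by
  set r := μ.real Set.univ with hr
  have hr0 : 0 < r := by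
    rw [hr, measureReal_def, ENNReal.toReal_pos_iff]
    exact ⟨by simpa [pos_iff_ne_zero] using NeZero.ne μ, measure_lt_top _ _⟩
  have hX := integral_exp_pos hA.integrable_neg
  set X := ∫ σ, Real.exp (-A σ) ∂μ with hXd
  have hJ := integral_exp_pos hA.integrable_one
  set J := ∫ σ, Real.exp (A σ) ∂μ with hJd
  have h1 : r ^ 2 ≤ J * X := by
    -- The coefficients are such that the two summands have product one, hence sum at least two, and
    -- such that the second one integrates to `r`.
    have h2 : ∫ σ, (2 : ℝ) ∂μ ≤ ∫ σ, (J / r * Real.exp (-A σ) + r / J * Real.exp (A σ)) ∂μ := by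
      refine integral_mono (integrable_const _)
        ((hA.integrable_neg.const_mul _).add (hA.integrable_one.const_mul _)) fun σ => ?_
      have e1 : Real.exp (-A σ) * Real.exp (A σ) = 1 := by rw [← Real.exp_add]; simp
      have e2 : (J / r * Real.exp (-A σ)) * (r / J * Real.exp (A σ)) = 1 := by
        rw [mul_mul_mul_comm, e1]; field_simp
      have e3 : 0 < J / r * Real.exp (-A σ) := by positivity
      have e4 : 0 < r / J * Real.exp (A σ) := by positivity
      simp only
      nlinarith [sq_nonneg (J / r * Real.exp (-A σ) - r / J * Real.exp (A σ))]
    rw [integral_add (hA.integrable_neg.const_mul _) (hA.integrable_one.const_mul _),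
      integral_const_mul, integral_const_mul, integral_const, ← hr, smul_eq_mul, ← hXd, ← hJd,
      div_mul_cancel₀ _ hJ.ne'] at h2
    have h3 : r ≤ J / r * X := by linarith
    have : r * r ≤ (J / r * X) * r := mul_le_mul_of_nonneg_right h3 hr0.le
    have e : (J / r * X) * r = J * X := by field_simp
    nlinarith
  have h4 : J ^ 2 ≤ r * ∫ σ, Real.exp (2 * A σ) ∂μ := by
    have e : ∀ σ, Real.exp (A σ) ^ 2 = Real.exp (2 * A σ) := fun σ => by
      rw [← Real.exp_nat_mul]; norm_num
    have := integral_sq_le_mul (μ := μ) (f := fun σ => Real.exp (A σ)) hA.integrable_one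
      (by simpa only [e] using hA.integrable 2)
    simpa only [e] using this
  have h5 : invMass μ A ≤ J / r ^ 2 := by
    rw [invMass, le_div_iff₀ (by positivity), inv_mul_le_iff₀ hX]
    linarith
  calc invMass μ A ^ 2 ≤ (J / r ^ 2) ^ 2 := pow_le_pow_left₀ invMass_nonneg h5 2
    _ = J ^ 2 * r⁻¹ ^ 4 := by field_simp
    _ ≤ (r * ∫ σ, Real.exp (2 * A σ) ∂μ) * r⁻¹ ^ 4 :=
      mul_le_mul_of_nonneg_right h4 (by positivity)
    _ = _ := by field_simp

omit [IsProbabilityMeasure P] in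
theorem IsBddGaussian.measurable_invMass (h : IsBddGaussian P H v) :
    Measurable fun ω => invMass μ fun σ => |H σ ω| := by
  have hm : Measurable fun x : Ω × T => Real.exp (-|H x.2 x.1|) :=
    (h.meas.comp measurable_swap).abs.neg.exp
  exact (hm.stronglyMeasurable.integral_prod_right' (ν := μ)).measurable.inv

theorem IsBddGaussian.integrable_invMass_sq [NeZero μ] (h : IsBddGaussian P H v) :
    Integrable (fun ω => invMass μ (fun σ => |H σ ω|) ^ 2) P := by
  refine ((h.integrable_integral_exp (μ := μ) 2).const_mul ((μ.real Set.univ)⁻¹ ^ 3)).mono'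
    (h.measurable_invMass.pow_const 2).aestronglyMeasurable ?_
  filter_upwards [h.ae_isExpWeight (μ := μ)] with ω hω
  rw [Real.norm_eq_abs, abs_of_nonneg (sq_nonneg _)]
  exact invMass_sq_le hω

end BddCov


/-! ### Integration by parts for the Hamiltonian -/

section Map

variable {X Y Z E : Type*} [MeasurableSpace X] [MeasurableSpace Y] [MeasurableSpace E]
  {μ : Measure X} {g : X → Y} {k : ℕ} {γ : Fin (k + 1) → Measure E} {m : ℕ → ℝ}

/-- The quantities attached to `μ` are rewritten through an image measure. For the image under `τ ↦
(τ, residual τ)` this shows that they depend on the residual process through its occupation measure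
only. -/
theorem logZ_map (hg : Measurable g) {W : Y → Z → ℝ} (hW : ∀ z, Measurable fun y => W y z) :
    logZ (μ.map g) W = logZ μ fun x => W (g x) := by
  funext z
  rw [logZ, logZ, integral_map hg.aemeasurable (hW z).exp.aestronglyMeasurable]

theorem gibbs_map (hg : Measurable g) {W : Y → Z → ℝ} (hW : ∀ z, Measurable fun y => W y z)
    {f : Y → ℝ} (hf : Measurable f) :
    gibbs (μ.map g) W f = gibbs μ (fun x => W (g x)) fun x => f (g x) := by
  funext z
  have : Measurable fun y => f y * Real.exp (W y z) := hf.mul (hW z).exp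
  rw [gibbs, gibbs, logZ_map hg hW, integral_map hg.aemeasurable this.aestronglyMeasurable]

theorem levelAvg_map (hg : Measurable g) {W : Y → (Fin (k + 1) → E) → ℝ}
    (hW : ∀ z, Measurable fun y => W y z) {f : Y → ℝ} (hf : Measurable f) (l : ℕ) :
    levelAvg γ m (μ.map g) W l f = levelAvg γ m μ (fun x => W (g x)) l fun x => f (g x) := by
  funext z
  rw [levelAvg, levelAvg, logZ_map hg hW, gibbs_map hg hW hf]

theorem rho_map (hg : Measurable g) {W : Y → (Fin (k + 1) → E) → ℝ}
    (hW : ∀ z, Measurable fun y => W y z) (x : X) :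
    rho γ m (μ.map g) W (g x) = rho γ m μ (fun x => W (g x)) x := by
  funext z
  rw [rho, rho, logZ_map hg hW]

theorem gibbs_const_mul {W : X → Z → ℝ} {f : X → ℝ} (a : ℝ) (z : Z) :
    gibbs μ W (fun x => a * f x) z = a * gibbs μ W f z := by
  simp only [gibbs, mul_assoc, integral_const_mul, mul_div_assoc]

theorem levelAvg_const_mul {W : X → (Fin (k + 1) → E) → ℝ} {f : X → ℝ} (a : ℝ) (l : ℕ)
    (z : Fin (k + 1) → E) :
    levelAvg γ m μ W l (fun x => a * f x) z = a * levelAvg γ m μ W l f z := by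
  have : gibbs μ W (fun x => a * f x) = fun w => a * gibbs μ W f w :=
    funext fun w => gibbs_const_mul a w
  rw [levelAvg, this, parisiAvg_const_mul, levelAvg]

/-- The logarithmic derivative of the density `rho` at `σ` in the direction `f`:
`f σ - ∑_j (m_j - m_{j-1}) γ_j (f)`. -/
noncomputable def drift (γ : Fin (k + 1) → Measure E) (m : ℕ → ℝ) (μ : Measure X)
    (V : X → (Fin (k + 1) → E) → ℝ) (f : X → ℝ) (σ : X) (z : Fin (k + 1) → E) : ℝ :=
  f σ - ∑ j ∈ Finset.Icc 1 k, (m j - m (j - 1)) * levelAvg γ m μ V j f z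

theorem drift_const_mul {W : X → (Fin (k + 1) → E) → ℝ} {f : X → ℝ} (a : ℝ) (σ : X)
    (z : Fin (k + 1) → E) :
    drift γ m μ W (fun x => a * f x) σ z = a * drift γ m μ W f σ z := by
  simp only [drift, levelAvg_const_mul, mul_sub, Finset.mul_sum, mul_left_comm]

theorem drift_map (hg : Measurable g) {W : Y → (Fin (k + 1) → E) → ℝ}
    (hW : ∀ z, Measurable fun y => W y z) {f : Y → ℝ} (hf : Measurable f) (x : X) :
    drift γ m (μ.map g) W f (g x) = drift γ m μ (fun x => W (g x)) (fun x => f (g x)) x := by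
  funext z
  simp only [drift, levelAvg_map hg hW hf]

end Map

section Drift

variable {X E : Type*} [MeasurableSpace X] [NormedAddCommGroup E] [MeasurableSpace E]
  [BorelSpace E] [SecondCountableTopology E] {μ : Measure X} [NeZero μ] {k : ℕ}
  {γ : Fin (k + 1) → Measure E} [∀ p, IsProbabilityMeasure (γ p)] {m : ℕ → ℝ} {B : ℝ}
  {A : X → ℝ} {V : X → (Fin (k + 1) → E) → ℝ}

/-- A bound for the size of the drift of functions bounded by one. -/
noncomputable def driftBound (m : ℕ → ℝ) (k : ℕ) : ℝ :=
  1 + ∑ j ∈ Finset.Icc 1 k, |m j - m (j - 1)|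

theorem driftBound_nonneg : 0 ≤ driftBound m k :=
  add_nonneg zero_le_one (Finset.sum_nonneg fun _ _ => abs_nonneg _)

theorem abs_drift_le (hγ : HasExpMoments γ) (hB : 0 ≤ B) (hm : ∀ l ≤ k, 0 ≤ m l)
    (hV : IsHam B A V) (hA : IsExpWeight μ A) {f : X → ℝ} {c : ℝ} (hc : ∀ σ, |f σ| ≤ c) (σ : X)
    (z : Fin (k + 1) → E) : |drift γ m μ V f σ z| ≤ c * driftBound m k := by
  rw [driftBound, mul_add, mul_one, Finset.mul_sum, drift]
  refine (abs_sub _ _).trans (add_le_add (hc σ) ((Finset.abs_sum_le_sum_abs _ _).trans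
    (Finset.sum_le_sum fun j hj => ?_)))
  rw [abs_mul, mul_comm]
  exact mul_le_mul_of_nonneg_right (abs_levelAvg_le hγ hB hm hV hA hc
    ((Finset.mem_Icc.1 hj).2.trans (Nat.le_succ k)) z) (abs_nonneg _)

omit [NormedAddCommGroup E] [BorelSpace E] [SecondCountableTopology E] [NeZero μ] in
theorem measurable_drift_kernel {α : Type*} [MeasurableSpace α] (κ : Kernel α X)
    [IsSFiniteKernel κ] {V : α → X → (Fin (k + 1) → E) → ℝ}
    (hV : Measurable fun x : (α × (Fin (k + 1) → E)) × X => V x.1.1 x.2 x.1.2)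
    {f : α → X → ℝ} (hf : Measurable (Function.uncurry f)) :
    Measurable fun x : (α × (Fin (k + 1) → E)) × X =>
      drift γ m (κ x.1.1) (V x.1.1) (f x.1.1) x.2 x.1.2 := by
  refine (hf.comp (f := fun x : (α × (Fin (k + 1) → E)) × X => (x.1.1, x.2))
    (by fun_prop)).sub (Finset.measurable_fun_sum _ fun j _ => Measurable.const_mul ?_ _)
  exact (measurable_levelAvg_kernel κ hV hf j).comp measurable_fst

end Drift

/-! ### Integration by parts in the Hamiltonian at a fixed configuration -/

section Field

variable {Ω T : Type*} [MeasurableSpace Ω] [MeasurableSpace T] {P : Measure Ω}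
  [IsProbabilityMeasure P] {μ : Measure T} [IsFiniteMeasure μ] {H : T → Ω → ℝ} {v : ℝ}
  {E : Type*} [NormedAddCommGroup E] [MeasurableSpace E] [BorelSpace E]
  [SecondCountableTopology E] {k : ℕ}
  {γ : Fin (k + 1) → Measure E} [∀ p, IsProbabilityMeasure (γ p)] {m : ℕ → ℝ} {B s : ℝ}
  {L : T → (Fin (k + 1) → E) → ℝ}

/-- An external field: measurable, Lipschitz in `z` and zero at `z = 0`. -/
structure IsField (B : ℝ) (L : T → (Fin (k + 1) → E) → ℝ) : Prop where
  meas : Measurable (Function.uncurry L)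
  lip : ∀ σ, IsLip B (L σ)
  zero : ∀ σ, L σ 0 = 0

/-- The Hamiltonian `s H + L`. -/
def ham (H : T → Ω → ℝ) (s : ℝ) (L : T → (Fin (k + 1) → E) → ℝ) (ω : Ω) (σ : T)
    (z : Fin (k + 1) → E) : ℝ := s * H σ ω + L σ z

omit [IsProbabilityMeasure P] [BorelSpace E] [SecondCountableTopology E] in
theorem IsField.measurable_ham (hL : IsField B L) (h : IsBddGaussian P H v) :
    Measurable fun x : (Ω × (Fin (k + 1) → E)) × T => ham H s L x.1.1 x.2 x.1.2 :=
  ((h.meas.comp (f := fun x : (Ω × (Fin (k + 1) → E)) × T => (x.2, x.1.1))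
    (by fun_prop)).const_mul s).add
    (hL.meas.comp (f := fun x : (Ω × (Fin (k + 1) → E)) × T => (x.2, x.1.2)) (by fun_prop))

omit [IsProbabilityMeasure P] [BorelSpace E] [SecondCountableTopology E] in
theorem IsField.isHam (hL : IsField B L) (h : IsBddGaussian P H v) (hs : |s| ≤ 1) (ω : Ω) :
    IsHam B (fun σ => |H σ ω|) (ham H s L ω) where
  meas := (hL.measurable_ham h).comp
    (f := fun x : T × (Fin (k + 1) → E) => ((ω, x.2), x.1)) (by fun_prop)
  lip σ z z' := by simpa [ham] using hL.lip σ z z'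
  bdd σ := by
    rw [ham, hL.zero, add_zero, abs_mul]
    exact mul_le_of_le_one_left (abs_nonneg _) hs

omit [IsProbabilityMeasure P] [BorelSpace E] [SecondCountableTopology E] in
theorem IsField.measurable_rho (hL : IsField B L) (h : IsBddGaussian P H v) :
    Measurable fun x : (Ω × (Fin (k + 1) → E)) × T =>
      rho γ m μ (ham H s L x.1.1) x.2 x.1.2 :=
  SpinGlass.measurable_rho (Kernel.const Ω μ) (hL.measurable_ham h)

/-- The random factor in the bound on the density. -/
noncomputable def rhoBound (μ : Measure T) (H : T → Ω → ℝ) (σ : T) (ω : Ω) : ℝ :=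
  Real.exp (4 * |H σ ω|) + invMass μ (fun τ => |H τ ω|) ^ 2

theorem IsBddGaussian.integrable_rhoBound [NeZero μ] (h : IsBddGaussian P H v) (σ : T) :
    Integrable (rhoBound μ H σ) P :=
  (h.exp_moment 4 σ).1.add h.integrable_invMass_sq

theorem IsBddGaussian.integrable_rhoBound_prod [NeZero μ] (h : IsBddGaussian P H v) :
    Integrable (fun x : T × Ω => rhoBound μ H x.1 x.2) (μ.prod P) :=
  (h.integrable_exp_prod 4).add (h.integrable_invMass_sq.comp_snd μ)

omit [IsFiniteMeasure μ] [IsProbabilityMeasure P] in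
-- The product of `exp (2 |H σ|)` and the inverse mass is split by `x y ≤ x² + y²` into two
-- integrable terms. The rate does not depend on `s`, `L` or `ω`, which permits domination uniformly
-- in `t`.
theorem exists_ham_rho_le (μ : Measure T) [NeZero μ] (hγ : HasExpMoments γ) (hB : 0 ≤ B)
    (hm : ∀ l ≤ k, 0 ≤ m l) (h : IsBddGaussian P H v) :
    ∃ K, 0 ≤ K ∧ ∀ s L, |s| ≤ 1 → IsField B L → ∀ ω, IsExpWeight μ (fun σ => |H σ ω|) →
      ∀ σ z, Real.exp |H σ ω| * rho γ m μ (ham H s L ω) σ z ≤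
        Real.exp (K * (1 + ‖z‖)) * rhoBound μ H σ ω := by
  obtain ⟨K, hK, hle⟩ := exists_rho_le (γ := γ) T hγ hB hm
  refine ⟨K, hK, fun s L hs hL ω hω σ z => ?_⟩
  have h1 := hle μ _ _ (hL.isHam h hs ω) hω σ z
  set I := invMass μ fun σ => |H σ ω|
  refine (mul_le_mul_of_nonneg_left h1 (Real.exp_pos _).le).trans ?_
  rw [mul_left_comm]
  refine mul_le_mul_of_nonneg_left ?_ (Real.exp_pos _).le
  have e : Real.exp (4 * |H σ ω|) = (Real.exp |H σ ω| * Real.exp |H σ ω|) ^ 2 := by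
    rw [← Real.exp_add, ← Real.exp_nat_mul]; congr 1; push_cast; ring
  rw [rhoBound, e]
  nlinarith [sq_nonneg (Real.exp |H σ ω| * Real.exp |H σ ω| - I),
    sq_nonneg (Real.exp |H σ ω| * Real.exp |H σ ω|), sq_nonneg I]

variable [NeZero μ] (hγ : HasExpMoments γ) (hB : 0 ≤ B) (hm : ∀ l ≤ k, 0 ≤ m l)
  (h : IsBddGaussian P H v) (hL : IsField B L) (hs : |s| ≤ 1)

include hγ hB hm h hL hs

theorem integrable_mul_rho {f : Ω → ℝ} (hf : Measurable f) {c : ℝ} {σ : T}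
    (hc : ∀ᵐ ω ∂P, |f ω| ≤ c * Real.exp |H σ ω|) (z : Fin (k + 1) → E) :
    Integrable (fun ω => f ω * rho γ m μ (ham H s L ω) σ z) P := by
  obtain ⟨K, -, hK⟩ := exists_ham_rho_le (γ := γ) μ hγ hB hm h
  have hmeas : Measurable fun ω => rho γ m μ (ham H s L ω) σ z :=
    (hL.measurable_rho (γ := γ) (m := m) (μ := μ) (s := s) h).comp
      (f := fun ω => ((ω, z), σ)) (by fun_prop)
  refine ((h.integrable_rhoBound (μ := μ) σ).const_mul (|c| * Real.exp (K * (1 + ‖z‖)))).mono'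
    (hf.mul hmeas).aestronglyMeasurable ?_
  filter_upwards [hc, h.ae_isExpWeight (μ := μ)] with ω h1 h2
  have hr := (rho_pos (γ := γ) (m := m) (μ := μ) (V := ham H s L ω) σ z).le
  rw [Real.norm_eq_abs, abs_mul, abs_of_nonneg hr, mul_assoc]
  calc |f ω| * rho γ m μ (ham H s L ω) σ z
      ≤ (|c| * Real.exp |H σ ω|) * rho γ m μ (ham H s L ω) σ z :=
        mul_le_mul_of_nonneg_right (h1.trans (mul_le_mul_of_nonneg_right (le_abs_self _)
          (Real.exp_pos _).le)) hr
    _ ≤ _ := by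
        rw [mul_assoc]
        exact mul_le_mul_of_nonneg_left (hK s L hs hL ω h2 σ z) (abs_nonneg _)

omit [NeZero μ] hγ hB hm hL hs [NormedAddCommGroup E] [BorelSpace E] [SecondCountableTopology E]
  [∀ p, IsProbabilityMeasure (γ p)] [IsFiniteMeasure μ] in
theorem IsBddGaussian.measurable_cov2 : Measurable (Function.uncurry (cov2 P H)) := by
  have : Measurable fun x : (T × T) × Ω => H x.1.1 x.2 * H x.1.2 x.2 :=
    (h.meas.comp (f := fun x : (T × T) × Ω => (x.1.1, x.2)) (by fun_prop)).mul
      (h.meas.comp (f := fun x : (T × T) × Ω => (x.1.2, x.2)) (by fun_prop))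
  exact (this.stronglyMeasurable.integral_prod_right' (ν := P)).measurable

/-- Gaussian integration by parts for the density at a fixed configuration. -/
theorem integral_process_mul_rho (hm0 : m 0 = 0) (hmk : m k = 1) (σ : T)
    (z : Fin (k + 1) → E) :
    ∫ ω, H σ ω * rho γ m μ (ham H s L ω) σ z ∂P =
      s * ∫ ω, rho γ m μ (ham H s L ω) σ z * drift γ m μ (ham H s L ω) (cov2 P H σ) σ z ∂P := by
  set C := cov2 P H σ with hC
  have hCm : Measurable C := h.measurable_cov2.comp (measurable_prodMk_left (x := σ))
  -- The regression coefficients: `H τ = b τ * H σ + residual τ`.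
  set b : T → ℝ := fun τ => C τ / C σ with hb
  have hbm : Measurable b := hCm.div_const _
  have hbc : ∀ τ, |b τ| ≤ v / |C σ| := fun τ => by
    rw [hb, abs_div]
    exact div_le_div_of_nonneg_right (h.bdd σ τ) (abs_nonneg _)
  have hbC : ∀ τ, C σ * (s * b τ) = s * C τ := fun τ => by
    have := cov2_div_mul_self h.gaussian σ τ
    simp only [hb, hC]; linear_combination s * this
  have hG : Measurable fun x : T × Ω => residual P H σ x.1 x.2 :=
    h.meas.sub ((hbm.comp measurable_fst).mul ((h.measurable_apply σ).comp measurable_snd))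
  -- A point of `T × ℝ` is a configuration together with its residual. Along the graph of the
  -- residual, `W₀` shifted by `y b'` is `s (y b + residual) + L`; for `y = H σ ω` this is the
  -- original Hamiltonian (`hWg`).
  set W₀ : T × ℝ → (Fin (k + 1) → E) → ℝ := fun x z => s * x.2 + L x.1 z with hW₀
  set b' : T × ℝ → ℝ := fun x => s * b x.1 with hb'
  have hb'm : Measurable b' := (hbm.comp measurable_fst).const_mul s
  have hb'c : ∀ x, |b' x| ≤ v / |C σ| := fun x => by
    rw [hb', abs_mul]
    exact (mul_le_of_le_one_left (abs_nonneg _) hs).trans (hbc _)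
  have hW₀m : Measurable (Function.uncurry W₀) := by
    have := hL.meas.comp (f := fun x : (T × ℝ) × (Fin (k + 1) → E) => (x.1.1, x.2))
      (by fun_prop)
    exact ((measurable_snd.comp measurable_fst).const_mul s).add this
  have hWm : Measurable fun x : ((ℝ × BddMeasure (T × ℝ) (μ Set.univ)) × (Fin (k + 1) → E)) ×
      (T × ℝ) => shift W₀ b' x.1.1.1 x.2 x.1.2 :=
    (hW₀m.comp (f := fun x : ((ℝ × BddMeasure (T × ℝ) (μ Set.univ)) × (Fin (k + 1) → E)) ×
      (T × ℝ) => (x.2, x.1.2)) (by fun_prop)).add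
      ((measurable_fst.comp (measurable_fst.comp measurable_fst)).mul
        (hb'm.comp measurable_snd))
  have hWz : ∀ y z, Measurable fun x => shift W₀ b' y x z := fun y z =>
    (hW₀m.comp (measurable_prodMk_right (y := z))).add (hb'm.const_mul y)
  have := isFiniteKernel_bddKernel (T × ℝ) (measure_lt_top μ Set.univ)
  -- The reference measure is read off the second parameter, which makes `rho` measurable jointly in
  -- the value `y` and the occupation measure.
  set κ := (bddKernel (T × ℝ) (μ Set.univ)).comap
    (Prod.snd : ℝ × BddMeasure (T × ℝ) (μ Set.univ) → _) measurable_snd with hκ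
  set Ψ : ℝ → BddMeasure (T × ℝ) (μ Set.univ) → ℝ := fun y M =>
    rho γ m M.1 (shift W₀ b' y) (σ, 0) z with hΨd
  set Ψ' : ℝ → BddMeasure (T × ℝ) (μ Set.univ) → ℝ := fun y M =>
    rho γ m M.1 (shift W₀ b' y) (σ, 0) z * drift γ m M.1 (shift W₀ b' y) b' (σ, 0) z with hΨ'd
  have hΨ : Measurable (Function.uncurry Ψ) :=
    (SpinGlass.measurable_rho (γ := γ) (m := m) κ (V := fun a => shift W₀ b' a.1) hWm).comp
      (f := fun x => ((x, z), (σ, 0))) (by fun_prop)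
  have hΨ' : Measurable (Function.uncurry Ψ') :=
    hΨ.mul ((measurable_drift_kernel (γ := γ) (m := m) κ (V := fun a => shift W₀ b' a.1) hWm
      (f := fun _ => b') (hb'm.comp measurable_snd)).comp
      (f := fun x => ((x, z), (σ, 0))) (by fun_prop))
  have hgood := h.ae_isExpWeight (μ := μ)
  have hd : ∀ᵐ ω ∂P, ∀ y, HasDerivAt (fun y => Ψ y (occupation μ _ hG ω))
      (Ψ' y (occupation μ _ hG ω)) y := by
    filter_upwards [hgood] with ω hω y
    have hg : Measurable fun τ => (τ, residual P H σ τ ω) :=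
      measurable_id.prodMk (hG.comp (measurable_prodMk_right (y := ω)))
    set M := μ.map fun τ => (τ, residual P H σ τ ω) with hM
    have : IsFiniteMeasure M := Measure.isFiniteMeasure_map _ _
    have : NeZero M := ⟨fun h0 => NeZero.ne μ ((Measure.map_eq_zero_iff hg.aemeasurable).1 h0)⟩
    have hA : IsExpWeight M fun x => |x.2| := by
      refine ⟨measurable_snd.abs, fun _ => abs_nonneg _, fun K => ?_⟩
      rw [hM, integrable_map_measure (by fun_prop) hg.aemeasurable]
      refine ((hω.integrable |K|).const_mul
        (Real.exp (|K| * (v / |C σ| * |H σ ω|)))).mono' ?_ (ae_of_all _ fun τ => ?_)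
      · exact (Measurable.comp (g := fun x : T × ℝ => Real.exp (K * |x.2|)) (by fun_prop)
          hg).aestronglyMeasurable
      · simp only [Function.comp_apply]
        rw [Real.norm_eq_abs, Real.abs_exp, ← Real.exp_add, Real.exp_le_exp, ← mul_add]
        have h1 : |residual P H σ τ ω| ≤ v / |C σ| * |H σ ω| + |H τ ω| := by
          rw [residual, add_comm]
          refine (abs_sub _ _).trans (add_le_add le_rfl ?_)
          rw [abs_mul]
          exact mul_le_mul_of_nonneg_right (hbc τ) (abs_nonneg _)
        exact (mul_le_mul_of_nonneg_right (le_abs_self K) (abs_nonneg _)).trans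
          (mul_le_mul_of_nonneg_left h1 (abs_nonneg _))
    have hV : IsHam B (fun x : T × ℝ => |x.2|) W₀ := by
      refine ⟨hW₀m, fun x z z' => by simpa [hW₀] using hL.lip x.1 z z', fun x => ?_⟩
      simp only [hW₀, hL.zero, add_zero, abs_mul]
      exact mul_le_of_le_one_left (abs_nonneg _) hs
    exact hasDerivAt_rho_shift hγ hB hm hV hA hb'm hb'c hm0 hmk (σ, 0) y z
  -- The point `(σ, 0)` represents `σ` because its own residual vanishes: identically if the
  -- variance is nonzero, almost surely if it is zero, since then `H σ = 0` almost surely.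
  have h0 : ∀ᵐ ω ∂P, residual P H σ σ ω = 0 := by
    by_cases hCσ : C σ = 0
    · have h1 : (fun ω => H σ ω * H σ ω) =ᵐ[P] 0 :=
        (integral_eq_zero_iff_of_nonneg (fun ω => mul_self_nonneg _)
          (integrable_mul_of_gaussian h.gaussian σ σ)).1 hCσ
      filter_upwards [h1] with ω hω
      have : H σ ω = 0 := by simpa using hω
      simp [residual, this]
    · refine ae_of_all _ fun ω => ?_
      rw [residual, ← hC, div_self hCσ]; ring
  have hWg : ∀ ω, (fun τ => shift W₀ b' (H σ ω) (τ, residual P H σ τ ω)) = ham H s L ω := by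
    intro ω; funext τ z
    simp only [shift, hW₀, hb', residual, ham, hb, hC]
    ring
  -- In the last identity the factor `C σ` turns the regression coefficients back into covariances,
  -- also when `C σ = 0`; the drift is then taken in the direction `cov2 P H σ`.
  have key : ∀ᵐ ω ∂P, Ψ (H σ ω) (occupation μ _ hG ω) = rho γ m μ (ham H s L ω) σ z ∧
      Ψ' (H σ ω) (occupation μ _ hG ω) = drift γ m μ (ham H s L ω) (fun x => s * b x) σ z *
        rho γ m μ (ham H s L ω) σ z ∧
      C σ * Ψ' (H σ ω) (occupation μ _ hG ω) = s * (rho γ m μ (ham H s L ω) σ z *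
        drift γ m μ (ham H s L ω) C σ z) := by
    filter_upwards [h0] with ω hω
    have hg : Measurable fun τ => (τ, residual P H σ τ ω) :=
      measurable_id.prodMk (hG.comp (measurable_prodMk_right (y := ω)))
    have e1 := rho_map (γ := γ) (m := m) (μ := μ) hg (hWz (H σ ω)) σ
    have e2 := drift_map (γ := γ) (m := m) (μ := μ) hg (hWz (H σ ω)) hb'm σ
    rw [hWg, hω] at e1 e2
    have e3 : ∀ z, C σ * drift γ m μ (ham H s L ω) (fun x => s * b x) σ z =
        s * drift γ m μ (ham H s L ω) C σ z := fun z => by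
      rw [← drift_const_mul, ← drift_const_mul]
      simp only [hbC]
    simp only [hΨd, hΨ'd, occupation, e1, e2, true_and]
    refine ⟨mul_comm _ _, ?_⟩
    rw [mul_left_comm, e3]; ring
  have hi0 : Integrable (fun ω => 1 * rho γ m μ (ham H s L ω) σ z) P :=
    integrable_mul_rho hγ hB hm h hL hs measurable_const (c := 1)
      (ae_of_all _ fun ω => by simp) z
  have hi1 : Integrable (fun ω => H σ ω * rho γ m μ (ham H s L ω) σ z) P :=
    integrable_mul_rho hγ hB hm h hL hs (h.measurable_apply σ) (c := 1)
      (ae_of_all _ fun ω => by linarith [Real.add_one_le_exp |H σ ω|]) z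
  have hi2 : Integrable (fun ω => drift γ m μ (ham H s L ω) (fun x => s * b x) σ z *
      rho γ m μ (ham H s L ω) σ z) P := by
    refine integrable_mul_rho hγ hB hm h hL hs ?_ (c := v / |C σ| * driftBound m k) ?_ z
    · exact (measurable_drift_kernel (γ := γ) (m := m) (Kernel.const Ω μ) (hL.measurable_ham h)
        (f := fun _ x => s * b x) ((hbm.comp measurable_snd).const_mul s)).comp
        (f := fun ω => ((ω, z), σ)) (by fun_prop)
    · filter_upwards [hgood] with ω hω
      have hc : ∀ x, |s * b x| ≤ v / |C σ| := fun x => hb'c (x, 0)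
      refine (abs_drift_le hγ hB hm (hL.isHam h hs ω) hω hc σ z).trans ?_
      exact le_mul_of_one_le_right (mul_nonneg ((abs_nonneg _).trans (hc σ)) driftBound_nonneg)
        (Real.one_le_exp (abs_nonneg _))
  have := integral_process_mul (μ := μ) (P := P) h.gaussian h.centered (h.measurable_apply σ) hG
    hΨ hΨ' hd
    (hi0.congr (by filter_upwards [key] with ω hω; rw [hω.1, one_mul]))
    (hi1.congr (by filter_upwards [key] with ω hω; rw [hω.1]))
    (hi2.congr (by filter_upwards [key] with ω hω; rw [hω.2.1]))
  rw [← integral_const_mul] at this ⊢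
  refine (integral_congr_ae ?_).trans (this.trans (integral_congr_ae ?_))
  · filter_upwards [key] with ω hω; rw [hω.1]
  · filter_upwards [key] with ω hω; exact hω.2.2

end Field


/-! ### Averages with respect to the weighted Gibbs measure -/

section Weighted

variable {X : Type*} [MeasurableSpace X] {μ : Measure X} [IsFiniteMeasure μ] [NeZero μ]
  {E : Type*} [NormedAddCommGroup E] [MeasurableSpace E] [BorelSpace E]
  [SecondCountableTopology E] {k : ℕ}
  {γ : Fin (k + 1) → Measure E} [∀ p, IsProbabilityMeasure (γ p)] {m : ℕ → ℝ} {B : ℝ}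
  {A : X → ℝ} {V : X → (Fin (k + 1) → E) → ℝ}

theorem le_exp_mul_one_add_norm {Z : Type*} [NormedAddCommGroup Z] (c : ℝ) (z : Z) :
    c ≤ Real.exp (|c| * (1 + ‖z‖)) := by
  have h1 : |c| ≤ |c| * (1 + ‖z‖) := by nlinarith [norm_nonneg z, abs_nonneg c]
  linarith [Real.add_one_le_exp (|c| * (1 + ‖z‖)), le_abs_self c]

/-- The average `𝔼 (W_1 ⋯ W_k ⟨f⟩)` over the `z_p`. -/
noncomputable def weightedAvg (γ : Fin (k + 1) → Measure E) (m : ℕ → ℝ) (μ : Measure X)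
    (V : X → (Fin (k + 1) → E) → ℝ) (f : X → (Fin (k + 1) → E) → ℝ) : ℝ :=
  ∫ z, ∫ σ, f σ z * rho γ m μ V σ z ∂μ ∂(Measure.pi γ)

/-- The average `𝔼 (W_1 ⋯ W_{l-1} γ_l^{⊗2} (f))` over the `z_p`. -/
noncomputable def overlapAvg (γ : Fin (k + 1) → Measure E) (m : ℕ → ℝ) (μ : Measure X)
    (V : X → (Fin (k + 1) → E) → ℝ) (l : ℕ) (f : X → X → ℝ) : ℝ :=
  ∫ z, (∏ j ∈ Finset.Ico 1 l, parisiW γ m (logZ μ V) j z) * levelAvg2 γ m μ V l f z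
    ∂(Measure.pi γ)

variable (hγ : HasExpMoments γ) (hB : 0 ≤ B) (hm : ∀ l ≤ k, 0 ≤ m l)
  (hV : IsHam B A V) (hA : IsExpWeight μ A)

include hγ in
omit [BorelSpace E] [SecondCountableTopology E] [∀ p, IsProbabilityMeasure (γ p)] in
theorem HasExpMoments.integrable_exp_one_add (c : ℝ) :
    Integrable (fun z : Fin (k + 1) → E => Real.exp (c * (1 + ‖z‖))) (Measure.pi γ) := by
  simp only [mul_add, Real.exp_add]
  exact (hγ c).const_mul _

include hγ hB hm hV hA

theorem integrable_mul_rho_prod {f : X → (Fin (k + 1) → E) → ℝ}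
    (hf : Measurable (Function.uncurry f)) {c : ℝ}
    (hc : ∀ σ z, |f σ z| ≤ Real.exp (c * (1 + ‖z‖)) * Real.exp (A σ)) :
    Integrable (fun x : (Fin (k + 1) → E) × X => f x.2 x.1 * rho γ m μ V x.2 x.1)
      ((Measure.pi γ).prod μ) := by
  obtain ⟨K, -, hK⟩ := exists_rho_le (γ := γ) X hγ hB hm
  have h2 := ((hA.integrable 2).mul_const (invMass μ A))
  refine ((hγ.integrable_exp_one_add (c + K)).mul_prod h2).mono' ?_ (ae_of_all _ fun x => ?_)
  · exact ((hf.comp measurable_swap).mul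
      ((measurable_rho_const hV.meas).comp measurable_swap)).aestronglyMeasurable
  · have h1 := hK μ A V hV hA x.2 x.1
    rw [Real.norm_eq_abs, abs_mul, abs_of_pos (rho_pos _ _)]
    refine (mul_le_mul (hc x.2 x.1) h1 (rho_pos _ _).le (by positivity)).trans_eq ?_
    rw [two_mul, Real.exp_add (A x.2), add_mul, Real.exp_add]; ring

theorem weightedAvg_eq {f : X → (Fin (k + 1) → E) → ℝ}
    (hf : Measurable (Function.uncurry f)) {c : ℝ}
    (hc : ∀ σ z, |f σ z| ≤ Real.exp (c * (1 + ‖z‖)) * Real.exp (A σ)) :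
    weightedAvg γ m μ V f =
      ∫ x : (Fin (k + 1) → E) × X, f x.2 x.1 * rho γ m μ V x.2 x.1 ∂((Measure.pi γ).prod μ) :=
  (integral_prod _ (integrable_mul_rho_prod hγ hB hm hV hA hf hc)).symm

omit hγ hB hm hV [IsFiniteMeasure μ] [NeZero μ] [MeasurableSpace E] [BorelSpace E]
  [SecondCountableTopology E] [∀ p, IsProbabilityMeasure (γ p)] in
theorem IsExpWeight.le_exp_of_le {c r : ℝ} (hr : r ≤ c) (σ : X) (z : Fin (k + 1) → E) :
    r ≤ Real.exp (|c| * (1 + ‖z‖)) * Real.exp (A σ) :=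
  (hr.trans (le_exp_mul_one_add_norm c z)).trans
    (le_mul_of_one_le_right (Real.exp_pos _).le (Real.one_le_exp (hA.nonneg σ)))

/-- The weighted average of a drift restricted to the levels in `s`. -/
theorem weightedAvg_sub_sum {f : X → X → ℝ} (hf : Measurable (Function.uncurry f)) {c : ℝ}
    (hc : ∀ σ τ, |f σ τ| ≤ c) {s : Finset ℕ} (hs : s ⊆ Finset.Icc 1 k) (w : ℕ → ℝ) :
    weightedAvg γ m μ V
        (fun σ z => f σ σ - ∑ j ∈ s, w j * levelAvg γ m μ V j (f σ) z) =
      weightedAvg γ m μ V (fun σ _ => f σ σ) - ∑ j ∈ s, w j * overlapAvg γ m μ V j f := by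
  have hl : ∀ j ∈ s, j ∈ Finset.Icc 1 (k + 1) := fun j hj => by
    have := hs hj; simp only [Finset.mem_Icc] at *; omega
  have hm1 : Measurable (Function.uncurry fun (σ : X) (_ : Fin (k + 1) → E) => f σ σ) :=
    hf.comp (f := fun x : X × (Fin (k + 1) → E) => (x.1, x.1)) (by fun_prop)
  have hc1 : ∀ σ (z : Fin (k + 1) → E), |f σ σ| ≤ Real.exp (|c| * (1 + ‖z‖)) * Real.exp (A σ) :=
    fun σ z => hA.le_exp_of_le (hc σ σ) σ z
  have hm2 : ∀ j, Measurable (Function.uncurry fun σ z => levelAvg γ m μ V j (f σ) z) :=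
    fun j => measurable_levelAvg_left hV hf j
  have hc2 : ∀ j ∈ s, ∀ σ z, |levelAvg γ m μ V j (f σ) z| ≤
      Real.exp (|c| * (1 + ‖z‖)) * Real.exp (A σ) := fun j hj σ z =>
    hA.le_exp_of_le (abs_levelAvg_le hγ hB hm hV hA (hc σ) (Finset.mem_Icc.1 (hl j hj)).2 z) σ z
  have i1 := integrable_mul_rho_prod hγ hB hm hV hA hm1 hc1
  have i2 : ∀ j ∈ s, Integrable (fun x : (Fin (k + 1) → E) × X =>
      w j * (levelAvg γ m μ V j (f x.2) x.1 * rho γ m μ V x.2 x.1)) ((Measure.pi γ).prod μ) :=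
    fun j hj => (integrable_mul_rho_prod hγ hB hm hV hA (hm2 j) (hc2 j hj)).const_mul _
  have e : ∀ x : (Fin (k + 1) → E) × X,
      (f x.2 x.2 - ∑ j ∈ s, w j * levelAvg γ m μ V j (f x.2) x.1) * rho γ m μ V x.2 x.1 =
      f x.2 x.2 * rho γ m μ V x.2 x.1 -
        ∑ j ∈ s, w j * (levelAvg γ m μ V j (f x.2) x.1 * rho γ m μ V x.2 x.1) := fun x => by
    rw [sub_mul, Finset.sum_mul]; simp only [mul_assoc]
  have i3 : Integrable (fun x : (Fin (k + 1) → E) × X => f x.2 x.2 * rho γ m μ V x.2 x.1 -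
      ∑ j ∈ s, w j * (levelAvg γ m μ V j (f x.2) x.1 * rho γ m μ V x.2 x.1))
      ((Measure.pi γ).prod μ) := i1.sub (integrable_finsetSum s i2)
  have h0 : weightedAvg γ m μ V
      (fun σ z => f σ σ - ∑ j ∈ s, w j * levelAvg γ m μ V j (f σ) z) =
      ∫ x : (Fin (k + 1) → E) × X, (f x.2 x.2 * rho γ m μ V x.2 x.1 -
        ∑ j ∈ s, w j * (levelAvg γ m μ V j (f x.2) x.1 * rho γ m μ V x.2 x.1))
        ∂((Measure.pi γ).prod μ) := by
    rw [integral_prod _ i3, weightedAvg]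
    exact integral_congr_ae (ae_of_all _ fun z => integral_congr_ae
      (ae_of_all _ fun σ => e (z, σ)))
  rw [h0, integral_sub i1 (integrable_finsetSum s i2), integral_finsetSum s i2,
    weightedAvg_eq hγ hB hm hV hA hm1 hc1]
  refine congrArg₂ _ rfl (Finset.sum_congr rfl fun j hj => ?_)
  rw [integral_const_mul, overlapAvg, ← integral_rho_mul_levelAvg hγ hB hm hV hA hf hc (hl j hj)]
  exact congrArg _ (weightedAvg_eq hγ hB hm hV hA (hm2 j) (hc2 j hj)).symm

end Weighted

/-! ### Integration by parts in the Hamiltonian for averaged quantities -/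

section Triple

variable {Ω T : Type*} [MeasurableSpace Ω] [MeasurableSpace T] {P : Measure Ω}
  [IsProbabilityMeasure P] {μ : Measure T} [IsFiniteMeasure μ] [NeZero μ] {H : T → Ω → ℝ} {v : ℝ}
  {E : Type*} [NormedAddCommGroup E] [MeasurableSpace E] [BorelSpace E]
  [SecondCountableTopology E] {k : ℕ}
  {γ : Fin (k + 1) → Measure E} [∀ p, IsProbabilityMeasure (γ p)] {m : ℕ → ℝ} {B s : ℝ}
  {L : T → (Fin (k + 1) → E) → ℝ}
  (hγ : HasExpMoments γ) (hB : 0 ≤ B) (hm : ∀ l ≤ k, 0 ≤ m l)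
  (h : IsBddGaussian P H v) (hL : IsField B L) (hs : |s| ≤ 1)

include hγ hB hm h

omit hB hm [BorelSpace E] [SecondCountableTopology E] [∀ p, IsProbabilityMeasure (γ p)] in
theorem integrable_exp_mul_rhoBound (K : ℝ) :
    Integrable (fun x : ((Fin (k + 1) → E) × T) × Ω =>
      Real.exp (K * (1 + ‖x.1.1‖)) * rhoBound μ H x.1.2 x.2)
      (((Measure.pi γ).prod μ).prod P) :=
  (measurePreserving_prodAssoc (Measure.pi γ) μ P).integrable_comp_of_integrable
    ((hγ.integrable_exp_one_add K).mul_prod h.integrable_rhoBound_prod)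

omit [IsProbabilityMeasure P] in
theorem exists_mul_ham_rho_le (μ : Measure T) [NeZero μ] (c : ℝ) :
    ∃ K, ∀ s L, |s| ≤ 1 → IsField B L → ∀ ω, IsExpWeight μ (fun σ => |H σ ω|) → ∀ σ z r,
      |r| ≤ Real.exp (c * (1 + ‖z‖)) * Real.exp |H σ ω| →
      |r * rho γ m μ (ham H s L ω) σ z| ≤ Real.exp (K * (1 + ‖z‖)) * rhoBound μ H σ ω := by
  obtain ⟨K, -, hK⟩ := exists_ham_rho_le (γ := γ) μ hγ hB hm h
  refine ⟨c + K, fun s L hs hL ω hω σ z r hr => ?_⟩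
  rw [abs_mul, abs_of_pos (rho_pos _ _), add_mul, Real.exp_add, mul_assoc]
  refine (mul_le_mul_of_nonneg_right hr (rho_pos _ _).le).trans ?_
  rw [mul_assoc]
  exact mul_le_mul_of_nonneg_left (hK s L hs hL ω hω σ z) (Real.exp_pos _).le

include hL hs

theorem integrable_mul_rho_triple {f : ((Fin (k + 1) → E) × T) × Ω → ℝ} (hf : Measurable f)
    {c : ℝ} (hc : ∀ᵐ ω ∂P, ∀ x : (Fin (k + 1) → E) × T,
      |f (x, ω)| ≤ Real.exp (c * (1 + ‖x.1‖)) * Real.exp |H x.2 ω|) :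
    Integrable (fun x : ((Fin (k + 1) → E) × T) × Ω =>
      f x * rho γ m μ (ham H s L x.2) x.1.2 x.1.1) (((Measure.pi γ).prod μ).prod P) := by
  obtain ⟨K, hK⟩ := exists_mul_ham_rho_le (γ := γ) hγ hB hm h μ c
  refine (integrable_exp_mul_rhoBound (μ := μ) hγ h K).mono' ?_ ?_
  · refine (hf.mul ((hL.measurable_rho (s := s) h).comp
      (f := fun x : ((Fin (k + 1) → E) × T) × Ω => ((x.2, x.1.1), x.1.2))
      (by fun_prop))).aestronglyMeasurable
  · have := (h.ae_isExpWeight (μ := μ)).and hc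
    filter_upwards [Measure.quasiMeasurePreserving_snd.ae this] with x hx
    exact hK s L hs hL x.2 hx.1 x.1.2 x.1.1 _ (hx.2 x.1)

/-- Integration by parts in the Hamiltonian for the weighted Gibbs average. -/
theorem integral_weightedAvg_process (hm0 : m 0 = 0) (hmk : m k = 1) :
    ∫ ω, weightedAvg γ m μ (ham H s L ω) (fun σ _ => H σ ω) ∂P =
      s * ∫ ω, (weightedAvg γ m μ (ham H s L ω) (fun σ _ => cov2 P H σ σ) -
        ∑ j ∈ Finset.Icc 1 k, (m j - m (j - 1)) *
          overlapAvg γ m μ (ham H s L ω) j (cov2 P H)) ∂P := by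
  have hgood := h.ae_isExpWeight (μ := μ)
  have hcov := h.measurable_cov2
  have hv : ∀ σ (c : ℝ), c ≤ v → ∀ (ω : Ω) (z : Fin (k + 1) → E),
      c ≤ Real.exp (|v| * (1 + ‖z‖)) * Real.exp |H σ ω| := fun σ c hc ω z =>
    (hc.trans (le_exp_mul_one_add_norm v z)).trans
      (le_mul_of_one_le_right (Real.exp_pos _).le (Real.one_le_exp (abs_nonneg _)))
  set f₁ : ((Fin (k + 1) → E) × T) × Ω → ℝ := fun x => H x.1.2 x.2 with hf₁
  have hf₁m : Measurable f₁ := h.meas.comp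
    (f := fun x : ((Fin (k + 1) → E) × T) × Ω => (x.1.2, x.2)) (by fun_prop)
  have hf₁c : ∀ ω (x : (Fin (k + 1) → E) × T),
      |f₁ (x, ω)| ≤ Real.exp (0 * (1 + ‖x.1‖)) * Real.exp |H x.2 ω| := fun ω x => by
    rw [zero_mul, Real.exp_zero, one_mul]
    linarith [Real.add_one_le_exp |H x.2 ω|]
  set f₂ : ((Fin (k + 1) → E) × T) × Ω → ℝ := fun x =>
    drift γ m μ (ham H s L x.2) (cov2 P H x.1.2) x.1.2 x.1.1 with hf₂
  have hf₂m : Measurable f₂ := by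
    refine Measurable.sub (hcov.comp
      (f := fun x : ((Fin (k + 1) → E) × T) × Ω => (x.1.2, x.1.2)) (by fun_prop))
      (Finset.measurable_fun_sum _ fun j _ => Measurable.const_mul ?_ _)
    exact (measurable_levelAvg_prod (γ := γ) (m := m) (μ := μ) (V := ham H s L)
      (hL.measurable_ham h) hcov j).comp
      (f := fun x : ((Fin (k + 1) → E) × T) × Ω => ((x.2, x.1.1), x.1.2)) (by fun_prop)
  have hf₂c : ∀ ω, IsExpWeight μ (fun σ => |H σ ω|) → ∀ x : (Fin (k + 1) → E) × T,
      |f₂ (x, ω)| ≤ Real.exp (|v * driftBound m k| * (1 + ‖x.1‖)) * Real.exp |H x.2 ω| :=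
    fun ω hω x => hω.le_exp_of_le
      (abs_drift_le hγ hB hm (hL.isHam h hs ω) hω (h.bdd x.2) x.2 x.1) x.2 x.1
  have i₁ := integrable_mul_rho_triple (μ := μ) (m := m) hγ hB hm h hL hs hf₁m
    (ae_of_all _ hf₁c)
  have i₂ := integrable_mul_rho_triple (μ := μ) (m := m) hγ hB hm h hL hs hf₂m
    (hgood.mono hf₂c)
  have e₁ : ∀ᵐ ω ∂P, weightedAvg γ m μ (ham H s L ω) (fun σ _ => H σ ω) =
      ∫ x, f₁ (x, ω) * rho γ m μ (ham H s L ω) x.2 x.1 ∂((Measure.pi γ).prod μ) := by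
    filter_upwards [hgood] with ω hω
    exact weightedAvg_eq hγ hB hm (hL.isHam h hs ω) hω
      ((h.measurable_path ω).comp measurable_fst) (fun σ z => hf₁c ω (z, σ))
  have e₂ : ∀ᵐ ω ∂P, weightedAvg γ m μ (ham H s L ω) (fun σ _ => cov2 P H σ σ) -
        ∑ j ∈ Finset.Icc 1 k, (m j - m (j - 1)) *
          overlapAvg γ m μ (ham H s L ω) j (cov2 P H) =
      ∫ x, f₂ (x, ω) * rho γ m μ (ham H s L ω) x.2 x.1 ∂((Measure.pi γ).prod μ) := by
    filter_upwards [hgood] with ω hω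
    rw [← weightedAvg_sub_sum hγ hB hm (hL.isHam h hs ω) hω hcov h.bdd subset_rfl]
    exact weightedAvg_eq hγ hB hm (hL.isHam h hs ω) hω
      (hf₂m.comp (f := fun x : T × (Fin (k + 1) → E) => ((x.2, x.1), ω)) (by fun_prop))
      (fun σ z => hf₂c ω hω (z, σ))
  -- The expectation over `ω` is moved inside, so that integration by parts is applied for each
  -- fixed pair of `z` and `σ`.
  rw [integral_congr_ae e₁, integral_congr_ae e₂,
    ← integral_integral_swap (f := fun x ω => f₁ (x, ω) * rho γ m μ (ham H s L ω) x.2 x.1) i₁,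
    ← integral_integral_swap (f := fun x ω => f₂ (x, ω) * rho γ m μ (ham H s L ω) x.2 x.1) i₂,
    ← integral_const_mul]
  refine integral_congr_ae (ae_of_all _ fun x => ?_)
  have := integral_process_mul_rho (μ := μ) (γ := γ) hγ hB hm h hL hs hm0 hmk x.2 x.1
  simp only [hf₁, hf₂]
  rw [this]
  simp only [mul_comm]

end Triple


/-! ### The Gaussian external field -/

section GaussField

variable {N k : ℕ} {v : Fin (k + 1) → NNReal}

/-- The sup norm is at most the sum of the absolute values of all coordinates, so the exponential
moment is bounded by a product of one-dimensional ones. -/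
theorem hasExpMoments_gaussian :
    HasExpMoments (fun p : Fin (k + 1) => Measure.pi fun _ : Fin N => gaussianReal 0 (v p)) := by
  intro K
  have h1 : ∀ p, Integrable (fun x : ℝ => Real.exp (|K| * |x|)) (gaussianReal 0 (v p)) := by
    intro p
    refine ((integrable_exp_mul_gaussianReal (μ := 0) (v := v p) |K|).add
      (integrable_exp_mul_gaussianReal (μ := 0) (v := v p) (-|K|))).mono' (by fun_prop)
      (ae_of_all _ fun x => ?_)
    rw [Real.norm_eq_abs, Real.abs_exp]
    exact exp_mul_abs_le _ _
  have h2 : ∀ p, Integrable (fun w : Fin N → ℝ => ∏ i, Real.exp (|K| * |w i|))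
      (Measure.pi fun _ => gaussianReal 0 (v p)) := fun p =>
    Integrable.fintype_prod (f := fun _ : Fin N => fun x : ℝ => Real.exp (|K| * |x|))
      fun _ => h1 p
  have h3 : Integrable (fun z : Fin (k + 1) → Fin N → ℝ => ∏ p, ∏ i, Real.exp (|K| * |z p i|))
      (Measure.pi fun p => Measure.pi fun _ => gaussianReal 0 (v p)) :=
    Integrable.fintype_prod (f := fun _ : Fin (k + 1) => fun w : Fin N → ℝ =>
      ∏ i, Real.exp (|K| * |w i|)) h2
  refine h3.mono' (by fun_prop) (ae_of_all _ fun z => ?_)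
  rw [Real.norm_eq_abs, Real.abs_exp]
  simp only [← Real.exp_sum]
  rw [Real.exp_le_exp]
  have h4 : ‖z‖ ≤ ∑ p, ∑ i, |z p i| := by
    have hi : ∀ p, 0 ≤ ∑ i, |z p i| := fun p => Finset.sum_nonneg fun _ _ => abs_nonneg _
    refine (pi_norm_le_iff_of_nonneg (Finset.sum_nonneg fun p _ => hi p)).2 fun p => ?_
    refine (pi_norm_le_iff_of_nonneg (Finset.sum_nonneg fun p _ => hi p)).2 fun i => ?_
    rw [Real.norm_eq_abs]
    exact (Finset.single_le_sum (f := fun i => |z p i|) (fun _ _ => abs_nonneg _)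
      (Finset.mem_univ i)).trans (Finset.single_le_sum (f := fun p => ∑ i, |z p i|)
      (fun p _ => hi p) (Finset.mem_univ p))
  calc K * ‖z‖ ≤ |K| * ‖z‖ := mul_le_mul_of_nonneg_right (le_abs_self K) (norm_nonneg z)
    _ ≤ |K| * ∑ p, ∑ i, |z p i| := mul_le_mul_of_nonneg_left h4 (abs_nonneg K)
    _ = _ := by simp only [Finset.mul_sum]

variable {T : Type*} [MeasurableSpace T]

/-- The external field `r ∑_i a_i ∑_p z_{i,p}`. -/
def field (k : ℕ) (a : T → Fin N → ℝ) (r : ℝ) (σ : T) (z : Fin (k + 1) → Fin N → ℝ) : ℝ :=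
  r * ∑ i, a σ i * ∑ p, z p i

omit [MeasurableSpace T] in
theorem abs_field_le {a : T → Fin N → ℝ} {b : ℝ} (hb : ∀ σ i, |a σ i| ≤ b) {r : ℝ} (hr : |r| ≤ 1)
    (σ : T) (z : Fin (k + 1) → Fin N → ℝ) :
    |field k a r σ z| ≤ (N * (b * (k + 1))) * ‖z‖ := by
  rw [field, abs_mul]
  refine (mul_le_of_le_one_left (abs_nonneg _) hr).trans ?_
  refine (Finset.abs_sum_le_sum_abs _ _).trans ?_
  have : ∀ i ∈ (Finset.univ : Finset (Fin N)), |a σ i * ∑ p, z p i| ≤ b * (k + 1) * ‖z‖ := by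
    intro i _
    rw [abs_mul, mul_assoc]
    refine mul_le_mul (hb σ i) ?_ (abs_nonneg _) ((abs_nonneg _).trans (hb σ i))
    refine (Finset.abs_sum_le_sum_abs _ _).trans ?_
    have h1 : ∀ p ∈ (Finset.univ : Finset (Fin (k + 1))), |z p i| ≤ ‖z‖ := fun p _ =>
      (norm_le_pi_norm (z p) i).trans (norm_le_pi_norm z p)
    refine (Finset.sum_le_card_nsmul _ _ _ h1).trans_eq ?_
    simp
  refine (Finset.sum_le_card_nsmul _ _ _ this).trans_eq ?_
  simp; ring

omit [MeasurableSpace T] in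
theorem field_sub (a : T → Fin N → ℝ) (r : ℝ) (σ : T) (z z' : Fin (k + 1) → Fin N → ℝ) :
    field k a r σ z - field k a r σ z' = field k a r σ (z - z') := by
  simp only [field, Pi.sub_apply, Finset.sum_sub_distrib, mul_sub]

omit [MeasurableSpace T] in
-- Moving the single variable `z_{i,p}` shifts the field by a bounded function of the configuration,
-- the same for all `p`; the dependence on `p` enters only through the levels.
theorem field_add_single (a : T → Fin N → ℝ) (r : ℝ) (σ : T) (z : Fin (k + 1) → Fin N → ℝ)
    (p : Fin (k + 1)) (i : Fin N) (y : ℝ) :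
    field k a r σ (z + Pi.single p (Pi.single i y)) = field k a r σ z + y * (r * a σ i) := by
  have h1 : ∀ i', ∑ p', (Pi.single p (Pi.single i y) : Fin (k + 1) → Fin N → ℝ) p' i' =
      (Pi.single i y : Fin N → ℝ) i' := fun i' => by
    rw [Finset.sum_eq_single p (fun p' _ hp => by simp [Pi.single_eq_of_ne hp]) (by simp)]
    simp
  have h2 : ∑ i', a σ i' * (Pi.single i y : Fin N → ℝ) i' = a σ i * y := by
    rw [Finset.sum_eq_single i (fun i' _ hp => by simp [Pi.single_eq_of_ne hp]) (by simp)]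
    simp
  simp only [field, Pi.add_apply, Finset.sum_add_distrib, mul_add, h1, h2]
  ring

theorem isField_field {a : T → Fin N → ℝ} (ha : ∀ i, Measurable fun σ => a σ i) {b : ℝ}
    (hb : ∀ σ i, |a σ i| ≤ b) {r : ℝ} (hr : |r| ≤ 1) :
    IsField (N * (b * (k + 1))) (field k a r) where
  meas := by
    unfold Function.uncurry field
    refine Measurable.const_mul (Finset.measurable_fun_sum _ fun i _ => ?_) _
    refine ((ha i).comp measurable_fst).mul (Finset.measurable_fun_sum _ fun p _ => ?_)
    fun_prop
  lip σ z z' := by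
    rw [field_sub]; exact abs_field_le hb hr σ _
  zero σ := by simp [field]

end GaussField

section Single

variable {X : Type*} [MeasurableSpace X] {μ : Measure X} [IsFiniteMeasure μ] [NeZero μ]
  {E : Type*} [NormedAddCommGroup E] [MeasurableSpace E] [BorelSpace E]
  [SecondCountableTopology E] {k : ℕ}
  {γ : Fin (k + 1) → Measure E} [∀ p, IsProbabilityMeasure (γ p)] {m : ℕ → ℝ} {B : ℝ}
  {A : X → ℝ} {V : X → (Fin (k + 1) → E) → ℝ}

theorem measurable_levelAvg_single (hV : IsHam B A V) (hA : IsExpWeight μ A) {f : X → ℝ}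
    (hf : Measurable f) (l : ℕ) : Measurable (levelAvg γ m μ V l f) :=
  measurable_parisiAvg_const (hV.isLip_logZ hA).continuous.measurable
    (measurable_gibbs_single hV.meas hf) l

omit [IsFiniteMeasure μ] in
theorem measurable_rho_single (hV : IsHam B A V) (hA : IsExpWeight μ A) (σ : X) :
    Measurable (rho γ m μ V σ) := by
  have h1 := (hV.isLip_logZ hA).continuous.measurable
  exact (measurable_prod_parisiW_const h1 _).mul (((hV.lip σ).continuous.measurable.sub h1).exp)

variable (hγ : HasExpMoments γ) (hB : 0 ≤ B) (hm : ∀ l ≤ k, 0 ≤ m l)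
  (hV : IsHam B A V) (hA : IsExpWeight μ A)

include hγ hB hm hV hA

omit [IsFiniteMeasure μ] in
theorem integrable_mul_rho_single {f : (Fin (k + 1) → E) → ℝ} (hf : Measurable f) {c c' : ℝ}
    (hc : ∀ z, |f z| ≤ c * Real.exp (c' * (1 + ‖z‖))) (σ : X) :
    Integrable (fun z => f z * rho γ m μ V σ z) (Measure.pi γ) := by
  obtain ⟨K, hK0, hK⟩ := exists_rho_le (γ := γ) X hγ hB hm
  refine ((hγ.integrable_exp_one_add (c' + K)).mul_const
    (c * (Real.exp (A σ) * invMass μ A))).mono'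
    (hf.mul (measurable_rho_single hV hA σ)).aestronglyMeasurable (ae_of_all _ fun z => ?_)
  rw [Real.norm_eq_abs, abs_mul, abs_of_pos (rho_pos _ _)]
  refine (mul_le_mul (hc z) (hK μ A V hV hA σ z) (rho_pos _ _).le
    ((abs_nonneg _).trans (hc z))).trans_eq ?_
  rw [add_mul, Real.exp_add]; ring

theorem levelAvg_sum {ι : Type*} (s : Finset ι) {f : ι → X → ℝ} (hf : ∀ i, Measurable (f i))
    {c : ℝ} (hc : ∀ i σ, |f i σ| ≤ c) (w : ι → ℝ) (l : ℕ) (z : Fin (k + 1) → E) :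
    levelAvg γ m μ V l (fun σ => ∑ i ∈ s, w i * f i σ) z =
      ∑ i ∈ s, w i * levelAvg γ m μ V l (f i) z := by
  classical
  induction s using Finset.induction_on with
  | empty => simpa using levelAvg_const_mul (γ := γ) (m := m) (μ := μ) (W := V) (f := 0) 0 l z
  | insert i s hi ih =>
    have h2 : ∀ σ, |∑ i ∈ s, w i * f i σ| ≤ ∑ i ∈ s, |w i| * c := fun σ =>
      (Finset.abs_sum_le_sum_abs _ _).trans (Finset.sum_le_sum fun i _ => by
        rw [abs_mul]; exact mul_le_mul_of_nonneg_left (hc i σ) (abs_nonneg _))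
    have := levelAvg_lin hγ hB hm hV hA (hf i)
      (Finset.measurable_fun_sum s fun i _ => (hf i).const_mul (w i)) (hc i) h2 (w i) 1 l z
    simp only [one_mul] at this
    simp only [Finset.sum_insert hi, this, ih]

end Single

/-! ### Integration by parts in the external field -/

section FieldParts

variable {N k : ℕ} {v : Fin (k + 1) → NNReal} {T : Type*} [MeasurableSpace T] {μ : Measure T}
  [IsFiniteMeasure μ] [NeZero μ] {m : ℕ → ℝ} {B : ℝ} {A : T → ℝ}
  {V : T → (Fin (k + 1) → Fin N → ℝ) → ℝ} {a : T → Fin N → ℝ} {b r : ℝ} {g : T → ℝ}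

/-- Changing one coordinate is written as a translation from a base point, to match the translation
formula for `rho`. -/
theorem update_update_eq (z : Fin (k + 1) → Fin N → ℝ) (w : Fin N → ℝ) (p : Fin (k + 1))
    (i : Fin N) (y : ℝ) : Function.update z p (Function.update w i y) =
      Function.update z p (Function.update w i 0) + Pi.single p (Pi.single i y) := by
  funext p' i'
  by_cases hp : p' = p
  · subst hp
    by_cases hi : i' = i
    · subst hi; simp
    · simp [Function.update_of_ne hi, Pi.single_eq_of_ne hi]
  · simp [Function.update_of_ne hp, Pi.single_eq_of_ne hp]

local notation "Γ" => fun p : Fin (k + 1) => Measure.pi fun _ : Fin N => gaussianReal 0 (v p)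

variable (hB : 0 ≤ B) (hm : ∀ l ≤ k, 0 ≤ m l) (hm0 : m 0 = 0) (hmk : m k = 1)
  (hV : IsHam B A V) (hA : IsExpWeight μ A) (hVf : ∀ σ z, V σ z = g σ + field k a r σ z)
  (ha : ∀ i, Measurable fun σ => a σ i) (hb : ∀ σ i, |a σ i| ≤ b)

include hB hm hm0 hmk hV hA hVf ha hb

/-- Integration by parts in one variable of the external field, at a fixed configuration. -/
theorem integral_apply_mul_rho (p : Fin (k + 1)) (i : Fin N) (σ : T) :
    ∫ z, z p i * rho Γ m μ V σ z ∂(Measure.pi Γ) =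
      v p * ∫ z, rho Γ m μ V σ z * (r * a σ i - ∑ j ∈ Finset.Icc 1 k, (m j - m (j - 1)) *
        if (p : ℕ) < j then levelAvg Γ m μ V j (fun τ => r * a τ i) z else 0)
        ∂(Measure.pi Γ) := by
  have hγ : HasExpMoments Γ := hasExpMoments_gaussian
  have hVe : ∀ σ z y, V σ (z + Pi.single p (Pi.single i y)) = V σ z + y * (r * a σ i) :=
    fun σ z y => by rw [hVf, hVf, field_add_single]; ring
  have ham : Measurable fun σ => r * a σ i := (ha i).const_mul r
  have hac : ∀ σ, |r * a σ i| ≤ |r| * b := fun σ => by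
    rw [abs_mul]; exact mul_le_mul_of_nonneg_left (hb σ i) (abs_nonneg r)
  have hd : ∀ z w y, HasDerivAt
      (fun y => rho Γ m μ V σ (Function.update z p (Function.update w i y))) _ y := fun z w y => by
    have := hasDerivAt_rho_translate (μ := μ) hγ hB hm hV hA ham hac hm0 hmk (p := p)
      (e := fun y => Pi.single p (Pi.single i y))
      (fun y p' hp => by simp [Pi.single_eq_of_ne hp]) hVe σ y
      (Function.update z p (Function.update w i 0))
    simpa only [← update_update_eq] using this
  have hint : ∀ (f : (Fin (k + 1) → Fin N → ℝ) → ℝ) (c : ℝ), Measurable f →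
      (∀ z, |f z| ≤ c * Real.exp (1 * (1 + ‖z‖))) →
      Integrable (fun z => f z * rho Γ m μ V σ z) (Measure.pi Γ) := fun f c hf hc =>
    integrable_mul_rho_single hγ hB hm hV hA hf hc σ
  have hone : ∀ z : Fin (k + 1) → Fin N → ℝ, 1 ≤ Real.exp (1 * (1 + ‖z‖)) := fun z =>
    Real.one_le_exp (by positivity)
  refine integral_apply_apply_mul_pi (v := v) p i hd ?_ (hint _ 1 ?_ fun z => ?_) ?_
  · simpa only [one_mul] using hint (fun _ => 1) 1 measurable_const
      fun z => by simpa using hone z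
  · fun_prop
  · rw [one_mul, one_mul]
    have : |z p i| ≤ ‖z‖ := (norm_le_pi_norm (z p) i).trans (norm_le_pi_norm z p)
    linarith [Real.add_one_le_exp (1 + ‖z‖)]
  · simp only [mul_comm (rho Γ m μ V σ _)]
    refine hint _ (|r| * b * driftBound m k) ?_ fun z => ?_
    · refine measurable_const.sub (Finset.measurable_fun_sum _ fun j _ => ?_)
      split_ifs
      · exact (measurable_levelAvg_single hV hA ham j).const_mul _
      · fun_prop
    · have hrb : 0 ≤ |r| * b := (abs_nonneg _).trans (hac σ)
      refine le_trans ?_ (le_mul_of_one_le_right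
        (mul_nonneg hrb driftBound_nonneg) (hone z))
      rw [driftBound, mul_add, mul_one, Finset.mul_sum]
      refine (abs_sub _ _).trans (add_le_add (hac σ) ((Finset.abs_sum_le_sum_abs _ _).trans
        (Finset.sum_le_sum fun j hj => ?_)))
      rw [abs_mul, mul_comm]
      refine mul_le_mul_of_nonneg_right ?_ (abs_nonneg _)
      split_ifs
      · exact abs_levelAvg_le hγ hB hm hV hA hac
          ((Finset.mem_Icc.1 hj).2.trans (Nat.le_succ k)) z
      · rwa [abs_zero]

/-- The scalar product of the coefficients of the external field. -/
def coefInner (a : T → Fin N → ℝ) (σ τ : T) : ℝ := ∑ i, a σ i * a τ i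

omit hB hm hm0 hmk hV hA hVf hb in
theorem measurable_coefInner : Measurable (Function.uncurry (coefInner a)) := by
  unfold Function.uncurry coefInner
  exact Finset.measurable_fun_sum _ fun i _ =>
    ((ha i).comp measurable_fst).mul ((ha i).comp measurable_snd)

omit hB hm hm0 hmk hV hA hVf ha [MeasurableSpace T] in
theorem abs_coefInner_le (σ τ : T) : |coefInner a σ τ| ≤ N * b ^ 2 := by
  refine (Finset.abs_sum_le_sum_abs _ _).trans ((Finset.sum_le_card_nsmul _ _ (b ^ 2)
    fun i _ => ?_).trans_eq (by simp))
  rw [abs_mul, sq]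
  exact mul_le_mul (hb σ i) (hb τ i) (abs_nonneg _) ((abs_nonneg _).trans (hb σ i))

/-- Summing the formulas for the coordinates `i` with coefficients `a σ i` assembles the products `a
σ i * a τ i` into `coefInner`, by linearity of `γ_j`. -/
theorem integral_sum_apply_mul_rho (p : Fin (k + 1)) (σ : T) :
    ∫ z, (∑ i, a σ i * z p i) * rho Γ m μ V σ z ∂(Measure.pi Γ) =
      v p * r * ∫ z, (coefInner a σ σ - ∑ j ∈ (Finset.Icc 1 k).filter ((p : ℕ) < ·),
        (m j - m (j - 1)) * levelAvg Γ m μ V j (coefInner a σ) z) * rho Γ m μ V σ z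
        ∂(Measure.pi Γ) := by
  have hγ : HasExpMoments Γ := hasExpMoments_gaussian
  have hi1 : ∀ i ∈ (Finset.univ : Finset (Fin N)), Integrable
      (fun z : Fin (k + 1) → Fin N → ℝ => a σ i * (z p i * rho Γ m μ V σ z)) (Measure.pi Γ) :=
    fun i _ => (integrable_mul_rho_single hγ hB hm hV hA (f := fun z => z p i) (c := 1) (c' := 1)
      (by fun_prop) (fun z => by
        rw [one_mul, one_mul]
        have : |z p i| ≤ ‖z‖ := (norm_le_pi_norm (z p) i).trans (norm_le_pi_norm z p)
        linarith [Real.add_one_le_exp (1 + ‖z‖)]) σ).const_mul _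
  have hi2 : ∀ i ∈ (Finset.univ : Finset (Fin N)), Integrable
      (fun z : Fin (k + 1) → Fin N → ℝ => a σ i * ((a σ i - ∑ j ∈ (Finset.Icc 1 k).filter
        ((p : ℕ) < ·), (m j - m (j - 1)) * levelAvg Γ m μ V j (fun τ => a τ i) z) *
        rho Γ m μ V σ z)) (Measure.pi Γ) := fun i _ => by
    refine (integrable_mul_rho_single hγ hB hm hV hA
      (c := b + ∑ j ∈ (Finset.Icc 1 k).filter ((p : ℕ) < ·), |m j - m (j - 1)| * b) (c' := 0)
      (measurable_const.sub (Finset.measurable_fun_sum _ fun j _ =>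
        (measurable_levelAvg_single hV hA (ha i) j).const_mul _)) (fun z => ?_) σ).const_mul _
    rw [zero_mul, Real.exp_zero, mul_one]
    refine (abs_sub _ _).trans (add_le_add (hb σ i) ((Finset.abs_sum_le_sum_abs _ _).trans
      (Finset.sum_le_sum fun j hj => ?_)))
    rw [abs_mul]
    exact mul_le_mul_of_nonneg_left (abs_levelAvg_le hγ hB hm hV hA (fun τ => hb τ i)
      ((Finset.mem_Icc.1 (Finset.mem_filter.1 hj).1).2.trans (Nat.le_succ k)) z) (abs_nonneg _)
  have e1 : ∀ z : Fin (k + 1) → Fin N → ℝ, (∑ i, a σ i * z p i) * rho Γ m μ V σ z =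
      ∑ i, a σ i * (z p i * rho Γ m μ V σ z) := fun z => by
    rw [Finset.sum_mul]; simp only [mul_assoc]
  have e2 : ∀ z, (coefInner a σ σ - ∑ j ∈ (Finset.Icc 1 k).filter ((p : ℕ) < ·),
        (m j - m (j - 1)) * levelAvg Γ m μ V j (coefInner a σ) z) * rho Γ m μ V σ z =
      ∑ i, a σ i * ((a σ i - ∑ j ∈ (Finset.Icc 1 k).filter
        ((p : ℕ) < ·), (m j - m (j - 1)) * levelAvg Γ m μ V j (fun τ => a τ i) z) *
        rho Γ m μ V σ z) := fun z => by
    have : ∀ j, levelAvg Γ m μ V j (coefInner a σ) z =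
        ∑ i, a σ i * levelAvg Γ m μ V j (fun τ => a τ i) z := fun j =>
      levelAvg_sum hγ hB hm hV hA Finset.univ (f := fun i τ => a τ i) ha (fun i τ => hb τ i) (a σ) j z
    simp only [this, coefInner]
    generalize rho Γ m μ V σ z = R
    generalize hw : (fun j => m j - m (j - 1)) = w
    have hw' : ∀ j, m j - m (j - 1) = w j := fun j => congrFun hw j
    simp only [hw', sub_mul, mul_sub (a σ _), Finset.sum_sub_distrib, Finset.sum_mul,
      Finset.mul_sum]
    refine congrArg₂ _ (by simp only [mul_assoc]) ?_
    rw [Finset.sum_comm]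
    exact Finset.sum_congr rfl fun i _ => Finset.sum_congr rfl fun j _ => by ring
  simp only [e1, e2]
  rw [integral_finsetSum _ hi1, integral_finsetSum _ hi2, Finset.mul_sum]
  refine Finset.sum_congr rfl fun i _ => ?_
  rw [integral_const_mul, integral_const_mul,
    integral_apply_mul_rho hB hm hm0 hmk hV hA hVf ha hb p i σ, mul_assoc, mul_left_comm,
    mul_left_comm r, ← integral_const_mul r]
  refine congrArg _ (congrArg _ (integral_congr_ae (ae_of_all _ fun z => ?_)))
  simp only [levelAvg_const_mul, Finset.sum_filter, mul_ite, mul_zero]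
  simp only [mul_sub, sub_mul, Finset.mul_sum, Finset.sum_mul, mul_ite, ite_mul, mul_zero,
    zero_mul]
  refine congrArg₂ _ (by ring) (Finset.sum_congr rfl fun j _ => ?_)
  split_ifs <;> ring

omit hB hm hm0 hmk hV hVf ha [IsFiniteMeasure μ] [NeZero μ] in
theorem abs_sum_apply_le (p : Fin (k + 1)) (σ : T) (z : Fin (k + 1) → Fin N → ℝ) :
    |∑ i, a σ i * z p i| ≤ Real.exp (N * b * (1 + ‖z‖)) * Real.exp (A σ) := by
  have h1 : |∑ i, a σ i * z p i| ≤ N * (b * ‖z‖) := by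
    refine (Finset.abs_sum_le_sum_abs _ _).trans ((Finset.sum_le_card_nsmul _ _ (b * ‖z‖)
      fun i _ => ?_).trans_eq (by simp))
    rw [abs_mul]
    exact mul_le_mul (hb σ i) ((norm_le_pi_norm (z p) i).trans (norm_le_pi_norm z p))
      (abs_nonneg _) ((abs_nonneg _).trans (hb σ i))
  have h2 : (0 : ℝ) ≤ N * b := by
    rcases Nat.eq_zero_or_pos N with rfl | hN
    · simp
    · exact mul_nonneg (Nat.cast_nonneg _) ((abs_nonneg _).trans (hb σ ⟨0, hN⟩))
  refine h1.trans (le_trans ?_ (le_mul_of_one_le_right (Real.exp_pos _).le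
    (Real.one_le_exp (hA.nonneg σ))))
  nlinarith [Real.add_one_le_exp (N * b * (1 + ‖z‖))]

/-- Integration by parts in the external field for the weighted Gibbs average. -/
theorem weightedAvg_sum_apply (p : Fin (k + 1)) :
    weightedAvg Γ m μ V (fun σ z => ∑ i, a σ i * z p i) =
      v p * r * (weightedAvg Γ m μ V (fun σ _ => coefInner a σ σ) -
        ∑ j ∈ (Finset.Icc 1 k).filter ((p : ℕ) < ·),
          (m j - m (j - 1)) * overlapAvg Γ m μ V j (coefInner a)) := by
  have hγ : HasExpMoments Γ := hasExpMoments_gaussian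
  have hmeas : Measurable (Function.uncurry fun (σ : T) (z : Fin (k + 1) → Fin N → ℝ) =>
      ∑ i, a σ i * z p i) :=
    Finset.measurable_fun_sum _ fun i _ => ((ha i).comp measurable_fst).mul (by fun_prop)
  have hc : ∀ σ (z : Fin (k + 1) → Fin N → ℝ), |∑ i, a σ i * z p i| ≤ Real.exp (N * b * (1 + ‖z‖)) * Real.exp (A σ) :=
    fun σ z => abs_sum_apply_le hA hb p σ z
  set s := (Finset.Icc 1 k).filter ((p : ℕ) < ·)
  have hs : s ⊆ Finset.Icc 1 k := Finset.filter_subset _ _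
  have hCm := measurable_coefInner ha
  have hCb := abs_coefInner_le hb
  have hsum : ∀ σ z, |coefInner a σ σ - ∑ j ∈ s, (m j - m (j - 1)) *
      levelAvg Γ m μ V j (coefInner a σ) z| ≤
      N * b ^ 2 + ∑ j ∈ s, |m j - m (j - 1)| * (N * b ^ 2) := fun σ z => by
    refine (abs_sub _ _).trans (add_le_add (hCb σ σ) ((Finset.abs_sum_le_sum_abs _ _).trans
      (Finset.sum_le_sum fun j hj => ?_)))
    rw [abs_mul]
    exact mul_le_mul_of_nonneg_left (abs_levelAvg_le hγ hB hm hV hA (hCb σ)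
      ((Finset.mem_Icc.1 (hs hj)).2.trans (Nat.le_succ k)) z) (abs_nonneg _)
  have hm2 : Measurable (Function.uncurry fun σ z => coefInner a σ σ -
      ∑ j ∈ s, (m j - m (j - 1)) * levelAvg Γ m μ V j (coefInner a σ) z) :=
    (hCm.comp (f := fun x : T × (Fin (k + 1) → Fin N → ℝ) => (x.1, x.1)) (by fun_prop)).sub
      (Finset.measurable_fun_sum _ fun j _ => (measurable_levelAvg_left hV hCm j).const_mul _)
  have hc2 := fun σ z => hA.le_exp_of_le (hsum σ z) σ z
  rw [← weightedAvg_sub_sum hγ hB hm hV hA hCm hCb hs,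
    weightedAvg_eq hγ hB hm hV hA hmeas hc, weightedAvg_eq hγ hB hm hV hA hm2 hc2,
    integral_prod_symm _ (integrable_mul_rho_prod hγ hB hm hV hA hmeas hc),
    integral_prod_symm _ (integrable_mul_rho_prod hγ hB hm hV hA hm2 hc2), ← integral_const_mul]
  exact integral_congr_ae (ae_of_all _ fun σ =>
    integral_sum_apply_mul_rho hB hm hm0 hmk hV hA hVf ha hb p σ)

end FieldParts


/-! ### The interpolation in abstract form -/

section Zero

variable {X : Type*} [MeasurableSpace X] {μ : Measure X} [NeZero μ]
  {E : Type*} [NormedAddCommGroup E] [MeasurableSpace E] [BorelSpace E]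
  [SecondCountableTopology E] {k : ℕ}
  {γ : Fin (k + 1) → Measure E} [∀ p, IsProbabilityMeasure (γ p)] {m : ℕ → ℝ} {B : ℝ}
  {A : X → ℝ} {V : X → (Fin (k + 1) → E) → ℝ}

omit [NeZero μ] [NormedAddCommGroup E] [BorelSpace E] [SecondCountableTopology E]
  [∀ p, IsProbabilityMeasure (γ p)] in
-- As `m_0 = 0`, the weight `W_0` equals one; so the average with `W_1 ⋯ W_k` is the one that occurs
-- in the derivative of `F_0`.
theorem weightedAvg_eq_parisiAvg (hm0 : m 0 = 0) (f : X → (Fin (k + 1) → E) → ℝ)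
    (z : Fin (k + 1) → E) :
    weightedAvg γ m μ V f = parisiAvg γ m (logZ μ V) 0 (gibbs' μ V f) z := by
  have h1 : ∀ z, ∏ j ∈ Finset.Icc 0 k, parisiW γ m (logZ μ V) j z =
      ∏ j ∈ Finset.Icc 1 k, parisiW γ m (logZ μ V) j z := fun z => by
    have : Finset.Icc 0 k = insert 0 (Finset.Icc 1 k) := by
      ext j; simp only [Finset.mem_Icc, Finset.mem_insert]; omega
    rw [this, Finset.prod_insert (by simp)]
    simp [parisiW, hm0]
  rw [weightedAvg, parisiAvg, condE_zero]
  refine integral_congr_ae (ae_of_all _ fun z => ?_)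
  simp only [h1, gibbs']
  rw [prod_parisiW_mul_gibbs]

theorem abs_weightedAvg_le (hγ : HasExpMoments γ) (hB : 0 ≤ B) (hm : ∀ l ≤ k, 0 ≤ m l)
    (hm0 : m 0 = 0) (hV : IsHam B A V) (hA : IsExpWeight μ A) {f : X → ℝ} {c : ℝ}
    (hc : ∀ᵐ σ ∂μ, |f σ| ≤ c) : |weightedAvg γ m μ V fun σ _ => f σ| ≤ c := by
  rw [weightedAvg_eq_parisiAvg hm0 _ 0]
  exact abs_parisiAvg_le hγ hB hm (hV.isLip_logZ hA) (fun w => hV.abs_gibbs_le hA hc w)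
    (Nat.zero_le _) 0

theorem weightedAvg_const (hγ : HasExpMoments γ) (hB : 0 ≤ B) (hm : ∀ l ≤ k, 0 ≤ m l)
    (hm0 : m 0 = 0) (hV : IsHam B A V) (hA : IsExpWeight μ A) :
    weightedAvg γ m μ V (fun _ _ => 1) = 1 := by
  have : gibbs' μ V (fun _ _ => 1) = fun _ => 1 := funext fun w => gibbs_one hV hA w
  rw [weightedAvg_eq_parisiAvg hm0 _ 0, this]
  exact parisiAvg_one hγ hB hm (hV.isLip_logZ hA) 0 (Nat.zero_le _) 0

theorem abs_overlapAvg_le (hγ : HasExpMoments γ) (hB : 0 ≤ B) (hm : ∀ l ≤ k, 0 ≤ m l)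
    (hV : IsHam B A V) (hA : IsExpWeight μ A) {f : X → X → ℝ} {c : ℝ}
    (hc : ∀ σ τ, |f σ τ| ≤ c) {l : ℕ} (hl : l ∈ Finset.Icc 1 (k + 1)) :
    |overlapAvg γ m μ V l f| ≤ c :=
  abs_integral_prod_Ico_mul_le hγ hB hm hV hA
    (fun z => abs_levelAvg2_le hγ hB hm hV hA hc (Finset.mem_Icc.1 hl).2 z) hl

/-- A bound for the recursion started at a Lipschitz function. -/
theorem exists_abs_parisiLevel_le (hγ : HasExpMoments γ) (hB : 0 ≤ B) (hm : ∀ l ≤ k, 0 ≤ m l) :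
    ∃ C, 0 ≤ C ∧ ∀ F : (Fin (k + 1) → E) → ℝ, IsLip B F → |parisiLevel γ m F 0 0| ≤ C + |F 0| := by
  set G : (Fin (k + 1) → E) → ℝ := fun z => B * ‖z‖
  have hG : IsLip B G := fun z z' => by
    simp only [G, ← mul_sub, abs_mul, abs_of_nonneg hB]
    exact mul_le_mul_of_nonneg_left (abs_norm_sub_norm_le z z') hB
  have hG' : IsLip B fun z => -G z := fun z z' => by
    rw [← abs_neg, show -(-G z - -G z') = G z - G z' by ring]; exact hG z z'
  refine ⟨|parisiLevel γ m G 0 0| + |parisiLevel γ m (fun z => -G z) 0 0|, by positivity,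
    fun F hF => ?_⟩
  have hb : ∀ z, |F z - F 0| ≤ G z := fun z => by simpa [G] using hF z 0
  have h1 := parisiLevel_mono (m := m) hγ hB hm hF hG (c := |F 0|) (fun z => by
    linarith [(abs_le.1 (hb z)).2, le_abs_self (F 0)]) 0 (Nat.zero_le _) 0
  have h2 := parisiLevel_mono (m := m) hγ hB hm hG' hF (c := |F 0|) (fun z => by
    linarith [(abs_le.1 (hb z)).1, neg_abs_le (F 0)]) 0 (Nat.zero_le _) 0
  rw [abs_le]
  constructor
  · linarith [neg_abs_le (parisiLevel γ m (fun z => -G z) 0 0),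
      abs_nonneg (parisiLevel γ m G 0 0)]
  · linarith [le_abs_self (parisiLevel γ m G 0 0),
      abs_nonneg (parisiLevel γ m (fun z => -G z) 0 0)]

end Zero

section LogZBound

variable {Ω T : Type*} [MeasurableSpace Ω] [MeasurableSpace T] {P : Measure Ω}
  [IsProbabilityMeasure P] {μ : Measure T} [IsFiniteMeasure μ] [NeZero μ] {H : T → Ω → ℝ} {v : ℝ}

theorem abs_log_le_add_inv {x : ℝ} (hx : 0 < x) : |Real.log x| ≤ x + x⁻¹ := by
  have h1 := Real.log_le_sub_one_of_pos hx
  have h2 := Real.log_le_sub_one_of_pos (inv_pos.2 hx)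
  rw [Real.log_inv] at h2
  have := inv_pos.2 hx
  rw [abs_le]; constructor <;> linarith

/-- Logarithms are bounded by `x + x⁻¹`; what remains are exponential moments of the path, constants
in the total mass, and the inverse mass, which is square integrable. -/
theorem IsBddGaussian.integrable_logZBound (h : IsBddGaussian P H v) :
    Integrable (fun ω => logZBound μ fun σ => |H σ ω|) P := by
  set r := μ.real Set.univ with hr
  have hr0 : 0 < r := by
    rw [hr, measureReal_def, ENNReal.toReal_pos_iff]
    exact ⟨by simpa [pos_iff_ne_zero] using NeZero.ne μ, measure_lt_top _ _⟩
  have hm1 : Measurable fun x : Ω × T => Real.exp |H x.2 x.1| :=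
    (h.meas.comp measurable_swap).abs.exp
  have hm2 : Measurable fun x : Ω × T => Real.exp (-|H x.2 x.1|) :=
    (h.meas.comp measurable_swap).abs.neg.exp
  have hmeas : Measurable fun ω => logZBound μ fun σ => |H σ ω| :=
    (hm1.stronglyMeasurable.integral_prod_right' (ν := μ)).measurable.log.abs.add
      (hm2.stronglyMeasurable.integral_prod_right' (ν := μ)).measurable.log.abs
  have hJ : Integrable (fun ω => ∫ σ, Real.exp |H σ ω| ∂μ) P := by
    simpa using h.integrable_integral_exp (μ := μ) 1
  refine ((hJ.add (integrable_const (r⁻¹ + r + 1))).add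
    (h.integrable_invMass_sq (μ := μ))).mono' hmeas.aestronglyMeasurable ?_
  filter_upwards [h.ae_isExpWeight (μ := μ)] with ω hω
  have h1 : r ≤ ∫ σ, Real.exp |H σ ω| ∂μ := by
    have := integral_mono (integrable_const (1 : ℝ)) hω.integrable_one
      fun σ => Real.one_le_exp (hω.nonneg σ)
    simpa [hr] using this
  have h2 : ∫ σ, Real.exp (-|H σ ω|) ∂μ ≤ r := by
    have := integral_mono hω.integrable_neg (integrable_const (1 : ℝ))
      fun σ => Real.exp_le_one_iff.2 (neg_nonpos.2 (hω.nonneg σ))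
    simpa [hr] using this
  have h3 := abs_log_le_add_inv (integral_exp_pos hω.integrable_one)
  have h4 := abs_log_le_add_inv (integral_exp_pos hω.integrable_neg)
  have h5 : (∫ σ, Real.exp |H σ ω| ∂μ)⁻¹ ≤ r⁻¹ := inv_anti₀ hr0 h1
  have h6 : (∫ σ, Real.exp (-|H σ ω|) ∂μ)⁻¹ = invMass μ fun σ => |H σ ω| := rfl
  simp only [Pi.add_apply]
  rw [Real.norm_eq_abs, abs_of_nonneg (by rw [logZBound]; positivity), logZBound]
  rw [h6] at h4
  nlinarith [sq_nonneg (invMass μ (fun σ => |H σ ω|) - 1)]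

end LogZBound

/-! ### The interpolating Hamiltonian and its derivative for `0 < t < 1` -/

section Interp

variable {Ω T : Type*} [MeasurableSpace Ω] [MeasurableSpace T] {P : Measure Ω}
  [IsProbabilityMeasure P] {μ : Measure T} [IsFiniteMeasure μ] [NeZero μ] {H : T → Ω → ℝ} {v : ℝ}
  {N k : ℕ} {w : Fin (k + 1) → NNReal} {m : ℕ → ℝ} {a : T → Fin N → ℝ} {b : ℝ}

/-- The interpolating Hamiltonian. -/
noncomputable def interp (H : T → Ω → ℝ) (k : ℕ) (a : T → Fin N → ℝ) (t : ℝ) :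
    Ω → T → (Fin (k + 1) → Fin N → ℝ) → ℝ := ham H (√t) (field k a (√(1 - t)))

/-- The derivative of the interpolating Hamiltonian. -/
noncomputable def interp' (H : T → Ω → ℝ) (k : ℕ) (a : T → Fin N → ℝ) (t : ℝ) (ω : Ω) (σ : T)
    (z : Fin (k + 1) → Fin N → ℝ) : ℝ :=
  1 / (2 * √t) * H σ ω - 1 / (2 * √(1 - t)) * field k a 1 σ z

local notation "Γ" => fun p : Fin (k + 1) => Measure.pi fun _ : Fin N => gaussianReal 0 (w p)

/-- The Parisi functional of the free energy of the interpolation. -/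
noncomputable def interpLevel (γ : Fin (k + 1) → Measure (Fin N → ℝ)) (m : ℕ → ℝ)
    (μ : Measure T) (H : T → Ω → ℝ) (a : T → Fin N → ℝ) (t : ℝ) (ω : Ω) : ℝ :=
  parisiLevel γ m (logZ μ (interp H k a t ω)) 0 0

theorem abs_sqrt_le_one {t : ℝ} (ht : t ∈ Set.Icc (0 : ℝ) 1) : |√t| ≤ 1 := by
  rw [abs_of_nonneg (Real.sqrt_nonneg t), Real.sqrt_le_one]; exact ht.2

theorem one_sub_mem_Icc {t : ℝ} (ht : t ∈ Set.Icc (0 : ℝ) 1) : 1 - t ∈ Set.Icc (0 : ℝ) 1 :=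
  ⟨by linarith [ht.2], by linarith [ht.1]⟩

variable (hm : ∀ l ≤ k, 0 ≤ m l) (h : IsBddGaussian P H v)
  (ha : ∀ i, Measurable fun σ => a σ i) (hb0 : 0 ≤ b) (hb : ∀ σ i, |a σ i| ≤ b)

include ha hb in
omit [IsProbabilityMeasure P] in
theorem isField_interp {t : ℝ} (ht : t ∈ Set.Icc (0 : ℝ) 1) :
    IsField (N * (b * (k + 1))) (field k a (√(1 - t))) :=
  isField_field ha hb (abs_sqrt_le_one (one_sub_mem_Icc ht))

include h ha hb in
omit [IsProbabilityMeasure P] in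
theorem isHam_interp {t : ℝ} (ht : t ∈ Set.Icc (0 : ℝ) 1) (ω : Ω) :
    IsHam (N * (b * (k + 1))) (fun σ => |H σ ω|) (interp H k a t ω) :=
  (isField_interp ha hb ht).isHam h (abs_sqrt_le_one ht) ω

include h ha in
omit [IsProbabilityMeasure P] [NeZero μ] in
theorem measurable_interp (t : ℝ) : Measurable
    fun x : (Ω × (Fin (k + 1) → Fin N → ℝ)) × T => interp H k a t x.1.1 x.2 x.1.2 := by
  have := h.meas
  unfold interp ham field
  refine Measurable.add ?_ (Measurable.const_mul (Finset.measurable_fun_sum _ fun i _ => ?_) _)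
  · exact (h.meas.comp (f := fun x : (Ω × (Fin (k + 1) → Fin N → ℝ)) × T => (x.2, x.1.1))
      (by fun_prop)).const_mul _
  · exact ((ha i).comp measurable_snd).mul (by fun_prop)

include hm h ha hb0 hb in
omit [IsProbabilityMeasure P] [IsFiniteMeasure μ] in
theorem exists_abs_interpLevel_le : ∃ C, ∀ t ∈ Set.Icc (0 : ℝ) 1, ∀ ω,
    IsExpWeight μ (fun σ => |H σ ω|) →
      |interpLevel Γ m μ H a t ω| ≤ C + logZBound μ fun σ => |H σ ω| := by
  obtain ⟨C, -, hC⟩ := exists_abs_parisiLevel_le (m := m) (γ := Γ)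
    (B := N * (b * (k + 1))) hasExpMoments_gaussian (by positivity) hm
  refine ⟨C, fun t ht ω hω => ?_⟩
  have hV := isHam_interp (k := k) h ha hb ht ω
  exact (hC _ (hV.isLip_logZ hω)).trans (by linarith [hV.abs_logZ_zero_le hω])

include h ha in
omit [IsProbabilityMeasure P] [NeZero μ] in
theorem measurable_interpLevel (t : ℝ) : Measurable (interpLevel Γ m μ H a t) :=
  (measurable_parisiLevel Γ (measurable_logZ (Kernel.const Ω μ) (measurable_interp h ha t)) m 0).comp
    (f := fun ω => (ω, 0)) (by fun_prop)

omit [MeasurableSpace Ω] [MeasurableSpace T] in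
theorem interp'_bound (hb : ∀ σ i, |a σ i| ≤ b) {r c : ℝ}
    (h1 : 1 / (2 * √r) ≤ c) (h2 : 1 / (2 * √(1 - r)) * (N * (b * (k + 1))) ≤ c) (ω : Ω) (σ : T)
    (z : Fin (k + 1) → Fin N → ℝ) :
    |interp' H k a r ω σ z| ≤ Real.exp (c * (1 + ‖z‖)) * Real.exp |H σ ω| := by
  have e1 : 0 ≤ 1 / (2 * √r) := by positivity
  have e2 : 0 ≤ 1 / (2 * √(1 - r)) := by positivity
  have h3 := abs_field_le (k := k) hb (r := 1) (by simp) σ z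
  have h4 : |interp' H k a r ω σ z| ≤ c * |H σ ω| + c * ‖z‖ := by
    refine (abs_sub _ _).trans (add_le_add ?_ ?_)
    · rw [abs_mul, abs_of_nonneg e1]
      exact mul_le_mul_of_nonneg_right h1 (abs_nonneg _)
    · rw [abs_mul, abs_of_nonneg e2]
      refine (mul_le_mul_of_nonneg_left h3 e2).trans ?_
      rw [← mul_assoc]
      exact mul_le_mul_of_nonneg_right h2 (norm_nonneg z)
  have hc : 0 ≤ c := e1.trans h1
  have h5 := Real.add_one_le_exp (c * (1 + ‖z‖))
  have h6 := Real.add_one_le_exp |H σ ω|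
  have hz := norm_nonneg z
  have hH := abs_nonneg (H σ ω)
  have hcz : 0 ≤ c * ‖z‖ := mul_nonneg hc hz
  refine h4.trans (le_trans ?_ (mul_le_mul h5 h6 (by positivity) (Real.exp_pos _).le))
  nlinarith [mul_nonneg hcz hH, mul_nonneg hc hH]

include ha in
theorem measurable_interp' (hH : Measurable fun x : T × Ω => H x.1 x.2) (r : ℝ) : Measurable
    fun x : (Ω × (Fin (k + 1) → Fin N → ℝ)) × T => interp' H k a r x.1.1 x.2 x.1.2 := by
  unfold interp' field
  refine Measurable.sub ?_ (Measurable.const_mul (Measurable.const_mul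
    (Finset.measurable_fun_sum _ fun i _ => ?_) _) _)
  · exact (hH.comp (f := fun x : (Ω × (Fin (k + 1) → Fin N → ℝ)) × T => (x.2, x.1.1))
      (by fun_prop)).const_mul _
  · exact ((ha i).comp measurable_snd).mul (by fun_prop)

include h ha hb in
omit [IsProbabilityMeasure P] in
theorem hamFam_interp {U : Set ℝ} (hU : U ⊆ Set.Ioo 0 1) {c : ℝ}
    (h1 : ∀ r ∈ U, 1 / (2 * √r) ≤ c)
    (h2 : ∀ r ∈ U, 1 / (2 * √(1 - r)) * (N * (b * (k + 1))) ≤ c) (ω : Ω) :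
    HamFam U (N * (b * (k + 1))) c (fun σ => |H σ ω|) (fun r => interp H k a r ω)
      (fun r => interp' H k a r ω) where
  ham r hr := isHam_interp h ha hb (Set.Ioo_subset_Icc_self (hU hr)) ω
  deriv r hr σ z := by
    have hr' := hU hr
    have d1 := (Real.hasDerivAt_sqrt hr'.1.ne').mul_const (H σ ω)
    have d2 := ((Real.hasDerivAt_sqrt (x := 1 - r) (by linarith [hr'.2])).comp r
      ((hasDerivAt_id r).const_sub 1)).mul_const (∑ i, a σ i * ∑ p, z p i)
    refine (d1.add d2).congr_deriv ?_
    simp only [interp', field, one_mul]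
    ring
  bound r hr σ z := interp'_bound hb (h1 r hr) (h2 r hr) ω σ z
  meas r hr := (measurable_interp' ha h.meas r).comp
    (f := fun x : T × (Fin (k + 1) → Fin N → ℝ) => ((ω, x.2), x.1)) (by fun_prop)

variable (hm0 : m 0 = 0)

include hm h ha hb0 hb hm0 in
-- Differentiation under the expectation over the disorder. The factors `1 / √t` and `1 / √(1 - t)`
-- are singular at the ends, so domination is obtained on a neighbourhood of `t` away from both.
theorem hasDerivAt_integral_interpLevel {t : ℝ} (ht : t ∈ Set.Ioo (0 : ℝ) 1) :
    HasDerivAt (fun t => ∫ ω, interpLevel Γ m μ H a t ω ∂P)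
      (∫ ω, weightedAvg Γ m μ (interp H k a t ω) (interp' H k a t ω) ∂P) t := by
  set B : ℝ := N * (b * (k + 1)) with hB
  have hB0 : 0 ≤ B := by positivity
  have hγ : HasExpMoments Γ := hasExpMoments_gaussian
  have hgood := h.ae_isExpWeight (μ := μ)
  -- On this interval `r ≥ t / 2` and `1 - r ≥ (1 - t) / 2`, which is what the two entries of `c`
  -- below record.
  set U := Set.Ioo (t / 2) ((1 + t) / 2) with hU
  have htU : t ∈ U := ⟨by linarith [ht.1], by linarith [ht.2]⟩
  have hUo : IsOpen U := isOpen_Ioo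
  have hU' : U ⊆ Set.Ioo 0 1 := fun r hr =>
    ⟨by linarith [hr.1, ht.1], by linarith [hr.2, ht.2]⟩
  set c := max (1 / (2 * √(t / 2))) (1 / (2 * √((1 - t) / 2)) * B) with hc
  have h1 : ∀ r ∈ U, 1 / (2 * √r) ≤ c := fun r hr => by
    refine le_trans ?_ (le_max_left _ _)
    have : 0 < √(t / 2) := Real.sqrt_pos.2 (by linarith [ht.1])
    exact one_div_le_one_div_of_le (by positivity)
      (mul_le_mul_of_nonneg_left (Real.sqrt_le_sqrt hr.1.le) zero_le_two)
  have h2 : ∀ r ∈ U, 1 / (2 * √(1 - r)) * B ≤ c := fun r hr => by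
    refine le_trans (mul_le_mul_of_nonneg_right ?_ hB0) (le_max_right _ _)
    have : 0 < √((1 - t) / 2) := Real.sqrt_pos.2 (by linarith [ht.2])
    exact one_div_le_one_div_of_le (by positivity)
      (mul_le_mul_of_nonneg_left (Real.sqrt_le_sqrt (by linarith [hr.2])) zero_le_two)
  obtain ⟨K, hK⟩ := exists_mul_ham_rho_le (γ := Γ) hγ hB0 hm h μ c
  obtain ⟨C, hC⟩ := exists_abs_interpLevel_le (w := w) (μ := μ) hm h ha hb0 hb
  have hbd := (integrable_exp_mul_rhoBound (μ := μ) (γ := Γ) hγ h K).integral_prod_right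
  have hint := integrable_mul_rho_triple (μ := μ) (γ := Γ) (m := m) hγ hB0 hm h
    (isField_interp ha hb (Set.Ioo_subset_Icc_self ht))
    (abs_sqrt_le_one (Set.Ioo_subset_Icc_self ht))
    (f := fun x => interp' H k a t x.2 x.1.2 x.1.1)
    ((measurable_interp' ha h.meas t).comp
      (f := fun x : ((Fin (k + 1) → Fin N → ℝ) × T) × Ω => ((x.2, x.1.1), x.1.2)) (by fun_prop))
    (c := c) (ae_of_all _ fun ω x => interp'_bound hb (h1 t htU) (h2 t htU) ω x.2 x.1)
  have hweq : ∀ ω, IsExpWeight μ (fun σ => |H σ ω|) → ∀ r ∈ U,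
      weightedAvg Γ m μ (interp H k a r ω) (interp' H k a r ω) =
        ∫ x, interp' H k a r ω x.2 x.1 * rho Γ m μ (interp H k a r ω) x.2 x.1
          ∂((Measure.pi Γ).prod μ) := fun ω hω r hr =>
    weightedAvg_eq hγ hB0 hm (isHam_interp h ha hb (Set.Ioo_subset_Icc_self (hU' hr)) ω) hω
      ((hamFam_interp h ha hb hU' h1 h2 ω).meas r hr)
      (fun σ z => interp'_bound hb (h1 r hr) (h2 r hr) ω σ z)
  refine (hasDerivAt_integral_of_dominated_loc_of_deriv_le (μ := P)
    (F := fun r ω => interpLevel Γ m μ H a r ω)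
    (F' := fun r ω => weightedAvg Γ m μ (interp H k a r ω) (interp' H k a r ω))
    (hUo.mem_nhds htU) (Filter.Eventually.of_forall fun r =>
      (measurable_interpLevel h ha r).aestronglyMeasurable) ?_ ?_ ?_ hbd ?_).2
  · refine ((integrable_const C).add (h.integrable_logZBound (μ := μ))).mono'
      (measurable_interpLevel h ha t).aestronglyMeasurable ?_
    filter_upwards [hgood] with ω hω
    exact hC t (Set.Ioo_subset_Icc_self ht) ω hω
  · refine (hint.integral_prod_right.congr ?_).aestronglyMeasurable
    filter_upwards [hgood] with ω hω
    exact (hweq ω hω t htU).symm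
  · filter_upwards [hgood, (integrable_exp_mul_rhoBound (μ := μ) (γ := Γ) hγ h K).prod_left_ae]
      with ω hω hω2 r hr
    rw [hweq ω hω r hr]
    refine norm_integral_le_of_norm_le hω2 (ae_of_all _ fun x => ?_)
    exact hK _ _ (abs_sqrt_le_one (Set.Ioo_subset_Icc_self (hU' hr)))
      (isField_interp ha hb (Set.Ioo_subset_Icc_self (hU' hr))) ω hω x.2 x.1 _
      (interp'_bound hb (h1 r hr) (h2 r hr) ω x.2 x.1)
  · filter_upwards [hgood] with ω hω r hr
    obtain ⟨K', hK'⟩ := (hamFam_interp (k := k) h ha hb hU' h1 h2 ω).derivFam hUo hB0 hω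
    obtain ⟨K'', hK''⟩ := hK'.parisiLevel (γ := Γ) hUo hγ hB0 hm 0 (Nat.zero_le _)
    rw [weightedAvg_eq_parisiAvg hm0 _ 0]
    exact hK''.deriv r hr 0

end Interp


/-! ### The derivative formula and its continuity -/

section Formula

variable {Ω T : Type*} [MeasurableSpace Ω] [MeasurableSpace T] {P : Measure Ω}
  [IsProbabilityMeasure P] {μ : Measure T} [IsFiniteMeasure μ] [NeZero μ] {H : T → Ω → ℝ} {v : ℝ}
  {N k : ℕ} {w : Fin (k + 1) → NNReal} {m : ℕ → ℝ} {a : T → Fin N → ℝ} {b : ℝ}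

local notation "Γ" => fun p : Fin (k + 1) => Measure.pi fun _ : Fin N => gaussianReal 0 (w p)

/-- The average `𝔼 (W_1 ⋯ W_k ⟨f⟩_t)`. -/
noncomputable def diagAvg (γ : Fin (k + 1) → Measure (Fin N → ℝ)) (m : ℕ → ℝ) (μ : Measure T)
    (P : Measure Ω) (H : T → Ω → ℝ) (a : T → Fin N → ℝ) (t : ℝ) (f : T → ℝ) : ℝ :=
  ∫ ω, weightedAvg γ m μ (interp H k a t ω) (fun σ _ => f σ) ∂P

/-- The average `μ_l (f) = 𝔼 (W_1 ⋯ W_{l-1} γ_l^{⊗2} (f))`. -/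
noncomputable def pairAvg (γ : Fin (k + 1) → Measure (Fin N → ℝ)) (m : ℕ → ℝ) (μ : Measure T)
    (P : Measure Ω) (H : T → Ω → ℝ) (a : T → Fin N → ℝ) (t : ℝ) (l : ℕ) (f : T → T → ℝ) : ℝ :=
  ∫ ω, overlapAvg γ m μ (interp H k a t ω) l f ∂P

variable (hm : ∀ l ≤ k, 0 ≤ m l) (h : IsBddGaussian P H v)
  (ha : ∀ i, Measurable fun σ => a σ i) (hb0 : 0 ≤ b) (hb : ∀ σ i, |a σ i| ≤ b)
  (hm0 : m 0 = 0)

include h ha in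
omit [IsProbabilityMeasure P] [NeZero μ] in
theorem measurable_weightedAvg (t : ℝ) {f : T → ℝ} (hf : Measurable f) :
    Measurable fun ω => weightedAvg Γ m μ (interp H k a t ω) fun σ _ => f σ := by
  have h1 := (hf.comp measurable_snd).mul (measurable_rho (γ := Γ) (m := m) (Kernel.const Ω μ)
    (measurable_interp (k := k) h ha t))
  have h2 := h1.stronglyMeasurable.integral_prod_right' (ν := μ)
  exact (h2.integral_prod_right' (ν := Measure.pi Γ)).measurable

include h ha in
omit [IsProbabilityMeasure P] [NeZero μ] in
theorem measurable_overlapAvg_integrand (t : ℝ) {f : T → T → ℝ}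
    (hf : Measurable (Function.uncurry f)) (l : ℕ) :
    Measurable fun x : Ω × (Fin (k + 1) → Fin N → ℝ) =>
      (∏ j ∈ Finset.Ico 1 l, parisiW Γ m (logZ μ (interp H k a t x.1)) j x.2) *
        levelAvg2 Γ m μ (interp H k a t x.1) l f x.2 := by
  have hV := measurable_interp (k := k) h ha t
  have h1 := measurable_prod_parisiW Γ (measurable_logZ (Kernel.const Ω μ) hV) m (Finset.Ico 1 l)
  have h2 := measurable_levelAvg2 (γ := Γ) (m := m) (μ := μ) hV hf l
  exact h1.mul h2

include h ha in
omit [IsProbabilityMeasure P] [NeZero μ] in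
theorem measurable_overlapAvg (t : ℝ) {f : T → T → ℝ} (hf : Measurable (Function.uncurry f))
    (l : ℕ) : Measurable fun ω => overlapAvg Γ m μ (interp H k a t ω) l f :=
  ((measurable_overlapAvg_integrand h ha t hf l).stronglyMeasurable.integral_prod_right'
    (ν := Measure.pi Γ)).measurable

include hm h ha hb0 hb hm0

theorem ae_abs_weightedAvg_le {t : ℝ} (ht : t ∈ Set.Icc (0 : ℝ) 1) {f : T → ℝ} {c : ℝ}
    (hc : ∀ᵐ σ ∂μ, |f σ| ≤ c) :
    ∀ᵐ ω ∂P, |weightedAvg Γ m μ (interp H k a t ω) fun σ _ => f σ| ≤ c := by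
  filter_upwards [h.ae_isExpWeight (μ := μ)] with ω hω
  exact abs_weightedAvg_le hasExpMoments_gaussian (by positivity) hm hm0
    (isHam_interp h ha hb ht ω) hω hc

theorem integrable_weightedAvg {t : ℝ} (ht : t ∈ Set.Icc (0 : ℝ) 1) {f : T → ℝ}
    (hf : Measurable f) {c : ℝ} (hc : ∀ᵐ σ ∂μ, |f σ| ≤ c) :
    Integrable (fun ω => weightedAvg Γ m μ (interp H k a t ω) fun σ _ => f σ) P :=
  (integrable_const c).mono' (measurable_weightedAvg h ha t hf).aestronglyMeasurable
    (ae_abs_weightedAvg_le hm h ha hb0 hb hm0 ht hc)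

theorem abs_diagAvg_le {t : ℝ} (ht : t ∈ Set.Icc (0 : ℝ) 1) {f : T → ℝ} {c : ℝ}
    (hc : ∀ᵐ σ ∂μ, |f σ| ≤ c) : |diagAvg Γ m μ P H a t f| ≤ c := by
  have := norm_integral_le_of_norm_le (μ := P) (f := fun ω =>
    weightedAvg Γ m μ (interp H k a t ω) fun σ _ => f σ) (integrable_const c)
    (ae_abs_weightedAvg_le (w := w) hm h ha hb0 hb hm0 ht hc)
  simpa [diagAvg] using this

omit hm0 in
theorem ae_abs_overlapAvg_le {t : ℝ} (ht : t ∈ Set.Icc (0 : ℝ) 1) {f : T → T → ℝ} {c : ℝ}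
    (hc : ∀ σ τ, |f σ τ| ≤ c) {l : ℕ} (hl : l ∈ Finset.Icc 1 k) :
    ∀ᵐ ω ∂P, |overlapAvg Γ m μ (interp H k a t ω) l f| ≤ c := by
  filter_upwards [h.ae_isExpWeight (μ := μ)] with ω hω
  exact abs_overlapAvg_le hasExpMoments_gaussian (by positivity) hm
    (isHam_interp h ha hb ht ω) hω hc (by simp only [Finset.mem_Icc] at *; omega)

omit hm0 in
theorem integrable_overlapAvg {t : ℝ} (ht : t ∈ Set.Icc (0 : ℝ) 1) {f : T → T → ℝ}
    (hf : Measurable (Function.uncurry f)) {c : ℝ}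
    (hc : ∀ σ τ, |f σ τ| ≤ c) {l : ℕ} (hl : l ∈ Finset.Icc 1 k) :
    Integrable (fun ω => overlapAvg Γ m μ (interp H k a t ω) l f) P :=
  (integrable_const c).mono' (measurable_overlapAvg h ha t hf l).aestronglyMeasurable
    (ae_abs_overlapAvg_le hm h ha hb0 hb ht hc hl)

omit hm0 in
theorem abs_pairAvg_le {t : ℝ} (ht : t ∈ Set.Icc (0 : ℝ) 1) {f : T → T → ℝ} {c : ℝ}
    (hc : ∀ σ τ, |f σ τ| ≤ c) {l : ℕ} (hl : l ∈ Finset.Icc 1 k) :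
    |pairAvg Γ m μ P H a t l f| ≤ c := by
  have := norm_integral_le_of_norm_le (μ := P) (f := fun ω =>
    overlapAvg Γ m μ (interp H k a t ω) l f) (integrable_const c)
    (ae_abs_overlapAvg_le (w := w) hm h ha hb0 hb ht hc hl)
  simpa [pairAvg] using this

theorem diagAvg_lin {t : ℝ} (ht : t ∈ Set.Icc (0 : ℝ) 1) {f g : T → ℝ} (hf : Measurable f)
    (hg : Measurable g) {c c' : ℝ} (hc : ∀ σ, |f σ| ≤ c) (hc' : ∀ σ, |g σ| ≤ c')
    (x y : ℝ) : diagAvg Γ m μ P H a t (fun σ => x * f σ + y * g σ) =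
      x * diagAvg Γ m μ P H a t f + y * diagAvg Γ m μ P H a t g := by
  have hγ : HasExpMoments Γ := hasExpMoments_gaussian
  rw [diagAvg, diagAvg, diagAvg, ← integral_const_mul, ← integral_const_mul, ← integral_add
    ((integrable_weightedAvg hm h ha hb0 hb hm0 ht hf (ae_of_all _ hc)).const_mul x)
    ((integrable_weightedAvg hm h ha hb0 hb hm0 ht hg (ae_of_all _ hc')).const_mul y)]
  refine integral_congr_ae ?_
  filter_upwards [h.ae_isExpWeight (μ := μ)] with ω hω
  have hV := isHam_interp (k := k) h ha hb ht ω
  have e := weightedAvg_eq_parisiAvg (γ := Γ) (μ := μ) (V := interp H k a t ω) hm0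
  have e1 : gibbs' μ (interp H k a t ω) (fun σ _ => x * f σ + y * g σ) =
      fun z => x * gibbs μ (interp H k a t ω) f z - (-y) * gibbs μ (interp H k a t ω) g z := by
    funext z
    rw [gibbs', gibbs_lin hV hω hf hg hc hc']; ring
  have hb' : ∀ (x : ℝ) {f : T → ℝ} {c : ℝ}, (∀ σ, |f σ| ≤ c) →
      ExpBounded (|x| * c) fun z => x * gibbs μ (interp H k a t ω) f z := fun x f c hc =>
    expBounded_of_le fun z => by
      rw [abs_mul]
      exact mul_le_mul_of_nonneg_left (hV.abs_gibbs_le hω (ae_of_all _ hc) z) (abs_nonneg x)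
  rw [e _ 0, e _ 0, e _ 0, e1, parisiAvg_sub hγ (by positivity) hm (hV.isLip_logZ hω) (hb' x hc)
    ((measurable_gibbs_single hV.meas hf).const_mul x) (hb' (-y) hc')
    ((measurable_gibbs_single hV.meas hg).const_mul _), parisiAvg_const_mul, parisiAvg_const_mul]
  have e2 : ∀ f : T → ℝ, gibbs' μ (interp H k a t ω) (fun σ _ => f σ) =
    gibbs μ (interp H k a t ω) f := fun f => rfl
  rw [e2, e2]; ring

omit hm0 in
theorem pairAvg_lin {t : ℝ} (ht : t ∈ Set.Icc (0 : ℝ) 1) {f g : T → T → ℝ}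
    (hf : Measurable (Function.uncurry f)) (hg : Measurable (Function.uncurry g)) {c c' : ℝ}
    (hc : ∀ σ τ, |f σ τ| ≤ c) (hc' : ∀ σ τ, |g σ τ| ≤ c') (x y : ℝ) {l : ℕ}
    (hl : l ∈ Finset.Icc 1 k) :
    pairAvg Γ m μ P H a t l (fun σ τ => x * f σ τ + y * g σ τ) =
      x * pairAvg Γ m μ P H a t l f + y * pairAvg Γ m μ P H a t l g := by
  have hγ : HasExpMoments Γ := hasExpMoments_gaussian
  have hl' : l ≤ k + 1 := by simp only [Finset.mem_Icc] at hl; omega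
  rw [pairAvg, pairAvg, pairAvg, ← integral_const_mul, ← integral_const_mul, ← integral_add
    ((integrable_overlapAvg hm h ha hb0 hb ht hf hc hl).const_mul x)
    ((integrable_overlapAvg hm h ha hb0 hb ht hg hc' hl).const_mul y)]
  refine integral_congr_ae ?_
  filter_upwards [h.ae_isExpWeight (μ := μ)] with ω hω
  have hV := isHam_interp (k := k) h ha hb ht ω
  have hB : 0 ≤ N * (b * (k + 1)) := by positivity
  have hi : ∀ {f : T → T → ℝ} {c : ℝ}, Measurable (Function.uncurry f) → (∀ σ τ, |f σ τ| ≤ c) →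
      Integrable (fun z => (∏ j ∈ Finset.Ico 1 l, parisiW Γ m (logZ μ (interp H k a t ω)) j z) *
        levelAvg2 Γ m μ (interp H k a t ω) l f z) (Measure.pi Γ) := fun {f c} hf hc =>
    integrable_prod_Ico_mul hγ hB hm hV hω
      ((measurable_levelAvg2 (γ := Γ) (m := m) (μ := μ) (measurable_interp (k := k) h ha t) hf
        l).comp (measurable_prodMk_left (x := ω)))
      (fun z => abs_levelAvg2_le hγ hB hm hV hω hc hl' z) hl'
  rw [overlapAvg, overlapAvg, overlapAvg, ← integral_const_mul, ← integral_const_mul,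
    ← integral_add ((hi hf hc).const_mul x) ((hi hg hc').const_mul y)]
  refine integral_congr_ae (ae_of_all _ fun z => ?_)
  simp only
  rw [levelAvg2_lin hγ hB hm hV hω hf hg hc hc' x y hl']
  ring

/-- Gaussian integration by parts: the derivative of the interpolation. -/
theorem integral_weightedAvg_interp' (hmk : m k = 1) {t : ℝ} (ht : t ∈ Set.Ioo (0 : ℝ) 1) :
    ∫ ω, weightedAvg Γ m μ (interp H k a t ω) (interp' H k a t ω) ∂P =
      1 / 2 * (diagAvg Γ m μ P H a t (fun σ => cov2 P H σ σ) -
        ∑ j ∈ Finset.Icc 1 k, (m j - m (j - 1)) * pairAvg Γ m μ P H a t j (cov2 P H)) -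
      1 / 2 * ∑ p : Fin (k + 1), w p * (diagAvg Γ m μ P H a t (fun σ => coefInner a σ σ) -
        ∑ j ∈ (Finset.Icc 1 k).filter ((p : ℕ) < ·),
          (m j - m (j - 1)) * pairAvg Γ m μ P H a t j (coefInner a)) := by
  set B : ℝ := N * (b * (k + 1)) with hB
  have hB0 : 0 ≤ B := by positivity
  have hγ : HasExpMoments Γ := hasExpMoments_gaussian
  have hgood := h.ae_isExpWeight (μ := μ)
  have htc := Set.Ioo_subset_Icc_self ht
  set s := √t with hs
  set r := √(1 - t) with hr
  have hs0 : 0 < s := Real.sqrt_pos.2 ht.1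
  have hr0 : 0 < r := Real.sqrt_pos.2 (by linarith [ht.2])
  have hL := isField_interp (k := k) ha hb htc
  have hs1 : |s| ≤ 1 := abs_sqrt_le_one htc
  have hVf : ∀ ω σ z, interp H k a t ω σ z = s * H σ ω + field k a r σ z := fun ω σ z => rfl
  have hHam := isHam_interp (k := k) h ha hb htc
  set S : Fin (k + 1) → Ω → ℝ := fun p ω => weightedAvg Γ m μ (interp H k a t ω) (fun σ _ => coefInner a σ σ) -
        ∑ j ∈ (Finset.Icc 1 k).filter ((p : ℕ) < ·),
          (m j - m (j - 1)) * overlapAvg Γ m μ (interp H k a t ω) j (coefInner a) with hS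
  have hSi : ∀ p, Integrable (S p) P := fun p => by
    refine (integrable_weightedAvg hm h ha hb0 hb hm0 htc
      ((measurable_coefInner ha).comp (f := fun σ => (σ, σ)) (by fun_prop))
      (ae_of_all _ fun σ => abs_coefInner_le hb σ σ)).sub (integrable_finsetSum _ fun j hj => ?_)
    exact (integrable_overlapAvg hm h ha hb0 hb htc (measurable_coefInner ha)
      (abs_coefInner_le hb) (Finset.mem_filter.1 hj).1).const_mul _
  have hHc : ∀ ω σ (z : Fin (k + 1) → Fin N → ℝ),
      |H σ ω| ≤ Real.exp (0 * (1 + ‖z‖)) * Real.exp |H σ ω| := fun ω σ z => by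
    rw [zero_mul, Real.exp_zero, one_mul]
    linarith [Real.add_one_le_exp |H σ ω|]
  have hHm : ∀ ω, Measurable (Function.uncurry fun σ (_ : Fin (k + 1) → Fin N → ℝ) => H σ ω) :=
    fun ω => (h.measurable_path ω).comp measurable_fst
  have hHi : Integrable (fun ω => weightedAvg Γ m μ (interp H k a t ω) fun σ _ => H σ ω) P := by
    have := (integrable_mul_rho_triple (μ := μ) (γ := Γ) (m := m) hγ hB0 hm h hL hs1
      (f := fun x => H x.1.2 x.2) (h.meas.comp
      (f := fun x : ((Fin (k + 1) → Fin N → ℝ) × T) × Ω => (x.1.2, x.2)) (by fun_prop))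
      (c := 0) (ae_of_all _ fun ω x => hHc ω x.2 x.1)).integral_prod_right
    refine this.congr ?_
    filter_upwards [hgood] with ω hω
    exact (weightedAvg_eq hγ hB0 hm (hHam ω) hω (hHm ω) (hHc ω)).symm
  -- The integration by parts over the field is carried out for a fixed path; the one over `H` needs
  -- the expectation and is left for `hproc`.
  have key : ∀ᵐ ω ∂P, weightedAvg Γ m μ (interp H k a t ω) (interp' H k a t ω) =
      1 / (2 * s) * weightedAvg Γ m μ (interp H k a t ω) (fun σ _ => H σ ω) -
        ∑ p, 1 / 2 * (w p * S p ω) := by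
    filter_upwards [hgood] with ω hω
    -- The factor `r` released by the integration by parts cancels the singular `1 / (2 r)` of the
    -- derivative, leaving `1 / 2`. The factor `s` does the same for the Hamiltonian.
    have hp : ∀ p : Fin (k + 1), 1 / 2 * (w p * S p ω) =
        1 / (2 * r) * weightedAvg Γ m μ (interp H k a t ω) fun σ z => ∑ i, a σ i * z p i := fun p => by
      rw [weightedAvg_sum_apply (b := b) (g := fun σ => s * H σ ω) hB0 hm hm0 hmk (hHam ω) hω
        (hVf ω) ha hb p]
      simp only [hS]
      field_simp
    simp only [hp]
    have hpm : ∀ p : Fin (k + 1), Measurable (Function.uncurry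
        fun (σ : T) (z : Fin (k + 1) → Fin N → ℝ) => ∑ i, a σ i * z p i) := fun p =>
      Finset.measurable_fun_sum _ fun i _ => ((ha i).comp measurable_fst).mul (by fun_prop)
    have hpc : ∀ (p : Fin (k + 1)) σ (z : Fin (k + 1) → Fin N → ℝ), |∑ i, a σ i * z p i| ≤
        Real.exp (N * b * (1 + ‖z‖)) * Real.exp |H σ ω| := fun p σ z =>
      abs_sum_apply_le hω hb p σ z
    have i1 := integrable_mul_rho_prod (γ := Γ) hγ hB0 hm (hHam ω) hω (hHm ω) (hHc ω)
    have i2 := fun p => integrable_mul_rho_prod (γ := Γ) hγ hB0 hm (hHam ω) hω (hpm p) (hpc p)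
    have e1 := weightedAvg_eq (γ := Γ) hγ hB0 hm (hHam ω) hω (hHm ω) (hHc ω)
    have e2 := fun p => weightedAvg_eq (γ := Γ) hγ hB0 hm (hHam ω) hω (hpm p) (hpc p)
    have hc1 : 1 / (2 * √t) ≤ 1 / (2 * √t) + 1 / (2 * √(1 - t)) * B := by
      have : 0 ≤ 1 / (2 * √(1 - t)) * B := by positivity
      linarith
    have hc2 : 1 / (2 * √(1 - t)) * B ≤ 1 / (2 * √t) + 1 / (2 * √(1 - t)) * B := by
      have : 0 ≤ 1 / (2 * √t) := by positivity
      linarith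
    have him : Measurable (Function.uncurry (interp' H k a t ω)) :=
      (measurable_interp' ha h.meas t).comp
        (f := fun x : T × (Fin (k + 1) → Fin N → ℝ) => ((ω, x.2), x.1)) (by fun_prop)
    rw [weightedAvg_eq hγ hB0 hm (hHam ω) hω him
      (fun σ z => interp'_bound hb hc1 hc2 ω σ z), e1]
    simp only [e2]
    rw [← integral_const_mul]
    simp only [← integral_const_mul]
    rw [← integral_finsetSum _ fun p _ => (i2 p).const_mul _,
      ← integral_sub (i1.const_mul _) (integrable_finsetSum _ fun p _ => (i2 p).const_mul _)]
    refine integral_congr_ae (ae_of_all _ fun x => ?_)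
    have e3 : ∑ i, a x.2 i * ∑ p, x.1 p i = ∑ p, ∑ i, a x.2 i * x.1 p i := by
      rw [Finset.sum_comm]; simp only [Finset.mul_sum]
    simp only [interp', field, one_mul, e3]
    rw [← Finset.mul_sum, ← Finset.sum_mul]
    ring
  rw [integral_congr_ae key, integral_sub (hHi.const_mul _)
    (integrable_finsetSum _ fun p _ => ((hSi p).const_mul _).const_mul _),
    integral_finsetSum _ fun p _ => ((hSi p).const_mul _).const_mul _, integral_const_mul]
  have hSint : ∀ (S : Finset ℕ), S ⊆ Finset.Icc 1 k → ∀ (f : T → T → ℝ) (c : ℝ),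
      Measurable (Function.uncurry f) → (∀ σ τ, |f σ τ| ≤ c) →
      ∫ ω, (weightedAvg Γ m μ (interp H k a t ω) (fun σ _ => f σ σ) -
        ∑ j ∈ S, (m j - m (j - 1)) * overlapAvg Γ m μ (interp H k a t ω) j f) ∂P =
      diagAvg Γ m μ P H a t (fun σ => f σ σ) -
        ∑ j ∈ S, (m j - m (j - 1)) * pairAvg Γ m μ P H a t j f := by
    intro S hS f c hf hc
    have j1 := integrable_weightedAvg (w := w) (μ := μ) hm h ha hb0 hb hm0 htc
      (f := fun σ => f σ σ) (hf.comp (f := fun σ => (σ, σ)) (by fun_prop)) (ae_of_all _ fun σ => hc σ σ)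
    have j2 := fun j (hj : j ∈ S) => (integrable_overlapAvg (w := w) (μ := μ) hm h ha hb0 hb htc hf hc
      (hS hj)).const_mul (m j - m (j - 1))
    rw [integral_sub j1 (integrable_finsetSum S j2), integral_finsetSum S j2]
    simp only [integral_const_mul]
    rfl
  have hproc : ∫ ω, weightedAvg Γ m μ (interp H k a t ω) (fun σ _ => H σ ω) ∂P =
      s * ∫ ω, (weightedAvg Γ m μ (interp H k a t ω) (fun σ _ => cov2 P H σ σ) -
        ∑ j ∈ Finset.Icc 1 k, (m j - m (j - 1)) *
          overlapAvg Γ m μ (interp H k a t ω) j (cov2 P H)) ∂P := integral_weightedAvg_process (μ := μ) (γ := Γ) hγ hB0 hm h hL hs1 hm0 hmk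
  rw [hSint _ subset_rfl _ v h.measurable_cov2 h.bdd] at hproc
  refine congrArg₂ _ ?_ ?_
  · rw [hproc]
    field_simp
  · rw [Finset.mul_sum]
    refine Finset.sum_congr rfl fun p _ => ?_
    rw [integral_const_mul, integral_const_mul,
      hSint _ (Finset.filter_subset _ _) _ _ (measurable_coefInner ha) (abs_coefInner_le hb)]

end Formula


/-! ### Convergence of the averages along convergent Hamiltonians -/

section TendstoAvg

variable {X : Type*} [MeasurableSpace X] {μ : Measure X} [IsFiniteMeasure μ] [NeZero μ]
  {E : Type*} [NormedAddCommGroup E] [MeasurableSpace E] [BorelSpace E]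
  [SecondCountableTopology E] {k : ℕ}
  {γ : Fin (k + 1) → Measure E} [∀ p, IsProbabilityMeasure (γ p)] {m : ℕ → ℝ} {B : ℝ}
  {A : X → ℝ} {I : Type*} {F : Filter I} [F.IsCountablyGenerated]
  {V : I → X → (Fin (k + 1) → E) → ℝ} {V₀ : X → (Fin (k + 1) → E) → ℝ}
  (hγ : HasExpMoments γ) (hB : 0 ≤ B) (hm : ∀ l ≤ k, 0 ≤ m l)
  (hV : ∀ t, IsHam B A (V t)) (hV₀ : IsHam B A V₀) (hA : IsExpWeight μ A)
  (hlim : ∀ σ z, Filter.Tendsto (fun t => V t σ z) F (nhds (V₀ σ z)))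

include hγ hB hm hV hV₀ hA hlim

theorem tendsto_levelAvg {f : I → X → ℝ} {f₀ : X → ℝ} {c : ℝ} (hf : ∀ t, Measurable (f t))
    (hc : ∀ t σ, |f t σ| ≤ c) (hfl : ∀ σ, Filter.Tendsto (fun t => f t σ) F (nhds (f₀ σ)))
    (l : ℕ) (z : Fin (k + 1) → E) :
    Filter.Tendsto (fun t => levelAvg γ m μ (V t) l (f t) z) F
      (nhds (levelAvg γ m μ V₀ l f₀ z)) :=
  (convFam_logZ hV hV₀ hA hlim).parisiAvg hγ hB hm (K' := c)
    (fun t => expBounded_of_le fun w => (hV t).abs_gibbs_le hA (ae_of_all _ (hc t)) w)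
    (fun t => measurable_gibbs_single (hV t).meas (hf t))
    (fun w => tendsto_gibbs hV hV₀ hA hlim hf hc hfl w) l z

theorem tendsto_levelAvg2 {f : X → X → ℝ} {c : ℝ} (hf : Measurable (Function.uncurry f))
    (hc : ∀ σ τ, |f σ τ| ≤ c) {l : ℕ} (hl : l ≤ k + 1) (z : Fin (k + 1) → E) :
    Filter.Tendsto (fun t => levelAvg2 γ m μ (V t) l f z) F (nhds (levelAvg2 γ m μ V₀ l f z)) := by
  refine tendsto_levelAvg hγ hB hm hV hV₀ hA hlim (c := c) (fun t => ?_)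
    (fun t σ => abs_levelAvg_le hγ hB hm (hV t) hA (hc σ) hl z) (fun σ => ?_) l z
  · have := (measurable_levelAvg_left (γ := γ) (m := m) (μ := μ) (hV t) hf l).comp
      (measurable_prodMk_right (y := z))
    exact this
  · exact tendsto_levelAvg hγ hB hm hV hV₀ hA hlim (f := fun _ => f σ)
      (fun _ => hf.comp (measurable_prodMk_left (x := σ))) (fun _ => hc σ)
      (fun _ => tendsto_const_nhds) l z

theorem tendsto_overlapAvg {f : X → X → ℝ} {c : ℝ} (hf : Measurable (Function.uncurry f))
    (hc : ∀ σ τ, |f σ τ| ≤ c) {l : ℕ} (hl : l ≤ k + 1) :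
    Filter.Tendsto (fun t => overlapAvg γ m μ (V t) l f) F (nhds (overlapAvg γ m μ V₀ l f)) := by
  have hs : Finset.Ico 1 l ⊆ Finset.range (k + 1) := fun j hj => by
    simp only [Finset.mem_Ico, Finset.mem_range] at *; omega
  obtain ⟨K, -, hK⟩ := exists_expBounded_prod_parisiW (γ := γ) (m := m) hγ hB hm
  have hconv := convFam_logZ hV hV₀ hA hlim
  refine tendsto_integral_filter_of_dominated_convergence
    (fun z => Real.exp (K * (1 + ‖z‖)) * c) (Filter.Eventually.of_forall fun t => ?_)
    (Filter.Eventually.of_forall fun t => ae_of_all _ fun z => ?_)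
    ((hγ.integrable_exp_one_add K).mul_const c) (ae_of_all _ fun z => ?_)
  · have h2 := (measurable_levelAvg2 (γ := γ) (m := m) (μ := μ) (α := Unit) (V := fun _ => V t)
      ((hV t).meas.comp (f := fun x : (Unit × (Fin (k + 1) → E)) × X => (x.2, x.1.2))
        (by fun_prop)) hf l).comp (measurable_prodMk_left (x := ()))
    exact ((measurable_prod_parisiW_const ((hV t).isLip_logZ hA).continuous.measurable _).mul
      h2).aestronglyMeasurable
  · rw [Real.norm_eq_abs, abs_mul]
    exact mul_le_mul (hK _ ((hV t).isLip_logZ hA) _ hs z)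
      (abs_levelAvg2_le hγ hB hm (hV t) hA hc hl z) (abs_nonneg _) (Real.exp_pos _).le
  · exact (hconv.prod_parisiW hγ hB hm hs z).mul
      (tendsto_levelAvg2 hγ hB hm hV hV₀ hA hlim hf hc hl z)

theorem tendsto_weightedAvg (hm0 : m 0 = 0) {f : X → ℝ} {c : ℝ} (hf : Measurable f)
    (hc : ∀ σ, |f σ| ≤ c) :
    Filter.Tendsto (fun t => weightedAvg γ m μ (V t) fun σ _ => f σ) F
      (nhds (weightedAvg γ m μ V₀ fun σ _ => f σ)) := by
  simp only [weightedAvg_eq_parisiAvg hm0 _ 0]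
  exact tendsto_levelAvg hγ hB hm hV hV₀ hA hlim (f := fun _ => f) (fun _ => hf) (fun _ => hc)
    (fun _ => tendsto_const_nhds) 0 0

end TendstoAvg

/-! ### Continuity in `t` and the derivative up to the end points -/

section Continuity

variable {Ω T : Type*} [MeasurableSpace Ω] [MeasurableSpace T] {P : Measure Ω}
  [IsProbabilityMeasure P] {μ : Measure T} [IsFiniteMeasure μ] [NeZero μ] {H : T → Ω → ℝ} {v : ℝ}
  {N k : ℕ} {w : Fin (k + 1) → NNReal} {m : ℕ → ℝ} {a : T → Fin N → ℝ} {b : ℝ}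

local notation "Γ" => fun p : Fin (k + 1) => Measure.pi fun _ : Fin N => gaussianReal 0 (w p)

variable (hm : ∀ l ≤ k, 0 ≤ m l) (h : IsBddGaussian P H v)
  (ha : ∀ i, Measurable fun σ => a σ i) (hb0 : 0 ≤ b) (hb : ∀ σ i, |a σ i| ≤ b)

omit [MeasurableSpace Ω] [MeasurableSpace T] in
-- The parameter runs over the subtype of `[0, 1]`, so that the uniform bounds hold for every index,
-- as `ConvFam` requires.
theorem tendsto_interp (t₀ : Set.Icc (0 : ℝ) 1) (ω : Ω) (σ : T) (z : Fin (k + 1) → Fin N → ℝ) :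
    Filter.Tendsto (fun t : Set.Icc (0 : ℝ) 1 => interp H k a t ω σ z) (nhds t₀)
      (nhds (interp H k a t₀ ω σ z)) := by
  have : Continuous fun t : Set.Icc (0 : ℝ) 1 => interp H k a t ω σ z := by
    unfold interp ham field; fun_prop
  exact this.tendsto t₀

include hm h ha hb0 hb

theorem continuousOn_integral_interpLevel :
    ContinuousOn (fun t => ∫ ω, interpLevel Γ m μ H a t ω ∂P) (Set.Icc 0 1) := by
  have hB : (0 : ℝ) ≤ N * (b * (k + 1)) := by positivity
  have hγ : HasExpMoments Γ := hasExpMoments_gaussian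
  obtain ⟨C, hC⟩ := exists_abs_interpLevel_le (w := w) (μ := μ) hm h ha hb0 hb
  rw [continuousOn_iff_continuous_domRestrict, continuous_iff_continuousAt]
  intro t₀
  refine tendsto_integral_filter_of_dominated_convergence
    (fun ω => C + logZBound μ fun σ => |H σ ω|)
    (Filter.Eventually.of_forall fun t => (measurable_interpLevel h ha t).aestronglyMeasurable)
    (Filter.Eventually.of_forall fun t => ?_)
    ((integrable_const C).add h.integrable_logZBound) ?_
  · filter_upwards [h.ae_isExpWeight (μ := μ)] with ω hω
    exact hC t t.2 ω hω
  · filter_upwards [h.ae_isExpWeight (μ := μ)] with ω hω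
    obtain ⟨_, hK⟩ := (convFam_logZ (fun t : Set.Icc (0 : ℝ) 1 => isHam_interp h ha hb t.2 ω)
      (isHam_interp h ha hb t₀.2 ω) hω fun σ z => tendsto_interp t₀ ω σ z).parisiLevel
      (γ := Γ) hγ hB hm 0 (Nat.zero_le _)
    exact hK.tendsto 0

theorem continuousOn_diagAvg (hm0 : m 0 = 0) {f : T → ℝ} {c : ℝ} (hf : Measurable f)
    (hc : ∀ σ, |f σ| ≤ c) :
    ContinuousOn (fun t => diagAvg Γ m μ P H a t f) (Set.Icc 0 1) := by
  have hB : (0 : ℝ) ≤ N * (b * (k + 1)) := by positivity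
  have hγ : HasExpMoments Γ := hasExpMoments_gaussian
  rw [continuousOn_iff_continuous_domRestrict, continuous_iff_continuousAt]
  intro t₀
  refine tendsto_integral_filter_of_dominated_convergence (fun ω => c)
    (Filter.Eventually.of_forall fun t => (measurable_weightedAvg h ha t hf).aestronglyMeasurable)
    (Filter.Eventually.of_forall fun t =>
      ae_abs_weightedAvg_le hm h ha hb0 hb hm0 t.2 (ae_of_all _ hc))
    (integrable_const c) ?_
  filter_upwards [h.ae_isExpWeight (μ := μ)] with ω hω
  exact tendsto_weightedAvg hγ hB hm (fun t : Set.Icc (0 : ℝ) 1 => isHam_interp h ha hb t.2 ω)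
    (isHam_interp h ha hb t₀.2 ω) hω (fun σ z => tendsto_interp t₀ ω σ z) hm0 hf hc

theorem continuousOn_pairAvg {f : T → T → ℝ} {c : ℝ} (hf : Measurable (Function.uncurry f))
    (hc : ∀ σ τ, |f σ τ| ≤ c) {l : ℕ} (hl : l ∈ Finset.Icc 1 k) :
    ContinuousOn (fun t => pairAvg Γ m μ P H a t l f) (Set.Icc 0 1) := by
  have hB : (0 : ℝ) ≤ N * (b * (k + 1)) := by positivity
  have hγ : HasExpMoments Γ := hasExpMoments_gaussian
  rw [continuousOn_iff_continuous_domRestrict, continuous_iff_continuousAt]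
  intro t₀
  refine tendsto_integral_filter_of_dominated_convergence (fun ω => c)
    (Filter.Eventually.of_forall fun t => (measurable_overlapAvg h ha t hf l).aestronglyMeasurable)
    (Filter.Eventually.of_forall fun t => ae_abs_overlapAvg_le hm h ha hb0 hb t.2 hc hl)
    (integrable_const c) ?_
  filter_upwards [h.ae_isExpWeight (μ := μ)] with ω hω
  exact tendsto_overlapAvg hγ hB hm (fun t : Set.Icc (0 : ℝ) 1 => isHam_interp h ha hb t.2 ω)
    (isHam_interp h ha hb t₀.2 ω) hω (fun σ z => tendsto_interp t₀ ω σ z) hf hc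
    (by simp only [Finset.mem_Icc] at hl; omega)

/-- The derivative of the interpolation, including the end points. -/
theorem hasDerivWithinAt_integral_interpLevel (hm0 : m 0 = 0) (hmk : m k = 1) {t : ℝ}
    (ht : t ∈ Set.Icc (0 : ℝ) 1) :
    HasDerivWithinAt (fun t => ∫ ω, interpLevel Γ m μ H a t ω ∂P)
      (1 / 2 * (diagAvg Γ m μ P H a t (fun σ => cov2 P H σ σ) -
        ∑ j ∈ Finset.Icc 1 k, (m j - m (j - 1)) * pairAvg Γ m μ P H a t j (cov2 P H)) -
      1 / 2 * ∑ p : Fin (k + 1), w p * (diagAvg Γ m μ P H a t (fun σ => coefInner a σ σ) -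
        ∑ j ∈ (Finset.Icc 1 k).filter ((p : ℕ) < ·),
          (m j - m (j - 1)) * pairAvg Γ m μ P H a t j (coefInner a))) (Set.Icc 0 1) t := by
  -- After integration by parts no singular factor is left, so this expression is defined and
  -- continuous on the closed interval.
  set D : ℝ → ℝ := fun t => 1 / 2 * (diagAvg Γ m μ P H a t (fun σ => cov2 P H σ σ) -
        ∑ j ∈ Finset.Icc 1 k, (m j - m (j - 1)) * pairAvg Γ m μ P H a t j (cov2 P H)) -
      1 / 2 * ∑ p : Fin (k + 1), w p * (diagAvg Γ m μ P H a t (fun σ => coefInner a σ σ) -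
        ∑ j ∈ (Finset.Icc 1 k).filter ((p : ℕ) < ·),
          (m j - m (j - 1)) * pairAvg Γ m μ P H a t j (coefInner a)) with hD
  set Φ : ℝ → ℝ := fun t => ∫ ω, interpLevel Γ m μ H a t ω ∂P with hΦ
  have hΦc : ContinuousOn Φ (Set.Icc 0 1) := continuousOn_integral_interpLevel hm h ha hb0 hb
  have hcm := measurable_coefInner ha
  have hdiag : ∀ {f : T → T → ℝ}, Measurable (Function.uncurry f) → Measurable fun σ => f σ σ :=
    fun hf => hf.comp (f := fun σ => (σ, σ)) (by fun_prop)
  have hDc : ContinuousOn D (Set.Icc 0 1) := by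
    refine (continuousOn_const.mul ?_).sub
      (continuousOn_const.mul (continuousOn_finsetSum _ fun p _ => continuousOn_const.mul ?_))
    · exact (continuousOn_diagAvg hm h ha hb0 hb hm0 (hdiag h.measurable_cov2)
        fun σ => h.bdd σ σ).sub (continuousOn_finsetSum _ fun j hj => continuousOn_const.mul
        (continuousOn_pairAvg hm h ha hb0 hb h.measurable_cov2 h.bdd hj))
    · exact (continuousOn_diagAvg hm h ha hb0 hb hm0 (hdiag hcm)
        fun σ => abs_coefInner_le hb σ σ).sub (continuousOn_finsetSum _ fun j hj =>
        continuousOn_const.mul (continuousOn_pairAvg hm h ha hb0 hb hcm (abs_coefInner_le hb)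
          (Finset.mem_filter.1 hj).1))
  have hder : ∀ t ∈ Set.Ioo (0 : ℝ) 1, HasDerivAt Φ (D t) t := fun t ht => by
    have := hasDerivAt_integral_interpLevel (w := w) (μ := μ) hm h ha hb0 hb hm0 ht
    rwa [integral_weightedAvg_interp' hm h ha hb0 hb hm0 hmk ht] at this
  have hdiff : DifferentiableOn ℝ Φ (Set.Ioo 0 1) := fun t ht =>
    (hder t ht).differentiableAt.differentiableWithinAt
  -- At an end point: a continuous function whose derivative has a limit there is differentiable
  -- from that side, with the limit as its derivative.
  rcases eq_or_lt_of_le ht.1 with h0 | h0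
  · subst h0
    refine (hasDerivWithinAt_Ici_of_tendsto_deriv hdiff ?_
      (Ioo_mem_nhdsGT one_pos) ?_).mono Set.Icc_subset_Ici_self
    · exact (hΦc 0 (by simp)).mono Set.Ioo_subset_Icc_self
    · have h1 : Filter.Tendsto D (nhdsWithin 0 (Set.Ioi 0)) (nhds (D 0)) := by
        have := (hDc 0 (by simp)).mono (Set.Ioo_subset_Icc_self)
        rwa [ContinuousWithinAt, nhdsWithin_Ioo_eq_nhdsGT one_pos] at this
      refine h1.congr' ?_
      filter_upwards [Ioo_mem_nhdsGT (one_pos (α := ℝ))] with s hs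
      exact (hder s hs).deriv.symm
  · rcases eq_or_lt_of_le ht.2 with h1 | h1
    · subst h1
      refine (hasDerivWithinAt_Iic_of_tendsto_deriv hdiff ?_
        (Ioo_mem_nhdsLT one_pos) ?_).mono Set.Icc_subset_Iic_self
      · exact (hΦc 1 (by simp)).mono Set.Ioo_subset_Icc_self
      · have h1 : Filter.Tendsto D (nhdsWithin 1 (Set.Iio 1)) (nhds (D 1)) := by
          have := (hDc 1 (by simp)).mono (Set.Ioo_subset_Icc_self)
          rwa [ContinuousWithinAt, nhdsWithin_Ioo_eq_nhdsLT one_pos] at this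
        refine h1.congr' ?_
        filter_upwards [Ioo_mem_nhdsLT (one_pos (α := ℝ))] with s hs
        exact (hder s hs).deriv.symm
    · exact (hder t ⟨h0, h1⟩).hasDerivWithinAt

end Continuity


/-! ### The covariance function -/

section Covariance

variable {ξ : ℝ → ℝ}

namespace IsCovarianceFunction

variable (hξ : IsCovarianceFunction ξ)

include hξ

theorem differentiable : Differentiable ℝ ξ := hξ.contDiff.differentiable (by norm_num)

theorem continuous_deriv : Continuous (deriv ξ) := hξ.contDiff.continuous_deriv (by norm_num)

theorem deriv_neg (x : ℝ) : deriv ξ (-x) = -deriv ξ x := by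
  have h := deriv_comp_neg ξ x
  rw [show (fun x => ξ (-x)) = ξ from funext hξ.even] at h
  linarith

theorem deriv_zero : deriv ξ 0 = 0 := by
  have := hξ.deriv_neg 0
  rw [neg_zero] at this
  linarith

/-- Positivity of the second derivative gives monotonicity on the half line, and `ξ'` is odd because
`ξ` is even. -/
theorem monotone_deriv : Monotone (deriv ξ) := by
  refine monotone_of_odd_of_monotoneOn_nonneg hξ.deriv_neg
    (strictMonoOn_of_deriv_pos (convex_Ici 0) hξ.continuous_deriv.continuousOn
      fun x hx => ?_).monotoneOn
  rw [interior_Ici] at hx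
  exact hξ.deriv2_pos x hx

/-- By the choice of `θ` the expression is `ξ x - ξ q - (x - q) ξ'(q)`, the gap between a convex
function and its tangent. Convexity holds on all of `ℝ`, so overlaps of either sign are covered. -/
theorem tangent_nonneg (x q : ℝ) : 0 ≤ ξ x - x * deriv ξ q + theta ξ q := by
  have hc := hξ.monotone_deriv.convexOn_univ_of_deriv hξ.differentiable
  have hd := (hξ.differentiable q).hasDerivAt
  rw [theta]
  rcases lt_trichotomy x q with h | h | h
  · have := hc.slope_le_of_hasDerivAt (Set.mem_univ x) (Set.mem_univ q) h hd
    rw [slope_def_field, div_le_iff₀ (by linarith)] at this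
    linarith
  · subst h; linarith
  · have := hc.le_slope_of_hasDerivAt (Set.mem_univ q) (Set.mem_univ x) h hd
    rw [slope_def_field, le_div_iff₀ (by linarith)] at this
    linarith

theorem exists_abs_deriv_le (r : ℝ) : ∃ M, 0 ≤ M ∧ ∀ x ∈ Set.Icc (-r) r, |deriv ξ x| ≤ M := by
  obtain ⟨M, hM⟩ := (isCompact_Icc (a := -r) (b := r)).exists_bound_of_continuousOn
    hξ.continuous_deriv.continuousOn
  exact ⟨max M 0, le_max_right _ _, fun x hx => (hM x hx).trans (le_max_left _ _)⟩

theorem exists_abs_le (r : ℝ) : ∃ M, ∀ x ∈ Set.Icc (-r) r, |ξ x| ≤ M :=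
  (isCompact_Icc (a := -r) (b := r)).exists_bound_of_continuousOn
    hξ.differentiable.continuous.continuousOn

/-- Both `ξ x - ξ u` and `(x - u) ξ'(u)` are at most `M ε`. First order in `ε` suffices, so only a
bound on `ξ'` is used. -/
theorem abs_tangent_le {r M : ℝ} (hM : ∀ x ∈ Set.Icc (-r) r, |deriv ξ x| ≤ M) {x u ε : ℝ}
    (hx : x ∈ Set.Icc (-r) r) (hu : u ∈ Set.Icc (-r) r) (hxu : |x - u| ≤ ε) :
    |ξ x - x * deriv ξ u + theta ξ u| ≤ 2 * M * ε := by
  have h1 := Convex.norm_image_sub_le_of_norm_deriv_le (fun y _ => hξ.differentiable y) hM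
    (convex_Icc (-r) r) hu hx
  have hM0 : 0 ≤ M := (abs_nonneg _).trans (hM u hu)
  simp only [Real.norm_eq_abs] at h1
  have h2 : |(x - u) * deriv ξ u| ≤ M * |x - u| := by
    rw [abs_mul, mul_comm]
    exact mul_le_mul_of_nonneg_right (hM u hu) (abs_nonneg _)
  have h3 := mul_le_mul_of_nonneg_left hxu hM0
  have h4 : ξ x - x * deriv ξ u + theta ξ u = (ξ x - ξ u) - (x - u) * deriv ξ u := by
    rw [theta]; ring
  rw [h4]
  refine (abs_sub _ _).trans ?_
  linarith

end IsCovarianceFunction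

end Covariance

/-! ### Rearrangement of sums -/

/-- Exchanging the sums, the steps with `p < j` telescope to `x j - x 0`. With `x j = ξ'(q_j)` the
variances of the `z_p` become the slopes `ξ'(q_j)`. -/
theorem sum_steps_mul_sub (x δ M : ℕ → ℝ) (D : ℝ) (k : ℕ) :
    ∑ p : Fin (k + 1), (x (p + 1) - x p) *
        (D - ∑ j ∈ (Finset.Icc 1 k).filter ((p : ℕ) < ·), δ j * M j) =
      (x (k + 1) - x 0) * D - ∑ j ∈ Finset.Icc 1 k, δ j * ((x j - x 0) * M j) := by
  rw [Fin.sum_univ_eq_sum_range (fun p => (x (p + 1) - x p) *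
    (D - ∑ j ∈ (Finset.Icc 1 k).filter (p < ·), δ j * M j)) (k + 1)]
  simp only [mul_sub (x (_ + 1) - x _)]
  rw [Finset.sum_sub_distrib, ← Finset.sum_mul, Finset.sum_range_sub]
  congr 1
  simp only [Finset.sum_filter, Finset.mul_sum]
  rw [Finset.sum_comm]
  refine Finset.sum_congr rfl fun j hj => ?_
  have hj' : j ≤ k := (Finset.mem_Icc.1 hj).2
  simp only [mul_ite, mul_zero, ← Finset.sum_filter]
  have : (Finset.range (k + 1)).filter (· < j) = Finset.range j := by
    ext i; simp only [Finset.mem_filter, Finset.mem_range]; omega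
  rw [this, ← Finset.sum_mul, Finset.sum_range_sub]
  ring

theorem sum_increments (m : ℕ → ℝ) (k : ℕ) :
    ∑ j ∈ Finset.Icc 1 k, (m j - m (j - 1)) = m k - m 0 := by
  have := abel_sum m (fun _ => 1) k
  simp at this
  linarith [this, Finset.sum_sub_distrib (s := Finset.Icc 1 k) m fun j => m (j - 1)]

/-! ### Averages of constants and the joint law -/

section Joint

variable {Ω T : Type*} [MeasurableSpace Ω] [MeasurableSpace T] {P : Measure Ω}
  [IsProbabilityMeasure P] {μ : Measure T} [IsFiniteMeasure μ] [NeZero μ] {H : T → Ω → ℝ} {v : ℝ}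
  {N k : ℕ} {w : Fin (k + 1) → NNReal} {m : ℕ → ℝ} {a : T → Fin N → ℝ} {b : ℝ}

local notation "Γ" => fun p : Fin (k + 1) => Measure.pi fun _ : Fin N => gaussianReal 0 (w p)

variable (hm : ∀ l ≤ k, 0 ≤ m l) (h : IsBddGaussian P H v)
  (ha : ∀ i, Measurable fun σ => a σ i) (hb0 : 0 ≤ b) (hb : ∀ σ i, |a σ i| ≤ b)

include hm h ha hb0 hb

theorem diagAvg_one (hm0 : m 0 = 0) {t : ℝ} (ht : t ∈ Set.Icc (0 : ℝ) 1) :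
    diagAvg Γ m μ P H a t (fun _ => 1) = 1 := by
  have : ∀ᵐ ω ∂P, weightedAvg Γ m μ (interp H k a t ω) (fun _ _ => 1) = 1 := by
    filter_upwards [h.ae_isExpWeight (μ := μ)] with ω hω
    exact weightedAvg_const hasExpMoments_gaussian (by positivity) hm hm0
      (isHam_interp h ha hb ht ω) hω
  rw [diagAvg, integral_congr_ae this]
  simp

theorem pairAvg_one {t : ℝ} (ht : t ∈ Set.Icc (0 : ℝ) 1) {l : ℕ} (hl : l ∈ Finset.Icc 1 k) :
    pairAvg Γ m μ P H a t l (fun _ _ => 1) = 1 := by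
  have hl' : l ∈ Finset.Icc 1 (k + 1) := by simp only [Finset.mem_Icc] at *; omega
  have : ∀ᵐ ω ∂P, overlapAvg Γ m μ (interp H k a t ω) l (fun _ _ => 1) = 1 := by
    filter_upwards [h.ae_isExpWeight (μ := μ)] with ω hω
    have hB : 0 ≤ N * (b * (k + 1)) := by positivity
    have hV := isHam_interp (k := k) h ha hb ht ω
    have h1 := integral_prod_parisiW_Ico (γ := Γ) hasExpMoments_gaussian hB hm
      (hV.isLip_logZ hω) hl'
    rw [overlapAvg]
    refine Eq.trans (integral_congr_ae (ae_of_all _ fun z => ?_)) h1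
    simp only
    rw [levelAvg2_one hasExpMoments_gaussian hB hm hV hω (Finset.mem_Icc.1 hl').2, mul_one]
  rw [pairAvg, integral_congr_ae this]
  simp

theorem diagAvg_affine (hm0 : m 0 = 0) {t : ℝ} (ht : t ∈ Set.Icc (0 : ℝ) 1) {f g : T → ℝ}
    (hf : Measurable f) (hg : Measurable g) {c c' : ℝ} (hc : ∀ σ, |f σ| ≤ c)
    (hc' : ∀ σ, |g σ| ≤ c') (x y e : ℝ) :
    diagAvg Γ m μ P H a t (fun σ => x * f σ + y * g σ + e) =
      x * diagAvg Γ m μ P H a t f + y * diagAvg Γ m μ P H a t g + e := by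
  have hfg : Measurable fun σ => x * f σ + y * g σ := (hf.const_mul x).add (hg.const_mul y)
  have hb1 : ∀ σ, |x * f σ + y * g σ| ≤ |x| * c + |y| * c' := fun σ => by
    refine (abs_add_le _ _).trans ?_
    rw [abs_mul, abs_mul]
    exact add_le_add (mul_le_mul_of_nonneg_left (hc σ) (abs_nonneg _))
      (mul_le_mul_of_nonneg_left (hc' σ) (abs_nonneg _))
  have h1 := diagAvg_lin (w := w) (μ := μ) hm h ha hb0 hb hm0 ht hfg
    (g := fun _ => 1) measurable_const hb1 (c' := 1) (fun σ => by simp) 1 e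
  rw [diagAvg_one hm h ha hb0 hb hm0 ht, diagAvg_lin hm h ha hb0 hb hm0 ht hf hg hc hc'] at h1
  simpa only [one_mul, mul_one] using h1

theorem pairAvg_affine {t : ℝ} (ht : t ∈ Set.Icc (0 : ℝ) 1) {f g : T → T → ℝ}
    (hf : Measurable (Function.uncurry f)) (hg : Measurable (Function.uncurry g)) {c c' : ℝ}
    (hc : ∀ σ τ, |f σ τ| ≤ c) (hc' : ∀ σ τ, |g σ τ| ≤ c') (x y e : ℝ) {l : ℕ}
    (hl : l ∈ Finset.Icc 1 k) :
    pairAvg Γ m μ P H a t l (fun σ τ => x * f σ τ + y * g σ τ + e) =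
      x * pairAvg Γ m μ P H a t l f + y * pairAvg Γ m μ P H a t l g + e := by
  have hfg : Measurable (Function.uncurry fun σ τ => x * f σ τ + y * g σ τ) :=
    (hf.const_mul x).add (hg.const_mul y)
  have hb1 : ∀ σ τ, |x * f σ τ + y * g σ τ| ≤ |x| * c + |y| * c' := fun σ τ => by
    refine (abs_add_le _ _).trans ?_
    rw [abs_mul, abs_mul]
    exact add_le_add (mul_le_mul_of_nonneg_left (hc σ τ) (abs_nonneg _))
      (mul_le_mul_of_nonneg_left (hc' σ τ) (abs_nonneg _))
  have h1 := pairAvg_lin (w := w) (μ := μ) hm h ha hb0 hb ht hfg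
    (g := fun _ _ => 1) measurable_const hb1 (c' := 1) (fun σ τ => by simp) 1 e hl
  rw [pairAvg_one hm h ha hb0 hb ht hl, pairAvg_lin hm h ha hb0 hb ht hf hg hc hc' _ _ hl] at h1
  simpa only [one_mul, mul_one] using h1

/-- Fubini between the disorder and the field, to match the definition of `μ_l` on the product
space. The norm is integrable because the weights are positive with mean one. -/
theorem pairAvg_eq_integral_prod {t : ℝ} (ht : t ∈ Set.Icc (0 : ℝ) 1) {f : T → T → ℝ}
    (hf : Measurable (Function.uncurry f)) {c : ℝ} (hc : ∀ σ τ, |f σ τ| ≤ c) {l : ℕ}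
    (hl : l ∈ Finset.Icc 1 k) :
    ∫ x : Ω × (Fin (k + 1) → Fin N → ℝ),
      (∏ j ∈ Finset.Ico 1 l, parisiW Γ m (logZ μ (interp H k a t x.1)) j x.2) *
        levelAvg2 Γ m μ (interp H k a t x.1) l f x.2 ∂(P.prod (Measure.pi Γ)) =
      pairAvg Γ m μ P H a t l f := by
  have hl' : l ∈ Finset.Icc 1 (k + 1) := by simp only [Finset.mem_Icc] at *; omega
  have hB : 0 ≤ N * (b * (k + 1)) := by positivity
  have hγ : HasExpMoments Γ := hasExpMoments_gaussian
  have hmeas := measurable_overlapAvg_integrand (w := w) (m := m) (μ := μ) h ha t hf l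
  have hi : Integrable (fun x : Ω × (Fin (k + 1) → Fin N → ℝ) =>
      (∏ j ∈ Finset.Ico 1 l, parisiW Γ m (logZ μ (interp H k a t x.1)) j x.2) *
        levelAvg2 Γ m μ (interp H k a t x.1) l f x.2) (P.prod (Measure.pi Γ)) := by
    refine (integrable_prod_iff hmeas.aestronglyMeasurable).2 ⟨?_, ?_⟩
    · filter_upwards [h.ae_isExpWeight (μ := μ)] with ω hω
      have hV := isHam_interp (k := k) h ha hb ht ω
      exact integrable_prod_Ico_mul hγ hB hm hV hω
        ((measurable_levelAvg2 (γ := Γ) (m := m) (μ := μ) (measurable_interp (k := k) h ha t) hf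
          l).comp (measurable_prodMk_left (x := ω)))
        (fun z => abs_levelAvg2_le hγ hB hm hV hω hc (Finset.mem_Icc.1 hl').2 z)
        (Finset.mem_Icc.1 hl').2
    · refine (integrable_const c).mono'
        (hmeas.norm.stronglyMeasurable.integral_prod_right'
          (ν := Measure.pi Γ)).aestronglyMeasurable ?_
      filter_upwards [h.ae_isExpWeight (μ := μ)] with ω hω
      have hV := isHam_interp (k := k) h ha hb ht ω
      have := abs_integral_prod_Ico_mul_le hγ hB hm hV hω
        (g := fun z => |levelAvg2 Γ m μ (interp H k a t ω) l f z|) (c := c)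
        (fun z => by
          rw [abs_abs]
          exact abs_levelAvg2_le hγ hB hm hV hω hc (Finset.mem_Icc.1 hl').2 z) hl'
      rw [Real.norm_eq_abs]
      refine le_trans (le_of_eq ?_) this
      congr 1
      refine integral_congr_ae (ae_of_all _ fun z => ?_)
      simp only
      rw [Real.norm_eq_abs, abs_mul, abs_of_nonneg (a := ∏ j ∈ Finset.Ico 1 l, _)
        (Finset.prod_nonneg fun _ _ => (parisiW_pos _ _ _).le)]
  exact integral_prod _ hi

omit hm h ha hb0 hb [IsProbabilityMeasure P] [IsFiniteMeasure μ] [NeZero μ] in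
theorem pairAvg_nonneg {t : ℝ} {f : T → T → ℝ} (hf : ∀ σ τ, 0 ≤ f σ τ) (l : ℕ) :
    0 ≤ pairAvg Γ m μ P H a t l f :=
  integral_nonneg fun _ => integral_nonneg fun z => mul_nonneg
    (Finset.prod_nonneg fun _ _ => (parisiW_pos _ _ _).le) (levelAvg2_nonneg hf z)

end Joint


/-! ### The model -/

section Model

variable {S : Set ℝ} {N k : ℕ} {b : ℝ}

/-- The coordinates of a configuration. -/
def coord (σ : Fin N → S) (i : Fin N) : ℝ := σ i

/-- The variance of `z_p`. -/
noncomputable def fieldVar (ξ : ℝ → ℝ) (q : ℕ → ℝ) (k : ℕ) (p : Fin (k + 1)) : NNReal :=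
  Real.toNNReal (deriv ξ (q (p + 1)) - deriv ξ (q p))

theorem measurable_coord (i : Fin N) : Measurable fun σ : Fin N → S => coord σ i :=
  measurable_subtype_coe.comp (measurable_pi_apply i)

theorem abs_coord_le (hb : ∀ x ∈ S, |x| ≤ b) (σ : Fin N → S) (i : Fin N) : |coord σ i| ≤ b :=
  hb _ (σ i).2

theorem coefInner_coord (hN : 1 ≤ N) (σ τ : Fin N → S) :
    coefInner coord σ τ = N * overlap σ τ := by
  have : (N : ℝ) ≠ 0 := by positivity
  rw [overlap, ← mul_assoc, mul_one_div_cancel this, one_mul]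
  rfl

theorem measurable_overlap : Measurable (Function.uncurry (overlap (S := S) (N := N))) :=
  (measurable_coefInner measurable_coord).const_mul (1 / (N : ℝ))

theorem measurable_overlap_self : Measurable fun σ : Fin N → S => overlap σ σ :=
  measurable_overlap.comp (f := fun σ : Fin N → S => (σ, σ)) (by fun_prop)

theorem abs_overlap_le (hN : 1 ≤ N) (hb : ∀ x ∈ S, |x| ≤ b) (σ τ : Fin N → S) :
    |overlap σ τ| ≤ b ^ 2 := by
  have h0 : (0 : ℝ) < N := by positivity
  have h1 := abs_coefInner_le (abs_coord_le hb) σ τ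
  rw [coefInner_coord hN, abs_mul, abs_of_pos h0] at h1
  exact le_of_mul_le_mul_left h1 h0

theorem measurableSet_selfOverlapWindow (u ε : ℝ) :
    MeasurableSet (selfOverlapWindow S N u ε) :=
  measurable_overlap_self measurableSet_Icc

variable {ν : Measure S} [IsProbabilityMeasure ν] {u ε : ℝ}

instance : IsFiniteMeasure (windowMeasure ν N u ε) := by
  unfold windowMeasure; infer_instance

omit [IsProbabilityMeasure ν] in
theorem neZero_windowMeasure
    (hU : Measure.pi (fun _ : Fin N => ν) (selfOverlapWindow S N u ε) ≠ 0) :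
    NeZero (windowMeasure ν N u ε) :=
  ⟨fun h => hU (Measure.restrict_eq_zero.1 h)⟩

omit [IsProbabilityMeasure ν] in
theorem ae_abs_overlap_self_sub_le :
    ∀ᵐ σ ∂(windowMeasure ν N u ε), |overlap σ σ - u| ≤ ε := by
  filter_upwards [ae_restrict_mem (measurableSet_selfOverlapWindow u ε)] with σ hσ
  rw [abs_le]
  exact ⟨by linarith [hσ.1], by linarith [hσ.2]⟩

/-- The squares lie in `[0, b²]`, which therefore contains the smallest interval. It places `u`
where `ξ'` is bounded. -/
theorem IsSmallestSqInterval.nonneg_and_le {d D : ℝ} (hb : ∀ x ∈ S, |x| ≤ b)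
    (h : IsSmallestSqInterval ν d D) : 0 ≤ d ∧ D ≤ b ^ 2 := by
  refine h.2 0 (b ^ 2) ?_
  rw [show {σ : S | (σ : ℝ) ^ 2 ∈ Set.Icc 0 (b ^ 2)} = Set.univ from
    Set.eq_univ_of_forall fun σ => ⟨sq_nonneg _, sq_le_sq.2 ((hb _ σ.2).trans (le_abs_self b))⟩]
  exact measure_univ

variable {Ω : Type*} [MeasurableSpace Ω] {P : Measure Ω} [IsProbabilityMeasure P] {ξ : ℝ → ℝ}
  {c : ℝ} {H : (Fin N → S) → Ω → ℝ} {m q : ℕ → ℝ}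

omit [IsProbabilityMeasure P] in
-- Overlaps are at most `b²`, where `ξ` is bounded, so the covariance is bounded by `N (c + sup
-- |ξ|)`.
theorem IsHamiltonian.exists_isBddGaussian (hN : 1 ≤ N) (hb : ∀ x ∈ S, |x| ≤ b)
    (hξ : IsCovarianceFunction ξ) (h : IsHamiltonian P ξ c H) : ∃ v, IsBddGaussian P H v := by
  obtain ⟨K, hK⟩ := hξ.exists_abs_le (b ^ 2)
  have h0 : (0 : ℝ) < N := by positivity
  refine ⟨N * (c + K), h.measurable, h.gaussian, h.centered, fun σ τ => ?_⟩
  have h1 := h.covariance σ τ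
  have h2 := hK _ (abs_le.1 (abs_overlap_le hN hb σ τ))
  have h3 : |1 / (N : ℝ) * cov2 P H σ τ| ≤ c + K := by
    have := abs_add_le (1 / (N : ℝ) * cov2 P H σ τ - ξ (overlap σ τ)) (ξ (overlap σ τ))
    rw [sub_add_cancel] at this
    exact this.trans (add_le_add h1 h2)
  rwa [abs_mul, abs_of_pos (by positivity), one_div, inv_mul_le_iff₀ h0] at h3

namespace IsParisiParam

variable (hp : IsParisiParam k m q u)

include hp

theorem m_nonneg {l : ℕ} (hl : l ≤ k) : 0 ≤ m l := by
  induction l with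
  | zero => exact hp.m_zero.ge
  | succ n ih => exact (ih (by omega)).trans (hp.m_mono n (by omega))

theorem m_sub_nonneg {l : ℕ} (hl : l ∈ Finset.Icc 1 k) : 0 ≤ m l - m (l - 1) := by
  obtain ⟨h1, h2⟩ := Finset.mem_Icc.1 hl
  have := hp.m_mono (l - 1) (by omega)
  rw [Nat.sub_add_cancel h1] at this
  linarith

theorem coe_fieldVar (hξ : IsCovarianceFunction ξ) (p : Fin (k + 1)) :
    (fieldVar ξ q k p : ℝ) = deriv ξ (q (p + 1)) - deriv ξ (q p) :=
  Real.coe_toNNReal _ (sub_nonneg.2 (hξ.monotone_deriv (hp.q_mono p (Nat.lt_succ_iff.1 p.2))))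

end IsParisiParam

variable [NeZero (windowMeasure ν N u ε)] (hN : 1 ≤ N) (hb0 : 0 ≤ b) (hb : ∀ x ∈ S, |x| ≤ b)
  (hξ : IsCovarianceFunction ξ) (h : IsHamiltonian P ξ c H) (hp : IsParisiParam k m q u)

include hN hb0 hb hξ h hp in
-- With the coordinates as coefficients of the field, the objects of the model unfold to the
-- abstract ones.
theorem muL_eq_pairAvg {t : ℝ} (ht : t ∈ Set.Icc (0 : ℝ) 1)
    {f : (Fin N → S) → (Fin N → S) → ℝ} (hf : Measurable (Function.uncurry f)) {c' : ℝ}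
    (hc : ∀ σ τ, |f σ τ| ≤ c') {l : ℕ} (hl : l ∈ Finset.Icc 1 k) :
    muL ν ξ u ε k m q P H t l f = pairAvg (fun p : Fin (k + 1) =>
      Measure.pi fun _ : Fin N => gaussianReal 0 (fieldVar ξ q k p)) m (windowMeasure ν N u ε) P H
        coord t l f := by
  obtain ⟨v, hv⟩ := h.exists_isBddGaussian hN hb hξ
  exact pairAvg_eq_integral_prod (fun l hl => hp.m_nonneg hl) hv measurable_coord hb0
    (abs_coord_le hb) ht hf hc hl

/-- The function of the overlap in the derivative of the interpolation. -/
noncomputable def overlapGap (ξ : ℝ → ℝ) (x : ℝ) (σ τ : Fin N → S) : ℝ :=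
  ξ (overlap σ τ) - overlap σ τ * deriv ξ x + theta ξ x

include hξ in
theorem measurable_overlapGap (x : ℝ) :
    Measurable (Function.uncurry (overlapGap (S := S) (N := N) ξ x)) :=
  ((hξ.differentiable.continuous.measurable.comp measurable_overlap).sub
    (measurable_overlap.mul_const _)).add_const _

include hξ hN hb in
theorem exists_abs_overlapGap_le (x : ℝ) :
    ∃ K, ∀ σ τ : Fin N → S, |overlapGap ξ x σ τ| ≤ K := by
  obtain ⟨K, hK⟩ := hξ.exists_abs_le (b ^ 2)
  refine ⟨K + b ^ 2 * |deriv ξ x| + |theta ξ x|, fun σ τ => ?_⟩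
  have h1 := abs_overlap_le hN hb σ τ
  refine (abs_add_le _ _).trans (add_le_add ((abs_sub _ _).trans (add_le_add (hK _ (abs_le.1 h1)) ?_)) le_rfl)
  rw [abs_mul]
  exact mul_le_mul_of_nonneg_right h1 (abs_nonneg _)

theorem overlapGap_nonneg (hξ : IsCovarianceFunction ξ) (x : ℝ) (σ τ : Fin N → S) :
    0 ≤ overlapGap ξ x σ τ := hξ.tangent_nonneg _ _

include hN hb0 hb hξ h hp in
theorem muL_overlapGap_nonneg {t : ℝ} (ht : t ∈ Set.Icc (0 : ℝ) 1) {l : ℕ}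
    (hl : l ∈ Finset.Icc 1 k) (x : ℝ) : 0 ≤ muL ν ξ u ε k m q P H t l (overlapGap ξ x) := by
  obtain ⟨K, hK⟩ := exists_abs_overlapGap_le (S := S) (N := N) hN hb hξ x
  rw [muL_eq_pairAvg hN hb0 hb hξ h hp ht (measurable_overlapGap hξ x) hK hl]
  exact pairAvg_nonneg (overlapGap_nonneg hξ x) l

/-- The deviation of the covariance from `ξ`. -/
noncomputable def covError (P : Measure Ω) (ξ : ℝ → ℝ) (H : (Fin N → S) → Ω → ℝ)
    (σ τ : Fin N → S) : ℝ := 1 / (N : ℝ) * cov2 P H σ τ - ξ (overlap σ τ)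

include hN hb0 hb hξ h hp in
/-- The derivative of the interpolation, with an error term. -/
theorem exists_hasDerivWithinAt_interpPhi {M : ℝ}
    (hM : ∀ x ∈ Set.Icc (-b ^ 2) (b ^ 2), |deriv ξ x| ≤ M) (hu : u ∈ Set.Icc (-b ^ 2) (b ^ 2))
    {t : ℝ} (ht : t ∈ Set.Icc (0 : ℝ) 1) : ∃ R : ℝ, |R| ≤ c + M * ε ∧
      HasDerivWithinAt (interpPhi ν ξ u ε k m q P H)
        (-(1 / 2) * ∑ l ∈ Finset.Icc 1 k, m l * (theta ξ (q (l + 1)) - theta ξ (q l)) -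
          1 / 2 * ∑ l ∈ Finset.Icc 1 k, (m l - m (l - 1)) *
            muL ν ξ u ε k m q P H t l (overlapGap ξ (q l)) + R) (Set.Icc 0 1) t := by
  obtain ⟨v, hv⟩ := h.exists_isBddGaussian hN hb hξ
  have hm : ∀ l ≤ k, 0 ≤ m l := fun l hl => hp.m_nonneg hl
  have ha := measurable_coord (S := S) (N := N)
  have hab := abs_coord_le (N := N) hb
  have hm0 := hp.m_zero
  have hN0 : (N : ℝ) ≠ 0 := by positivity
  set w := fieldVar ξ q k with hw
  have hder := (hasDerivWithinAt_integral_interpLevel (w := w) (μ := windowMeasure ν N u ε)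
    hm hv ha hb0 hab hm0 hp.m_last ht).const_mul (1 / (N : ℝ))
  set D := diagAvg (fun p : Fin (k + 1) => Measure.pi fun _ : Fin N => gaussianReal 0 (w p)) m
    (windowMeasure ν N u ε) P H coord t with hD
  set A := pairAvg (fun p : Fin (k + 1) => Measure.pi fun _ : Fin N => gaussianReal 0 (w p)) m
    (windowMeasure ν N u ε) P H coord t with hA
  have hCm := hv.measurable_cov2
  have hRm := measurable_coefInner ha
  have hRb := abs_coefInner_le hab
  have hdiag : ∀ {f : (Fin N → S) → (Fin N → S) → ℝ}, Measurable (Function.uncurry f) →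
      Measurable fun σ => f σ σ := fun hf => hf.comp (f := fun σ => (σ, σ)) (by fun_prop)
  have hEb : ∀ σ τ, |covError P ξ H σ τ| ≤ c := h.covariance
  have hEm : Measurable (Function.uncurry (covError P ξ H)) :=
    (hCm.const_mul _).sub (hξ.differentiable.continuous.measurable.comp measurable_overlap)
  -- The normalized covariance replaces `ξ` in the tangent gap at the price of the covariance error;
  -- the right side is the affine combination produced by the two integrations by parts.
  have hsum : ∀ x (σ τ : Fin N → S), covError P ξ H σ τ + overlapGap ξ x σ τ =
      1 / (N : ℝ) * cov2 P H σ τ + -(1 / (N : ℝ) * deriv ξ x) * coefInner coord σ τ +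
        theta ξ x := fun x σ τ => by
    rw [covError, overlapGap, coefInner_coord hN]
    field_simp
    ring
  have hDeq := diagAvg_affine (w := w) (μ := windowMeasure ν N u ε) hm hv ha hb0 hab hm0 ht
    (hdiag hCm) (hdiag hRm) (fun σ => hv.bdd σ σ) (fun σ => hRb σ σ) (1 / (N : ℝ))
    (-(1 / (N : ℝ) * deriv ξ u)) (theta ξ u)
  simp only [← hsum u, ← hD] at hDeq
  -- The diagonal term is the only place where the window matters: almost every configuration has
  -- self-overlap within `ε` of `u`, so the tangent gap at `u` is at most `2 M ε`.
  have hDle : |D fun σ => covError P ξ H σ σ + overlapGap ξ u σ σ| ≤ c + 2 * M * ε := by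
    refine abs_diagAvg_le hm hv ha hb0 hab hm0 ht ?_
    filter_upwards [ae_abs_overlap_self_sub_le (ν := ν) (N := N)] with σ hσ
    exact (abs_add_le _ _).trans (add_le_add (hEb σ σ)
      (hξ.abs_tangent_le hM (abs_le.1 (abs_overlap_le hN hb σ σ)) hu hσ))
  have hAeq : ∀ l ∈ Finset.Icc 1 k, muL ν ξ u ε k m q P H t l (overlapGap ξ (q l)) +
      A l (covError P ξ H) = 1 / (N : ℝ) * A l (cov2 P H) -
        1 / (N : ℝ) * deriv ξ (q l) * A l (coefInner coord) + theta ξ (q l) := fun l hl => by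
    obtain ⟨K, hK⟩ := exists_abs_overlapGap_le (S := S) (N := N) hN hb hξ (q l)
    have hGm := measurable_overlapGap (S := S) (N := N) hξ (q l)
    rw [muL_eq_pairAvg hN hb0 hb hξ h hp ht hGm hK hl]
    have h1 := pairAvg_lin (w := w) (μ := windowMeasure ν N u ε) hm hv ha hb0 hab ht
      hEm hGm hEb hK 1 1 hl
    have h2 := pairAvg_affine (w := w) (μ := windowMeasure ν N u ε) hm hv ha hb0 hab ht
      hCm hRm hv.bdd hRb (1 / (N : ℝ)) (-(1 / (N : ℝ) * deriv ξ (q l))) (theta ξ (q l)) hl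
    simp only [← hsum (q l)] at h2
    simp only [one_mul] at h1
    rw [h1] at h2
    linarith
  have hAle : ∀ l ∈ Finset.Icc 1 k, |A l (covError P ξ H)| ≤ c := fun l hl =>
    abs_pairAvg_le hm hv ha hb0 hab ht hEb hl
  -- The diagonal part is at most `(c + 2 M ε) / 2`. The off-diagonal errors are at most `c / 2`,
  -- since the increments of `m` are nonnegative with sum `m_k - m_0 = 1`. Together this is `c + M
  -- ε`.
  refine ⟨1 / 2 * (D fun σ => covError P ξ H σ σ + overlapGap ξ u σ σ) -
    1 / 2 * ∑ l ∈ Finset.Icc 1 k, (m l - m (l - 1)) * A l (covError P ξ H), ?_, ?_⟩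
  · have h1 : |∑ l ∈ Finset.Icc 1 k, (m l - m (l - 1)) * A l (covError P ξ H)| ≤ c := by
      refine (Finset.abs_sum_le_sum_abs _ _).trans ?_
      have : ∑ l ∈ Finset.Icc 1 k, (m l - m (l - 1)) * c = c := by
        rw [← Finset.sum_mul, sum_increments, hp.m_last, hm0]; ring
      refine le_trans (Finset.sum_le_sum fun l hl => ?_) this.le
      rw [abs_mul, abs_of_nonneg (hp.m_sub_nonneg hl)]
      exact mul_le_mul_of_nonneg_left (hAle l hl) (hp.m_sub_nonneg hl)
    rw [abs_le] at h1 hDle ⊢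
    constructor <;> linarith [h1.1, h1.2, hDle.1, hDle.2]
  · refine HasDerivWithinAt.congr_deriv hder (Eq.symm ?_)
    have hv' : ∀ p : Fin (k + 1), (w p : ℝ) = deriv ξ (q (p + 1)) - deriv ξ (q p) :=
      hp.coe_fieldVar hξ
    simp only [hv']
    -- The variances telescope from `ξ'(q_0) = ξ'(0) = 0` to `ξ'(q_{k+1}) = ξ'(u)`; the sum of the
    -- increments of `θ` is rearranged by parts to meet the terms `θ(q_l)` of the overlap gaps.
    rw [sum_steps_mul_sub (fun j => deriv ξ (q j)) (fun j => m j - m (j - 1))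
      (fun j => A j (coefInner coord)), hp.q_last, hp.q_zero, hξ.deriv_zero, hDeq,
      abel_sum m fun j => theta ξ (q j)]
    have hmu : ∑ l ∈ Finset.Icc 1 k, (m l - m (l - 1)) *
        muL ν ξ u ε k m q P H t l (overlapGap ξ (q l)) =
        1 / (N : ℝ) * ∑ l ∈ Finset.Icc 1 k, (m l - m (l - 1)) * A l (cov2 P H) -
        1 / (N : ℝ) * ∑ l ∈ Finset.Icc 1 k, (m l - m (l - 1)) *
          (deriv ξ (q l) * A l (coefInner coord)) +
        ∑ l ∈ Finset.Icc 1 k, (m l - m (l - 1)) * theta ξ (q l) -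
        ∑ l ∈ Finset.Icc 1 k, (m l - m (l - 1)) * A l (covError P ξ H) := by
      rw [Finset.mul_sum, Finset.mul_sum, ← Finset.sum_sub_distrib, ← Finset.sum_add_distrib,
        ← Finset.sum_sub_distrib]
      refine Finset.sum_congr rfl fun l hl => ?_
      rw [eq_sub_of_add_eq (hAeq l hl)]
      ring
    simp only [sub_zero, hp.q_last, hp.m_last, hm0]
    rw [hmu]
    ring

end Model


/-! ### Additivity of the Parisi functional over sites -/

section Sites

/-- A family of independent variables indexed by levels and sites may be grouped either way; boxes
form a generating π-system on which the two products agree. -/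
theorem measurePreserving_swap {α β : Type*} [Fintype α] [Fintype β] (γ : α → Measure ℝ)
    [∀ p, IsProbabilityMeasure (γ p)] :
    MeasurePreserving (fun (z : α → β → ℝ) i p => z p i)
      (Measure.pi fun p => Measure.pi fun _ : β => γ p) (Measure.pi fun _ : β => Measure.pi γ) := by
  have hm : Measurable fun (z : α → β → ℝ) i p => z p i := by
    refine measurable_pi_iff.2 fun i => measurable_pi_iff.2 fun p => ?_
    fun_prop
  refine ⟨hm, (Measure.pi_eq_generateFrom (fun _ => generateFrom_pi) (fun _ => isPiSystem_pi)
    (fun _ => ⟨fun _ => Set.univ, fun _ => ⟨fun _ => Set.univ, ?_, Set.pi_univ _⟩,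
      fun _ => measure_lt_top _ _, Set.iUnion_const _⟩) fun s hs => ?_).symm⟩
  · intro _ _
    exact (MeasurableSet.univ : MeasurableSet (Set.univ : Set ℝ))
  · choose t ht hts using hs
    have ht' : ∀ i p, MeasurableSet (t i p) := fun i p => ht i p (Set.mem_univ p)
    have hs' : ∀ i, MeasurableSet (s i) := fun i => by
      rw [← hts i]; exact MeasurableSet.univ_pi (ht' i)
    have hpre : (fun (z : α → β → ℝ) i p => z p i) ⁻¹' Set.univ.pi s =
        Set.univ.pi fun p => Set.univ.pi fun i => t i p := by
      ext z
      simp only [Set.mem_preimage, Set.mem_univ_pi, ← hts]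
      exact forall_comm
    rw [Measure.map_apply hm (MeasurableSet.univ_pi hs'), hpre]
    simp only [Measure.pi_pi, ← hts]
    exact Finset.prod_comm

variable {N k : ℕ} {γ : Fin (k + 1) → Measure ℝ} [∀ p, IsProbabilityMeasure (γ p)]

theorem hasExpMoments_gaussianReal (v : Fin (k + 1) → NNReal) :
    HasExpMoments fun p : Fin (k + 1) => gaussianReal 0 (v p) := by
  intro K
  have h1 : ∀ p, Integrable (fun x : ℝ => Real.exp (|K| * |x|)) (gaussianReal 0 (v p)) := by
    intro p
    refine ((integrable_exp_mul_gaussianReal (μ := 0) (v := v p) |K|).add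
      (integrable_exp_mul_gaussianReal (μ := 0) (v := v p) (-|K|))).mono' (by fun_prop)
      (ae_of_all _ fun x => ?_)
    rw [Real.norm_eq_abs, Real.abs_exp]
    exact exp_mul_abs_le _ _
  have h2 : Integrable (fun z : Fin (k + 1) → ℝ => ∏ p, Real.exp (|K| * |z p|))
      (Measure.pi fun p => gaussianReal 0 (v p)) :=
    Integrable.fintype_prod (f := fun _ : Fin (k + 1) => fun x : ℝ => Real.exp (|K| * |x|)) h1
  refine h2.mono' (by fun_prop) (ae_of_all _ fun z => ?_)
  rw [Real.norm_eq_abs, Real.abs_exp, ← Real.exp_sum, Real.exp_le_exp, ← Finset.mul_sum]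
  have h3 : ‖z‖ ≤ ∑ p, |z p| :=
    (pi_norm_le_iff_of_nonneg (Finset.sum_nonneg fun p _ => abs_nonneg _)).2 fun p =>
      Finset.single_le_sum (f := fun p => |z p|) (fun _ _ => abs_nonneg _) (Finset.mem_univ p)
  exact (mul_le_mul_of_nonneg_right (le_abs_self K) (norm_nonneg z)).trans
    (mul_le_mul_of_nonneg_left h3 (abs_nonneg K))

/-- `lse` of a sum of functions of independent variables. -/
theorem lse_sum {a : ℝ} {f : Fin N → (Fin (k + 1) → ℝ) → ℝ}
    (hf : ∀ i, Integrable (f i) (Measure.pi γ))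
    (hf' : ∀ i, Integrable (fun y => Real.exp (a * f i y)) (Measure.pi γ)) :
    lse (Measure.pi fun p => Measure.pi fun _ : Fin N => γ p) a
      (fun z => ∑ i, f i fun p => z p i) = ∑ i, lse (Measure.pi γ) a (f i) := by
  have hsw := measurePreserving_swap (β := Fin N) γ
  have htr : ∀ g : (Fin N → Fin (k + 1) → ℝ) → ℝ,
      AEStronglyMeasurable g (Measure.pi fun _ : Fin N => Measure.pi γ) →
      ∫ z, g (fun i p => z p i) ∂(Measure.pi fun p => Measure.pi fun _ : Fin N => γ p) =
        ∫ y, g y ∂(Measure.pi fun _ : Fin N => Measure.pi γ) := fun g hg => by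
    rw [← hsw.map_eq, integral_map hsw.measurable.aemeasurable]
    rwa [hsw.map_eq]
  have hev : ∀ i : Fin N, ∀ g : (Fin (k + 1) → ℝ) → ℝ, Integrable g (Measure.pi γ) →
      Integrable (fun y : Fin N → Fin (k + 1) → ℝ => g (y i))
        (Measure.pi fun _ : Fin N => Measure.pi γ) := fun i g hg =>
    (measurePreserving_eval (fun _ : Fin N => Measure.pi γ) i).integrable_comp_of_integrable hg
  by_cases ha : a = 0
  · simp only [lse, ha, if_true]
    have hi := fun i => hev i _ (hf i)
    rw [htr (fun y => ∑ i, f i (y i)) (integrable_finsetSum _ fun i _ => hi i).aestronglyMeasurable,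
      integral_finsetSum _ fun i _ => hi i]
    exact Finset.sum_congr rfl fun i _ => integral_comp_eval (hf i).aestronglyMeasurable
  · simp only [lse, ha, if_false, Finset.mul_sum, Real.exp_sum]
    rw [htr (fun y => ∏ i, Real.exp (a * f i (y i)))
      (Integrable.fintype_prod (f := fun i y => Real.exp (a * f i y)) hf').aestronglyMeasurable,
      integral_fintype_prod_eq_prod (fun i y => Real.exp (a * f i y)),
      Real.log_prod fun i _ => (integral_exp_pos (hf' i)).ne', Finset.mul_sum]

/-- The vectors attached to different sites are independent, so exponentials of sums factor and each
step keeps the sum over sites. -/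
theorem parisiLevel_sum {m : ℕ → ℝ} {B : ℝ} (hγ : HasExpMoments γ) (hB : 0 ≤ B)
    (hm : ∀ l ≤ k, 0 ≤ m l) {F : (Fin (k + 1) → ℝ) → ℝ} (hF : IsLip B F) :
    ∀ l ≤ k + 1, ∀ z : Fin (k + 1) → Fin N → ℝ,
      parisiLevel (fun p => Measure.pi fun _ : Fin N => γ p) m
        (fun z => ∑ i, F fun p => z p i) l z = ∑ i, parisiLevel γ m F l fun p => z p i := by
  refine level_induction ?_ fun l hl ih => ?_
  · simp only [parisiLevel_last, implies_true]
  · intro z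
    have hL := hF.parisiLevel hγ hB hm (l + 1) (by omega)
    rw [parisiLevel_of_le _ m _ hl, parisiLevel_of_le γ m F hl, parisiStep_eq_lse]
    simp only [parisiStep_eq_lse, ih]
    refine Eq.trans ?_ (lse_sum (f := fun i y => parisiLevel γ m F (l + 1)
      (merge l (fun p => z p i) y)) (fun i => hL.integrable_merge hB hγ l _)
      fun i => hL.integrable_exp_merge hB (hm l hl) hγ l _)
    congr 1
    funext z'
    refine Finset.sum_congr rfl fun i _ => ?_
    congr 1
    funext p
    simp only [merge]
    split_ifs <;> rfl

omit [∀ p, IsProbabilityMeasure (γ p)] in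
theorem parisiLevel_const {E : Type*} [MeasurableSpace E] {γ : Fin (k + 1) → Measure E}
    [∀ p, IsProbabilityMeasure (γ p)] (m : ℕ → ℝ) (c : ℝ) :
    ∀ l ≤ k + 1, ∀ z, parisiLevel γ m (fun _ => c) l z = c := by
  refine level_induction ?_ fun l hl ih => ?_
  · simp only [parisiLevel_last, implies_true]
  · intro z
    rw [parisiLevel_of_le γ m _ hl]
    by_cases ha : m l = 0 <;> simp [parisiStep, condE, ha, ih]

end Sites


/-! ### Bounds on the local free energy -/

section SingleSite

variable {S : Set ℝ} {b : ℝ} {ν : Measure S} [IsProbabilityMeasure ν]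

theorem isHam_site (hb : ∀ x ∈ S, |x| ≤ b) (k : ℕ) (lam : ℝ) :
    IsHam (b * (k + 1)) (fun _ : S => |lam| * b ^ 2)
      fun (σ : S) (z : Fin (k + 1) → ℝ) => (σ : ℝ) * ∑ p, z p + lam * (σ : ℝ) ^ 2 where
  meas := by
    unfold Function.uncurry
    fun_prop
  lip σ z z' := by
    have h1 : |∑ p, (z p - z' p)| ≤ (k + 1) * ‖z - z'‖ := by
      refine (Finset.abs_sum_le_sum_abs _ _).trans ?_
      refine (Finset.sum_le_card_nsmul _ _ ‖z - z'‖ fun p _ => norm_le_pi_norm (z - z') p).trans ?_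
      simp
    rw [show (σ : ℝ) * ∑ p, z p + lam * (σ : ℝ) ^ 2 - ((σ : ℝ) * ∑ p, z' p + lam * (σ : ℝ) ^ 2) =
      (σ : ℝ) * ∑ p, (z p - z' p) by rw [Finset.sum_sub_distrib]; ring, abs_mul, mul_assoc]
    exact mul_le_mul (hb _ σ.2) h1 (abs_nonneg _) ((abs_nonneg _).trans (hb _ σ.2))
  bdd σ := by
    simp only [Pi.zero_apply, Finset.sum_const_zero, mul_zero, zero_add]
    rw [abs_mul, abs_of_nonneg (sq_nonneg (σ : ℝ))]
    exact mul_le_mul_of_nonneg_left (sq_le_sq.2 ((hb _ σ.2).trans (le_abs_self b))) (abs_nonneg _)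

theorem isExpWeight_const {X : Type*} [MeasurableSpace X] {μ : Measure X} [IsFiniteMeasure μ]
    {c : ℝ} (hc : 0 ≤ c) : IsExpWeight μ fun _ => c :=
  ⟨measurable_const, fun _ => hc, fun _ => integrable_const _⟩

theorem isLip_XLast (hb : ∀ x ∈ S, |x| ≤ b) (k : ℕ) (lam : ℝ) :
    IsLip (b * (k + 1)) (XLast ν k lam) :=
  (isHam_site hb k lam).isLip_logZ (isExpWeight_const (by positivity))

theorem isLip_sum_XLast (hb0 : 0 ≤ b) (hb : ∀ x ∈ S, |x| ≤ b) (N k : ℕ) (lam : ℝ) :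
    IsLip (N * (b * (k + 1)))
      fun z : Fin (k + 1) → Fin N → ℝ => ∑ i, XLast ν k lam fun p => z p i := by
  intro z z'
  rw [← Finset.sum_sub_distrib]
  refine (Finset.abs_sum_le_sum_abs _ _).trans ?_
  refine (Finset.sum_le_card_nsmul _ _ (b * (k + 1) * ‖z - z'‖) fun i _ => ?_).trans ?_
  · refine (isLip_XLast hb k lam _ _).trans (mul_le_mul_of_nonneg_left ?_ (by positivity))
    refine (pi_norm_le_iff_of_nonneg (norm_nonneg _)).2 fun p => ?_
    exact (norm_le_pi_norm ((z - z') p) i).trans (norm_le_pi_norm (z - z') p)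
  · simp only [Finset.card_univ, Fintype.card_fin, nsmul_eq_mul]
    exact (by ring : (N : ℝ) * (b * (k + 1) * ‖z - z'‖) = N * (b * (k + 1)) * ‖z - z'‖).le

variable {N k : ℕ} {u ε d D : ℝ}

theorem IsSmallestSqInterval.ae_sq_mem (h : IsSmallestSqInterval ν d D) :
    ∀ᵐ σ ∂(Measure.pi fun _ : Fin N => ν), ∀ i, ((σ i : S) : ℝ) ^ 2 ∈ Set.Icc d D := by
  have hm : MeasurableSet {σ : S | (σ : ℝ) ^ 2 ∈ Set.Icc d D} :=
    measurableSet_Icc.preimage (by fun_prop)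
  have h1 : ∀ᵐ σ : S ∂ν, (σ : ℝ) ^ 2 ∈ Set.Icc d D := (mem_ae_iff_prob_eq_one hm).2 h.1
  exact ae_all_iff.2 fun i => (Measure.tendsto_eval_ae_ae (μ := fun _ : Fin N => ν) (i := i)).eventually h1

/-- On the window almost every self-overlap lies both in `[u - ε, u + ε]` and in `[d, D]`. A
nonnegative `λ` uses the larger of the lower ends, a negative `λ` the smaller of the upper ends. -/
theorem ae_mul_uWindow_le (hN : 1 ≤ N) (h : IsSmallestSqInterval ν d D) (lam : ℝ) :
    ∀ᵐ σ ∂(windowMeasure ν N u ε), N * (lam * uWindow d D u ε lam) ≤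
      ∑ i, lam * (σ i : ℝ) ^ 2 := by
  filter_upwards [ae_restrict_mem (measurableSet_selfOverlapWindow u ε),
    ae_restrict_of_ae h.ae_sq_mem] with σ hσ hσ'
  have h0 : (0 : ℝ) < N := by positivity
  have hR : ∑ i, (σ i : ℝ) ^ 2 = N * overlap σ σ := by
    rw [overlap, ← mul_assoc, mul_one_div_cancel h0.ne', one_mul]
    exact Finset.sum_congr rfl fun i _ => sq _
  have hd : d ≤ overlap σ σ := by
    have := Finset.sum_le_sum fun i (_ : i ∈ Finset.univ) => (hσ' i).1
    rw [hR] at this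
    simp only [Finset.sum_const, Finset.card_univ, Fintype.card_fin, nsmul_eq_mul] at this
    exact le_of_mul_le_mul_left this h0
  have hD : overlap σ σ ≤ D := by
    have := Finset.sum_le_sum fun i (_ : i ∈ Finset.univ) => (hσ' i).2
    rw [hR] at this
    simp only [Finset.sum_const, Finset.card_univ, Fintype.card_fin, nsmul_eq_mul] at this
    exact le_of_mul_le_mul_left this h0
  rw [← Finset.mul_sum, hR, ← mul_assoc, ← mul_assoc, mul_comm (N : ℝ) lam, mul_assoc, mul_assoc]
  simp only [uWindow]
  split_ifs with hl
  · exact mul_le_mul_of_nonneg_left (mul_le_mul_of_nonneg_left (max_le hd hσ.1) h0.le) hl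
  · exact mul_le_mul_of_nonpos_left (mul_le_mul_of_nonneg_left (le_min hD hσ.2) h0.le)
      (not_le.1 hl).le

/-- At `t = 0` the sites decouple. -/
theorem log_integral_window_le [NeZero (windowMeasure ν N u ε)] (hN : 1 ≤ N)
    (hb : ∀ x ∈ S, |x| ≤ b) (h : IsSmallestSqInterval ν d D) (lam : ℝ)
    (z : Fin (k + 1) → Fin N → ℝ) :
    Real.log (∫ σ, Real.exp (∑ i, (σ i : ℝ) * ∑ p, z p i) ∂(windowMeasure ν N u ε)) ≤
      (∑ i, XLast ν k lam fun p => z p i) + -(N * (lam * uWindow d D u ε lam)) := by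
  have hsite : ∀ i, Integrable (fun σ : S =>
      Real.exp ((σ : ℝ) * ∑ p, z p i + lam * (σ : ℝ) ^ 2)) ν := fun i =>
    (isHam_site hb k lam).integrable_exp (isExpWeight_const (by positivity)) fun p => z p i
  have hprod : Integrable (fun σ : Fin N → S =>
      ∏ i, Real.exp ((σ i : ℝ) * ∑ p, z p i + lam * (σ i : ℝ) ^ 2))
      (Measure.pi fun _ : Fin N => ν) :=
    Integrable.fintype_prod (f := fun i (σ : S) =>
      Real.exp ((σ : ℝ) * ∑ p, z p i + lam * (σ : ℝ) ^ 2)) hsite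
  have hfree : Integrable (fun σ : Fin N → S => Real.exp (∑ i, (σ i : ℝ) * ∑ p, z p i))
      (Measure.pi fun _ : Fin N => ν) := by
    simp only [Real.exp_sum]
    have := fun i => (isHam_site hb k 0).integrable_exp
      (isExpWeight_const (μ := ν) (c := |0| * b ^ 2) (by positivity)) fun p => z p i
    simp only [zero_mul, add_zero] at this
    exact Integrable.fintype_prod (f := fun i (σ : S) => Real.exp ((σ : ℝ) * ∑ p, z p i)) this
  have h1 : ∫ σ, Real.exp (∑ i, (σ i : ℝ) * ∑ p, z p i) ∂(windowMeasure ν N u ε) ≤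
      (∏ i, ∫ σ : S, Real.exp ((σ : ℝ) * ∑ p, z p i + lam * (σ : ℝ) ^ 2) ∂ν) *
        Real.exp (-(N * (lam * uWindow d D u ε lam))) := by
    -- On the window the factor `exp (λ ∑ σ_i² - N λ u_N(λ))` is at least one and may be inserted.
    -- The positive integrand is then integrated over the whole product space, where it factors over
    -- the sites.
    rw [← integral_fintype_prod_eq_prod (fun i (σ : S) =>
      Real.exp ((σ : ℝ) * ∑ p, z p i + lam * (σ : ℝ) ^ 2))]
    refine le_trans ?_ (mul_le_mul_of_nonneg_right
      (setIntegral_le_integral (s := selfOverlapWindow S N u ε) hprod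
        (ae_of_all _ fun σ => Finset.prod_nonneg fun i _ => (Real.exp_pos _).le))
      (Real.exp_pos _).le)
    rw [← integral_mul_const]
    refine integral_mono_ae hfree.integrableOn (hprod.integrableOn.mul_const _) ?_
    filter_upwards [ae_mul_uWindow_le (u := u) (ε := ε) hN h lam] with σ hσ
    rw [← Real.exp_sum, ← Real.exp_add, Real.exp_le_exp, Finset.sum_add_distrib]
    linarith
  have hpos := fun i => integral_exp_pos (hsite i)
  have h2 := Real.log_le_log
    (integral_exp_pos (μ := windowMeasure ν N u ε) hfree.integrableOn) h1
  rwa [Real.log_mul (Finset.prod_pos fun i _ => hpos i).ne' (Real.exp_pos _).ne', Real.log_exp,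
    Real.log_prod fun i _ => (hpos i).ne'] at h2

end SingleSite

/-! ### The end points of the interpolation and the upper bound -/

section FreeEnergy

variable {S : Set ℝ} {N k : ℕ} {b : ℝ} {ν : Measure S} [IsProbabilityMeasure ν] {u ε : ℝ}
  {Ω : Type*} [MeasurableSpace Ω] {P : Measure Ω} [IsProbabilityMeasure P] {ξ : ℝ → ℝ}
  {c : ℝ} {H : (Fin N → S) → Ω → ℝ} {m q : ℕ → ℝ} {d D : ℝ}

omit [IsProbabilityMeasure ν] [IsProbabilityMeasure P] in
-- At `t = 1` the function `F` does not involve the field, and the recursion leaves constants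
-- unchanged.
theorem localFreeEnergy_eq_interpPhi_one :
    localFreeEnergy ν P H u ε = interpPhi ν ξ u ε k m q P H 1 := by
  have hz : ∀ p : Fin (k + 1), IsProbabilityMeasure (zLawN N ξ q p) := fun p => by
    unfold zLawN zLaw; infer_instance
  rw [localFreeEnergy, interpPhi]
  congr 1
  refine integral_congr_ae (ae_of_all _ fun ω => ?_)
  have : interpF ν u ε k 1 (fun σ => H σ ω) = fun _ =>
      Real.log (∫ σ, Real.exp (H σ ω) ∂(windowMeasure ν N u ε)) := by
    funext z
    simp [interpF, interpH]
  simp only [parisiFunctional, this]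
  exact (parisiLevel_const m _ 0 (Nat.zero_le _) 0).symm

/-- The interpolation at `t = 0` is bounded by the single-site functional. -/
theorem interpPhi_zero_le [NeZero (windowMeasure ν N u ε)] (hN : 1 ≤ N) (hb0 : 0 ≤ b)
    (hb : ∀ x ∈ S, |x| ≤ b) (hd : IsSmallestSqInterval ν d D)
    (hp : IsParisiParam k m q u) (lam : ℝ) :
    interpPhi ν ξ u ε k m q P H 0 ≤ -lam * uWindow d D u ε lam + X0 ν ξ k m q lam := by
  have h0 : (0 : ℝ) < N := by positivity
  have hm : ∀ l ≤ k, 0 ≤ m l := fun l hl => hp.m_nonneg hl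
  set F : (Fin (k + 1) → Fin N → ℝ) → ℝ := fun z =>
    Real.log (∫ σ, Real.exp (∑ i, (σ i : ℝ) * ∑ p, z p i) ∂(windowMeasure ν N u ε)) with hF
  -- At `t = 0` the disorder disappears, so its expectation is trivial.
  have hF0 : ∀ ω, interpF ν u ε k 0 (fun σ => H σ ω) = F := fun ω => by
    funext z
    simp [interpF, interpH, hF]
  have hLip : IsLip (N * (b * (k + 1))) F := by
    have hfield := isField_field (k := k) measurable_coord (abs_coord_le (N := N) hb) (r := 1)
      (by simp)
    have hH : IsHam (N * (b * (k + 1))) (fun _ => 0) (field k (coord (S := S) (N := N)) 1) :=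
      ⟨hfield.meas, hfield.lip, fun σ => by simp [hfield.zero σ]⟩
    have := hH.isLip_logZ (isExpWeight_const (μ := windowMeasure ν N u ε) le_rfl)
    have e : logZ (windowMeasure ν N u ε) (field k (coord (S := S) (N := N)) 1) = F := by
      funext z
      simp [logZ, field, coord, hF]
    rwa [e] at this
  have h1 := parisiLevel_mono (γ := fun p : Fin (k + 1) =>
      Measure.pi fun _ : Fin N => gaussianReal 0 (fieldVar ξ q k p)) (m := m)
    hasExpMoments_gaussian (by positivity) hm hLip (isLip_sum_XLast (ν := ν) hb0 hb N k lam)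
    (fun z => log_integral_window_le hN hb hd lam z) 0 (Nat.zero_le _) 0
  have h2 := parisiLevel_sum (N := N) (m := m) (hasExpMoments_gaussianReal (fieldVar ξ q k))
    (by positivity) hm (isLip_XLast (ν := ν) hb k lam) 0 (Nat.zero_le _) 0
  rw [h2] at h1
  simp only [Pi.zero_apply, Finset.sum_const, Finset.card_univ, Fintype.card_fin,
    nsmul_eq_mul] at h1
  have h3 : interpPhi ν ξ u ε k m q P H 0 = 1 / (N : ℝ) * parisiLevel (fun p : Fin (k + 1) =>
      Measure.pi fun _ : Fin N => gaussianReal 0 (fieldVar ξ q k p)) m F 0 0 := by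
    rw [interpPhi]
    simp only [hF0]
    simp only [integral_const, probReal_univ, one_smul]
    rfl
  have h4 : X0 ν ξ k m q lam = parisiLevel (fun p : Fin (k + 1) =>
    gaussianReal 0 (fieldVar ξ q k p)) m (XLast ν k lam) 0 (fun _ => 0) := rfl
  rw [h3, h4, one_div, inv_mul_le_iff₀ h0]
  refine h1.trans (le_of_eq ?_)
  ring

theorem image_one_le_of_hasDerivWithinAt {f f' : ℝ → ℝ} {K : ℝ}
    (hf : ∀ t ∈ Set.Icc (0 : ℝ) 1, HasDerivWithinAt f (f' t) (Set.Icc 0 1) t)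
    (hK : ∀ t ∈ Set.Icc (0 : ℝ) 1, f' t ≤ K) : f 1 ≤ f 0 + K := by
  have hd : ∀ t ∈ interior (Set.Icc (0 : ℝ) 1), HasDerivAt f (f' t) t := fun t ht =>
    (hf t (interior_subset ht)).hasDerivAt (mem_interior_iff_mem_nhds.1 ht)
  have := Convex.image_sub_le_mul_sub_of_deriv_le (convex_Icc (0 : ℝ) 1)
    (fun t ht => (hf t ht).continuousWithinAt)
    (fun t ht => (hd t ht).differentiableAt.differentiableWithinAt) (C := K)
    (fun t ht => by rw [(hd t ht).deriv]; exact hK t (interior_subset ht))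
    0 (by simp) 1 (by simp) zero_le_one
  linarith

end FreeEnergy

end SpinGlass

theorem mainTheorem5
    (S : Set ℝ) (hS : Bornology.IsBounded S)
    (ν : Measure S) [IsProbabilityMeasure ν]
    (ξ : ℝ → ℝ) (hξ : SpinGlass.IsCovarianceFunction ξ)
    (d D : ℝ) (hdD : SpinGlass.IsSmallestSqInterval ν d D) :
    ∃ L : ℝ, 0 < L ∧
      ∀ (N : ℕ) (_ : 1 ≤ N) (u : ℝ) (_ : u ∈ Set.Icc d D) (ε : ℝ) (_ : 0 < ε)
        (_ : Measure.pi (fun _ : Fin N => ν) (SpinGlass.selfOverlapWindow S N u ε) ≠ 0)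
        (Ω : Type*) (_ : MeasurableSpace Ω) (P : Measure Ω) (_ : IsProbabilityMeasure P)
        (c : ℝ) (H : (Fin N → S) → Ω → ℝ) (_ : SpinGlass.IsHamiltonian P ξ c H)
        (k : ℕ) (m q : ℕ → ℝ) (_ : SpinGlass.IsParisiParam k m q u),
        -- the derivative of the interpolation
        (∀ t ∈ Set.Icc (0 : ℝ) 1, ∃ R : ℝ, |R| ≤ c + L * ε ∧
          HasDerivWithinAt (SpinGlass.interpPhi ν ξ u ε k m q P H)
            (-(1 / 2) * ∑ l ∈ Finset.Icc 1 k,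
                m l * (SpinGlass.theta ξ (q (l + 1)) - SpinGlass.theta ξ (q l))
              - (1 / 2) * ∑ l ∈ Finset.Icc 1 k, (m l - m (l - 1)) *
                SpinGlass.muL ν ξ u ε k m q P H t l (fun σ τ =>
                  ξ (SpinGlass.overlap σ τ)
                    - SpinGlass.overlap σ τ * deriv ξ (q l) + SpinGlass.theta ξ (q l))
              + R)
            (Set.Icc 0 1) t) ∧
        -- the terms of the second sum are nonnegative
        (∀ t ∈ Set.Icc (0 : ℝ) 1, ∀ l ∈ Finset.Icc 1 k,
          0 ≤ (m l - m (l - 1)) * SpinGlass.muL ν ξ u ε k m q P H t l (fun σ τ =>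
                ξ (SpinGlass.overlap σ τ)
                  - SpinGlass.overlap σ τ * deriv ξ (q l) + SpinGlass.theta ξ (q l))) ∧
        -- the upper bound on the local free energy
        SpinGlass.localFreeEnergy ν P H u ε = SpinGlass.interpPhi ν ξ u ε k m q P H 1 ∧
        SpinGlass.interpPhi ν ξ u ε k m q P H 1 ≤
          SpinGlass.interpPhi ν ξ u ε k m q P H 0
            - (1 / 2) * ∑ l ∈ Finset.Icc 1 k,
                m l * (SpinGlass.theta ξ (q (l + 1)) - SpinGlass.theta ξ (q l))
            + (c + L * ε) ∧
        ∀ lam : ℝ, SpinGlass.localFreeEnergy ν P H u ε ≤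
          -lam * SpinGlass.uWindow d D u ε lam + SpinGlass.X0 ν ξ k m q lam
            - (1 / 2) * ∑ l ∈ Finset.Icc 1 k,
                m l * (SpinGlass.theta ξ (q (l + 1)) - SpinGlass.theta ξ (q l))
            + (c + L * ε) := by
  obtain ⟨b', hb'⟩ := hS.exists_norm_le
  set b := max b' 0
  have hb : ∀ x ∈ S, |x| ≤ b := fun x hx => (hb' x hx).trans (le_max_left _ _)
  have hb0 : 0 ≤ b := le_max_right _ _
  obtain ⟨M, hM0, hM⟩ := hξ.exists_abs_deriv_le (b ^ 2)
  -- `M` bounds `ξ'` on `[-b², b²]`, with `b` a bound for `S`, so it is fixed before `N` and all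
  -- other data; the added one only ensures positivity.
  refine ⟨M + 1, by positivity, ?_⟩
  intro N hN u hu ε hε hU Ω _ P _ c H hH k m q hp
  have := SpinGlass.neZero_windowMeasure hU
  obtain ⟨hd0, hDb⟩ := hdD.nonneg_and_le hb
  have hu' : u ∈ Set.Icc (-b ^ 2) (b ^ 2) :=
    ⟨by linarith [hu.1, sq_nonneg b], hu.2.trans hDb⟩
  have hder := fun t ht => SpinGlass.exists_hasDerivWithinAt_interpPhi (t := t) (ν := ν) (ε := ε) hN hb0 hb
    hξ hH hp hM hu' ht
  have hpos : ∀ t ∈ Set.Icc (0 : ℝ) 1, ∀ l ∈ Finset.Icc 1 k, 0 ≤ (m l - m (l - 1)) *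
      SpinGlass.muL ν ξ u ε k m q P H t l (SpinGlass.overlapGap ξ (q l)) := fun t ht l hl =>
    mul_nonneg (hp.m_sub_nonneg hl) (SpinGlass.muL_overlapGap_nonneg hN hb0 hb hξ hH hp ht hl _)
  have hone : SpinGlass.localFreeEnergy ν P H u ε = SpinGlass.interpPhi ν ξ u ε k m q P H 1 :=
    SpinGlass.localFreeEnergy_eq_interpPhi_one
  have hle : SpinGlass.interpPhi ν ξ u ε k m q P H 1 ≤ SpinGlass.interpPhi ν ξ u ε k m q P H 0
      - (1 / 2) * ∑ l ∈ Finset.Icc 1 k,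
        m l * (SpinGlass.theta ξ (q (l + 1)) - SpinGlass.theta ξ (q l))
      + (c + (M + 1) * ε) := by
    choose! R hR hR' using hder
    -- The second sum has nonnegative terms and enters with a minus sign, so dropping it bounds the
    -- derivative by a constant.
    have := SpinGlass.image_one_le_of_hasDerivWithinAt hR' (K := -(1 / 2) * ∑ l ∈ Finset.Icc 1 k,
        m l * (SpinGlass.theta ξ (q (l + 1)) - SpinGlass.theta ξ (q l)) + (c + (M + 1) * ε))
      fun t ht => by
        have h1 := Finset.sum_nonneg (hpos t ht)
        have h2 := (abs_le.1 (hR t ht)).2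
        linarith
    linarith
  refine ⟨fun t ht => ?_, hpos, hone, hle, fun lam => ?_⟩
  · obtain ⟨R, hR, hR'⟩ := hder t ht
    exact ⟨R, by linarith, hR'⟩
  · have := SpinGlass.interpPhi_zero_le (P := P) (H := H) (ξ := ξ) (ε := ε) hN hb0 hb hdD hp lam
    rw [hone]
    linarith
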